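/- **Setting.** Let $m\ge 2$ and $t\ge 0$ be integers. The random search tree for a finite set of $n$ keys is built as follows. For $n=0$ it is empty; for $1\le n\le m-1$ all keys are stored in the root. For $n\ge m$, $m-1$ pivots $x_1<\dots<x_{m-1}$ are selected and stored in the root; they split the other keys into $m$ ordered blocks, and the $m$ subtrees of the root are, given the pivots, independent random search trees for these blocks. If $n\ge mt+m-1$, the pivots are $y_{t+1},y_{2(t+1)},\dots,y_{(m-1)(t+1)}$, where $y_1<\dots<y_{mt+m-1}$ is a uniformly random set of $mt+m-1$ keys; if $m\le n<mt+m-1$, they are selected by an arbitrary fixed supplementary rule (possibly random, depending only on the order of the keys). Let $X_{n,k}$ be the number of keys stored in nodes of depth $k$ in the tree with $n$ keys, and let $W_n(z)=\sum_k X_{n,k}z^k$. Let $F(\theta)=\frac{t!}{m\,(mt+m-1)!}(\theta+t)(\theta+t+1)\cdots(\theta+mt+m-2)$, let $\lambda_1(z),\lambda_2(z),\dots$ be the roots of $F(\theta)=z$, counted with multiplicities and ordered by decreasing real part, and let $D_1$ be the set of all $z\in\mathbb C$ with $\Re\lambda_1(z)>1$ and $\Re\lambda_1(z)>\Re\lambda_2(z)$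 (the latter being void if there is only one root). For $\alpha>0$ let $\beta(\alpha)>0$ be the solution of $\beta\lambda_1'(\beta)=\alpha$. Let $\alpha_0=\bigl(\frac1{t+1}+\dots+\frac1{(t+1)m-1}\bigr)^{-1}$ and let $\alpha_+>\alpha_0$ be the solution of $\lambda_1(\beta(\alpha))-\alpha\log\beta(\alpha)-1=0$. Let $V=(V_1,\dots,V_m)$ have the Dirichlet distribution on the simplex $\{s_j\ge 0,\ \sum_j s_j=1\}$ with density $\frac{((t+1)m-1)!}{(t!)^m}(s_1\cdots s_m)^t$. For a domain $B\subseteq\mathbb C$, $\mathcal H(B)$ is the space of analytic functions on $B$ with the topology of uniform convergence on compact sets and its Borel $\sigma$-field. **Theorem.** There is a domain (nonempty connected open set) $B\subseteq D_1$ that contains the real interval $(1/m,\beta(\alpha_+))$, with $\mathbb E W_n(z)\ne0$ for all $n\ge1$ and $z\in B$, and a random element $Y$ of $\mathcal H(B)$ such that 1. $Y$ satisfies the equality in distribution in $\mathcal H(B)$ $$Y(z)\overset{d}{=}\sum_{j=1}^m zV_j^{\lambda_1(z)-1}Y^{(j)}(z),$$ where $Y^{(1)},\dots,Y^{(m)}$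 are copies of $Y$ and $V,Y^{(1)},\dots,Y^{(m)}$ are independent; 2. $\mathbb E|Y(z)|<\infty$ and $\mathbb E Y(z)=1$ for every $z\in B$; 3. for every $x\in(1/m,\beta(\alpha_+))$ there is an $s>1$ such that $\mathbb E|Y(z)|^{s}$ is finite and bounded for $z\in B$ in a neighborhood of $x$; 4. as $n\to\infty$, $W_n/\mathbb E W_n\to Y$ in distribution in $\mathcal H(B)$. -/

import Mathlib

open MeasureTheory Filter Topology
open scoped Nat Polynomial ENNReal NNReal

namespace SearchTreeProfile

/-! ### Search trees and their profile -/

/-- An `m`-ary tree with keys in `ℕ`: it is empty, or it has a root that stores a finite set of keys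
and carries `m` subtrees in order. -/
inductive SearchTree (m : ℕ) : Type
  | empty : SearchTree m
  | node (keys : Finset ℕ) (children : Fin m → SearchTree m) : SearchTree m

/-- Every set of trees is an event (the random trees below are discrete). -/
instance (m : ℕ) : MeasurableSpace (SearchTree m) := ⊤

/-- The profile: `T.profile k` is the number of keys stored in nodes of depth `k`. -/
def SearchTree.profile {m : ℕ} : SearchTree m → ℕ → ℕ
  | .empty, _ => 0
  | .node keys _, 0 => keys.card
  | .node _ children, k + 1 => ∑ i, (children i).profile k

/-- The profile polynomial `W(z) = ∑ₖ Xₖ zᵏ`; the sum has only finitely many nonzero terms. -/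
noncomputable def SearchTree.profilePoly {m : ℕ} (T : SearchTree m) (z : ℂ) : ℂ :=
  ∑' k : ℕ, (T.profile k : ℂ) * z ^ k

/-! ### The random search tree with parameters `m` and `t` -/

/-- The rank of `x` in `S`: the number of keys of `S` that are at most `x`. It is `1` for the
smallest key of `S` and `|S|` for the largest one. -/
def rank (S : Finset ℕ) (x : ℕ) : ℕ := (S.filter (· ≤ x)).card

/-- A supplementary rule for selecting the pivots among `n` keys when `m ≤ n < mt + m - 1`. It may be
random, but it depends only on the order of the keys: it selects a set of `m - 1` ranks out of
`1, …, n`. The values `law n` for other `n` are never used. -/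
structure SupplementaryRule (m t : ℕ) where
  law : ℕ → PMF (Finset ℕ)
  mem_powersetCard : ∀ n, m ≤ n → n < m * t + m - 1 →
    ∀ R ∈ (law n).support, R ∈ (Finset.Icc 1 n).powersetCard (m - 1)

/-- The pivots `y_{t+1}, y_{2(t+1)}, …, y_{(m-1)(t+1)}` in a set `Y = {y_1 < ⋯ < y_{mt+m-1}}`, that is,
the elements of `Y` whose rank is a multiple of `t + 1` (note that `mt + m - 1 = m(t+1) - 1`). -/
def regularPivots (t : ℕ) (Y : Finset ℕ) : Finset ℕ := Y.filter fun y => t + 1 ∣ rank Y y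

/-- The law of the set of pivots for a set `S` of at least `m` keys: if `|S| ≥ mt + m - 1`, then
`mt + m - 1` keys are selected uniformly at random and the regular pivots among them are taken;
otherwise the pivots are selected by the supplementary rule. -/
noncomputable def pivotLaw {m t : ℕ} (σ : SupplementaryRule m t) (S : Finset ℕ) : PMF (Finset ℕ) :=
  if h : m * t + m - 1 ≤ S.card then
    (PMF.uniformOfFinset (S.powersetCard (m * t + m - 1))
      (Finset.powersetCard_nonempty.2 h)).map (regularPivots t)
  else (σ.law S.card).map fun R => S.filter fun x => rank S x ∈ R

/-- The `i`-th block of the remaining keys: the non-pivots with exactly `i` pivots below them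
(with blocks numbered from `0`). -/
def block (S P : Finset ℕ) (i : ℕ) : Finset ℕ :=
  (S \ P).filter fun x => (P.filter (· < x)).card = i

theorem exists_rank_eq (Y : Finset ℕ) (t : ℕ) (h : t + 1 ≤ Y.card) : ∃ y ∈ Y, rank Y y = t+1 := by
  refine ⟨Y.orderEmbOfFin rfl ⟨t, h⟩, Finset.orderEmbOfFin_mem _ _ _, ?_⟩
  have : Y.filter (· ≤ Y.orderEmbOfFin rfl ⟨t, h⟩) = (Finset.univ.filter (fun i : Fin Y.card => i ≤ ⟨t,h⟩)).map (Y.orderEmbOfFin rfl).toEmbedding := by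
    ext y
    simp only [Finset.mem_filter, Finset.mem_map, Finset.mem_univ, true_and]
    constructor
    · rintro ⟨hy, hle⟩
      obtain ⟨i, rfl⟩ : y ∈ Set.range (Y.orderEmbOfFin rfl) := by simpa using hy
      exact ⟨i, by simpa using hle, rfl⟩
    · rintro ⟨i, hi, rfl⟩
      exact ⟨Finset.orderEmbOfFin_mem _ _ _, by simpa using hi⟩
  rw [rank, this, Finset.card_map]
  have : (Finset.univ.filter (fun i : Fin Y.card => i ≤ ⟨t,h⟩)) = Finset.Iic ⟨t,h⟩ := by ext; simp
  rw [this, Fin.card_Iic]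

/-- For `m ≥ 2` and at least `m` keys, every block is smaller than the whole set of keys. -/
theorem card_block_lt (m t : ℕ) (hm : 2 ≤ m) (σ : SupplementaryRule m t) (S : Finset ℕ) (hS : m ≤ S.card)
    (P : Finset ℕ) (hP : P ∈ (pivotLaw σ S).support) (i : ℕ) : (block S P i).card < S.card := by
  have key : ∃ x ∈ S, x ∈ P := by
    unfold pivotLaw at hP
    split_ifs at hP with h
    · simp only [PMF.support_map, PMF.support_uniformOfFinset, Set.mem_image, Finset.mem_coe, Finset.mem_powersetCard] at hP
      obtain ⟨Y, ⟨hYS, hc⟩, rfl⟩ := hP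
      obtain ⟨y, hy, hr⟩ := exists_rank_eq Y t (by nlinarith [hc, Nat.sub_add_cancel (show 1 ≤ m * t + m by omega)])
      exact ⟨y, hYS hy, by simp [regularPivots, hy, hr]⟩
    · simp only [PMF.support_map, Set.mem_image] at hP
      obtain ⟨R, hR, rfl⟩ := hP
      have h2 := Finset.mem_powersetCard.1 (σ.mem_powersetCard S.card hS (by omega) R hR)
      obtain ⟨r, hr⟩ : R.Nonempty := Finset.card_pos.1 (by omega)
      have h3 := Finset.mem_Icc.1 (h2.1 hr)
      obtain ⟨y, hy, hyr⟩ := exists_rank_eq S (r-1) (by omega)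
      exact ⟨y, hy, by simp [hy, hyr, Nat.sub_add_cancel h3.1, hr]⟩
  obtain ⟨x, hx, hxP⟩ := key
  apply Finset.card_lt_card
  refine ⟨fun y hy => (Finset.mem_sdiff.1 (Finset.mem_filter.1 hy).1).1, fun hh => ?_⟩
  exact (Finset.mem_sdiff.1 (Finset.mem_filter.1 (hh hx)).1).2 hxP

/-- The joint law of independent random variables with laws `p 0, …, p (k-1)`. -/
noncomputable def independentLaw {α : Type} : {k : ℕ} → (Fin k → PMF α) → PMF (Fin k → α)
  | 0, _ => PMF.pure Fin.elim0
  | _ + 1, p => (p 0).bind fun a =>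
      (independentLaw fun i => p i.succ).map fun f => Fin.cons a f

/-- The law of the random search tree for the set `S` of keys. The empty set gives the empty tree;
at most `m - 1` keys are all stored in the root; otherwise the pivots are selected and stored in the
root, and the subtrees are, conditionally on the pivots, independent random search trees for the
blocks. For `m ≥ 2` the test `card < card`
always succeeds (see `card_block_lt`): it only serves to make the recursion well founded. -/
noncomputable def treeLaw {m t : ℕ} (σ : SupplementaryRule m t) (S : Finset ℕ) :
    PMF (SearchTree m) :=
  if S = ∅ then PMF.pure .empty
  else if S.card < m then PMF.pure (.node S fun _ => .empty)
  else (pivotLaw σ S).bind fun P =>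
    (independentLaw fun i : Fin m =>
      if _h : (block S P i).card < S.card then treeLaw σ (block S P i)
      else PMF.pure .empty).map (SearchTree.node P)
termination_by S.card

/-- The distribution of the random search tree with `n` keys. -/
noncomputable def treeMeasure {m t : ℕ} (σ : SupplementaryRule m t) (n : ℕ) :
    Measure (SearchTree m) :=
  (treeLaw σ (Finset.range n)).toMeasure

instance {m t : ℕ} (σ : SupplementaryRule m t) (n : ℕ) : IsProbabilityMeasure (treeMeasure σ n) :=
  inferInstanceAs (IsProbabilityMeasure (treeLaw σ (Finset.range n)).toMeasure)

/-- The expected profile polynomial `𝔼 Wₙ(z)`. -/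
noncomputable def expectedPoly {m t : ℕ} (σ : SupplementaryRule m t) (n : ℕ) (z : ℂ) : ℂ :=
  ∫ T, T.profilePoly z ∂(treeMeasure σ n)

/-! ### The dominant root and the constants `α₀`, `β(α)`, `α₊` -/

/-- The polynomial `F(θ) = t! / (m (mt+m-1)!) · (θ+t)(θ+t+1)⋯(θ+mt+m-2)`. -/
noncomputable def polyF (m t : ℕ) : ℂ[X] :=
  Polynomial.C ((t ! : ℂ) / ((m : ℂ) * ((m * t + m - 1)! : ℂ))) *
    ∏ i ∈ Finset.Icc t (m * t + m - 2), (Polynomial.X + Polynomial.C (i : ℂ))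

/-- The roots of `F(θ) = z`, counted with multiplicities. -/
noncomputable def rootsF (m t : ℕ) (z : ℂ) : Multiset ℂ := (polyF m t - Polynomial.C z).roots

/-- `λ₁(z)`: a root of `F(θ) = z` of largest real part. -/
noncomputable def dominantRoot (m t : ℕ) (z : ℂ) : ℂ :=
  Classical.epsilon fun θ => θ ∈ rootsF m t z ∧ ∀ θ' ∈ rootsF m t z, θ'.re ≤ θ.re

/-- The set `D_s` of all `z` with `Re λ₁(z) > s` and `Re λ₁(z) > Re λ_j(z)` for all the other roots
`λ_j(z)`, `j ≥ 2`, counted with multiplicities. -/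
def regionD (m t : ℕ) (s : ℝ) : Set ℂ :=
  {z | s < (dominantRoot m t z).re ∧
    ∀ θ ∈ (rootsF m t z).erase (dominantRoot m t z), θ.re < (dominantRoot m t z).re}

/-- `α₀ = (1/(t+1) + 1/(t+2) + ⋯ + 1/((t+1)m-1))⁻¹`. -/
noncomputable def alphaZero (m t : ℕ) : ℝ :=
  (∑ i ∈ Finset.Icc (t + 1) ((t + 1) * m - 1), (1 : ℝ) / (i : ℝ))⁻¹

/-- `β(α)`: the positive solution `β` of `β λ₁'(β) = α` (unique for every `α > 0`). -/
noncomputable def beta (m t : ℕ) (α : ℝ) : ℝ :=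
  Classical.epsilon fun β : ℝ => 0 < β ∧ (β : ℂ) * deriv (dominantRoot m t) (β : ℂ) = (α : ℂ)

/-- `α₊`: the (unique) solution `α > α₀` of `λ₁(β(α)) - α log β(α) - 1 = 0`. -/
noncomputable def alphaPlus (m t : ℕ) : ℝ :=
  Classical.epsilon fun α : ℝ => alphaZero m t < α ∧
    dominantRoot m t (beta m t α : ℂ) - ((α * Real.log (beta m t α) : ℝ) : ℂ) - 1 = 0

/-! ### The space of analytic functions -/

/-- `H(B)`: the analytic functions on `B`, regarded as a subset of the space `C(B, ℂ)` of continuous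
functions on `B`. -/
def Hol (B : Set ℂ) : Type :=
  {f : C(B, ℂ) // ∃ g : ℂ → ℂ, AnalyticOnNhd ℂ g B ∧ ∀ z : B, f z = g z}

/-- The topology of uniform convergence on compact sets (the compact-open topology). -/
noncomputable instance (B : Set ℂ) : TopologicalSpace (Hol B) :=
  inferInstanceAs (TopologicalSpace
    {f : C(B, ℂ) // ∃ g : ℂ → ℂ, AnalyticOnNhd ℂ g B ∧ ∀ z : B, f z = g z})

/-- The Borel σ-algebra of `H(B)`. -/
noncomputable instance (B : Set ℂ) : MeasurableSpace (Hol B) := borel (Hol B)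

instance (B : Set ℂ) : BorelSpace (Hol B) := ⟨rfl⟩

/-- Evaluation of `f ∈ H(B)` at a point of `B`. -/
noncomputable instance (B : Set ℂ) : CoeFun (Hol B) fun _ => B → ℂ := ⟨fun f => f.1⟩

/-! ### The limiting fixed-point equation -/

/-- The Dirichlet distribution with all parameters equal to `t + 1`: the law of `(V₁, …, V_m)` on the
simplex `{s : s_j ≥ 0, s₁ + ⋯ + s_m = 1}` with density `((t+1)m-1)! / (t!)^m · (s₁ ⋯ s_m)^t` with
respect to Lebesgue measure in the coordinates `s₁, …, s_{m-1}`. -/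
noncomputable def dirichlet (m t : ℕ) : Measure (Fin m → ℝ) :=
  let extend : (Fin (m - 1) → ℝ) → Fin m → ℝ := fun s j =>
    if h : (j : ℕ) < m - 1 then s ⟨j, h⟩ else 1 - ∑ i, s i
  (((volume : Measure (Fin (m - 1) → ℝ)).restrict {s | ∀ j, 0 ≤ extend s j}).withDensity fun s =>
    ENNReal.ofReal ((((t + 1) * m - 1)! : ℝ) / (t ! : ℝ) ^ m * (∏ j, extend s j) ^ t)).map extend

/-- A probability law `ν` on `H(B)` solves the stochastic fixed-point equation
`Y(z) =ᵈ z V₁^(λ₁(z)-1) Y⁽¹⁾(z) + ⋯ + z V_m^(λ₁(z)-1) Y⁽ᵐ⁾(z)` (equality in law of random elements of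
`H(B)`), where `V = (V₁, …, V_m)` has the Dirichlet law, `Y⁽¹⁾, …, Y⁽ᵐ⁾` have the law `ν`, and
`V, Y⁽¹⁾, …, Y⁽ᵐ⁾` are independent: the right-hand side is a random element `Φ(V, Y⁽¹⁾, …, Y⁽ᵐ⁾)` of
`H(B)` and it has the law `ν`. -/
def SolvesFixedPoint (m t : ℕ) (B : Set ℂ) (ν : Measure (Hol B)) : Prop :=
  ∃ Φ : (Fin m → ℝ) × (Fin m → Hol B) → Hol B,
    AEMeasurable Φ ((dirichlet m t).prod (Measure.pi fun _ => ν)) ∧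
    (∀ (v : Fin m → ℝ) (y : Fin m → Hol B) (z : B),
      Φ (v, y) z = ∑ j, (z : ℂ) * (v j : ℂ) ^ (dominantRoot m t z - 1) * y j z) ∧
    ((dirichlet m t).prod (Measure.pi fun _ => ν)).map Φ = ν

end SearchTreeProfile

open SearchTreeProfile

namespace SearchTreeProfile

/-! Two facts carry the proof: an asymptotic formula for the mean, uniform for complex `z` near the
interval, and a contraction of the fluctuations in `L^s` for some `s > 1`.

Mean. Splitting at the root gives a linear recursion for `𝔼 Wₙ(z)`, which becomes homogeneous after
subtracting a constant. For the series `∑ C(k+t,t) A(k+t) x^k` it is the Euler equation `F(T) f = z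
f` with `T = (1-x) d/dx - t` (`aeval_shiftOp_baseSeries`). Factoring `F - z` over its roots leaves
first-order recursions, and the dominant root gives `𝔼 Wₙ(z) ~ E(z) rise (λ₁(z)) n`, where `rise θ
n` is of order `n^(θ-1)` (`exists_expansion_const`, `exists_tendstoUniformlyOn_mean`). Positivity
shows `E ≠ 0` on the interval, so there are two-sided bounds nearby (`exists_mean_bounds`).

Fluctuations. Given the block sizes `I`, the difference `Wₙ - 𝔼 Wₙ` is a function of `I` of mean
zero plus `z` times a sum of independent centred terms. For `1 < s ≤ 2` the `s`-th moments of such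
sums are additive up to constants, and one split multiplies the weight `rise ρ n`, `ρ = s (Re λ₁ -
1) + 1`, by `|z|^s / F(ρ)`. This factor equals 1 at `s = 1` for real `z = F(θ)`, and it drops below
1 for `s` slightly above 1 as long as `heightGap` is positive, which holds on all of `(1/m, β(α₊))`
(`exists_exponent`, `heightGap_lt`). Hence `Wₙ / 𝔼 Wₙ` is bounded in `L^s`, locally uniformly in `z`
(`hasCost_polyLaw`, `exists_isGood_ball`).

Limit. Replacing the polynomials of the subtrees `k` levels below the root by their means changes
characteristic functions by a geometrically small amount, uniformly in `n`
(`norm_profileChar_sub_approxChar_le`). For fixed `k` everything converges, because the block sizes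
divided by `n` converge to the Dirichlet law (`tendsto_ev_splitLaw`). So the finite-dimensional
characteristic functions converge, and their limits satisfy the fixed-point equation
(`HasCharLimit.eq_integral`). Cauchy's formula turns the pointwise moment bounds into tightness in
`H(B)`, so the laws themselves converge (`Hol.exists_tendsto`), and the `L^s` bounds let the mean 1
pass to the limit. The domain `B` is a connected component of the open set `goodSet σ` on which all
estimates hold locally uniformly. -/

/-! ### The dominant root near a simple dominant root. -/

/-- A simple root `θ₀` of `P = z₀` which strictly dominates the others extends to a holomorphic
dominant root of `P = z` for `z` near `z₀`, with a uniform gap. -/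
theorem exists_local_dominant_root (P : ℂ[X]) (θ₀ : ℂ) (hd : P.derivative.eval θ₀ ≠ 0)
    (hdom : ∀ θ, P.eval θ = P.eval θ₀ → θ ≠ θ₀ → θ.re < θ₀.re) :
    ∃ δ > 0, ∀ ε > 0, ∃ r > 0, ∃ g : ℂ → ℂ,
      DifferentiableOn ℂ g (Metric.ball (P.eval θ₀) r) ∧
      ∀ z ∈ Metric.ball (P.eval θ₀) r, P.eval (g z) = z ∧ ‖g z - θ₀‖ < ε ∧
        P.derivative.eval (g z) ≠ 0 ∧ HasDerivAt g (P.derivative.eval (g z))⁻¹ z ∧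
        ∀ θ, P.eval θ = z → θ ≠ g z → θ.re < θ₀.re - δ := by
  have hstrict : HasStrictDerivAt (fun x => P.eval x) (P.derivative.eval θ₀) θ₀ :=
    P.hasStrictDerivAt θ₀
  set e := (hstrict.hasStrictFDerivAt_equiv hd).toOpenPartialHomeomorph (fun x => P.eval x) with he
  have hecoe : ∀ x, e x = P.eval x := fun x => rfl
  have hsrc : θ₀ ∈ e.source :=
    (hstrict.hasStrictFDerivAt_equiv hd).mem_toOpenPartialHomeomorph_source
  have hPne : P - Polynomial.C (P.eval θ₀) ≠ 0 := by
    intro h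
    have : P.derivative = 0 := by rw [sub_eq_zero.1 h]; simp
    simp [this] at hd
  have hdeg : 0 < P.degree := by
    by_contra h
    rw [Polynomial.eq_C_of_degree_le_zero (not_lt.1 h)] at hd
    simp at hd
  -- a gap for the roots at `P θ₀`
  obtain ⟨δ, hδ, hgap⟩ : ∃ δ > 0, ∀ θ, P.eval θ = P.eval θ₀ → θ ≠ θ₀ → θ.re < θ₀.re - δ := by
    set s := ((P - Polynomial.C (P.eval θ₀)).roots.toFinset).erase θ₀ with hs
    have hmem : ∀ θ, P.eval θ = P.eval θ₀ → θ ≠ θ₀ → θ ∈ s := by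
      intro θ h1 h2
      simp [hs, h2, hPne, Polynomial.IsRoot, h1]
    rcases s.eq_empty_or_nonempty with h0 | h0
    · exact ⟨1, one_pos, fun θ h1 h2 => by simpa [h0] using hmem θ h1 h2⟩
    · obtain ⟨θm, hm, hmax⟩ := s.exists_max_image (fun θ => θ.re) h0
      have : θm.re < θ₀.re := by
        rw [hs] at hm
        have h3 := Finset.mem_erase.1 hm
        refine hdom θm ?_ h3.1
        have := (Polynomial.mem_roots hPne).1 (Multiset.mem_toFinset.1 h3.2)
        simpa [Polynomial.IsRoot, sub_eq_zero] using this
      refine ⟨(θ₀.re - θm.re) / 2, by linarith, fun θ h1 h2 => ?_⟩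
      have := hmax θ (hmem θ h1 h2)
      linarith
  refine ⟨δ, hδ, fun ε hε => ?_⟩
  -- a neighbourhood on which the local inverse behaves well
  have hcont : ContinuousAt e.symm (P.eval θ₀) := e.continuousAt_symm (e.map_source hsrc)
  have hsymm0 : e.symm (P.eval θ₀) = θ₀ := e.left_inv hsrc
  have hnear : ∀ᶠ z in 𝓝 (P.eval θ₀), z ∈ e.target ∧ ‖e.symm z - θ₀‖ < ε ∧
      P.derivative.eval (e.symm z) ≠ 0 := by
    refine Filter.Eventually.and (e.open_target.mem_nhds (e.map_source hsrc))
      (Filter.Eventually.and ?_ ?_)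
    · have : Tendsto (fun z => ‖e.symm z - θ₀‖) (𝓝 (P.eval θ₀)) (𝓝 ‖e.symm (P.eval θ₀) - θ₀‖) :=
        (hcont.sub continuousAt_const).norm
      rw [hsymm0, sub_self, norm_zero] at this
      exact this.eventually_lt_const hε
    · have h1 : ContinuousAt (fun z => P.derivative.eval (e.symm z)) (P.eval θ₀) :=
        ContinuousAt.comp (g := fun x => P.derivative.eval x) P.derivative.continuous.continuousAt hcont
      exact h1.eventually_ne (by rw [hsymm0]; exact hd)
  -- no other root far to the right
  have hfar : ∀ᶠ z in 𝓝 (P.eval θ₀), ∀ θ, P.eval θ = z → θ ∉ e.source → θ.re < θ₀.re - δ := by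
    -- Properness of a nonconstant polynomial makes `K` compact, so its image is closed. The gap
    -- keeps `P.eval θ₀` out of this image, hence a whole neighbourhood of it.
    set K := {θ : ℂ | ‖P.eval θ‖ ≤ ‖P.eval θ₀‖ + 1 ∧ θ₀.re - δ ≤ θ.re ∧ θ ∉ e.source} with hK
    have hKc : IsCompact K := by
      have h1 : IsCompact ((fun θ => P.eval θ) ⁻¹' Metric.closedBall 0 (‖P.eval θ₀‖ + 1)) :=
        (P.isProperMap_eval hdeg).isCompact_preimage (isCompact_closedBall _ _)
      have h2 : IsClosed ({θ : ℂ | θ₀.re - δ ≤ θ.re} ∩ e.sourceᶜ) :=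
        (isClosed_le continuous_const Complex.continuous_re).inter e.open_source.isClosed_compl
      convert h1.inter_right h2 using 1
      ext θ
      simp [hK]
    have hclosed : IsClosed ((fun θ => P.eval θ) '' K) := (hKc.image P.continuous).isClosed
    have hnot : P.eval θ₀ ∉ (fun θ => P.eval θ) '' K := by
      rintro ⟨θ, hθ, h⟩
      have hne : θ ≠ θ₀ := fun h' => hθ.2.2 (h' ▸ hsrc)
      have := hgap θ h hne
      linarith [hθ.2.1]
    have h3 : ∀ᶠ z in 𝓝 (P.eval θ₀), ‖z‖ < ‖P.eval θ₀‖ + 1 :=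
      continuous_norm.continuousAt.eventually_lt_const (by linarith)
    filter_upwards [hclosed.isOpen_compl.mem_nhds hnot, h3] with z hz hz3 θ hθ hθs
    by_contra hcon
    exact hz ⟨θ, ⟨by rw [hθ]; exact hz3.le, not_lt.1 hcon, hθs⟩, hθ⟩
  obtain ⟨r, hr, hball⟩ := Metric.eventually_nhds_iff_ball.1 (hnear.and hfar)
  have hder : ∀ z ∈ Metric.ball (P.eval θ₀) r,
      HasDerivAt e.symm (P.derivative.eval (e.symm z))⁻¹ z := fun z hz =>
    e.hasDerivAt_symm (hball z hz).1.1 (hball z hz).1.2.2 (P.hasDerivAt _)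
  refine ⟨r, hr, e.symm, fun z hz => (hder z hz).differentiableAt.differentiableWithinAt,
    fun z hz => ?_⟩
  obtain ⟨⟨h1, h2, h3⟩, h4⟩ := hball z hz
  refine ⟨e.right_inv h1, h2, h3, hder z hz, fun θ hθ hne => h4 θ hθ fun hs => hne ?_⟩
  rw [← hθ]
  exact (e.left_inv hs).symm

/-- The predicate that `θ` is the strictly dominant root of `F = z`. -/
theorem dominantRoot_eq_of_dominant {m t : ℕ} {z θ : ℂ} (h : θ ∈ rootsF m t z)
    (hd : ∀ θ' ∈ (rootsF m t z).erase θ, θ'.re < θ.re) : dominantRoot m t z = θ := by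
  have hex : ∃ θ, θ ∈ rootsF m t z ∧ ∀ θ' ∈ rootsF m t z, θ'.re ≤ θ.re := by
    refine ⟨θ, h, fun θ' h' => ?_⟩
    by_cases heq : θ' = θ
    · rw [heq]
    · exact (hd θ' ((Multiset.mem_erase_of_ne heq).2 h')).le
  have hspec := Classical.epsilon_spec hex
  by_contra hne
  have h1 := hd _ ((Multiset.mem_erase_of_ne hne).2 hspec.1)
  exact absurd (hspec.2 θ h) (not_le.2 h1)

/-! ### The real branch of the dominant root. -/

/-- The restriction of `F` to the real line. -/
noncomputable def realF (m t : ℕ) (θ : ℝ) : ℝ :=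
  (t ! : ℝ) / ((m : ℝ) * ((m * t + m - 1)! : ℝ)) * ∏ i ∈ Finset.Icc t (m * t + m - 2), (θ + i)

theorem polyF_eval (m t : ℕ) (θ : ℂ) : (polyF m t).eval θ =
    (t ! : ℂ) / ((m : ℂ) * ((m * t + m - 1)! : ℂ)) *
      ∏ i ∈ Finset.Icc t (m * t + m - 2), (θ + i) := by
  simp [polyF, Polynomial.eval_prod]

theorem polyF_eval_ofReal (m t : ℕ) (θ : ℝ) :
    (polyF m t).eval (θ : ℂ) = (realF m t θ : ℂ) := by
  rw [polyF_eval, realF]; push_cast; rfl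

variable {m t : ℕ}

theorem add_pos_of_mem_Icc {θ : ℝ} (hθ : -(t : ℝ) < θ) {N i : ℕ} (hi : i ∈ Finset.Icc t N) :
    0 < θ + i := by
  have : (t : ℝ) ≤ i := by exact_mod_cast (Finset.mem_Icc.1 hi).1
  linarith

theorem leadingF_pos (hm : 2 ≤ m) :
    0 < (t ! : ℝ) / ((m : ℝ) * ((m * t + m - 1)! : ℝ)) := by positivity

theorem realF_pos (hm : 2 ≤ m) {θ : ℝ} (hθ : -(t : ℝ) < θ) : 0 < realF m t θ :=
  mul_pos (leadingF_pos hm) (Finset.prod_pos fun _ hi => add_pos_of_mem_Icc hθ hi)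

theorem t_mem_Icc (hm : 2 ≤ m) : t ∈ Finset.Icc t (m * t + m - 2) := by
  have : t ≤ m * t := Nat.le_mul_of_pos_left _ (by omega)
  simp; omega

theorem realF_lt (hm : 2 ≤ m) {θ θ' : ℝ} (hθ : -(t : ℝ) < θ) (h : θ < θ') :
    realF m t θ < realF m t θ' := by
  refine mul_lt_mul_of_pos_left ?_ (leadingF_pos hm)
  exact Finset.prod_lt_prod_of_nonempty (fun _ hi => add_pos_of_mem_Icc hθ hi)
    (fun i _ => by linarith) ⟨t, t_mem_Icc hm⟩

theorem realF_lt_iff (hm : 2 ≤ m) {θ θ' : ℝ} (hθ : -(t : ℝ) < θ) (hθ' : -(t : ℝ) < θ') :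
    realF m t θ < realF m t θ' ↔ θ < θ' := by
  constructor
  · intro h
    by_contra hcon
    rcases (not_lt.1 hcon).eq_or_lt with h1 | h1
    · rw [h1] at h; exact lt_irrefl _ h
    · exact lt_asymm h (realF_lt hm hθ' h1)
  · exact realF_lt hm hθ

theorem continuous_realF : Continuous (realF m t) := by
  unfold realF; fun_prop

theorem prod_Icc_add_one (a b : ℕ) (h : a ≤ b + 1) :
    (a ! : ℝ) * ∏ i ∈ Finset.Icc a b, ((1 : ℝ) + i) = ((b + 1)! : ℝ) := by
  obtain ⟨c, hc⟩ : ∃ c, b + 1 = a + c := ⟨b + 1 - a, by omega⟩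
  have : Finset.Icc a b = Finset.Ico a (a + c) := by ext; simp; omega
  rw [this, hc, Finset.prod_Ico_eq_prod_range, Nat.add_sub_cancel_left]
  clear this hc h
  induction c with
  | zero => simp
  | succ c ih =>
    rw [Finset.prod_range_succ, ← mul_assoc, ih, ← add_assoc, Nat.factorial_succ]
    push_cast; ring

/-- This is the origin of the left endpoint of the interval: `λ₁(1/m) = 1`. -/
theorem realF_one (hm : 2 ≤ m) : realF m t 1 = 1 / m := by
  have h1 : t ≤ m * t := Nat.le_mul_of_pos_left _ (by omega)
  have h := prod_Icc_add_one t (m * t + m - 2) (by omega)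
  have h2 : m * t + m - 2 + 1 = m * t + m - 1 := by omega
  rw [h2] at h
  have h3 : ((m * t + m - 1)! : ℝ) ≠ 0 := by positivity
  have h4 : (m : ℝ) ≠ 0 := by positivity
  rw [realF, div_mul_eq_mul_div, h]
  field_simp

/-- Intermediate value theorem between the zero `-t` and a point `b ≥ 1`, where the single factor `b
+ t` already exceeds `x / c` and the other factors are at least 1. -/
theorem exists_realF_eq (hm : 2 ≤ m) {x : ℝ} (hx : 0 < x) : ∃ θ, -(t : ℝ) < θ ∧ realF m t θ = x := by
  set c := (t ! : ℝ) / ((m : ℝ) * ((m * t + m - 1)! : ℝ)) with hc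
  have hcpos : 0 < c := leadingF_pos hm
  have h0 : realF m t (-(t : ℝ)) = 0 := by
    rw [realF, Finset.prod_eq_zero (t_mem_Icc hm) (by ring), mul_zero]
  set b := max 1 (x / c) with hb
  have hb1 : 1 ≤ b := le_max_left _ _
  have hbig : x ≤ realF m t b := by
    have h1 : b ≤ ∏ i ∈ Finset.Icc t (m * t + m - 2), (b + (i : ℝ)) := by
      rw [← Finset.mul_prod_erase _ _ (t_mem_Icc hm)]
      have h2 : (1 : ℝ) ≤ ∏ i ∈ (Finset.Icc t (m * t + m - 2)).erase t, (b + (i : ℝ)) := by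
        rw [← Finset.prod_const_one (s := (Finset.Icc t (m * t + m - 2)).erase t)]
        refine Finset.prod_le_prod (fun _ _ => zero_le_one) fun i _ => ?_
        have : (0 : ℝ) ≤ i := Nat.cast_nonneg _
        linarith
      have h3 : (0 : ℝ) ≤ t := Nat.cast_nonneg _
      nlinarith
    calc x = c * (x / c) := by field_simp
      _ ≤ c * b := by gcongr; exact le_max_right _ _
      _ ≤ _ := by rw [realF]; gcongr
  have h3 : (0 : ℝ) ≤ t := Nat.cast_nonneg _
  obtain ⟨θ, hθ, hθx⟩ := intermediate_value_Icc (by linarith : -(t : ℝ) ≤ b)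
    (continuous_realF (m := m) (t := t)).continuousOn ⟨h0.le.trans hx.le, hbig⟩
  refine ⟨θ, lt_of_le_of_ne hθ.1 fun h => ?_, hθx⟩
  rw [← h, h0] at hθx
  exact hx.ne hθx

/-- If `θ'` were not strictly to the left of `θ`, every factor `θ' + i` would have larger modulus
than the positive number `θ + i`, so the two products could not agree. -/
theorem re_lt_of_polyF_eval_eq (hm : 2 ≤ m) {θ : ℝ} (hθ : -(t : ℝ) < θ) {θ' : ℂ}
    (h : (polyF m t).eval θ' = (polyF m t).eval (θ : ℂ)) (hne : θ' ≠ θ) :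
    θ'.re < (θ : ℂ).re := by
  by_contra hcon
  rw [not_lt, Complex.ofReal_re] at hcon
  have hlt : ∀ i ∈ Finset.Icc t (m * t + m - 2), ‖(θ : ℂ) + i‖ < ‖θ' + i‖ := by
    intro i hi
    have hpos := add_pos_of_mem_Icc hθ hi
    have e1 : ‖(θ : ℂ) + i‖ = θ + i := by
      rw [← Complex.ofReal_natCast, ← Complex.ofReal_add, Complex.norm_real,
        Real.norm_of_nonneg hpos.le]
    rw [e1]
    have e2 : (θ' + i).re = θ'.re + i := by simp
    by_cases him : θ'.im = 0
    · have hre : θ < θ'.re := lt_of_le_of_ne hcon fun h' => hne (Complex.ext (by simp [h']) (by simp [him]))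
      calc θ + i < (θ' + i).re := by rw [e2]; linarith
        _ ≤ _ := Complex.re_le_norm _
    · calc θ + i ≤ |(θ' + i).re| := by rw [e2]; exact (by linarith : θ + i ≤ θ'.re + i).trans (le_abs_self _)
        _ < ‖θ' + i‖ := Complex.abs_re_lt_norm.2 (by simpa using him)
  have hprod : ∏ i ∈ Finset.Icc t (m * t + m - 2), ‖(θ : ℂ) + i‖ <
      ∏ i ∈ Finset.Icc t (m * t + m - 2), ‖θ' + i‖ := by
    refine Finset.prod_lt_prod_of_nonempty (fun i hi => ?_) hlt ⟨t, t_mem_Icc hm⟩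
    have hpos := add_pos_of_mem_Icc hθ hi
    rw [← Complex.ofReal_natCast, ← Complex.ofReal_add, Complex.norm_real]
    exact norm_pos_iff.2 hpos.ne'
  rw [polyF_eval, polyF_eval] at h
  have hc : (t ! : ℂ) / ((m : ℂ) * ((m * t + m - 1)! : ℂ)) ≠ 0 := by
    have : (m : ℂ) ≠ 0 := by exact_mod_cast (by omega : m ≠ 0)
    have h3 : ((m * t + m - 1)! : ℂ) ≠ 0 := by exact_mod_cast Nat.factorial_ne_zero _
    have h4 : (t ! : ℂ) ≠ 0 := by exact_mod_cast Nat.factorial_ne_zero _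
    positivity
  have := congrArg norm (mul_left_cancel₀ hc h)
  rw [norm_prod, norm_prod] at this
  exact hprod.ne this.symm

theorem polyF_derivative_eval {θ : ℂ} (hθ : ∀ i ∈ Finset.Icc t (m * t + m - 2), θ + i ≠ 0) :
    (polyF m t).derivative.eval θ =
      (polyF m t).eval θ * ∑ i ∈ Finset.Icc t (m * t + m - 2), (θ + i)⁻¹ := by
  rw [polyF_eval, polyF, Polynomial.derivative_C_mul, Polynomial.eval_C_mul, mul_assoc,
    Polynomial.derivative_prod_finset, Polynomial.eval_finsetSum]
  congr 1
  rw [Finset.mul_sum]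
  refine Finset.sum_congr rfl fun i hi => ?_
  rw [← Finset.prod_erase_mul _ (fun i : ℕ => θ + (i : ℂ)) hi, mul_assoc,
    mul_inv_cancel₀ (hθ i hi)]
  simp [Polynomial.eval_prod]

theorem polyF_derivative_eval_ofReal {θ : ℝ} (hθ : -(t : ℝ) < θ) :
    (polyF m t).derivative.eval (θ : ℂ) =
      ((realF m t θ * ∑ i ∈ Finset.Icc t (m * t + m - 2), (θ + i)⁻¹ : ℝ) : ℂ) := by
  rw [polyF_derivative_eval, polyF_eval_ofReal]
  · push_cast; rfl
  · intro i hi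
    rw [← Complex.ofReal_natCast, ← Complex.ofReal_add]
    exact Complex.ofReal_ne_zero.2 (add_pos_of_mem_Icc hθ hi).ne'

theorem sum_inv_pos (hm : 2 ≤ m) {θ : ℝ} (hθ : -(t : ℝ) < θ) :
    0 < ∑ i ∈ Finset.Icc t (m * t + m - 2), (θ + i)⁻¹ :=
  Finset.sum_pos (fun _ hi => inv_pos.2 (add_pos_of_mem_Icc hθ hi)) ⟨t, t_mem_Icc hm⟩

theorem polyF_derivative_ne_zero (hm : 2 ≤ m) {θ : ℝ} (hθ : -(t : ℝ) < θ) :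
    (polyF m t).derivative.eval (θ : ℂ) ≠ 0 := by
  rw [polyF_derivative_eval_ofReal hθ]
  exact Complex.ofReal_ne_zero.2 (mul_pos (realF_pos hm hθ) (sum_inv_pos hm hθ)).ne'

theorem polyF_sub_C_ne_zero (hm : 2 ≤ m) (z : ℂ) : polyF m t - Polynomial.C z ≠ 0 := by
  intro h
  have : (polyF m t).derivative = 0 := by rw [sub_eq_zero.1 h]; simp
  have h2 := polyF_derivative_ne_zero (t := t) hm (θ := 1) (by
    have : (0 : ℝ) ≤ t := Nat.cast_nonneg _
    linarith)
  simp [this] at h2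

theorem mem_rootsF (hm : 2 ≤ m) {z θ : ℂ} : θ ∈ rootsF m t z ↔ (polyF m t).eval θ = z := by
  rw [rootsF, Polynomial.mem_roots (polyF_sub_C_ne_zero hm z), Polynomial.IsRoot]
  simp [sub_eq_zero]

/-- Near the positive real axis the dominant root is simple, analytic, and separated from the
other roots. -/
theorem dominantRoot_local (hm : 2 ≤ m) {θ₀ : ℝ} (hθ : -(t : ℝ) < θ₀) :
    ∃ δ > 0, ∀ ε > 0, ε ≤ δ → ∃ r > 0, ∀ z ∈ Metric.ball (realF m t θ₀ : ℂ) r,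
      (polyF m t).eval (dominantRoot m t z) = z ∧ ‖dominantRoot m t z - θ₀‖ < ε ∧
      dominantRoot m t z ∈ rootsF m t z ∧
      HasDerivAt (dominantRoot m t) ((polyF m t).derivative.eval (dominantRoot m t z))⁻¹ z ∧
      ∀ θ ∈ (rootsF m t z).erase (dominantRoot m t z), θ.re < θ₀ - δ := by
  obtain ⟨δ, hδ, H⟩ := exists_local_dominant_root (polyF m t) (θ₀ : ℂ)
    (polyF_derivative_ne_zero hm hθ) (fun θ h hne => re_lt_of_polyF_eval_eq hm hθ h hne)
  refine ⟨δ, hδ, fun ε hε hεδ => ?_⟩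
  obtain ⟨r, hr, g, -, hg⟩ := H ε hε
  rw [polyF_eval_ofReal] at hg
  have herase : ∀ z ∈ Metric.ball (realF m t θ₀ : ℂ) r,
      ∀ θ ∈ (rootsF m t z).erase (g z), θ.re < θ₀ - δ := by
    intro z hz θ hmem
    obtain ⟨h1, h2, h3, h4, h5⟩ := hg z hz
    have hmem' := (mem_rootsF hm).1 (Multiset.mem_of_mem_erase hmem)
    refine h5 θ hmem' fun heq => ?_
    rw [heq] at hmem
    -- A second copy of `g z` among the roots would make it a multiple root, where the derivative
    -- vanishes.
    have hcount : 1 < (polyF m t - Polynomial.C z).rootMultiplicity (g z) := by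
      rw [← Polynomial.count_roots]
      have := Multiset.one_le_count_iff_mem.2 hmem
      rw [Multiset.count_erase_self] at this
      change 1 ≤ Multiset.count (g z) (polyF m t - Polynomial.C z).roots - 1 at this
      omega
    have := (Polynomial.one_lt_rootMultiplicity_iff_isRoot (polyF_sub_C_ne_zero hm z)).1 hcount
    apply h3
    simpa [Polynomial.IsRoot] using this.2
  -- The condition `ε ≤ δ` keeps `g z` to the right of the line `re = θ₀ - δ`, beyond which no other
  -- root lies.
  have hdom : ∀ z ∈ Metric.ball (realF m t θ₀ : ℂ) r, dominantRoot m t z = g z := by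
    intro z hz
    obtain ⟨h1, h2, h3, h4, h5⟩ := hg z hz
    refine dominantRoot_eq_of_dominant ((mem_rootsF hm).2 h1) fun θ hθ' => ?_
    have h6 := herase z hz θ hθ'
    have h7 := (abs_lt.1 ((Complex.abs_re_le_norm _).trans_lt h2)).1
    simp only [Complex.sub_re, Complex.ofReal_re] at h7
    linarith
  refine ⟨r, hr, fun z hz => ?_⟩
  rw [hdom z hz]
  obtain ⟨h1, h2, h3, h4, h5⟩ := hg z hz
  refine ⟨h1, h2, (mem_rootsF hm).2 h1, h4.congr_of_eventuallyEq ?_, herase z hz⟩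
  filter_upwards [Metric.isOpen_ball.mem_nhds hz] with w hw using hdom w hw

theorem dominantRoot_realF (hm : 2 ≤ m) {θ : ℝ} (hθ : -(t : ℝ) < θ) :
    dominantRoot m t (realF m t θ : ℂ) = θ := by
  obtain ⟨δ, hδ, H⟩ := dominantRoot_local hm hθ
  obtain ⟨r, hr, h⟩ := H δ hδ le_rfl
  obtain ⟨h1, h2, h3, h4, h5⟩ := h _ (Metric.mem_ball_self hr)
  by_contra hne
  have hmem : (θ : ℂ) ∈ rootsF m t (realF m t θ : ℂ) := (mem_rootsF hm).2 (polyF_eval_ofReal m t θ)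
  have := h5 θ ((Multiset.mem_erase_of_ne (Ne.symm hne)).2 hmem)
  simp at this
  linarith

/-! ### The constants `α₀`, `β(α)`, `α₊` -/

/-- `β λ₁'(β)` as a function of `θ = λ₁(β)`. -/
noncomputable def logSlope (m t : ℕ) (θ : ℝ) : ℝ :=
  (∑ i ∈ Finset.Icc t (m * t + m - 2), (θ + i)⁻¹)⁻¹

theorem logSlope_pos (hm : 2 ≤ m) {θ : ℝ} (hθ : -(t : ℝ) < θ) : 0 < logSlope m t θ :=
  inv_pos.2 (sum_inv_pos hm hθ)

/-- The inverse function rule gives `λ₁'(F(θ)) = 1 / F'(θ)`, and `F / F'` is the reciprocal of the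
logarithmic derivative `∑ 1/(θ+i)`. -/
theorem mul_deriv_dominantRoot (hm : 2 ≤ m) {θ : ℝ} (hθ : -(t : ℝ) < θ) :
    (realF m t θ : ℂ) * deriv (dominantRoot m t) (realF m t θ : ℂ) = (logSlope m t θ : ℂ) := by
  obtain ⟨δ, hδ, H⟩ := dominantRoot_local hm hθ
  obtain ⟨r, hr, h⟩ := H δ hδ le_rfl
  obtain ⟨h1, h2, h3, h4, h5⟩ := h _ (Metric.mem_ball_self hr)
  rw [h4.deriv, dominantRoot_realF hm hθ, polyF_derivative_eval_ofReal hθ, logSlope]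
  have := (realF_pos (t := t) hm hθ).ne'
  rw [← Complex.ofReal_inv, ← Complex.ofReal_mul, mul_inv, mul_inv_cancel_left₀ this]

theorem logSlope_lt (hm : 2 ≤ m) {θ θ' : ℝ} (hθ : -(t : ℝ) < θ) (h : θ < θ') :
    logSlope m t θ < logSlope m t θ' := by
  unfold logSlope
  refine (inv_lt_inv₀ (sum_inv_pos hm hθ) (sum_inv_pos hm (hθ.trans h))).2 ?_
  refine Finset.sum_lt_sum_of_nonempty ⟨t, t_mem_Icc hm⟩ fun i hi => ?_
  exact (inv_lt_inv₀ (add_pos_of_mem_Icc (hθ.trans h) hi) (add_pos_of_mem_Icc hθ hi)).2 (by linarith)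

theorem logSlope_inj (hm : 2 ≤ m) {θ θ' : ℝ} (hθ : -(t : ℝ) < θ) (hθ' : -(t : ℝ) < θ')
    (h : logSlope m t θ = logSlope m t θ') : θ = θ' := by
  rcases lt_trichotomy θ θ' with h1 | h1 | h1
  · exact absurd h (logSlope_lt hm hθ h1).ne
  · exact h1
  · exact absurd h (logSlope_lt hm hθ' h1).ne'

/-- The choice made by `beta` is forced: every positive number is some `F(θ')`, and strict
monotonicity of `logSlope` determines `θ'`. -/
theorem beta_logSlope (hm : 2 ≤ m) {θ : ℝ} (hθ : -(t : ℝ) < θ) :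
    beta m t (logSlope m t θ) = realF m t θ := by
  have hex : ∃ β : ℝ, 0 < β ∧ (β : ℂ) * deriv (dominantRoot m t) (β : ℂ) = (logSlope m t θ : ℂ) :=
    ⟨realF m t θ, realF_pos hm hθ, mul_deriv_dominantRoot hm hθ⟩
  obtain ⟨h1, h2⟩ := Classical.epsilon_spec hex
  change 0 < beta m t (logSlope m t θ) at h1
  change (beta m t (logSlope m t θ) : ℂ) * deriv (dominantRoot m t) (beta m t (logSlope m t θ) : ℂ)
    = _ at h2
  obtain ⟨θ', hθ', h3⟩ := exists_realF_eq (t := t) hm h1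
  rw [← h3, mul_deriv_dominantRoot hm hθ'] at h2
  rw [← h3, logSlope_inj hm hθ' hθ (Complex.ofReal_injective h2)]

theorem continuousOn_logSlope (hm : 2 ≤ m) : ContinuousOn (logSlope m t) (Set.Ioi (-(t : ℝ))) := by
  intro θ hθ
  refine ContinuousAt.continuousWithinAt ?_
  refine ContinuousAt.inv₀ ?_ (sum_inv_pos hm hθ).ne'
  refine tendsto_finsetSum _ fun i hi => ?_
  exact ContinuousAt.inv₀ (by fun_prop) (add_pos_of_mem_Icc hθ hi).ne'

/-- Thus `α₀` belongs to `λ₁ = 1`, that is to `β = 1/m`, and the condition `α > α₀` means `λ₁ > 1`.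
-/
theorem logSlope_one (hm : 2 ≤ m) : logSlope m t 1 = alphaZero m t := by
  unfold logSlope alphaZero
  congr 1
  have h1 : t ≤ m * t := Nat.le_mul_of_pos_left _ (by omega)
  have : (t + 1) * m - 1 = m * t + m - 2 + 1 := by
    have : (t + 1) * m = m * t + m := by ring
    omega
  rw [this]
  refine Finset.sum_bij (fun i _ => i + 1) ?_ ?_ ?_ ?_
  · intro i hi; simp at hi ⊢; omega
  · intro i _ j _ h; simpa using h
  · intro j hj; simp at hj; exact ⟨j - 1, by simp; omega, by omega⟩
  · intro i _; push_cast; rw [one_div, add_comm]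

/-- An elementary lower bound that shows that `logSlope` is unbounded. -/
theorem le_logSlope (hm : 2 ≤ m) {θ : ℝ} (hθ : -(t : ℝ) < θ) :
    (θ + t) / (Finset.Icc t (m * t + m - 2)).card ≤ logSlope m t θ := by
  unfold logSlope
  have hc : (0 : ℝ) < (Finset.Icc t (m * t + m - 2)).card := by
    exact_mod_cast Finset.card_pos.2 ⟨t, t_mem_Icc hm⟩
  rw [← inv_div]
  refine (inv_le_inv₀ (div_pos hc (by linarith)) (sum_inv_pos hm hθ)).2 ?_
  rw [div_eq_mul_inv, ← nsmul_eq_mul]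
  refine Finset.sum_le_card_nsmul _ _ _ fun i hi => ?_
  have : (t : ℝ) ≤ i := by exact_mod_cast (Finset.mem_Icc.1 hi).1
  exact (inv_le_inv₀ (add_pos_of_mem_Icc hθ hi) (by linarith)).2 (by linarith)

theorem exists_logSlope_eq (hm : 2 ≤ m) {α : ℝ} (hα : logSlope m t 1 < α) :
    ∃ θ, 1 < θ ∧ logSlope m t θ = α := by
  set c : ℝ := ((Finset.Icc t (m * t + m - 2)).card : ℝ) with hc
  have hcpos : (0 : ℝ) < c := by
    rw [hc]
    exact_mod_cast Finset.card_pos.2 ⟨t, t_mem_Icc hm⟩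
  have ht : (0 : ℝ) ≤ t := Nat.cast_nonneg _
  have hα0 : 0 < α := (logSlope_pos hm (by linarith)).trans hα
  set b := max 1 (α * c) with hb
  have hb1 : (1 : ℝ) ≤ b := le_max_left _ _
  have h1 : α ≤ logSlope m t b := by
    refine le_trans ?_ (le_logSlope hm (by linarith))
    rw [le_div_iff₀ hcpos]
    linarith [le_max_right 1 (α * c)]
  obtain ⟨θ, hθ, h⟩ := intermediate_value_Icc hb1
    ((continuousOn_logSlope (t := t) hm).mono fun x hx => by
      have := hx.1; simp only [Set.mem_Ioi]; linarith) ⟨hα.le, h1⟩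
  refine ⟨θ, lt_of_le_of_ne hθ.1 fun h' => ?_, h⟩
  rw [← h'] at h
  exact hα.ne h

theorem log_realF (hm : 2 ≤ m) {θ : ℝ} (hθ : -(t : ℝ) < θ) : Real.log (realF m t θ) =
    Real.log ((t ! : ℝ) / ((m : ℝ) * ((m * t + m - 1)! : ℝ))) +
      ∑ i ∈ Finset.Icc t (m * t + m - 2), Real.log (θ + i) := by
  rw [realF, Real.log_mul (leadingF_pos hm).ne'
    (Finset.prod_pos fun _ hi => add_pos_of_mem_Icc hθ hi).ne',
    Real.log_prod fun i hi => (add_pos_of_mem_Icc hθ hi).ne']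

/-- `(λ₁ - α log β - 1) / α` as a function of `θ = λ₁(β)`. -/
noncomputable def heightGap (m t : ℕ) (θ : ℝ) : ℝ :=
  (θ - 1) * ∑ i ∈ Finset.Icc t (m * t + m - 2), (θ + i)⁻¹ - Real.log (realF m t θ)

theorem logSlope_mul_heightGap (hm : 2 ≤ m) {θ : ℝ} (hθ : -(t : ℝ) < θ) :
    logSlope m t θ * heightGap m t θ = θ - 1 - logSlope m t θ * Real.log (realF m t θ) := by
  have := (sum_inv_pos (t := t) hm hθ).ne'
  rw [heightGap, logSlope]
  generalize ∑ i ∈ Finset.Icc t (m * t + m - 2), (θ + (i : ℝ))⁻¹ = a at this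
  field_simp

/-- Up to a constant, `heightGap` is a sum of terms `(x-1)/(x+i) - log(x+i)`, and each has
derivative `(1-x)/(x+i)²`, which is negative for `x > 1`. -/
theorem heightGap_lt (hm : 2 ≤ m) {θ θ' : ℝ} (hθ : 1 ≤ θ) (h : θ < θ') :
    heightGap m t θ' < heightGap m t θ := by
  have ht : (0 : ℝ) ≤ t := Nat.cast_nonneg _
  have key : ∀ i : ℕ, (θ' - 1) * (θ' + i)⁻¹ - Real.log (θ' + i) <
      (θ - 1) * (θ + i)⁻¹ - Real.log (θ + i) := by
    intro i
    have hi : (0 : ℝ) ≤ i := Nat.cast_nonneg _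
    have hanti : StrictAntiOn (fun x : ℝ => (x - 1) * (x + i)⁻¹ - Real.log (x + i)) (Set.Ici 1) := by
      have hder : ∀ x : ℝ, 1 ≤ x → HasDerivAt (fun x : ℝ => (x - 1) * (x + i)⁻¹ - Real.log (x + i))
          ((1 - x) / (x + i) ^ 2) x := by
        intro x hx
        have h0 : x + i ≠ 0 := by positivity
        have h1 : HasDerivAt (fun x : ℝ => x + i) 1 x := (hasDerivAt_id x).add_const _
        have h2 : HasDerivAt (fun x : ℝ => x - 1) 1 x := (hasDerivAt_id x).sub_const _
        refine ((h2.mul (h1.inv h0)).sub (h1.log h0)).congr_deriv ?_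
        simp only [Pi.inv_apply]
        field_simp
        ring
      refine strictAntiOn_of_deriv_neg (convex_Ici 1)
        (fun x hx => (hder x hx).continuousAt.continuousWithinAt) fun x hx => ?_
      rw [interior_Ici] at hx
      have hx' : (1 : ℝ) < x := hx
      rw [(hder x hx'.le).deriv]
      exact div_neg_of_neg_of_pos (by linarith) (by positivity)
    exact hanti hθ (hθ.trans h.le) h
  have e : ∀ x : ℝ, 1 ≤ x → heightGap m t x = ∑ i ∈ Finset.Icc t (m * t + m - 2),
      ((x - 1) * (x + i)⁻¹ - Real.log (x + i)) -
        Real.log ((t ! : ℝ) / ((m : ℝ) * ((m * t + m - 1)! : ℝ))) := by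
    intro x hx
    rw [heightGap, log_realF hm (by linarith), Finset.sum_sub_distrib, Finset.mul_sum]
    ring
  rw [e θ hθ, e θ' (hθ.trans h.le)]
  have := Finset.sum_lt_sum_of_nonempty ⟨t, t_mem_Icc (t := t) hm⟩ fun i _ => key i
  linarith

theorem heightGap_one_pos (hm : 2 ≤ m) : 0 < heightGap m t 1 := by
  have h1 : (1 : ℝ) < m := by exact_mod_cast (by omega : 1 < m)
  rw [heightGap, realF_one hm, one_div, Real.log_inv]
  have := Real.log_pos h1
  simpa using this

theorem continuousOn_heightGap (hm : 2 ≤ m) :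
    ContinuousOn (heightGap m t) (Set.Ioi (-(t : ℝ))) := by
  intro θ hθ
  refine ContinuousAt.continuousWithinAt ?_
  refine ContinuousAt.sub (ContinuousAt.mul (by fun_prop) ?_)
    (continuous_realF.continuousAt.log (realF_pos hm hθ).ne')
  exact tendsto_finsetSum _ fun i hi =>
    ContinuousAt.inv₀ (by fun_prop) (add_pos_of_mem_Icc hθ hi).ne'

/-- The function is `log m > 0` at 1. Its first part never exceeds the number `c` of factors, so it
is negative at the point `b` with `log F(b) = c + 1`. -/
theorem exists_heightGap_eq_zero (hm : 2 ≤ m) : ∃ θ, 1 < θ ∧ heightGap m t θ = 0 := by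
  have ht : (0 : ℝ) ≤ t := Nat.cast_nonneg _
  set c : ℝ := ((Finset.Icc t (m * t + m - 2)).card : ℝ) with hc
  obtain ⟨b, hb, hbF⟩ := exists_realF_eq (t := t) hm (Real.exp_pos (c + 1))
  have hb1 : 1 < b := by
    rw [← realF_lt_iff (t := t) hm (by linarith) hb, realF_one hm, hbF]
    have h1 : (1 : ℝ) ≤ m := by exact_mod_cast (by omega : 1 ≤ m)
    have h2 : 1 / (m : ℝ) ≤ 1 := by rw [div_le_one (by linarith)]; exact h1
    have h3 : (0 : ℝ) ≤ c := Nat.cast_nonneg _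
    have := Real.add_one_le_exp (c + 1)
    linarith
  have hneg : heightGap m t b ≤ 0 := by
    rw [heightGap, hbF, Real.log_exp, Finset.mul_sum]
    have : ∑ i ∈ Finset.Icc t (m * t + m - 2), (b - 1) * (b + i)⁻¹ ≤ c := by
      rw [hc, ← nsmul_one]
      refine Finset.sum_le_card_nsmul _ _ _ fun i hi => ?_
      have hi : (0 : ℝ) ≤ i := Nat.cast_nonneg _
      rw [← div_eq_mul_inv, div_le_one (by linarith)]
      linarith
    linarith
  obtain ⟨θ, hθ, h⟩ := intermediate_value_Icc' hb1.le
    ((continuousOn_heightGap (t := t) hm).mono fun x hx => by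
      have := hx.1; simp only [Set.mem_Ioi]; linarith) ⟨hneg, (heightGap_one_pos hm).le⟩
  refine ⟨θ, lt_of_le_of_ne hθ.1 fun h' => ?_, h⟩
  rw [← h'] at h
  exact (heightGap_one_pos hm).ne' h

/-- `β(α₊) = F(θ₊)` where `θ₊ > 1` is the zero of `heightGap`. -/
theorem beta_alphaPlus (hm : 2 ≤ m) :
    ∃ θp, 1 < θp ∧ heightGap m t θp = 0 ∧ beta m t (alphaPlus m t) = realF m t θp := by
  have ht : (0 : ℝ) ≤ t := Nat.cast_nonneg _
  have key : ∀ θ, 1 < θ →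
      (dominantRoot m t (beta m t (logSlope m t θ) : ℂ) -
        ((logSlope m t θ * Real.log (beta m t (logSlope m t θ)) : ℝ) : ℂ) - 1 = 0 ↔
        heightGap m t θ = 0) := by
    intro θ hθ
    have hθt : -(t : ℝ) < θ := by linarith
    rw [beta_logSlope hm hθt, dominantRoot_realF hm hθt, ← Complex.ofReal_sub,
      ← Complex.ofReal_one, ← Complex.ofReal_sub, Complex.ofReal_eq_zero]
    have h2 := logSlope_mul_heightGap (t := t) hm hθt
    have h3 := (logSlope_pos (t := t) hm hθt).ne'
    constructor
    · intro h
      have : logSlope m t θ * heightGap m t θ = 0 := by rw [h2]; linarith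
      exact (mul_eq_zero.1 this).resolve_left h3
    · intro h
      rw [h, mul_zero] at h2
      linarith
  have hex : ∃ α : ℝ, alphaZero m t < α ∧
      dominantRoot m t (beta m t α : ℂ) - ((α * Real.log (beta m t α) : ℝ) : ℂ) - 1 = 0 := by
    obtain ⟨θ, hθ, h⟩ := exists_heightGap_eq_zero (t := t) hm
    refine ⟨logSlope m t θ, ?_, (key θ hθ).2 h⟩
    rw [← logSlope_one hm]
    exact logSlope_lt hm (by linarith) hθ
  obtain ⟨h1, h2⟩ := Classical.epsilon_spec hex
  change alphaZero m t < alphaPlus m t at h1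
  change dominantRoot m t (beta m t (alphaPlus m t) : ℂ) -
    ((alphaPlus m t * Real.log (beta m t (alphaPlus m t)) : ℝ) : ℂ) - 1 = 0 at h2
  rw [← logSlope_one hm] at h1
  obtain ⟨θ, hθ, h3⟩ := exists_logSlope_eq hm h1
  rw [← h3] at h2 ⊢
  exact ⟨θ, hθ, (key θ hθ).1 h2, beta_logSlope hm (by linarith)⟩

theorem one_div_lt_beta_alphaPlus (hm : 2 ≤ m) : 1 / (m : ℝ) < beta m t (alphaPlus m t) := by
  obtain ⟨θ, h1, -, h3⟩ := beta_alphaPlus (t := t) hm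
  have ht : (0 : ℝ) ≤ t := Nat.cast_nonneg _
  rw [h3, ← realF_one (t := t) hm]
  exact realF_lt hm (by linarith) h1

/-- The function `s ↦ log F(s(θ-1)+1) - s log F(θ)` vanishes at `s = 1` and has derivative
`heightGap m t θ` there, so it is positive just above 1. -/
theorem exists_exponent (hm : 2 ≤ m) {θ : ℝ} (hθ : 1 < θ) (h : 0 < heightGap m t θ) :
    ∃ s : ℝ, 1 < s ∧ s < 2 ∧ realF m t θ ^ s < realF m t (s * (θ - 1) + 1) := by
  have ht : (0 : ℝ) ≤ t := Nat.cast_nonneg _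
  set f : ℝ → ℝ := fun s => Real.log (realF m t (s * (θ - 1) + 1)) - s * Real.log (realF m t θ)
    with hf
  have hf1 : f 1 = 0 := by simp [hf]
  have hF : HasDerivAt (fun x => Real.log (realF m t x))
      (∑ i ∈ Finset.Icc t (m * t + m - 2), (θ + i)⁻¹) θ := by
    have h1 : HasDerivAt (fun x : ℝ => Real.log ((t ! : ℝ) / ((m : ℝ) * ((m * t + m - 1)! : ℝ))) +
        ∑ i ∈ Finset.Icc t (m * t + m - 2), Real.log (x + i))
        (∑ i ∈ Finset.Icc t (m * t + m - 2), (θ + i)⁻¹) θ := by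
      refine HasDerivAt.const_add _ (HasDerivAt.fun_sum fun i hi => ?_)
      have h2 : HasDerivAt (fun x : ℝ => x + i) 1 θ := (hasDerivAt_id θ).add_const _
      simpa using h2.log (add_pos_of_mem_Icc (by linarith) hi).ne'
    refine h1.congr_of_eventuallyEq ?_
    filter_upwards [Ioi_mem_nhds (by linarith : -(t : ℝ) < θ)] with x hx using log_realF hm hx
  have hd : HasDerivAt f (heightGap m t θ) 1 := by
    have h1 : HasDerivAt (fun s : ℝ => s * (θ - 1) + 1) (θ - 1) 1 := by
      simpa using ((hasDerivAt_id (1 : ℝ)).mul_const (θ - 1)).add_const 1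
    have h2 : HasDerivAt (fun s : ℝ => s * Real.log (realF m t θ)) (Real.log (realF m t θ)) 1 := by
      simpa using (hasDerivAt_id (1 : ℝ)).mul_const (Real.log (realF m t θ))
    have h4 := (HasDerivAt.comp_of_eq (1 : ℝ) hF h1 (by ring)).sub h2
    refine h4.congr_deriv ?_
    rw [heightGap]; ring
  have hs := (hasDerivWithinAt_iff_tendsto_slope' (by simp)).1 (hd.hasDerivWithinAt (s := Set.Ioi 1))
  have h1 := hs.eventually_const_lt h
  have h2 : ∀ᶠ s in 𝓝[>] (1 : ℝ), s ∈ Set.Ioo (1 : ℝ) 2 := Ioo_mem_nhdsGT (by norm_num)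
  obtain ⟨s, hs1, hs2⟩ := (h1.and h2).exists
  refine ⟨s, hs2.1, hs2.2, ?_⟩
  rw [slope_def_field, hf1, sub_zero] at hs1
  have hpos : 0 < f s := by
    have := hs2.1
    by_contra hcon
    exact absurd hs1 (not_lt.2 (div_nonpos_of_nonpos_of_nonneg (not_lt.1 hcon) (by linarith)))
  have hs0 : 0 < s * (θ - 1) := mul_pos (by linarith [hs2.1]) (by linarith)
  rw [← Real.log_lt_log_iff (Real.rpow_pos_of_pos (realF_pos hm (by linarith)) _)
    (realF_pos hm (by linarith)), Real.log_rpow (realF_pos hm (by linarith))]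
  simp only [hf] at hpos
  linarith

/-- Every `x` in `(1/m, β(α₊))` is `F(θ)` for a `θ > 1` at which the `s`-contraction condition holds
for some `s > 1`. -/
theorem exists_theta_of_mem_interval (hm : 2 ≤ m) {x : ℝ} (h1 : 1 / (m : ℝ) < x)
    (h2 : x < beta m t (alphaPlus m t)) :
    ∃ θ s : ℝ, 1 < θ ∧ realF m t θ = x ∧ 1 < s ∧ s < 2 ∧ x ^ s < realF m t (s * (θ - 1) + 1) := by
  have ht : (0 : ℝ) ≤ t := Nat.cast_nonneg _
  have hm0 : (0 : ℝ) < m := by positivity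
  have hx : 0 < x := (by positivity : 0 < 1 / (m : ℝ)).trans h1
  obtain ⟨θ, hθ, rfl⟩ := exists_realF_eq (t := t) hm hx
  obtain ⟨θp, hp1, hp2, hp3⟩ := beta_alphaPlus (t := t) hm
  rw [hp3, realF_lt_iff hm hθ (by linarith)] at h2
  rw [← realF_one (t := t) hm, realF_lt_iff hm (by linarith) hθ] at h1
  obtain ⟨s, hs1, hs2, hs3⟩ := exists_exponent (t := t) hm h1 (by
    rw [← hp2]; exact heightGap_lt hm h1.le h2)
  exact ⟨θ, s, h1, rfl, hs1, hs2, hs3⟩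

/-! ### Ranks, pivots and block sizes -/

/-- The number of pivots below `x`. -/
def below (P : Finset ℕ) (x : ℕ) : ℕ := (P.filter (· < x)).card

/-- The sizes of the blocks determined by a set of pivots. -/
def blockSizes (m : ℕ) (S P : Finset ℕ) : Fin m → ℕ := fun i => (block S P i).card

theorem mem_block {S P : Finset ℕ} {i x : ℕ} :
    x ∈ block S P i ↔ x ∈ S ∧ x ∉ P ∧ below P x = i := by
  simp [block, below, and_assoc]

theorem below_mono (P : Finset ℕ) {x y : ℕ} (h : x ≤ y) : below P x ≤ below P y :=
  Finset.card_le_card fun a ha => by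
    simp only [Finset.mem_filter] at ha ⊢
    exact ⟨ha.1, ha.2.trans_le h⟩

theorem below_lt_of_mem {P : Finset ℕ} {x y : ℕ} (hx : x ∈ P) (h : x < y) :
    below P x < below P y := by
  refine Finset.card_lt_card ⟨fun a ha => ?_, fun hsub => ?_⟩
  · simp only [Finset.mem_filter] at ha ⊢
    exact ⟨ha.1, ha.2.trans h⟩
  · have := hsub (Finset.mem_filter.2 ⟨hx, h⟩)
    simp at this

theorem below_le_card (P : Finset ℕ) (x : ℕ) : below P x ≤ P.card :=
  Finset.card_le_card (Finset.filter_subset _ _)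

theorem rank_eq_below_add_one {P : Finset ℕ} {x : ℕ} (hx : x ∈ P) : rank P x = below P x + 1 := by
  have : P.filter (· ≤ x) = insert x (P.filter (· < x)) := by
    ext a
    simp only [Finset.mem_filter, Finset.mem_insert]
    constructor
    · rintro ⟨h1, h2⟩
      rcases h2.eq_or_lt with h | h
      · exact Or.inl h
      · exact Or.inr ⟨h1, h⟩
    · rintro (h | h)
      · exact ⟨h ▸ hx, h.le⟩
      · exact ⟨h.1, h.2.le⟩
  rw [rank, this, Finset.card_insert_of_notMem (by simp), below]

theorem rank_eq_below {P : Finset ℕ} {x : ℕ} (hx : x ∉ P) : rank P x = below P x := by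
  rw [rank, below]
  congr 1
  refine Finset.filter_congr fun a ha => ⟨fun h => lt_of_le_of_ne h fun h' => hx (h' ▸ ha), le_of_lt⟩

theorem rank_lt_rank {Y : Finset ℕ} {x y : ℕ} (hy : y ∈ Y) (h : x < y) : rank Y x < rank Y y := by
  refine Finset.card_lt_card ⟨fun a ha => ?_, fun hsub => ?_⟩
  · simp only [Finset.mem_filter] at ha ⊢
    exact ⟨ha.1, ha.2.trans h.le⟩
  · have := hsub (Finset.mem_filter.2 ⟨hy, le_rfl⟩)
    simp only [Finset.mem_filter] at this
    omega

theorem rank_injOn (Y : Finset ℕ) : Set.InjOn (rank Y) Y := by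
  intro x hx y hy h
  rcases lt_trichotomy x y with h1 | h1 | h1
  · exact absurd h (rank_lt_rank hy h1).ne
  · exact h1
  · exact absurd h (rank_lt_rank hx h1).ne'

theorem rank_lt_iff {Y : Finset ℕ} {x y : ℕ} (hx : x ∈ Y) (hy : y ∈ Y) :
    rank Y x < rank Y y ↔ x < y := by
  refine ⟨fun h => ?_, rank_lt_rank hy⟩
  by_contra hcon
  rcases (not_lt.1 hcon).eq_or_lt with h1 | h1
  · rw [h1] at h; exact lt_irrefl _ h
  · exact lt_asymm h (rank_lt_rank hx h1)

theorem rank_mem_Ioc {Y : Finset ℕ} {x : ℕ} (hx : x ∈ Y) : rank Y x ∈ Finset.Ioc 0 Y.card :=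
  Finset.mem_Ioc.2 ⟨Finset.card_pos.2 ⟨x, by simp [hx]⟩, Finset.card_le_card (Finset.filter_subset _ _)⟩

theorem exists_rank_eq_of_mem_Ioc {Y : Finset ℕ} {k : ℕ} (hk : k ∈ Finset.Ioc 0 Y.card) :
    ∃ y ∈ Y, rank Y y = k := by
  have := Finset.mem_Ioc.1 hk
  obtain ⟨y, hy, h⟩ := exists_rank_eq Y (k - 1) (by omega)
  exact ⟨y, hy, by omega⟩

theorem image_rank_filter (Y : Finset ℕ) (p : ℕ → Prop) [DecidablePred p] :
    (Y.filter fun y => p (rank Y y)).image (rank Y) = (Finset.Ioc 0 Y.card).filter p := by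
  ext k
  simp only [Finset.mem_image, Finset.mem_filter]
  constructor
  · rintro ⟨y, ⟨hy, hp⟩, rfl⟩
    exact ⟨rank_mem_Ioc hy, hp⟩
  · rintro ⟨hk, hp⟩
    obtain ⟨y, hy, rfl⟩ := exists_rank_eq_of_mem_Ioc hk
    exact ⟨y, ⟨hy, hp⟩, rfl⟩

/-- Ranks identify `Y` with `1, …, |Y|`, so that counting keys by rank becomes counting integers. -/
theorem card_filter_rank (Y : Finset ℕ) (p : ℕ → Prop) [DecidablePred p] :
    (Y.filter fun y => p (rank Y y)).card = ((Finset.Ioc 0 Y.card).filter p).card := by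
  rw [← image_rank_filter, Finset.card_image_of_injOn]
  exact (rank_injOn Y).mono (Finset.filter_subset _ _)

theorem below_regularPivots (t : ℕ) {Y : Finset ℕ} {y : ℕ} (hy : y ∈ Y) :
    below (regularPivots t Y) y = (rank Y y - 1) / (t + 1) := by
  have h1 : (regularPivots t Y).filter (· < y) =
      Y.filter fun x => t + 1 ∣ rank Y x ∧ rank Y x < rank Y y := by
    ext x
    simp only [regularPivots, Finset.mem_filter, and_assoc]
    refine and_congr_right fun hx => and_congr_right fun _ => (rank_lt_iff hx hy).symm
  have h2 := Finset.mem_Ioc.1 (rank_mem_Ioc hy)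
  rw [below, h1, card_filter_rank Y fun k => t + 1 ∣ k ∧ k < rank Y y,
    ← Nat.Ioc_filter_dvd_card_eq_div]
  congr 1
  ext k
  simp only [Finset.mem_filter, Finset.mem_Ioc]
  constructor
  · rintro ⟨⟨h3, h4⟩, h5, h6⟩; exact ⟨⟨h3, by omega⟩, h5⟩
  · rintro ⟨⟨h3, h4⟩, h5⟩; exact ⟨⟨h3, by omega⟩, h5, by omega⟩

theorem pred_mul_add (hm : 1 ≤ m) : m * t + m - 1 = (m - 1) * (t + 1) + t := by
  obtain ⟨d, rfl⟩ : ∃ d, m = d + 1 := ⟨m - 1, by omega⟩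
  have : (d + 1) * t + (d + 1) = d * (t + 1) + t + 1 := by ring
  rw [Nat.add_sub_cancel]; omega

theorem card_regularPivots (hm : 1 ≤ m) {Y : Finset ℕ} (hY : Y.card = m * t + m - 1) :
    (regularPivots t Y).card = m - 1 := by
  rw [regularPivots, card_filter_rank Y fun k => t + 1 ∣ k, Nat.Ioc_filter_dvd_card_eq_div, hY,
    pred_mul_add hm, add_comm, Nat.add_mul_div_right _ _ (Nat.succ_pos t)]
  simp

/-- The sampled keys in the `j`-th block are those whose rank lies strictly between the consecutive
multiples `j(t+1)` and `(j+1)(t+1)`. -/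
theorem card_inter_block (hm : 1 ≤ m) {S Y : Finset ℕ} (hYS : Y ⊆ S) (hY : Y.card = m * t + m - 1)
    (j : Fin m) : (Y ∩ block S (regularPivots t Y) j).card = t := by
  have h1 : Y ∩ block S (regularPivots t Y) j =
      Y.filter fun y => ¬ t + 1 ∣ rank Y y ∧ (rank Y y - 1) / (t + 1) = j := by
    ext y
    simp only [Finset.mem_inter, mem_block, Finset.mem_filter]
    constructor
    · rintro ⟨h1, -, h3, h4⟩
      rw [below_regularPivots t h1] at h4
      exact ⟨h1, fun h => h3 (by simp [regularPivots, h1, h]), h4⟩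
    · rintro ⟨h1, h2, h3⟩
      refine ⟨h1, hYS h1, fun h => h2 (Finset.mem_filter.1 h).2, ?_⟩
      rw [below_regularPivots t h1, h3]
  rw [h1, card_filter_rank Y fun k => ¬ t + 1 ∣ k ∧ (k - 1) / (t + 1) = j]
  have h2 : (Finset.Ioc 0 Y.card).filter (fun k => ¬ t + 1 ∣ k ∧ (k - 1) / (t + 1) = j) =
      Finset.Ioc (j * (t + 1)) (j * (t + 1) + t) := by
    have hj : (j : ℕ) * (t + 1) ≤ (m - 1) * (t + 1) := Nat.mul_le_mul_right _ (by omega)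
    ext k
    simp only [Finset.mem_filter, Finset.mem_Ioc, hY, pred_mul_add hm]
    rw [Nat.div_eq_iff (by omega : 0 < t + 1)]
    constructor
    · rintro ⟨⟨h3, h4⟩, h5, h6, h7⟩
      refine ⟨by omega, ?_⟩
      by_contra hcon
      apply h5
      have : k = (j + 1) * (t + 1) := by
        have : ((j : ℕ) + 1) * (t + 1) = j * (t + 1) + t + 1 := by ring
        omega
      exact ⟨_, by rw [this, mul_comm]⟩
    · rintro ⟨h3, h4⟩
      refine ⟨⟨by omega, by omega⟩, ?_, by omega, by omega⟩
      rintro ⟨c, hc⟩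
      have h5 : (j : ℕ) < c := by
        by_contra hcon
        have := Nat.mul_le_mul_left (t + 1) (not_lt.1 hcon)
        rw [mul_comm (j : ℕ)] at h3
        omega
      have h6 : ((j : ℕ) + 1) * (t + 1) ≤ c * (t + 1) := Nat.mul_le_mul_right _ h5
      have h7 : ((j : ℕ) + 1) * (t + 1) = j * (t + 1) + t + 1 := by ring
      rw [mul_comm (t + 1)] at hc
      omega
  rw [h2, Nat.card_Ioc]
  omega

/-- The union of a set of pivots with subsets of its blocks. -/
def withBlocks (P : Finset ℕ) (f : Fin m → Finset ℕ) : Finset ℕ :=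
  P ∪ Finset.univ.biUnion f

theorem card_filter_withBlocks {S P : Finset ℕ} {f : Fin m → Finset ℕ}
    (hf : ∀ j, f j ⊆ block S P j) (q : ℕ → Prop) [DecidablePred q] :
    ((withBlocks P f).filter q).card = (P.filter q).card + ∑ j, ((f j).filter q).card := by
  rw [withBlocks, Finset.filter_union, Finset.card_union_of_disjoint, Finset.filter_biUnion,
    Finset.card_biUnion]
  · intro i _ j _ hij
    refine Finset.disjoint_left.2 fun x hx hx' => hij ?_
    have h1 := (mem_block.1 (hf i (Finset.mem_filter.1 hx).1)).2.2
    have h2 := (mem_block.1 (hf j (Finset.mem_filter.1 hx').1)).2.2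
    exact Fin.ext (h1.symm.trans h2)
  · refine Finset.disjoint_left.2 fun x hx hx' => ?_
    simp only [Finset.mem_filter, Finset.mem_biUnion, Finset.mem_univ, true_and] at hx hx'
    obtain ⟨⟨j, hj⟩, -⟩ := hx'
    exact (mem_block.1 (hf j hj)).2.1 hx.1

theorem card_withBlocks {S P : Finset ℕ} {f : Fin m → Finset ℕ}
    (hf : ∀ j, f j ⊆ block S P j) : (withBlocks P f).card = P.card + ∑ j, (f j).card := by
  have := card_filter_withBlocks hf fun _ => True
  simpa using this

/-- Blocks before the `c`-th lie entirely below `x` and blocks after it entirely above, because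
`below P` is monotone. -/
theorem sum_card_filter_le {S P : Finset ℕ} {f : Fin m → Finset ℕ}
    (hf : ∀ j, f j ⊆ block S P j) (x : ℕ) (c : Fin m) (hc : below P x = c) :
    ∑ j, ((f j).filter (· ≤ x)).card =
      ∑ j ∈ Finset.univ.filter (· < c), (f j).card + ((f c).filter (· ≤ x)).card := by
  have h1 : ∀ j, ((f j).filter (· ≤ x)).card = (if j < c then (f j).card else 0) +
      (if j = c then ((f c).filter (· ≤ x)).card else 0) := by
    intro j
    rcases lt_trichotomy j c with h | h | h
    · rw [if_pos h, if_neg h.ne, add_zero, Finset.filter_true_of_mem]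
      intro y hy
      by_contra hcon
      have h2 := below_mono P (not_le.1 hcon).le
      rw [hc, (mem_block.1 (hf j hy)).2.2] at h2
      exact absurd h (not_lt.2 h2)
    · subst h; simp
    · rw [if_neg h.le.not_gt, if_neg h.ne', add_zero, Finset.card_eq_zero]
      refine Finset.filter_false_of_mem fun y hy hle => ?_
      have h2 := below_mono P hle
      rw [hc, (mem_block.1 (hf j hy)).2.2] at h2
      exact absurd h (not_lt.2 h2)
  rw [Finset.sum_congr rfl fun j _ => h1 j, Finset.sum_add_distrib, Finset.sum_ite_eq',
    Finset.sum_filter]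
  simp

theorem rank_withBlocks_pivot {S P : Finset ℕ} {f : Fin m → Finset ℕ}
    (hf : ∀ j, f j ⊆ block S P j) {x : ℕ} (hx : x ∈ P) (c : Fin m) (hc : below P x = c) :
    rank (withBlocks P f) x =
      c + 1 + (∑ j ∈ Finset.univ.filter (· < c), (f j).card + (f c).card) := by
  have h := card_filter_withBlocks hf (· ≤ x)
  rw [sum_card_filter_le hf x c hc] at h
  rw [rank, h, ← hc, ← rank_eq_below_add_one hx, rank]
  congr 3
  refine Finset.filter_true_of_mem fun y hy => ?_
  by_contra hcon
  have h2 := below_lt_of_mem hx (not_le.1 hcon)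
  rw [hc, (mem_block.1 (hf c hy)).2.2] at h2
  exact lt_irrefl _ h2

theorem rank_withBlocks_other {S P : Finset ℕ} {f : Fin m → Finset ℕ}
    (hf : ∀ j, f j ⊆ block S P j) {x : ℕ} (c : Fin m) (hx : x ∈ f c) :
    rank (withBlocks P f) x =
      c + (∑ j ∈ Finset.univ.filter (· < c), (f j).card + ((f c).filter (· ≤ x)).card) := by
  have hb := mem_block.1 (hf c hx)
  have h := card_filter_withBlocks hf (· ≤ x)
  rw [sum_card_filter_le hf x c hb.2.2] at h
  rw [rank, h, ← hb.2.2, ← rank_eq_below hb.2.1, rank]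

theorem withBlocks_block {S P : Finset ℕ} (hPS : P ⊆ S) (hP : P.card < m) :
    withBlocks P (fun j : Fin m => block S P j) = S := by
  ext x
  simp only [withBlocks, Finset.mem_union, Finset.mem_biUnion, Finset.mem_univ, true_and, mem_block]
  constructor
  · rintro (h | ⟨j, h, -⟩)
    · exact hPS h
    · exact h
  · intro h
    by_cases hx : x ∈ P
    · exact Or.inl hx
    · exact Or.inr ⟨⟨below P x, (below_le_card P x).trans_lt hP⟩, h, hx, rfl⟩

theorem sum_blockSizes {S P : Finset ℕ} (hPS : P ⊆ S) (hP : P.card < m) :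
    P.card + ∑ j, blockSizes m S P j = S.card := by
  have := card_withBlocks (S := S) (P := P) (f := fun j : Fin m => block S P j) fun j => subset_rfl
  rw [withBlocks_block hPS hP] at this
  exact this.symm

/-- The block sizes determine the rank in `S` of each pivot, and ranks are injective on `S`. -/
theorem subset_of_blockSizes_eq {S P P' : Finset ℕ} (hPS : P ⊆ S) (hPS' : P' ⊆ S)
    (hP : P.card < m) (hc : P.card = P'.card) (h : blockSizes m S P = blockSizes m S P') :
    P ⊆ P' := by
  intro x hx
  obtain ⟨y, hy, hxy⟩ := exists_rank_eq_of_mem_Ioc (Y := P') (k := rank P x) (by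
    rw [← hc]; exact rank_mem_Ioc hx)
  have h1 := rank_eq_below_add_one hx
  have h2 := rank_eq_below_add_one hy
  have hcm : below P x < m := (below_le_card P x).trans_lt hP
  have h3 := rank_withBlocks_pivot (S := S) (f := fun j : Fin m => block S P j)
    (fun j => subset_rfl) hx ⟨below P x, hcm⟩ rfl
  have h4 := rank_withBlocks_pivot (S := S) (f := fun j : Fin m => block S P' j)
    (fun j => subset_rfl) hy ⟨below P x, hcm⟩ (by simp only; omega)
  rw [withBlocks_block hPS hP] at h3
  rw [withBlocks_block hPS' (hc ▸ hP)] at h4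
  have h5 : ∀ j : Fin m, (block S P j).card = (block S P' j).card := fun j => congrFun h j
  simp only [h5] at h3
  have h6 := h5 ⟨below P x, hcm⟩
  simp only at h6 h4
  rw [h6] at h3
  have := rank_injOn S (hPS hx) (hPS' hy) (h3.trans h4.symm)
  exact this ▸ hy

theorem blockSizes_injOn (m : ℕ) (hm : 1 ≤ m) (S : Finset ℕ) :
    Set.InjOn (blockSizes m S) (S.powersetCard (m - 1)) := by
  intro P hP P' hP' h
  rw [Finset.mem_coe, Finset.mem_powersetCard] at hP hP'
  exact subset_antisymm
    (subset_of_blockSizes_eq hP.1 hP'.1 (by omega) (hP.2.trans hP'.2.symm) h)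
    (subset_of_blockSizes_eq hP'.1 hP.1 (by omega) (hP'.2.trans hP.2.symm) h.symm)

/-- With `t` sampled keys in every block, the pivot with `c` pivots below it gets rank `(c+1)(t+1)`,
while the sampled keys of block `c` get ranks `c(t+1) + r` with `1 ≤ r ≤ t`. -/
theorem regularPivots_withBlocks {S P : Finset ℕ} (hP : P.card = m - 1) (hm : 1 ≤ m)
    {f : Fin m → Finset ℕ} (hf : ∀ j : Fin m, f j ∈ (block S P j).powersetCard t) :
    regularPivots t (withBlocks P f) = P := by
  have hf1 : ∀ j, f j ⊆ block S P j := fun j => (Finset.mem_powersetCard.1 (hf j)).1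
  have hf2 : ∀ j, (f j).card = t := fun j => (Finset.mem_powersetCard.1 (hf j)).2
  have hsum : ∀ c : Fin m, ∑ j ∈ Finset.univ.filter (· < c), (f j).card = c * t := by
    intro c
    simp only [hf2, Finset.sum_const, smul_eq_mul]
    congr 1
    have : Finset.univ.filter (· < c) = Finset.Iio c := by ext; simp
    rw [this, Fin.card_Iio]
  ext x
  simp only [regularPivots, Finset.mem_filter]
  constructor
  · rintro ⟨hx, hdvd⟩
    rw [withBlocks, Finset.mem_union, Finset.mem_biUnion] at hx
    rcases hx with hx | ⟨c, -, hx⟩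
    · exact hx
    · exfalso
      rw [rank_withBlocks_other hf1 c hx, hsum] at hdvd
      have h1 : 0 < ((f c).filter (· ≤ x)).card := Finset.card_pos.2 ⟨x, by simp [hx]⟩
      have h2 : ((f c).filter (· ≤ x)).card ≤ t := by
        rw [← hf2 c]; exact Finset.card_le_card (Finset.filter_subset _ _)
      have h3 : (c : ℕ) + (c * t + ((f c).filter (· ≤ x)).card) =
          c * (t + 1) + ((f c).filter (· ≤ x)).card := by ring
      rw [h3, Nat.dvd_add_right (Dvd.intro_left _ rfl)] at hdvd
      have := Nat.le_of_dvd h1 hdvd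
      omega
  · intro hx
    refine ⟨Finset.mem_union_left _ hx, ?_⟩
    have hcm : below P x < m := (below_le_card P x).trans_lt (by omega)
    rw [rank_withBlocks_pivot hf1 hx ⟨below P x, hcm⟩ rfl, hsum, hf2]
    exact ⟨below P x + 1, by simp only; ring⟩

theorem withBlocks_inter_block {S P : Finset ℕ} {f : Fin m → Finset ℕ}
    (hf : ∀ j, f j ⊆ block S P j) (j : Fin m) : withBlocks P f ∩ block S P j = f j := by
  ext x
  simp only [withBlocks, Finset.mem_inter, Finset.mem_union, Finset.mem_biUnion, Finset.mem_univ,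
    true_and]
  constructor
  · rintro ⟨h | ⟨i, hi⟩, h'⟩
    · exact absurd h (mem_block.1 h').2.1
    · have h1 := (mem_block.1 (hf i hi)).2.2
      have h2 := (mem_block.1 h').2.2
      have : i = j := Fin.ext (h1.symm.trans h2)
      exact this ▸ hi
  · intro h
    exact ⟨Or.inr ⟨j, h⟩, hf j h⟩

/-- The number of samples with a given set of regular pivots. -/
theorem card_samples (hm : 1 ≤ m) {S P : Finset ℕ} (hPS : P ⊆ S) (hP : P.card = m - 1) :
    ((S.powersetCard (m * t + m - 1)).filter fun Y => regularPivots t Y = P).card =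
      ∏ j : Fin m, (blockSizes m S P j).choose t := by
  have h : ∏ j : Fin m, (blockSizes m S P j).choose t =
      (Fintype.piFinset fun j : Fin m => (block S P j).powersetCard t).card := by
    simp [Fintype.card_piFinset, blockSizes]
  rw [h]
  -- A sample with pivot set `P` amounts to an independent choice of `t` keys from each block.
  refine Finset.card_nbij' (fun Y j => Y ∩ block S P j) (fun f => withBlocks P f) ?_ ?_ ?_ ?_
  · intro Y hY
    simp only [Finset.coe_filter, Finset.mem_powersetCard, Set.mem_ofPred_eq] at hY
    simp only [Finset.mem_coe, Fintype.mem_piFinset, Finset.mem_powersetCard]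
    intro j
    refine ⟨Finset.inter_subset_right, ?_⟩
    rw [← hY.2]
    exact card_inter_block hm hY.1.1 hY.1.2 j
  · intro f hf
    simp only [Finset.mem_coe, Fintype.mem_piFinset] at hf
    have hf1 : ∀ j, f j ⊆ block S P j := fun j => (Finset.mem_powersetCard.1 (hf j)).1
    simp only [Finset.coe_filter, Finset.mem_powersetCard, Set.mem_ofPred_eq]
    refine ⟨⟨?_, ?_⟩, regularPivots_withBlocks hP hm hf⟩
    · refine Finset.union_subset hPS (Finset.biUnion_subset.2 fun j _ x hx => ?_)
      exact (mem_block.1 (hf1 j hx)).1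
    · rw [card_withBlocks hf1, hP,
        Finset.sum_congr rfl fun j _ => (Finset.mem_powersetCard.1 (hf j)).2]
      simp
      omega
  · intro Y hY
    simp only [Finset.coe_filter, Finset.mem_powersetCard, Set.mem_ofPred_eq] at hY
    obtain ⟨⟨hYS, hYc⟩, rfl⟩ := hY
    ext x
    simp only [withBlocks, Finset.mem_union, Finset.mem_biUnion, Finset.mem_univ, true_and,
      Finset.mem_inter]
    constructor
    · rintro (h | ⟨j, h, -⟩)
      · exact (Finset.mem_filter.1 h).1
      · exact h
    · intro hx
      by_cases hxP : x ∈ regularPivots t Y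
      · exact Or.inl hxP
      · exact Or.inr ⟨⟨below (regularPivots t Y) x, (below_le_card _ x).trans_lt (by omega)⟩, hx,
          mem_block.2 ⟨hYS hx, hxP, rfl⟩⟩
  · intro f hf
    simp only [Finset.mem_coe, Fintype.mem_piFinset] at hf
    ext1 j
    exact withBlocks_inter_block (fun j => (Finset.mem_powersetCard.1 (hf j)).1) j

/-! ### Generating functions and the law of the block sizes. -/

theorem coeff_prod_mk {R : Type*} [CommRing R] (g : Fin m → ℕ → R) (N : ℕ) :
    PowerSeries.coeff N (∏ j, PowerSeries.mk (g j)) =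
      ∑ i ∈ Finset.piAntidiag Finset.univ N, ∏ j, g j (i j) := by
  rw [PowerSeries.coeff_prod]
  refine Finset.sum_bij (fun l _ => (l : Fin m → ℕ)) ?_ ?_ ?_ ?_
  · intro l hl
    have := (Finset.mem_finsuppAntidiag.1 hl).1
    simpa using this
  · intro l _ l' _ h
    exact DFunLike.coe_injective h
  · intro f hf
    refine ⟨Finsupp.equivFunOnFinite.symm f, ?_, by simp⟩
    have := (Finset.mem_piAntidiag.1 hf).1
    simpa [Finset.mem_finsuppAntidiag] using this
  · intro l _
    simp

theorem mk_choose (R : Type*) [CommRing R] (t : ℕ) :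
    (PowerSeries.mk fun i => ((i.choose t : ℕ) : R)) =
      PowerSeries.X ^ t * (PowerSeries.invOneSubPow R (t + 1)).val := by
  ext n
  rw [PowerSeries.coeff_X_pow_mul', PowerSeries.invOneSubPow_val_succ_eq_mk_add_choose]
  split_ifs with h
  · simp [Nat.add_sub_cancel' h]
  · simp [Nat.choose_eq_zero_of_lt (not_le.1 h)]

theorem invOneSubPow_pow (R : Type*) [CommRing R] (a k : ℕ) :
    PowerSeries.invOneSubPow R a ^ k = PowerSeries.invOneSubPow R (a * k) := by
  simp_rw [PowerSeries.invOneSubPow_eq_inv_one_sub_pow, pow_mul]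

/-- Vandermonde's identity for compositions. -/
theorem sum_prod_choose (hm : 1 ≤ m) (N : ℕ) :
    ∑ i ∈ Finset.piAntidiag (Finset.univ : Finset (Fin m)) N, ∏ j, (i j).choose t =
      (N + (m - 1)).choose (m * t + m - 1) := by
  -- Compare coefficients in `(X^t / (1-X)^(t+1))^m = X^(mt) / (1-X)^(m(t+1))`.
  have h := coeff_prod_mk (m := m) (fun _ i => ((i.choose t : ℕ) : ℤ)) N
  rw [mk_choose, Finset.prod_const, Finset.card_univ, Fintype.card_fin, mul_pow, ← pow_mul,
    ← Units.val_pow_eq_pow_val, invOneSubPow_pow, PowerSeries.coeff_X_pow_mul',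
    PowerSeries.invOneSubPow_val_eq_mk_sub_one_add_choose_of_pos (S := ℤ) _ (by positivity)] at h
  have h1 : (t + 1) * m - 1 = m * t + m - 1 := by
    have : (t + 1) * m = m * t + m := by ring
    omega
  have h2 : t * m = m * t := mul_comm _ _
  rw [h1] at h
  have h3 : (if t * m ≤ N then PowerSeries.coeff (N - t * m) (PowerSeries.mk fun n =>
      (((m * t + m - 1 + n).choose (m * t + m - 1) : ℕ) : ℤ)) else 0) =
      (((N + (m - 1)).choose (m * t + m - 1) : ℕ) : ℤ) := by
    split_ifs with hN
    · rw [PowerSeries.coeff_mk]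
      congr 2
      omega
    · rw [Nat.choose_eq_zero_of_lt (by omega)]
      simp
  rw [h3] at h
  exact_mod_cast h.symm

/-- The law of the block sizes for `n` keys. -/
noncomputable def splitLaw (σ : SupplementaryRule m t) (n : ℕ) : PMF (Fin m → ℕ) :=
  (pivotLaw σ (Finset.range n)).map (blockSizes m (Finset.range n))

theorem pivots_of_mem_support {σ : SupplementaryRule m t} {S P : Finset ℕ} (hm : 2 ≤ m)
    (hS : m ≤ S.card) (hP : P ∈ (pivotLaw σ S).support) : P ⊆ S ∧ P.card = m - 1 := by
  unfold pivotLaw at hP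
  split_ifs at hP with h
  · simp only [PMF.support_map, PMF.support_uniformOfFinset, Set.mem_image, Finset.mem_coe,
      Finset.mem_powersetCard] at hP
    obtain ⟨Y, ⟨hYS, hc⟩, rfl⟩ := hP
    exact ⟨(Finset.filter_subset _ _).trans hYS, card_regularPivots (by omega) hc⟩
  · simp only [PMF.support_map, Set.mem_image] at hP
    obtain ⟨R, hR, rfl⟩ := hP
    have h2 := Finset.mem_powersetCard.1 (σ.mem_powersetCard S.card hS (by omega) R hR)
    refine ⟨Finset.filter_subset _ _, ?_⟩
    rw [card_filter_rank S fun k => k ∈ R, ← h2.2]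
    congr 1
    ext k
    simp only [Finset.mem_filter, Finset.mem_Ioc]
    refine ⟨fun h => h.2, fun h => ⟨?_, h⟩⟩
    have := Finset.mem_Icc.1 (h2.1 h)
    omega

theorem sum_of_mem_support_map {σ : SupplementaryRule m t} {S : Finset ℕ} (hm : 2 ≤ m)
    (hS : m ≤ S.card) {i : Fin m → ℕ}
    (hi : i ∈ ((pivotLaw σ S).map (blockSizes m S)).support) :
    ∑ j, i j = S.card - (m - 1) := by
  rw [PMF.mem_support_map_iff] at hi
  obtain ⟨P, hP, rfl⟩ := hi
  obtain ⟨h1, h2⟩ := pivots_of_mem_support hm hS hP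
  have := sum_blockSizes (m := m) h1 (by omega)
  omega

theorem sum_of_mem_support_splitLaw {σ : SupplementaryRule m t} {n : ℕ} (hm : 2 ≤ m)
    (hn : m ≤ n) {i : Fin m → ℕ} (hi : i ∈ (splitLaw σ n).support) :
    ∑ j, i j = n - (m - 1) := by
  have := sum_of_mem_support_map (S := Finset.range n) hm (by simpa using hn) hi
  simpa using this

theorem lt_of_mem_support_splitLaw {σ : SupplementaryRule m t} {n : ℕ} (hm : 2 ≤ m)
    (hn : m ≤ n) {i : Fin m → ℕ} (hi : i ∈ (splitLaw σ n).support) (j : Fin m) : i j < n := by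
  have h1 := sum_of_mem_support_splitLaw hm hn hi
  have h2 := Finset.single_le_sum (f := i) (fun _ _ => Nat.zero_le _) (Finset.mem_univ j)
  omega

theorem finite_support_splitLaw {σ : SupplementaryRule m t} {n : ℕ} (hm : 2 ≤ m) (hn : m ≤ n) :
    (splitLaw σ n).support.Finite := by
  refine (Finset.piAntidiag (Finset.univ : Finset (Fin m)) (n - (m - 1))).finite_toSet.subset ?_
  intro i hi
  simpa using sum_of_mem_support_splitLaw hm hn hi

theorem map_uniformOfFinset_apply {α β : Type} [DecidableEq β] (s : Finset α) (hs : s.Nonempty)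
    (f : α → β) (b : β) : ((PMF.uniformOfFinset s hs).map f) b =
      ((s.filter fun a => f a = b).card : ℝ≥0∞) / s.card := by
  classical
  rw [PMF.map_apply, tsum_eq_sum (s := s)]
  · rw [Finset.card_filter, Nat.cast_sum, ENNReal.div_eq_inv_mul, Finset.mul_sum]
    refine Finset.sum_congr rfl fun a ha => ?_
    rw [PMF.uniformOfFinset_apply, if_pos ha]
    by_cases h : b = f a
    · simp [h]
    · simp [h, Ne.symm h]
  · intro a ha
    rw [PMF.uniformOfFinset_apply, if_neg ha, ite_self]

/-- A nonempty fibre consists of samples with one common pivot set, so `card_samples` gives the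
inequality `≤`. Summed over all compositions both sides equal `C(|S|, mt+m-1)`, by
`sum_prod_choose`, and so equality holds in every term. -/
theorem card_samples_blockSizes (hm : 1 ≤ m) {S : Finset ℕ} (hS : m * t + m - 1 ≤ S.card)
    {i : Fin m → ℕ} (hi : ∑ j, i j = S.card - (m - 1)) :
    ((S.powersetCard (m * t + m - 1)).filter
      fun Y => blockSizes m S (regularPivots t Y) = i).card = ∏ j, (i j).choose t := by
  have hpiv : ∀ Y ∈ S.powersetCard (m * t + m - 1),
      regularPivots t Y ⊆ S ∧ (regularPivots t Y).card = m - 1 := by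
    intro Y hY
    rw [Finset.mem_powersetCard] at hY
    exact ⟨(Finset.filter_subset _ _).trans hY.1, card_regularPivots hm hY.2⟩
  have hle : ∀ i : Fin m → ℕ, ((S.powersetCard (m * t + m - 1)).filter
      fun Y => blockSizes m S (regularPivots t Y) = i).card ≤ ∏ j, (i j).choose t := by
    intro i
    rcases Finset.eq_empty_or_nonempty ((S.powersetCard (m * t + m - 1)).filter
      fun Y => blockSizes m S (regularPivots t Y) = i) with h | ⟨Y₀, hY₀⟩
    · rw [h]; exact Nat.zero_le _
    · rw [Finset.mem_filter] at hY₀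
      obtain ⟨h1, h2⟩ := hpiv Y₀ hY₀.1
      rw [← hY₀.2, ← card_samples hm h1 h2]
      refine Finset.card_le_card fun Y hY => ?_
      rw [Finset.mem_filter] at hY ⊢
      obtain ⟨h3, h4⟩ := hpiv Y hY.1
      exact ⟨hY.1, blockSizes_injOn m hm S (Finset.mem_coe.2 (Finset.mem_powersetCard.2 ⟨h3, h4⟩))
        (Finset.mem_coe.2 (Finset.mem_powersetCard.2 ⟨h1, h2⟩)) (hY.2.trans (by rw [hY₀.2]))⟩
  have hmt : m - 1 ≤ m * t + m - 1 := by
    have : 0 ≤ m * t := Nat.zero_le _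
    omega
  have hsum : ∑ i ∈ Finset.piAntidiag (Finset.univ : Finset (Fin m)) (S.card - (m - 1)),
      ((S.powersetCard (m * t + m - 1)).filter
        fun Y => blockSizes m S (regularPivots t Y) = i).card =
      ∑ i ∈ Finset.piAntidiag (Finset.univ : Finset (Fin m)) (S.card - (m - 1)),
        ∏ j, (i j).choose t := by
    rw [sum_prod_choose hm, Nat.sub_add_cancel (hmt.trans hS), ← Finset.card_powersetCard,
      ← Finset.card_eq_sum_card_fiberwise]
    intro Y hY
    obtain ⟨h1, h2⟩ := hpiv Y hY
    have := sum_blockSizes (m := m) h1 (by omega)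
    simp only [Finset.mem_coe, Finset.mem_piAntidiag]
    refine ⟨?_, fun _ _ => Finset.mem_univ _⟩
    change ∑ j, blockSizes m S (regularPivots t Y) j = _
    omega
  exact (Finset.sum_eq_sum_iff_of_le fun i _ => hle i).1 hsum i
    (Finset.mem_piAntidiag.2 ⟨hi, fun _ _ => Finset.mem_univ _⟩)

theorem map_blockSizes_apply (hm : 2 ≤ m) (σ : SupplementaryRule m t) {S : Finset ℕ}
    (hS : m * t + m - 1 ≤ S.card) (hS' : m ≤ S.card) (i : Fin m → ℕ) :
    (pivotLaw σ S).map (blockSizes m S) i =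
      if ∑ j, i j = S.card - (m - 1) then
        ((∏ j, (i j).choose t : ℕ) : ℝ≥0∞) / (S.card.choose (m * t + m - 1) : ℕ) else 0 := by
  split_ifs with hi
  · rw [pivotLaw, dif_pos hS, PMF.map_comp, map_uniformOfFinset_apply, Finset.card_powersetCard]
    congr 2
    exact card_samples_blockSizes (by omega) hS hi
  · by_contra hne
    exact hi (sum_of_mem_support_map hm hS' ((PMF.mem_support_iff _ _).2 hne))

/-- Passing from keys to ranks preserves order, hence blocks. This makes the supplementary rule
insensitive to the actual keys. -/
theorem block_rank {S : Finset ℕ} {R : Finset ℕ} (hR : R ⊆ Finset.Icc 1 S.card) (i : ℕ) :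
    (block S (S.filter fun x => rank S x ∈ R) i).card = (block (Finset.Icc 1 S.card) R i).card := by
  have hbelow : ∀ x ∈ S, below (S.filter fun x => rank S x ∈ R) x = below R (rank S x) := by
    intro x hx
    have : (S.filter fun y => rank S y ∈ R).filter (· < x) =
        S.filter fun y => rank S y ∈ R ∧ rank S y < rank S x := by
      ext y
      simp only [Finset.mem_filter, and_assoc]
      refine and_congr_right fun hy => and_congr_right fun _ => (rank_lt_iff hy hx).symm
    rw [below, this, card_filter_rank S fun k => k ∈ R ∧ k < rank S x, below]
    congr 1
    ext k
    simp only [Finset.mem_filter, Finset.mem_Ioc]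
    refine ⟨fun h => h.2, fun h => ⟨?_, h⟩⟩
    have := Finset.mem_Icc.1 (hR h.1)
    omega
  have h1 : block S (S.filter fun x => rank S x ∈ R) i =
      S.filter fun x => rank S x ∉ R ∧ below R (rank S x) = i := by
    ext x
    simp only [mem_block, Finset.mem_filter, not_and]
    constructor
    · rintro ⟨h1, h2, h3⟩
      exact ⟨h1, h2 h1, by rw [← hbelow x h1, h3]⟩
    · rintro ⟨h1, h2, h3⟩
      exact ⟨h1, fun _ => h2, by rw [hbelow x h1, h3]⟩
  rw [h1, card_filter_rank S fun k => k ∉ R ∧ below R k = i]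
  congr 1
  ext k
  simp only [Finset.mem_filter, Finset.mem_Ioc, mem_block, Finset.mem_Icc]
  rfl

/-- The law of the block sizes depends only on the number of keys. -/
theorem map_blockSizes_eq_splitLaw (hm : 2 ≤ m) (σ : SupplementaryRule m t) {S : Finset ℕ}
    (hS : m ≤ S.card) : (pivotLaw σ S).map (blockSizes m S) = splitLaw σ S.card := by
  suffices H : ∀ S S' : Finset ℕ, m ≤ S.card → S.card = S'.card →
      (pivotLaw σ S).map (blockSizes m S) = (pivotLaw σ S').map (blockSizes m S') from
    H _ _ hS (by simp)
  intro S S' hS hc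
  by_cases h : m * t + m - 1 ≤ S.card
  · ext i
    rw [map_blockSizes_apply hm σ h hS, map_blockSizes_apply hm σ (hc ▸ h) (hc ▸ hS), hc]
  · have key : ∀ S : Finset ℕ, m ≤ S.card → ¬ m * t + m - 1 ≤ S.card →
        (pivotLaw σ S).map (blockSizes m S) =
          (σ.law S.card).bind fun R => PMF.pure (blockSizes m (Finset.Icc 1 S.card) R) := by
      intro S hS h
      rw [pivotLaw, dif_neg h, PMF.map_comp, ← PMF.bind_pure_comp]
      ext i
      simp only [PMF.bind_apply]
      refine tsum_congr fun R => ?_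
      by_cases hR : R ∈ (σ.law S.card).support
      · have h2 := Finset.mem_powersetCard.1 (σ.mem_powersetCard S.card hS (by omega) R hR)
        have : blockSizes m S (S.filter fun x => rank S x ∈ R) =
            blockSizes m (Finset.Icc 1 S.card) R := funext fun j => block_rank h2.1 j
        simp only [Function.comp_apply]
        rw [this]
      · rw [PMF.mem_support_iff, not_not] at hR
        simp [hR]
    rw [key S hS h, key S' (hc ▸ hS) (hc ▸ h), hc]

theorem splitLaw_apply (hm : 2 ≤ m) (σ : SupplementaryRule m t) {n : ℕ}
    (hn : m * t + m - 1 ≤ n) (hn' : m ≤ n) (i : Fin m → ℕ) :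
    splitLaw σ n i = if ∑ j, i j = n - (m - 1) then
        ((∏ j, (i j).choose t : ℕ) : ℝ≥0∞) / (n.choose (m * t + m - 1) : ℕ) else 0 := by
  have := map_blockSizes_apply hm σ (S := Finset.range n) (by simpa using hn) (by simpa using hn') i
  rwa [Finset.card_range] at this

/-! ### Expectations for finitely supported laws -/

section Expectation

variable {α β : Type} {E F : Type*} [AddCommGroup E] [Module ℝ E] [AddCommGroup F] [Module ℝ F]

/-- The expectation of `f` under a law with finite support. -/
noncomputable def ev (p : PMF α) (f : α → E) : E := ∑ᶠ a, (p a).toReal • f a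

theorem ev_eq_sum {p : PMF α} {s : Finset α} (hs : p.support ⊆ s) (f : α → E) :
    ev p f = ∑ a ∈ s, (p a).toReal • f a := by
  refine finsum_eq_sum_of_support_subset _ fun a ha => hs ?_
  rw [PMF.mem_support_iff]
  intro h
  simp [h] at ha

theorem sum_toReal_eq_one {p : PMF α} {s : Finset α} (hs : p.support ⊆ s) :
    ∑ a ∈ s, (p a).toReal = 1 := by
  rw [← ENNReal.toReal_sum fun a _ => p.apply_ne_top a, ← ENNReal.toReal_one, ← p.tsum_coe,
    tsum_eq_sum (s := s)]
  intro a ha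
  by_contra h
  exact ha (hs h)

theorem ev_congr {p : PMF α} {f g : α → E} (h : ∀ a ∈ p.support, f a = g a) : ev p f = ev p g := by
  refine finsum_congr fun a => ?_
  by_cases ha : a ∈ p.support
  · rw [h a ha]
  · rw [PMF.mem_support_iff, not_not] at ha
    simp [ha]

theorem ev_pure (a : α) (f : α → E) : ev (PMF.pure a) f = f a := by
  classical
  rw [ev_eq_sum (s := {a}) (by simp)]
  simp

theorem ev_const {p : PMF α} (hp : p.support.Finite) (c : E) : ev p (fun _ => c) = c := by
  rw [ev_eq_sum (s := hp.toFinset) (by simp), ← Finset.sum_smul, sum_toReal_eq_one (by simp),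
    one_smul]

theorem ev_add {p : PMF α} (hp : p.support.Finite) (f g : α → E) :
    ev p (fun a => f a + g a) = ev p f + ev p g := by
  simp only [ev_eq_sum (s := hp.toFinset) (by simp : p.support ⊆ _), smul_add,
    Finset.sum_add_distrib]

theorem ev_sub {p : PMF α} (hp : p.support.Finite) (f g : α → E) :
    ev p (fun a => f a - g a) = ev p f - ev p g := by
  simp only [ev_eq_sum (s := hp.toFinset) (by simp : p.support ⊆ _), smul_sub,
    Finset.sum_sub_distrib]

theorem ev_linear {p : PMF α} (hp : p.support.Finite) (L : E →ₗ[ℝ] F) (f : α → E) :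
    ev p (fun a => L (f a)) = L (ev p f) := by
  simp only [ev_eq_sum (s := hp.toFinset) (by simp : p.support ⊆ _), map_sum, map_smul]

theorem ev_sum {p : PMF α} (hp : p.support.Finite) {ι : Type*} (s : Finset ι) (f : ι → α → E) :
    ev p (fun a => ∑ i ∈ s, f i a) = ∑ i ∈ s, ev p (f i) := by
  simp only [ev_eq_sum (s := hp.toFinset) (by simp : p.support ⊆ _), Finset.smul_sum]
  exact Finset.sum_comm

theorem ev_bind {p : PMF α} {q : α → PMF β} (hp : p.support.Finite)
    (hq : ∀ a ∈ p.support, (q a).support.Finite) (f : β → E) :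
    ev (p.bind q) f = ev p fun a => ev (q a) f := by
  classical
  set s := hp.toFinset with hs
  have hps : p.support ⊆ s := by simp [hs]
  have hfin : (p.bind q).support.Finite := by
    rw [PMF.support_bind]
    exact hp.biUnion hq
  set u := hfin.toFinset with hu
  have hqu : ∀ a ∈ p.support, (q a).support ⊆ u := by
    intro a ha b hb
    simp only [hu, Set.Finite.coe_toFinset, PMF.support_bind, Set.mem_iUnion]
    exact ⟨a, ha, hb⟩
  rw [ev_eq_sum (s := u) (by simp [hu]), ev_eq_sum hps]
  have h1 : ∀ b, ((p.bind q) b).toReal = ∑ a ∈ s, (p a).toReal * (q a b).toReal := by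
    intro b
    rw [PMF.bind_apply, tsum_eq_sum (s := s),
      ENNReal.toReal_sum fun a _ => ENNReal.mul_ne_top (p.apply_ne_top a) ((q a).apply_ne_top b)]
    · simp [ENNReal.toReal_mul]
    · intro a ha
      have : p a = 0 := by
        by_contra h
        exact ha (hps h)
      simp [this]
  simp only [h1, Finset.sum_smul]
  rw [Finset.sum_comm]
  refine Finset.sum_congr rfl fun a ha => ?_
  have ha' : a ∈ p.support := by simpa [hs] using ha
  rw [ev_eq_sum (hqu a ha'), Finset.smul_sum]
  simp [mul_smul]

theorem ev_map {p : PMF α} (hp : p.support.Finite) (g : α → β) (f : β → E) :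
    ev (p.map g) f = ev p fun a => f (g a) := by
  rw [← PMF.bind_pure_comp, ev_bind hp (by simp)]
  exact ev_congr fun a _ => ev_pure _ _

theorem ev_mono {p : PMF α} (hp : p.support.Finite) {f g : α → ℝ} (h : ∀ a ∈ p.support, f a ≤ g a) :
    ev p f ≤ ev p g := by
  rw [ev_eq_sum (s := hp.toFinset) (by simp), ev_eq_sum (s := hp.toFinset) (by simp)]
  refine Finset.sum_le_sum fun a ha => ?_
  exact mul_le_mul_of_nonneg_left (h a (by simpa using ha)) ENNReal.toReal_nonneg

theorem ev_nonneg {p : PMF α} (hp : p.support.Finite) {f : α → ℝ} (h : ∀ a ∈ p.support, 0 ≤ f a) :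
    0 ≤ ev p f := by
  rw [← ev_const hp (0 : ℝ)]
  exact ev_mono hp h

theorem ev_mul_left {p : PMF α} (hp : p.support.Finite) {K : Type*} [Ring K] [Algebra ℝ K]
    (c : K) (f : α → K) : ev p (fun a => c * f a) = c * ev p f :=
  ev_linear hp (LinearMap.mulLeft ℝ c) f

theorem norm_ev_le {E : Type*} [NormedAddCommGroup E] [NormedSpace ℝ E] {p : PMF α}
    (hp : p.support.Finite) (f : α → E) : ‖ev p f‖ ≤ ev p fun a => ‖f a‖ := by
  rw [ev_eq_sum (s := hp.toFinset) (by simp), ev_eq_sum (s := hp.toFinset) (by simp)]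
  refine (norm_sum_le _ _).trans (Finset.sum_le_sum fun a _ => ?_)
  rw [norm_smul, Real.norm_of_nonneg ENNReal.toReal_nonneg, smul_eq_mul]

/-- Links `ev` with the Bochner integral. All tree laws here have finite support, so expectations
can be handled as finite sums. -/
theorem integral_toMeasure {E : Type*} [NormedAddCommGroup E] [NormedSpace ℝ E] [CompleteSpace E]
    [MeasurableSpace α] [MeasurableSingletonClass α] {p : PMF α} (hp : p.support.Finite)
    (f : α → E) : ∫ a, f a ∂p.toMeasure = ev p f := by
  rw [← p.restrict_toMeasure_support]
  conv_lhs => rw [show p.support = (hp.toFinset : Set α) by simp]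
  rw [setIntegral_finset _ IntegrableOn.finset, ev_eq_sum (s := hp.toFinset) (by simp)]
  refine Finset.sum_congr rfl fun a _ => ?_
  rw [Measure.real, p.toMeasure_apply_singleton a (measurableSet_singleton a)]

end Expectation

/-! ### Independent families with finitely supported laws. -/

section IndependentLaw

variable {α β : Type} {E : Type*} [AddCommGroup E] [Module ℝ E]

theorem finite_support_map {p : PMF α} (hp : p.support.Finite) (g : α → β) :
    (p.map g).support.Finite := by
  rw [PMF.support_map]
  exact hp.image _

theorem finite_support_bind {p : PMF α} {q : α → PMF β} (hp : p.support.Finite)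
    (hq : ∀ a ∈ p.support, (q a).support.Finite) : (p.bind q).support.Finite := by
  rw [PMF.support_bind]
  exact hp.biUnion hq

theorem finite_support_independentLaw {k : ℕ} {p : Fin k → PMF α}
    (hp : ∀ i, (p i).support.Finite) : (independentLaw p).support.Finite := by
  induction k with
  | zero => simp [independentLaw]
  | succ k ih =>
    rw [independentLaw]
    exact finite_support_bind (hp 0) fun a _ => finite_support_map (ih fun i => hp i.succ) _

theorem independentLaw_map {k : ℕ} (p : Fin k → PMF α) (g : α → β) :
    (independentLaw p).map (fun f i => g (f i)) = independentLaw fun i => (p i).map g := by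
  induction k with
  | zero =>
    simp only [independentLaw, PMF.pure_map]
    congr 1
    exact Subsingleton.elim _ _
  | succ k ih =>
    simp only [independentLaw]
    rw [PMF.map_bind, PMF.bind_map]
    congr 1
    funext a
    rw [Function.comp_apply, ← ih, PMF.map_comp, PMF.map_comp]
    congr 1
    funext f
    ext i
    refine Fin.cases ?_ (fun i => ?_) i <;> simp

theorem ev_independentLaw_succ {k : ℕ} {p : Fin (k + 1) → PMF α} (hp : ∀ i, (p i).support.Finite)
    (f : (Fin (k + 1) → α) → E) : ev (independentLaw p) f =
      ev (p 0) fun a => ev (independentLaw fun i => p i.succ) fun g => f (Fin.cons a g) := by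
  have h := finite_support_independentLaw fun i : Fin k => hp i.succ
  rw [independentLaw, ev_bind (hp 0) fun a _ => finite_support_map h _]
  exact ev_congr fun a _ => ev_map h _ _

theorem ev_independentLaw_apply {k : ℕ} {p : Fin k → PMF α} (hp : ∀ i, (p i).support.Finite)
    (i : Fin k) (f : α → E) : (ev (independentLaw p) fun g => f (g i)) = ev (p i) f := by
  induction k with
  | zero => exact i.elim0
  | succ k ih =>
    have h := finite_support_independentLaw fun i : Fin k => hp i.succ
    rw [ev_independentLaw_succ hp]
    refine Fin.cases ?_ (fun i => ?_) i
    · simp only [Fin.cons_zero]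
      exact ev_congr fun a _ => ev_const h _
    · simp only [Fin.cons_succ]
      rw [ev_congr fun a _ => ih (fun i => hp i.succ) i, ev_const (hp 0)]

end IndependentLaw

/-! ### The law of the profile polynomial -/

/-- The profile polynomial, as a polynomial. -/
noncomputable def treePoly : SearchTree m → ℂ[X]
  | .empty => 0
  | .node keys ch => Polynomial.C (keys.card : ℂ) + Polynomial.X * ∑ i, treePoly (ch i)

theorem coeff_treePoly (T : SearchTree m) (k : ℕ) : (treePoly T).coeff k = T.profile k := by
  induction T generalizing k with
  | empty => simp [treePoly, SearchTree.profile]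
  | node keys ch ih =>
    cases k with
    | zero => simp [treePoly, SearchTree.profile]
    | succ k =>
      rw [treePoly, SearchTree.profile, Polynomial.coeff_add, Polynomial.coeff_C_succ, zero_add,
        Polynomial.coeff_X_mul, Polynomial.finsetSum_coeff]
      simp [ih]

theorem profilePoly_eq_eval (T : SearchTree m) (z : ℂ) : T.profilePoly z = (treePoly T).eval z := by
  rw [SearchTree.profilePoly, Polynomial.eval_eq_sum, Polynomial.sum,
    tsum_eq_sum (s := (treePoly T).support)]
  · simp [coeff_treePoly]
  · intro k hk
    rw [← coeff_treePoly, Polynomial.notMem_support_iff.1 hk, zero_mul]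

/-- The law of the profile polynomial for `n` keys. -/
noncomputable def polyLaw (σ : SupplementaryRule m t) (n : ℕ) : PMF ℂ[X] :=
  (treeLaw σ (Finset.range n)).map treePoly

/-- On the support of the pivot law the size test in `treeLaw` succeeds by `card_block_lt`; pivot
sets off the support carry no mass. -/
theorem treeLaw_eq_bind (hm : 2 ≤ m) (σ : SupplementaryRule m t) {S : Finset ℕ} (hS : m ≤ S.card) :
    treeLaw σ S = (pivotLaw σ S).bind fun P =>
      (independentLaw fun i : Fin m => treeLaw σ (block S P i)).map (SearchTree.node P) := by
  have h0 : S ≠ ∅ := by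
    rintro rfl
    simp at hS
    omega
  rw [treeLaw, if_neg h0, if_neg (by omega)]
  ext T
  simp only [PMF.bind_apply]
  refine tsum_congr fun P => ?_
  by_cases hP : P ∈ (pivotLaw σ S).support
  · simp only [card_block_lt m t hm σ S hS P hP, dite_true]
  · rw [PMF.mem_support_iff, not_not] at hP
    simp [hP]

/-- How the profile polynomials of the subtrees determine that of the tree. -/
noncomputable def joinPoly (m : ℕ) (f : Fin m → ℂ[X]) : ℂ[X] :=
  Polynomial.C ((m - 1 : ℕ) : ℂ) + Polynomial.X * ∑ i, f i

/-- By `hq` the polynomial of a subtree depends in law only on the size of its block, so the pivots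
enter only through `blockSizes`. This is the inductive step that removes the actual keys from the
problem. -/
theorem map_treePoly_eq (hm : 2 ≤ m) (σ : SupplementaryRule m t) {S : Finset ℕ} (hS : m ≤ S.card)
    (q : ℕ → PMF ℂ[X])
    (hq : ∀ S' : Finset ℕ, S'.card < S.card → (treeLaw σ S').map treePoly = q S'.card) :
    (treeLaw σ S).map treePoly = (splitLaw σ S.card).bind fun I =>
      (independentLaw fun j => q (I j)).map (joinPoly m) := by
  rw [treeLaw_eq_bind hm σ hS, PMF.map_bind, ← map_blockSizes_eq_splitLaw hm σ hS, PMF.bind_map]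
  ext T
  simp only [PMF.bind_apply]
  refine tsum_congr fun P => ?_
  by_cases hP : P ∈ (pivotLaw σ S).support
  · have hc := (pivots_of_mem_support hm hS hP).2
    congr 1
    have h1 : (independentLaw fun j : Fin m => q (blockSizes m S P j)) =
        independentLaw fun j : Fin m => (treeLaw σ (block S P j)).map treePoly := by
      congr 1
      funext j
      rw [hq _ (card_block_lt m t hm σ S hS P hP j)]
      rfl
    rw [Function.comp_apply, h1, ← independentLaw_map, PMF.map_comp, PMF.map_comp]
    congr 2
    funext f
    simp [treePoly, joinPoly, hc]
  · rw [PMF.mem_support_iff, not_not] at hP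
    simp [hP]

theorem map_treePoly_of_lt (σ : SupplementaryRule m t) {S : Finset ℕ} (hS : S.card < m) :
    (treeLaw σ S).map treePoly = PMF.pure (Polynomial.C (S.card : ℂ)) := by
  rw [treeLaw]
  split_ifs with h0
  · subst h0
    rw [PMF.pure_map]
    simp [treePoly]
  · rw [PMF.pure_map]
    simp [treePoly]

theorem map_treePoly_eq_polyLaw (hm : 2 ≤ m) (σ : SupplementaryRule m t) (S : Finset ℕ) :
    (treeLaw σ S).map treePoly = polyLaw σ S.card := by
  induction hn : S.card using Nat.strong_induction_on generalizing S with
  | _ n ih =>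
    subst hn
    rw [polyLaw]
    by_cases hS : S.card < m
    · rw [map_treePoly_of_lt σ hS, map_treePoly_of_lt σ (by simpa using hS), Finset.card_range]
    · rw [map_treePoly_eq hm σ (not_lt.1 hS) (polyLaw σ) fun S' h => ih _ h S' rfl,
        map_treePoly_eq hm σ (by simpa using hS) (polyLaw σ) fun S' h =>
          ih _ (by simpa using h) S' rfl, Finset.card_range]

theorem polyLaw_of_lt (σ : SupplementaryRule m t) {n : ℕ} (hn : n < m) :
    polyLaw σ n = PMF.pure (Polynomial.C (n : ℂ)) := by
  have := map_treePoly_of_lt σ (S := Finset.range n) (by simpa using hn)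
  rwa [Finset.card_range] at this

theorem polyLaw_eq_bind (hm : 2 ≤ m) (σ : SupplementaryRule m t) {n : ℕ} (hn : m ≤ n) :
    polyLaw σ n = (splitLaw σ n).bind fun I =>
      (independentLaw fun j => polyLaw σ (I j)).map (joinPoly m) := by
  have := map_treePoly_eq hm σ (S := Finset.range n) (by simpa using hn) (polyLaw σ)
    fun S' _ => map_treePoly_eq_polyLaw hm σ S'
  rwa [Finset.card_range] at this

theorem finite_support_polyLaw (hm : 2 ≤ m) (σ : SupplementaryRule m t) (n : ℕ) :
    (polyLaw σ n).support.Finite := by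
  induction n using Nat.strong_induction_on with
  | _ n ih =>
    by_cases hn : n < m
    · rw [polyLaw_of_lt σ hn]; simp
    · rw [polyLaw_eq_bind hm σ (not_lt.1 hn)]
      refine finite_support_bind (finite_support_splitLaw hm (not_lt.1 hn)) fun I hI => ?_
      exact finite_support_map (finite_support_independentLaw fun j =>
        ih _ (lt_of_mem_support_splitLaw hm (not_lt.1 hn) hI j)) _

theorem finite_support_treeLaw (hm : 2 ≤ m) (σ : SupplementaryRule m t) (S : Finset ℕ) :
    (treeLaw σ S).support.Finite := by
  induction hn : S.card using Nat.strong_induction_on generalizing S with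
  | _ n ih =>
    subst hn
    by_cases hS : m ≤ S.card
    · rw [treeLaw_eq_bind hm σ hS]
      refine finite_support_bind ?_ fun P hP => finite_support_map
        (finite_support_independentLaw fun j =>
          ih _ (card_block_lt m t hm σ S hS P hP j) _ rfl) _
      refine S.powerset.finite_toSet.subset fun P hP => ?_
      simpa using (pivots_of_mem_support hm hS hP).1
    · rw [treeLaw]
      split_ifs with h1 h2
      · simp
      · simp
      · omega

/-- The expected profile polynomial. -/
noncomputable def meanPoly (σ : SupplementaryRule m t) (n : ℕ) : ℂ[X] := ev (polyLaw σ n) id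

theorem eval_meanPoly (hm : 2 ≤ m) (σ : SupplementaryRule m t) (n : ℕ) (z : ℂ) :
    (meanPoly σ n).eval z = ev (polyLaw σ n) fun p => p.eval z :=
  (ev_linear (finite_support_polyLaw hm σ n)
    ((Polynomial.leval z : ℂ[X] →ₗ[ℂ] ℂ).restrictScalars ℝ) id).symm

theorem expectedPoly_eq_eval (hm : 2 ≤ m) (σ : SupplementaryRule m t) (n : ℕ) (z : ℂ) :
    expectedPoly σ n z = (meanPoly σ n).eval z := by
  rw [eval_meanPoly hm, expectedPoly, treeMeasure,
    integral_toMeasure (finite_support_treeLaw hm σ _), polyLaw,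
    ev_map (finite_support_treeLaw hm σ _)]
  exact ev_congr fun T _ => profilePoly_eq_eval T z

theorem meanPoly_of_lt (σ : SupplementaryRule m t) {n : ℕ} (hn : n < m) :
    meanPoly σ n = Polynomial.C (n : ℂ) := by
  rw [meanPoly, polyLaw_of_lt σ hn, ev_pure, id]

theorem eval_joinPoly (f : Fin m → ℂ[X]) (z : ℂ) :
    (joinPoly m f).eval z = ((m - 1 : ℕ) : ℂ) + z * ∑ j, (f j).eval z := by
  simp [joinPoly, Polynomial.eval_finsetSum]

theorem eval_meanPoly_eq (hm : 2 ≤ m) (σ : SupplementaryRule m t) {n : ℕ} (hn : m ≤ n) (z : ℂ) :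
    (meanPoly σ n).eval z = ((m - 1 : ℕ) : ℂ) +
      z * ev (splitLaw σ n) fun I => ∑ j, (meanPoly σ (I j)).eval z := by
  have hs := finite_support_splitLaw (σ := σ) hm hn
  have hp := finite_support_polyLaw hm σ
  rw [eval_meanPoly hm, polyLaw_eq_bind hm σ hn, ev_bind hs fun I _ =>
    finite_support_map (finite_support_independentLaw fun j => hp _) _]
  have h1 : ∀ I : Fin m → ℕ, (ev ((independentLaw fun j => polyLaw σ (I j)).map (joinPoly m))
      fun p => p.eval z) = ((m - 1 : ℕ) : ℂ) + z * ∑ j, (meanPoly σ (I j)).eval z := by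
    intro I
    have hi := finite_support_independentLaw (p := fun j => polyLaw σ (I j)) fun j => hp _
    simp only [ev_map hi, eval_joinPoly]
    rw [ev_add hi, ev_const hi, ev_mul_left hi, ev_sum hi]
    congr 2
    refine Finset.sum_congr rfl fun j _ => ?_
    rw [eval_meanPoly hm]
    exact ev_independentLaw_apply (p := fun j => polyLaw σ (I j)) (fun j => hp _) j
      (fun p => p.eval z)
  simp only [h1]
  rw [ev_add hs, ev_const hs, ev_mul_left hs]

/-! ### Rising factorials and the Euler operator -/

/-- `θ(θ+1)⋯(θ+n-1)/n!`, the coefficients of `(1-x)^(-θ)`. -/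
noncomputable def rise {K : Type*} [Field K] (θ : K) (n : ℕ) : K :=
  ∏ k ∈ Finset.range n, (θ + k) / (k + 1)

section Rise
variable {K : Type*} [Field K]

@[simp] theorem rise_zero (θ : K) : rise θ 0 = 1 := by simp [rise]

theorem rise_succ (θ : K) (n : ℕ) : rise θ (n + 1) = rise θ n * ((θ + n) / (n + 1)) := by
  rw [rise, Finset.prod_range_succ, rise]

theorem succ_mul_rise_succ [CharZero K] (θ : K) (n : ℕ) :
    ((n : K) + 1) * rise θ (n + 1) = (θ + n) * rise θ n := by
  rw [rise_succ]
  have : (n : K) + 1 ≠ 0 := by exact_mod_cast Nat.succ_ne_zero n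
  field_simp

theorem rise_one [CharZero K] (n : ℕ) : rise (1 : K) n = 1 := by
  rw [rise]
  refine Finset.prod_eq_one fun k _ => ?_
  rw [add_comm]
  exact div_self (by exact_mod_cast Nat.succ_ne_zero k)

/-- Both sides are the coefficient of `x^n` in the `t`-th derivative of `(1-x)^(-θ)`, divided by
`t!`. -/
theorem choose_mul_rise_add [CharZero K] (θ : K) (n t : ℕ) :
    ((n + t).choose t : K) * rise θ (n + t) = rise θ t * rise (θ + t) n := by
  induction n with
  | zero => simp
  | succ n ih =>
    have h1 : (n + 1 + t).choose t * (n + 1) = (n + t).choose t * (n + t + 1) := by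
      have h := Nat.add_one_mul_choose_eq (n + t) n
      have e1 : (n + t).choose n = (n + t).choose t := Nat.choose_symm_add
      have e2 : (n + t).succ.choose n.succ = (n + 1 + t).choose t := by
        rw [show (n + t).succ = n + 1 + t by omega]; exact Nat.choose_symm_add
      rw [e1, e2] at h
      have : (n + t).succ = n + t + 1 := rfl
      nlinarith
    have h1' : ((n + 1 + t).choose t : K) * (n + 1) = (n + t).choose t * (n + t + 1) := by
      exact_mod_cast h1
    have h2 : n + 1 + t = n + t + 1 := by omega
    have h3 := succ_mul_rise_succ θ (n + t)
    have h4 := succ_mul_rise_succ (θ + t) n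
    have hn : (n : K) + 1 ≠ 0 := by exact_mod_cast Nat.succ_ne_zero n
    apply mul_right_cancel₀ hn
    rw [h2] at h1' ⊢
    push_cast at h3
    calc ((n + t + 1).choose t : K) * rise θ (n + t + 1) * (n + 1)
        = ((n + t + 1).choose t : K) * (n + 1) * rise θ (n + t + 1) := by ring
      _ = (n + t).choose t * ((n + t + 1) * rise θ (n + t + 1)) := by rw [h1']; ring
      _ = ((n + t).choose t * rise θ (n + t)) * (θ + (n + t)) := by rw [h3]; ring
      _ = rise θ t * ((θ + t + n) * rise (θ + t) n) := by rw [ih]; ring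
      _ = rise θ t * rise (θ + t) (n + 1) * (n + 1) := by rw [← h4]; ring

end Rise

/-- The Euler operator `(1 - x) d/dx`. -/
noncomputable def eulerOp : Module.End ℂ (PowerSeries ℂ) :=
  LinearMap.mulLeft ℂ (1 - PowerSeries.X) ∘ₗ
    (PowerSeries.derivative ℂ : PowerSeries ℂ →ₗ[ℂ] PowerSeries ℂ)

theorem eulerOp_apply (f : PowerSeries ℂ) :
    eulerOp f = (1 - PowerSeries.X) * PowerSeries.derivative ℂ f := rfl

theorem coeff_eulerOp (f : PowerSeries ℂ) (n : ℕ) : PowerSeries.coeff n (eulerOp f) =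
    (n + 1) * PowerSeries.coeff (n + 1) f - n * PowerSeries.coeff n f := by
  rw [eulerOp_apply, sub_mul, one_mul, map_sub]
  cases n with
  | zero => simp [PowerSeries.coeff_derivative]
  | succ n =>
    rw [PowerSeries.coeff_succ_X_mul, PowerSeries.coeff_derivative, PowerSeries.coeff_derivative]
    push_cast; ring

theorem eulerOp_mk_rise (μ : ℂ) :
    eulerOp (PowerSeries.mk (rise μ)) = μ • PowerSeries.mk (rise μ) := by
  ext n
  rw [coeff_eulerOp, PowerSeries.coeff_mk, PowerSeries.coeff_mk, succ_mul_rise_succ]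
  simp
  ring

theorem coeff_iterate_derivative (f : PowerSeries ℂ) (r k : ℕ) :
    PowerSeries.coeff k ((PowerSeries.derivative ℂ)^[r] f) =
      ((k + r).descFactorial r : ℂ) * PowerSeries.coeff (k + r) f := by
  induction r generalizing k with
  | zero => simp
  | succ r ih =>
    rw [Function.iterate_succ_apply', PowerSeries.coeff_derivative, ih, Nat.descFactorial_succ]
    have : k + 1 + r = k + (r + 1) := by omega
    rw [this]
    have h2 : k + (r + 1) - r = k + 1 := by omega
    rw [h2]
    push_cast; ring

theorem eulerOp_mul_pow (g : PowerSeries ℂ) (k : ℕ) :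
    eulerOp ((1 - PowerSeries.X) ^ k * g) + (k : ℂ) • ((1 - PowerSeries.X) ^ k * g) =
      (1 - PowerSeries.X) ^ (k + 1) * PowerSeries.derivative ℂ g := by
  have h1 : PowerSeries.derivative ℂ ((1 - PowerSeries.X : PowerSeries ℂ)) = -1 := by
    rw [map_sub, PowerSeries.derivative_X, PowerSeries.derivative_one, zero_sub]
  rw [eulerOp_apply, Derivation.leibniz, Derivation.leibniz_pow, h1]
  cases k with
  | zero => simp
  | succ k =>
    simp only [smul_eq_mul, Nat.add_sub_cancel, nsmul_eq_mul, Algebra.smul_def]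
    push_cast
    ring

/-- Induction on `r`: by the product rule in `eulerOp_mul_pow`, applying `eulerOp + r` after
multiplication by `(1-x)^r` is `(1-x)^(r+1) d/dx`. -/
theorem aeval_eulerOp_prod (r : ℕ) (f : PowerSeries ℂ) :
    Polynomial.aeval eulerOp (∏ i ∈ Finset.range r, (Polynomial.X + Polynomial.C (i : ℂ))) f =
      (1 - PowerSeries.X) ^ r * (PowerSeries.derivative ℂ)^[r] f := by
  induction r with
  | zero => simp
  | succ r ih =>
    rw [Finset.prod_range_succ, mul_comm, map_mul, Module.End.mul_apply, ih, map_add,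
      Polynomial.aeval_X, Polynomial.aeval_C, LinearMap.add_apply, Module.algebraMap_end_apply,
      eulerOp_mul_pow, Function.iterate_succ_apply']

/-- The Euler operator shifted by `t`. -/
noncomputable def shiftOp (t : ℕ) : Module.End ℂ (PowerSeries ℂ) :=
  eulerOp - algebraMap ℂ _ (t : ℂ)

theorem coeff_shiftOp_sub (t : ℕ) (μ : ℂ) (f : PowerSeries ℂ) (n : ℕ) :
    PowerSeries.coeff n ((Polynomial.aeval (shiftOp t) (Polynomial.X - Polynomial.C μ)) f) =
      (n + 1) * PowerSeries.coeff (n + 1) f - (n + (t + μ)) * PowerSeries.coeff n f := by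
  rw [map_sub, Polynomial.aeval_X, Polynomial.aeval_C, LinearMap.sub_apply, shiftOp,
    LinearMap.sub_apply, Module.algebraMap_end_apply, Module.algebraMap_end_apply, map_sub, map_sub,
    coeff_eulerOp]
  simp
  ring

theorem shiftOp_mk_rise (t : ℕ) (θ : ℂ) :
    shiftOp t (PowerSeries.mk (rise (θ + t))) = θ • PowerSeries.mk (rise (θ + t)) := by
  rw [shiftOp, LinearMap.sub_apply, eulerOp_mk_rise, Module.algebraMap_end_apply, ← sub_smul,
    add_sub_cancel_right]

theorem aeval_apply_of_eq_smul {V : Type*} [AddCommGroup V] [Module ℂ V] {T : Module.End ℂ V}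
    {v : V} {μ : ℂ} (h : T v = μ • v) (p : ℂ[X]) : Polynomial.aeval T p v = p.eval μ • v := by
  induction p using Polynomial.induction_on' with
  | add p q hp hq => rw [map_add, LinearMap.add_apply, hp, hq, Polynomial.eval_add, add_smul]
  | monomial n a =>
    rw [Polynomial.aeval_monomial, Module.End.mul_apply, Module.algebraMap_end_apply,
      Polynomial.eval_monomial, mul_smul]
    congr 1
    induction n with
    | zero => simp
    | succ n ih => rw [pow_succ', Module.End.mul_apply, ih, map_smul, h, smul_smul, pow_succ]

/-- The reason for the shift by `t`: the factors `θ + i` of `F`, which start at `i = t`, become the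
consecutive factors `eulerOp + i` starting at `i = 0`. -/
theorem aeval_shiftOp_polyF (hm : 2 ≤ m) (f : PowerSeries ℂ) :
    Polynomial.aeval (shiftOp t) (polyF m t) f =
      ((t ! : ℂ) / ((m : ℂ) * ((m * t + m - 1)! : ℂ))) •
        ((1 - PowerSeries.X) ^ ((m - 1) * (t + 1)) *
          (PowerSeries.derivative ℂ)^[(m - 1) * (t + 1)] f) := by
  have h1 : shiftOp t = Polynomial.aeval eulerOp (Polynomial.X - Polynomial.C (t : ℂ)) := by
    simp [shiftOp]
  rw [h1, ← Polynomial.aeval_comp, polyF, Polynomial.mul_comp, Polynomial.C_comp, map_mul,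
    Module.End.mul_apply, Polynomial.aeval_C, Module.algebraMap_end_apply, ← aeval_eulerOp_prod]
  congr 3
  have h2 : Finset.Icc t (m * t + m - 2) = Finset.Ico t (t + (m - 1) * (t + 1)) := by
    have h3 := pred_mul_add (m := m) (t := t) (by omega)
    have h4 : (m - 1) * (t + 1) ≥ 1 := Nat.mul_pos (by omega) (by omega)
    ext i
    simp only [Finset.mem_Icc, Finset.mem_Ico]
    omega
  rw [h2, Polynomial.prod_comp, Finset.prod_Ico_eq_prod_range, Nat.add_sub_cancel_left]
  refine Finset.prod_congr rfl fun i _ => ?_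
  simp only [Polynomial.add_comp, Polynomial.X_comp, Polynomial.C_comp]
  push_cast
  rw [Polynomial.C_add]
  ring

/-! ### The splitting recursion as an Euler equation. -/

/-- The expectation of `∑ⱼ A(Iⱼ)` for the block sizes `I` of `n` keys. -/
noncomputable def splitMean (m t : ℕ) (A : ℕ → ℂ) (n : ℕ) : ℂ :=
  (∑ i ∈ Finset.piAntidiag (Finset.univ : Finset (Fin m)) (n - (m - 1)),
    ((∏ j, (i j).choose t : ℕ) : ℂ) * ∑ j, A (i j)) / (n.choose (m * t + m - 1) : ℕ)

theorem splitMean_eq_ev (hm : 2 ≤ m) (σ : SupplementaryRule m t) {n : ℕ}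
    (hn : m * t + m - 1 ≤ n) (hn' : m ≤ n) (A : ℕ → ℂ) :
    splitMean m t A n = ev (splitLaw σ n) fun I => ∑ j, A (I j) := by
  rw [ev_eq_sum (s := Finset.piAntidiag Finset.univ (n - (m - 1))), splitMean, Finset.sum_div]
  · refine Finset.sum_congr rfl fun i hi => ?_
    rw [splitLaw_apply hm σ hn hn', if_pos (Finset.mem_piAntidiag.1 hi).1, ENNReal.toReal_div,
      ENNReal.toReal_natCast, ENNReal.toReal_natCast, Complex.real_smul]
    push_cast
    ring
  · intro i hi
    simpa using sum_of_mem_support_splitLaw hm hn' hi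

/-- The series `∑ₖ C(k+t,t) A(k+t) xᵏ`. -/
noncomputable def baseSeries (t : ℕ) (A : ℕ → ℂ) : PowerSeries ℂ :=
  PowerSeries.mk fun k => ((k + t).choose t : ℂ) * A (k + t)

theorem baseSeries_rise (t : ℕ) (θ : ℂ) :
    baseSeries t (rise θ) = rise θ t • PowerSeries.mk (rise (θ + t)) := by
  ext n
  simp [baseSeries, choose_mul_rise_add]

theorem mk_choose_mul (t : ℕ) (A : ℕ → ℂ) :
    (PowerSeries.mk fun i => (i.choose t : ℂ) * A i) = PowerSeries.X ^ t * baseSeries t A := by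
  ext n
  rw [PowerSeries.coeff_X_pow_mul', baseSeries]
  split_ifs with h
  · simp [Nat.sub_add_cancel h]
  · simp [Nat.choose_eq_zero_of_lt (not_le.1 h)]

/-- All `m` blocks contribute equally. For one of them the sum is a convolution in which one factor
carries `A` and the other `m - 1` factors are `x^t / (1-x)^(t+1)`. -/
theorem splitMean_eq_coeff (hm : 1 ≤ m) (A : ℕ → ℂ) {n : ℕ} (hn : m * t + m - 1 ≤ n) :
    splitMean m t A n = m * PowerSeries.coeff (n - (m * t + m - 1))
      (baseSeries t A * (PowerSeries.invOneSubPow ℂ ((m - 1) * (t + 1))).val) /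
        (n.choose (m * t + m - 1) : ℕ) := by
  rw [splitMean]
  congr 1
  have h1 : ∀ j₀ : Fin m, ∑ i ∈ Finset.piAntidiag (Finset.univ : Finset (Fin m)) (n - (m - 1)),
      ((∏ j, (i j).choose t : ℕ) : ℂ) * A (i j₀) = PowerSeries.coeff (n - (m * t + m - 1))
      (baseSeries t A * (PowerSeries.invOneSubPow ℂ ((m - 1) * (t + 1))).val) := by
    intro j₀
    have h2 := coeff_prod_mk (m := m) (fun j i => if j = j₀ then (i.choose t : ℂ) * A i else
      ((i.choose t : ℕ) : ℂ)) (n - (m - 1))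
    have h3 : ∀ i : Fin m → ℕ, ∏ j, (if j = j₀ then ((i j).choose t : ℂ) * A (i j) else
        (((i j).choose t : ℕ) : ℂ)) = ((∏ j, (i j).choose t : ℕ) : ℂ) * A (i j₀) := by
      intro i
      rw [← Finset.prod_erase_mul _ _ (Finset.mem_univ j₀), if_pos rfl, Nat.cast_prod,
        ← Finset.prod_erase_mul Finset.univ (fun j => ((i j).choose t : ℂ)) (Finset.mem_univ j₀),
        ← mul_assoc]
      congr 2
      exact Finset.prod_congr rfl fun j hj => by rw [if_neg (Finset.ne_of_mem_erase hj)]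
    simp only [h3] at h2
    rw [← h2, ← Finset.prod_erase_mul _ _ (Finset.mem_univ j₀)]
    have h4 : ∏ j ∈ Finset.univ.erase j₀, PowerSeries.mk (fun i => if j = j₀ then
        (i.choose t : ℂ) * A i else ((i.choose t : ℕ) : ℂ)) =
        (PowerSeries.X ^ t * (PowerSeries.invOneSubPow ℂ (t + 1)).val) ^ (m - 1) := by
      rw [← mk_choose]
      have : ∀ j ∈ Finset.univ.erase j₀, PowerSeries.mk (fun i => if j = j₀ then
        (i.choose t : ℂ) * A i else ((i.choose t : ℕ) : ℂ)) =
          PowerSeries.mk fun i => ((i.choose t : ℕ) : ℂ) := fun j hj => by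
        simp [Finset.ne_of_mem_erase hj]
      rw [Finset.prod_congr rfl this, Finset.prod_const, Finset.card_erase_of_mem (Finset.mem_univ _),
        Finset.card_univ, Fintype.card_fin]
    simp only [h4, if_true]
    rw [mk_choose_mul, mul_pow, ← pow_mul, ← Units.val_pow_eq_pow_val, invOneSubPow_pow]
    have h5 : t * (m - 1) + t = m * t := by
      obtain ⟨d, rfl⟩ : ∃ d, m = d + 1 := ⟨m - 1, by omega⟩
      rw [Nat.add_sub_cancel]; ring
    have h6 : PowerSeries.X ^ (t * (m - 1)) * (PowerSeries.invOneSubPow ℂ ((t + 1) * (m - 1))).val *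
        (PowerSeries.X ^ t * baseSeries t A) = PowerSeries.X ^ (m * t) *
        (baseSeries t A * (PowerSeries.invOneSubPow ℂ ((m - 1) * (t + 1))).val) := by
      rw [← h5, pow_add, mul_comm (t + 1)]; ring
    have h7 : n - (m - 1) - m * t = n - (m * t + m - 1) := by omega
    rw [h6, PowerSeries.coeff_X_pow_mul', if_pos (by omega), h7]
  simp only [Finset.mul_sum]
  rw [Finset.sum_comm, Finset.sum_congr rfl fun j _ => h1 j]
  simp

/-- The binomial coefficient in the denominator of `splitMean` is exactly what `(m-1)(t+1)`
derivatives of `baseSeries` produce. This turns the recursion into a differential equation. -/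
theorem coeff_iterate_derivative_baseSeries (hm : 1 ≤ m) (A : ℕ → ℂ) {n : ℕ}
    (hn : m * t + m - 1 ≤ n) :
    PowerSeries.coeff (n - (m * t + m - 1))
      ((PowerSeries.derivative ℂ)^[(m - 1) * (t + 1)] (baseSeries t A)) =
      (n.choose (m * t + m - 1) : ℕ) * ((m * t + m - 1)! / t !) * A n := by
  obtain ⟨k, rfl⟩ := Nat.exists_eq_add_of_le' hn
  rw [Nat.add_sub_cancel, coeff_iterate_derivative, baseSeries, PowerSeries.coeff_mk,
    pred_mul_add hm]
  set r := (m - 1) * (t + 1) with hr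
  rw [← add_assoc]
  have h1 : (k + r).descFactorial r * k ! = (k + r)! := by
    rw [mul_comm]
    have := Nat.factorial_mul_descFactorial (n := k + r) (k := r) (by omega)
    rwa [Nat.add_sub_cancel] at this
  have h2 : (k + r + t).choose t * (k + r)! * t ! = (k + r + t)! := by
    have := Nat.add_choose_mul_factorial_mul_factorial (k + r) t
    exact this
  have h3 : (k + r + t).choose (r + t) * k ! * (r + t)! = (k + r + t)! := by
    have := Nat.add_choose_mul_factorial_mul_factorial k (r + t)
    rw [← add_assoc] at this
    exact this
  have h1' : ((k + r).descFactorial r : ℂ) * (k ! : ℂ) = ((k + r)! : ℂ) := by exact_mod_cast h1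
  have h2' : ((k + r + t).choose t : ℂ) * ((k + r)! : ℂ) * (t ! : ℂ) = ((k + r + t)! : ℂ) := by
    exact_mod_cast h2
  have h3' : ((k + r + t).choose (r + t) : ℂ) * (k ! : ℂ) * ((r + t)! : ℂ) = ((k + r + t)! : ℂ) := by
    exact_mod_cast h3
  have hk : (k ! : ℂ) ≠ 0 := by exact_mod_cast k.factorial_ne_zero
  have ht : (t ! : ℂ) ≠ 0 := by exact_mod_cast t.factorial_ne_zero
  have key : ((k + r).descFactorial r : ℂ) * ((k + r + t).choose t : ℂ) =
      ((k + r + t).choose (r + t) : ℂ) * (((r + t)! : ℂ) / (t ! : ℂ)) := by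
    rw [← mul_div_assoc, eq_div_iff ht]
    apply mul_right_cancel₀ hk
    calc _ = ((k + r + t).choose t : ℂ) * (((k + r).descFactorial r : ℂ) * (k ! : ℂ)) * (t ! : ℂ) := by
          ring
      _ = ((k + r + t).choose (r + t) : ℂ) * (k ! : ℂ) * ((r + t)! : ℂ) := by rw [h1', h2', h3']
      _ = _ := by ring
  rw [← mul_assoc, key]

theorem eq_of_one_sub_pow_mul (f g : PowerSeries ℂ) (r : ℕ) :
    (1 - PowerSeries.X) ^ r * f = g ↔ f = g * (PowerSeries.invOneSubPow ℂ r).val := by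
  have h : (1 - PowerSeries.X : PowerSeries ℂ) ^ r * (PowerSeries.invOneSubPow ℂ r).val = 1 := by
    rw [← PowerSeries.invOneSubPow_inv_eq_one_sub_pow]
    exact (PowerSeries.invOneSubPow ℂ r).inv_val
  constructor
  · rintro rfl
    calc f = ((1 - PowerSeries.X : PowerSeries ℂ) ^ r * (PowerSeries.invOneSubPow ℂ r).val) * f := by
          rw [h, one_mul]
      _ = _ := by ring
  · rintro rfl
    calc _ = ((1 - PowerSeries.X : PowerSeries ℂ) ^ r * (PowerSeries.invOneSubPow ℂ r).val) * g := by
          ring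
      _ = g := by rw [h, one_mul]

theorem leadingF_ne_zero (hm : 2 ≤ m) : (t ! : ℂ) / ((m : ℂ) * ((m * t + m - 1)! : ℂ)) ≠ 0 := by
  have := Complex.ofReal_ne_zero.2 (leadingF_pos (t := t) hm).ne'
  push_cast at this
  exact this

/-- A solution of the recursion `A n = z 𝔼 ∑ⱼ A(Iⱼ)` is annihilated by `F(T) - z`. -/
theorem aeval_shiftOp_baseSeries (hm : 2 ≤ m) {A : ℕ → ℂ} {z : ℂ}
    (hA : ∀ n, m * t + m - 1 ≤ n → A n = z * splitMean m t A n) :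
    Polynomial.aeval (shiftOp t) (polyF m t - Polynomial.C z) (baseSeries t A) = 0 := by
  rw [map_sub, LinearMap.sub_apply, aeval_shiftOp_polyF hm, Polynomial.aeval_C,
    Module.algebraMap_end_apply, sub_eq_zero, ← mul_smul_comm, eq_of_one_sub_pow_mul]
  ext k
  have hn : m * t + m - 1 ≤ k + (m * t + m - 1) := by omega
  have h1 := coeff_iterate_derivative_baseSeries (t := t) (by omega : 1 ≤ m) A hn
  have h2 := splitMean_eq_coeff (t := t) (by omega : 1 ≤ m) A hn
  have h3 := hA _ hn
  rw [Nat.add_sub_cancel] at h1 h2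
  have hc : (((k + (m * t + m - 1)).choose (m * t + m - 1) : ℕ) : ℂ) ≠ 0 := by
    exact_mod_cast (Nat.choose_pos hn).ne'
  have hm0 : (m : ℂ) ≠ 0 := by exact_mod_cast (by omega : m ≠ 0)
  have ht : (t ! : ℂ) ≠ 0 := by exact_mod_cast t.factorial_ne_zero
  have hM : ((m * t + m - 1)! : ℂ) ≠ 0 := by exact_mod_cast Nat.factorial_ne_zero _
  rw [PowerSeries.coeff_smul, h1, smul_mul_assoc, PowerSeries.coeff_smul, h3, h2]
  simp only [smul_eq_mul]
  field_simp

/-- The rising factorials solve the recursion with `z = F(θ)`. -/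
theorem splitMean_rise (hm : 2 ≤ m) {θ : ℂ} {n : ℕ} (hn : m * t + m - 1 ≤ n) :
    (polyF m t).eval θ * splitMean m t (rise θ) n = rise θ n := by
  have h0 : shiftOp t (baseSeries t (rise θ)) = θ • baseSeries t (rise θ) := by
    rw [baseSeries_rise, map_smul, shiftOp_mk_rise, smul_comm]
  have h1 := aeval_apply_of_eq_smul h0 (polyF m t)
  rw [aeval_shiftOp_polyF hm, ← mul_smul_comm, eq_of_one_sub_pow_mul] at h1
  have h2 := congrArg (PowerSeries.coeff (n - (m * t + m - 1))) h1
  rw [PowerSeries.coeff_smul, coeff_iterate_derivative_baseSeries (by omega) _ hn, smul_mul_assoc,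
    PowerSeries.coeff_smul] at h2
  rw [splitMean_eq_coeff (by omega) _ hn]
  have hc : ((n.choose (m * t + m - 1) : ℕ) : ℂ) ≠ 0 := by
    exact_mod_cast (Nat.choose_pos hn).ne'
  have hm0 : (m : ℂ) ≠ 0 := by exact_mod_cast (by omega : m ≠ 0)
  have ht : (t ! : ℂ) ≠ 0 := by exact_mod_cast t.factorial_ne_zero
  have hM : ((m * t + m - 1)! : ℂ) ≠ 0 := by exact_mod_cast Nat.factorial_ne_zero _
  simp only [smul_eq_mul] at h2
  rw [← mul_div_assoc, div_eq_iff hc, mul_left_comm, ← h2]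
  field_simp

/-- The case `θ = 1` of `splitMean_rise`, since `F(1) = 1/m` and `rise 1` is constantly 1. -/
theorem splitMean_one (hm : 2 ≤ m) {n : ℕ} (hn : m * t + m - 1 ≤ n) (c : ℂ) :
    splitMean m t (fun _ => c) n = m * c := by
  have h := splitMean_rise (t := t) hm (θ := 1) hn
  have h1 : (polyF m t).eval (1 : ℂ) = 1 / m := by
    have := polyF_eval_ofReal m t 1
    rw [realF_one hm] at this
    simpa using this
  have h2 : (rise (1 : ℂ)) = fun _ => 1 := funext rise_one
  have hm0 : (m : ℂ) ≠ 0 := by exact_mod_cast (by omega : m ≠ 0)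
  rw [h1, h2] at h
  have h3 : splitMean m t (fun _ => c) n = splitMean m t (fun _ => (1 : ℂ)) n * c := by
    simp only [splitMean, Finset.sum_const, nsmul_eq_mul, mul_one]
    rw [div_mul_eq_mul_div, Finset.sum_mul]
    simp only [mul_assoc]
  field_simp at h
  rw [h3, h]

theorem splitMean_add (A B : ℕ → ℂ) (n : ℕ) :
    splitMean m t (fun k => A k + B k) n = splitMean m t A n + splitMean m t B n := by
  simp only [splitMean, Finset.sum_add_distrib, mul_add, add_div]

/-- The centred means solve the homogeneous recursion. -/
theorem meanPoly_recursion (hm : 2 ≤ m) (σ : SupplementaryRule m t) {z : ℂ} (hz : 1 - m * z ≠ 0)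
    {n : ℕ} (hn : m * t + m - 1 ≤ n) :
    (meanPoly σ n).eval z - ((m - 1 : ℕ) : ℂ) / (1 - m * z) =
      z * splitMean m t (fun k => (meanPoly σ k).eval z - ((m - 1 : ℕ) : ℂ) / (1 - m * z)) n := by
  have h1 : (meanPoly σ n).eval z =
      ((m - 1 : ℕ) : ℂ) + z * splitMean m t (fun k => (meanPoly σ k).eval z) n := by
    by_cases hn' : m ≤ n
    · rw [eval_meanPoly_eq hm σ hn', splitMean_eq_ev hm σ hn hn']
    -- Only `t = 0` leaves room for `n = m - 1`. There the single composition is zero and both sides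
    -- equal `m - 1`.
    · have ht : n = m - 1 := by
        have : 0 ≤ m * t := Nat.zero_le _
        omega
      rw [meanPoly_of_lt σ (by omega), splitMean, ht, Nat.sub_self]
      simp [meanPoly_of_lt σ (by omega : 0 < m)]
  have h2 := splitMean_add (m := m) (t := t)
    (fun k => (meanPoly σ k).eval z) (fun _ => -(((m - 1 : ℕ) : ℂ) / (1 - m * z))) n
  rw [splitMean_one hm hn] at h2
  simp only [← sub_eq_add_neg] at h2
  have h3 : ((m - 1 : ℕ) : ℂ) = ((m - 1 : ℕ) : ℂ) / (1 - m * z) * (1 - m * z) := by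
    rw [div_mul_cancel₀ _ hz]
  rw [h2, h1]
  linear_combination h3

/-! ### Uniform growth bounds for solutions of the Euler equation. -/

theorem rise_pos {a : ℝ} (ha : 0 < a) (n : ℕ) : 0 < rise a n :=
  Finset.prod_pos fun k _ => by positivity

theorem one_le_rise {a : ℝ} (ha : 1 ≤ a) (n : ℕ) : 1 ≤ rise a n := by
  induction n with
  | zero => simp
  | succ n ih =>
    rw [rise_succ]
    refine one_le_mul_of_one_le_of_one_le ih ?_
    rw [one_le_div (by positivity)]
    linarith

/-- A discrete Gronwall lemma with a uniform constant. -/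
theorem exists_growth_const {τ η K : ℝ} (hτ : 1 ≤ τ) (hη : 0 < η) (hK : 0 ≤ K) (N₀ : ℕ) :
    ∃ C, 0 ≤ C ∧ ∀ (a ρ : ℕ → ℝ) (B : ℝ), 0 ≤ B → (∀ n, 0 ≤ a n) →
      (∀ n : ℕ, 0 ≤ ρ n ∧ ρ n ≤ n + K) → (∀ n : ℕ, N₀ ≤ n → ρ n ≤ n + τ - η) → a 0 ≤ B →
      (∀ n : ℕ, (n + 1) * a (n + 1) ≤ ρ n * a n + B * rise τ n) → ∀ n, a n ≤ C * B * rise τ n := by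
  -- `R` is what the crude bound `ρ n ≤ n + K` yields; it is used only up to `N₀`. The summand `1/η`
  -- of `C` serves to absorb the inhomogeneous term beyond `N₀`.
  let R : ℕ → ℝ := fun n => Nat.rec 1 (fun k x => (k + K) * x + rise τ k) n
  have hR0 : R 0 = 1 := rfl
  have hRs : ∀ n : ℕ, R (n + 1) = (n + K) * R n + rise τ n := fun n => rfl
  have hRnn : ∀ n, 0 ≤ R n := by
    intro n
    induction n with
    | zero => rw [hR0]; exact zero_le_one
    | succ n ih =>
      rw [hRs]
      have := (rise_pos (by linarith : 0 < τ) n).le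
      positivity
  set C := ∑ k ∈ Finset.range (N₀ + 1), R k + 1 / η with hC
  have hC0 : 0 ≤ C := add_nonneg (Finset.sum_nonneg fun k _ => hRnn k) (by positivity)
  have hCη : 1 ≤ η * C := by
    have h1 : 0 ≤ ∑ k ∈ Finset.range (N₀ + 1), R k := Finset.sum_nonneg fun k _ => hRnn k
    have h2 : η * (1 / η) = 1 := by field_simp
    rw [hC, mul_add, h2]
    nlinarith
  refine ⟨C, hC0, fun a ρ B hB ha hρ hρ' ha0 hrec => ?_⟩
  have hrn : ∀ n, 1 ≤ rise τ n := one_le_rise hτ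
  have hcrude : ∀ n, a n ≤ R n * B := by
    intro n
    induction n with
    | zero => simpa [hR0] using ha0
    | succ n ih =>
      have h1 : a (n + 1) ≤ (n + 1) * a (n + 1) := by
        have := ha (n + 1)
        have hn : (0 : ℝ) ≤ n := Nat.cast_nonneg n
        nlinarith
      refine h1.trans ((hrec n).trans ?_)
      have h2 : ρ n * a n ≤ (n + K) * (R n * B) := by
        refine mul_le_mul (hρ n).2 ih (ha n) ?_
        positivity
      rw [hRs]
      nlinarith
  have hsmall : ∀ n ≤ N₀, a n ≤ C * B * rise τ n := by
    intro n hn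
    have h1 : R n ≤ C := by
      have := Finset.single_le_sum (f := R) (fun k _ => hRnn k) (Finset.mem_range.2 (by omega : n < N₀ + 1))
      have h2 : 0 ≤ 1 / η := by positivity
      linarith
    calc a n ≤ R n * B := hcrude n
      _ ≤ C * B := by gcongr
      _ ≤ C * B * rise τ n := le_mul_of_one_le_right (by positivity) (hrn n)
  intro n
  induction n with
  | zero => exact hsmall 0 (Nat.zero_le _)
  | succ n ih =>
    rcases Nat.lt_or_ge n N₀ with h | h
    · exact hsmall _ h
    · have hn : (0 : ℝ) < n + 1 := by positivity
      have h1 : ρ n * a n ≤ (n + τ - η) * (C * B * rise τ n) :=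
        mul_le_mul (hρ' n h) ih (ha n) ((hρ n).1.trans (hρ' n h))
      have h2 := hrec n
      have h3 := succ_mul_rise_succ τ n
      -- The spare `η` in the bound for `ρ n` pays for the inhomogeneous term, and `(τ + n) rise τ n
      -- = (n + 1) rise τ (n + 1)` closes the induction.
      have h4 : B * rise τ n ≤ η * (C * B * rise τ n) := by
        have : 0 ≤ B * rise τ n := mul_nonneg hB (by linarith [hrn n])
        calc B * rise τ n ≤ (η * C) * (B * rise τ n) := le_mul_of_one_le_left this hCη
          _ = _ := by ring
      have h5 : ((n : ℝ) + 1) * a (n + 1) ≤ (n + 1) * (C * B * rise τ (n + 1)) := by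
        calc _ ≤ (n + τ - η) * (C * B * rise τ n) + η * (C * B * rise τ n) := by linarith
          _ = C * B * ((τ + n) * rise τ n) := by ring
          _ = _ := by rw [← h3]; ring
      exact le_of_mul_le_mul_left h5 hn

/-- For bounded `w` the norm of `n + w` is `n + re w + O(1/n)` uniformly; the two margins of size
`η` leave room for the error. -/
theorem exists_norm_add_le {K τ η : ℝ} (hη : 0 < η) : ∃ N₀ : ℕ, ∀ n : ℕ, N₀ ≤ n → ∀ w : ℂ,
    ‖w‖ ≤ K → w.re ≤ τ - 2 * η → ‖(n : ℂ) + w‖ ≤ n + τ - η := by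
  obtain ⟨N₀, hN⟩ := exists_nat_ge (K ^ 2 / η + |K| + |τ| + η)
  refine ⟨N₀, fun n hn w hw hre => ?_⟩
  have hn' : K ^ 2 / η + |K| + |τ| + η ≤ n := hN.trans (by exact_mod_cast hn)
  have h0 : 0 ≤ K ^ 2 / η := by positivity
  have hK := le_abs_self K
  have hK0 := abs_nonneg K
  have hτ := neg_abs_le τ
  have hτ0 := abs_nonneg τ
  have h1 : (0 : ℝ) ≤ n + τ - η := by linarith
  have ha := (Complex.abs_re_le_norm w).trans hw
  have hb := (Complex.abs_im_le_norm w).trans hw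
  have ha' := abs_le.1 ha
  have hb2 : w.im ^ 2 ≤ K ^ 2 := by rw [← sq_abs w.im]; exact pow_le_pow_left₀ (abs_nonneg _) hb 2
  rw [← abs_of_nonneg (norm_nonneg ((n : ℂ) + w)), ← abs_of_nonneg h1, ← sq_le_sq, Complex.sq_norm,
    Complex.normSq_apply]
  simp only [Complex.add_re, Complex.natCast_re, Complex.add_im, Complex.natCast_im, zero_add]
  have h2 : K ^ 2 ≤ η * (2 * n + τ - η + w.re) := by
    have : K ^ 2 = η * (K ^ 2 / η) := by field_simp
    rw [this]
    refine mul_le_mul_of_nonneg_left ?_ hη.le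
    linarith
  have h3 : η * (2 * n + τ - η + w.re) ≤ (τ - η - w.re) * (2 * n + τ - η + w.re) := by
    refine mul_le_mul_of_nonneg_right (by linarith) ?_
    linarith
  nlinarith

/-- The monic polynomial with given roots. -/
noncomputable def rootPoly (L : Multiset ℂ) : ℂ[X] :=
  (L.map fun μ => Polynomial.X - Polynomial.C μ).prod

theorem rootPoly_cons (μ : ℂ) (L : Multiset ℂ) :
    rootPoly (μ ::ₘ L) = (Polynomial.X - Polynomial.C μ) * rootPoly L := by
  simp [rootPoly]

theorem norm_coeff_shiftOp_le (μ : ℂ) (f : PowerSeries ℂ) (n : ℕ) {K B : ℝ} (hμ : ‖μ‖ ≤ K)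
    (h0 : ‖PowerSeries.coeff n f‖ ≤ B) (h1 : ‖PowerSeries.coeff (n + 1) f‖ ≤ B) :
    ‖PowerSeries.coeff n (Polynomial.aeval (shiftOp t) (Polynomial.X - Polynomial.C μ) f)‖ ≤
      (2 * n + t + K + 1) * B := by
  have hB := (norm_nonneg _).trans h0
  rw [coeff_shiftOp_sub]
  have e1 : ‖(n : ℂ) + 1‖ = n + 1 := by
    rw [← Nat.cast_one, ← Nat.cast_add, Complex.norm_natCast]; push_cast; ring
  have e2 : ‖(n : ℂ) + (t + μ)‖ ≤ n + (t + K) := by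
    refine (norm_add_le _ _).trans (add_le_add (by simp) ((norm_add_le _ _).trans ?_))
    exact add_le_add (by simp) hμ
  calc _ ≤ ‖((n : ℂ) + 1) * PowerSeries.coeff (n + 1) f‖ +
        ‖((n : ℂ) + (t + μ)) * PowerSeries.coeff n f‖ := norm_sub_le _ _
    _ ≤ (n + 1) * B + (n + (t + K)) * B := by
        rw [norm_mul, norm_mul, e1]
        have : 0 ≤ K := (norm_nonneg _).trans hμ
        gcongr
    _ = _ := by ring

/-- Each factor `T - μ` looks one coefficient further and costs a bounded factor. The constant
depends on the roots only through the bound `K`, which gives uniformity in `z`. -/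
theorem norm_coeff_rootPoly_le (t : ℕ) {K : ℝ} (hK : 0 ≤ K) (l N : ℕ) : ∃ C, 0 ≤ C ∧
    ∀ L : Multiset ℂ, L.card = l → (∀ μ ∈ L, ‖μ‖ ≤ K) → ∀ (f : PowerSeries ℂ) (B : ℝ),
      (∀ i ≤ N + l, ‖PowerSeries.coeff i f‖ ≤ B) →
      ∀ i ≤ N, ‖PowerSeries.coeff i (Polynomial.aeval (shiftOp t) (rootPoly L) f)‖ ≤ C * B := by
  induction l with
  | zero =>
    refine ⟨1, zero_le_one, fun L hL _ f B hB i hi => ?_⟩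
    rw [Multiset.card_eq_zero] at hL
    subst hL
    simpa [rootPoly] using hB i hi
  | succ l ih =>
    obtain ⟨C, hC, H⟩ := ih
    refine ⟨C * (2 * (N + l) + t + K + 1), by positivity, fun L hL hLK f B hB i hi => ?_⟩
    obtain ⟨μ, hμ⟩ := Multiset.card_pos_iff_exists_mem.1 (by omega : 0 < L.card)
    obtain ⟨L', rfl⟩ := Multiset.exists_cons_of_mem hμ
    rw [Multiset.card_cons, Nat.add_right_cancel_iff] at hL
    rw [rootPoly_cons, mul_comm, map_mul, Module.End.mul_apply, mul_assoc]
    refine H L' hL (fun ν hν => hLK ν (Multiset.mem_cons_of_mem hν)) _ _ (fun k hk => ?_) i hi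
    have hB0 : 0 ≤ B := (norm_nonneg _).trans (hB 0 (Nat.zero_le _))
    refine (norm_coeff_shiftOp_le μ f k (hLK μ (Multiset.mem_cons_self _ _)) (hB k (by omega))
      (hB (k + 1) (by omega))).trans ?_
    have : (k : ℝ) ≤ N + l := by exact_mod_cast hk
    gcongr

/-- Induction on the number of roots. The series `g = (T - μ) f` is annihilated by the remaining
factors, and `f` solves `(n+1) f_{n+1} = (n+t+μ) f_n + g_n`, to which `exists_growth_const` applies.
Avoiding partial fractions keeps the constants uniform when roots collide. -/
theorem norm_coeff_le_of_rootPoly (t : ℕ) {K σ τ : ℝ} (hK : 0 ≤ K) (hτ : 1 ≤ τ) (h : t + σ < τ)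
    (l : ℕ) : ∃ C, 0 ≤ C ∧ ∀ L : Multiset ℂ, L.card = l → (∀ μ ∈ L, ‖μ‖ ≤ K ∧ μ.re ≤ σ) →
      ∀ f : PowerSeries ℂ, Polynomial.aeval (shiftOp t) (rootPoly L) f = 0 → ∀ B : ℝ, 0 ≤ B →
      (∀ i < l, ‖PowerSeries.coeff i f‖ ≤ B) →
      ∀ n, ‖PowerSeries.coeff n f‖ ≤ C * B * rise τ n := by
  induction l with
  | zero =>
    refine ⟨0, le_rfl, fun L hL _ f hf B _ _ n => ?_⟩
    rw [Multiset.card_eq_zero] at hL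
    subst hL
    have : f = 0 := by simpa [rootPoly] using hf
    simp [this]
  | succ l ih =>
    obtain ⟨C, hC, H⟩ := ih
    set η := (τ - t - σ) / 2 with hη
    have hη0 : 0 < η := by rw [hη]; linarith
    obtain ⟨N₀, hN⟩ := exists_norm_add_le (K := t + K) (τ := τ) hη0
    obtain ⟨C', hC', H'⟩ := exists_growth_const hτ hη0 (by positivity : 0 ≤ t + K) N₀
    set D := C * (2 * l + t + K + 1) + 1 with hD
    have hD0 : 0 ≤ D := by positivity
    have hD1 : 1 ≤ D := by rw [hD]; have : 0 ≤ C * (2 * l + t + K + 1) := by positivity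
                           linarith
    refine ⟨C' * D, by positivity, fun L hL hLK f hf B hB hfB n => ?_⟩
    obtain ⟨μ, hμ⟩ := Multiset.card_pos_iff_exists_mem.1 (by omega : 0 < L.card)
    obtain ⟨L', rfl⟩ := Multiset.exists_cons_of_mem hμ
    rw [Multiset.card_cons, Nat.add_right_cancel_iff] at hL
    rw [rootPoly_cons, mul_comm, map_mul, Module.End.mul_apply] at hf
    set g := Polynomial.aeval (shiftOp t) (Polynomial.X - Polynomial.C μ) f with hg
    have hgn : ∀ n, ‖PowerSeries.coeff n g‖ ≤ C * ((2 * l + t + K + 1) * B) * rise τ n := by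
      refine H L' hL (fun ν hν => hLK ν (Multiset.mem_cons_of_mem hν)) g hf _ (by positivity) ?_
      intro i hi
      refine (norm_coeff_shiftOp_le μ f i (hLK μ (Multiset.mem_cons_self _ _)).1 (hfB i (by omega))
        (hfB (i + 1) (by omega))).trans ?_
      have : (i : ℝ) ≤ l := by exact_mod_cast hi.le
      gcongr
    have hw := hLK μ (Multiset.mem_cons_self _ _)
    have hwn : ‖(t : ℂ) + μ‖ ≤ t + K := (norm_add_le _ _).trans (add_le_add (by simp) hw.1)
    rw [mul_assoc C' D B]
    refine H' (fun n => ‖PowerSeries.coeff n f‖) (fun n => ‖(n : ℂ) + (t + μ)‖) (D * B)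
      (by positivity) (fun n => norm_nonneg _) (fun n => ⟨norm_nonneg _, ?_⟩) (fun n hn => ?_) ?_
      (fun n => ?_) n
    · exact (norm_add_le _ _).trans (add_le_add (by simp) hwn)
    · refine hN n hn _ hwn ?_
      rw [hη]
      simp
      linarith [hw.2]
    · exact (hfB 0 (by omega)).trans (le_mul_of_one_le_left hB hD1)
    · have h1 := coeff_shiftOp_sub t μ f n
      rw [← hg, eq_sub_iff_add_eq] at h1
      have e1 : ‖(n : ℂ) + 1‖ = n + 1 := by
        rw [← Nat.cast_one, ← Nat.cast_add, Complex.norm_natCast]; push_cast; ring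
      rw [← e1, ← norm_mul, ← h1]
      refine (norm_add_le _ _).trans ?_
      rw [norm_mul, add_comm]
      refine add_le_add_right ((hgn n).trans ?_) _
      have := rise_pos (by linarith : 0 < τ) n
      rw [hD]
      nlinarith [mul_nonneg hB this.le]

theorem natDegree_polyF (hm : 2 ≤ m) : (polyF m t).natDegree = (m - 1) * (t + 1) := by
  rw [polyF, Polynomial.natDegree_C_mul (leadingF_ne_zero hm), Polynomial.natDegree_prod_of_monic]
  · simp only [Polynomial.natDegree_X_add_C, Finset.sum_const, smul_eq_mul, mul_one, Nat.card_Icc]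
    have := pred_mul_add (m := m) (t := t) (by omega)
    have h4 : 1 ≤ (m - 1) * (t + 1) := Nat.mul_pos (by omega) (by omega)
    omega
  · exact fun i _ => Polynomial.monic_X_add_C _

theorem card_rootsF (hm : 2 ≤ m) (z : ℂ) : (rootsF m t z).card = (m - 1) * (t + 1) := by
  rw [rootsF, ← Polynomial.Splits.natDegree_eq_card_roots (IsAlgClosed.splits _),
    Polynomial.natDegree_sub_C, natDegree_polyF hm]

theorem pow_le_norm_eval_rootPoly {gap : ℝ} (hgap : 0 ≤ gap) {ν : ℂ} (L : Multiset ℂ)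
    (hL : ∀ μ ∈ L, gap ≤ ν.re - μ.re) : gap ^ L.card ≤ ‖(rootPoly L).eval ν‖ := by
  induction L using Multiset.induction with
  | empty => simp [rootPoly]
  | cons μ L ih =>
    rw [rootPoly_cons, Polynomial.eval_mul, norm_mul, Multiset.card_cons, pow_succ']
    refine mul_le_mul ?_ (ih fun μ' h => hL μ' (Multiset.mem_cons_of_mem h)) (by positivity)
      (norm_nonneg _)
    have h1 := hL μ (Multiset.mem_cons_self _ _)
    simp only [Polynomial.eval_sub, Polynomial.eval_X, Polynomial.eval_C]
    refine h1.trans ?_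
    rw [← Complex.sub_re]
    exact Complex.re_le_norm _

theorem norm_rise_le {ν : ℂ} {K : ℝ} (hν : ‖ν‖ ≤ K) {i r : ℕ} (hi : i ≤ r) :
    ‖rise ν i‖ ≤ (K + r + 1) ^ r := by
  have hK : 0 ≤ K := (norm_nonneg _).trans hν
  rw [rise, norm_prod]
  calc ∏ k ∈ Finset.range i, ‖(ν + k) / (k + 1)‖ ≤ ∏ k ∈ Finset.range i, (K + r + 1) := by
        refine Finset.prod_le_prod (fun _ _ => norm_nonneg _) fun k hk => ?_
        have hk' : (k : ℝ) ≤ r := by exact_mod_cast (Finset.mem_range.1 hk).le.trans hi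
        have e1 : ‖(k : ℂ) + 1‖ = k + 1 := by
          rw [← Nat.cast_one, ← Nat.cast_add, Complex.norm_natCast]; push_cast; ring
        rw [norm_div, e1, div_le_iff₀ (by positivity)]
        have h1 : ‖ν + k‖ ≤ K + r := (norm_add_le _ _).trans (add_le_add hν (by simpa using hk'))
        have h2 : (0 : ℝ) ≤ k := Nat.cast_nonneg k
        have h3 : (0 : ℝ) ≤ r := Nat.cast_nonneg r
        nlinarith
    _ = (K + r + 1) ^ i := by simp
    _ ≤ _ := pow_le_pow_right₀ (by linarith [(Nat.cast_nonneg r : (0 : ℝ) ≤ r)]) hi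

/-- The expansion of a solution of the Euler equation along the dominant root, with an error that
is uniform in the data. -/
theorem exists_expansion_const (hm : 2 ≤ m) (t : ℕ) {K σ τ gap : ℝ} (hK : 0 ≤ K) (hτ : 1 ≤ τ)
    (h : t + σ < τ) (hgap : 0 < gap) : ∃ C, 0 ≤ C ∧ ∀ (z : ℂ) (ν : ℂ) (L : Multiset ℂ),
      rootsF m t z = ν ::ₘ L → ‖ν‖ ≤ K → (∀ μ ∈ L, ‖μ‖ ≤ K ∧ μ.re ≤ σ ∧ gap ≤ ν.re - μ.re) →
      ∀ (f : PowerSeries ℂ) (B : ℝ), 0 ≤ B →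
        Polynomial.aeval (shiftOp t) (polyF m t - Polynomial.C z) f = 0 →
        (∀ i < (m - 1) * (t + 1), ‖PowerSeries.coeff i f‖ ≤ B) →
        ∃ c : ℂ, ∀ n, ‖PowerSeries.coeff n f - c * rise (ν + t) n‖ ≤ C * B * rise τ n := by
  set r := (m - 1) * (t + 1) with hr
  have hr1 : 1 ≤ r := Nat.mul_pos (by omega) (by omega)
  obtain ⟨C₁, hC₁, H₁⟩ := norm_coeff_rootPoly_le t hK (r - 1) 0
  obtain ⟨C₂, hC₂, H₂⟩ := norm_coeff_le_of_rootPoly t hK hτ h (r - 1)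
  set D := 1 + C₁ / gap ^ (r - 1) * (K + t + r + 1) ^ r with hD
  have hD0 : 0 ≤ D := by positivity
  refine ⟨C₂ * D, by positivity, fun z ν L hroots hν hL f B hB hf hfB => ?_⟩
  have hcard : L.card = r - 1 := by
    have := card_rootsF (t := t) hm z
    rw [hroots, Multiset.card_cons] at this
    omega
  have hfac : polyF m t - Polynomial.C z =
      Polynomial.C (polyF m t - Polynomial.C z).leadingCoeff *
        ((Polynomial.X - Polynomial.C ν) * rootPoly L) := by
    rw [← rootPoly_cons, ← hroots]
    exact Polynomial.Splits.eq_prod_roots (IsAlgClosed.splits _)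
  have hlead : (polyF m t - Polynomial.C z).leadingCoeff ≠ 0 :=
    Polynomial.leadingCoeff_ne_zero.2 (polyF_sub_C_ne_zero hm z)
  rw [hfac, map_mul, Module.End.mul_apply, Polynomial.aeval_C, Module.algebraMap_end_apply,
    smul_eq_zero_iff_right hlead, map_mul, Module.End.mul_apply] at hf
  set b := Polynomial.aeval (shiftOp t) (rootPoly L) f with hb
  -- `(T - ν) b = 0` is a first-order recursion, so `b` is a multiple of the eigenvector
  -- `(1-x)^(-(ν+t))`.
  have hbn : b = PowerSeries.coeff 0 b • PowerSeries.mk (rise (ν + t)) := by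
    ext n
    rw [PowerSeries.coeff_smul, PowerSeries.coeff_mk, smul_eq_mul]
    induction n with
    | zero => simp
    | succ n ih =>
      have h1 := coeff_shiftOp_sub t ν b n
      rw [hf, map_zero] at h1
      have h2 := succ_mul_rise_succ (ν + t : ℂ) n
      have hn : (n : ℂ) + 1 ≠ 0 := by exact_mod_cast Nat.succ_ne_zero n
      apply mul_left_cancel₀ hn
      rw [mul_left_comm, h2]
      rw [ih] at h1
      linear_combination -h1
  have hb0 : ‖PowerSeries.coeff 0 b‖ ≤ C₁ * B :=
    H₁ L hcard (fun μ hμ => (hL μ hμ).1) f B (fun i hi => hfB i (by omega)) 0 le_rfl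
  have hev := pow_le_norm_eval_rootPoly hgap.le L fun μ hμ => (hL μ hμ).2.2
  rw [hcard] at hev
  have hevpos : 0 < ‖(rootPoly L).eval ν‖ := (by positivity : 0 < gap ^ (r - 1)).trans_le hev
  -- On that eigenvector `rootPoly L` acts as the scalar `(rootPoly L).eval ν`, bounded below
  -- because of `gap`. With this `c`, the remainder `e` is annihilated by the nondominant factors
  -- alone.
  set c := PowerSeries.coeff 0 b / (rootPoly L).eval ν with hc
  have hcn : ‖c‖ ≤ C₁ / gap ^ (r - 1) * B := by
    rw [hc, norm_div, div_mul_eq_mul_div]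
    exact div_le_div₀ (by positivity) hb0 (by positivity) hev
  set e := f - c • PowerSeries.mk (rise (ν + t)) with he
  have hee : Polynomial.aeval (shiftOp t) (rootPoly L) e = 0 := by
    rw [he, map_sub, map_smul, aeval_apply_of_eq_smul (shiftOp_mk_rise t ν), ← hb, smul_smul, hc,
      div_mul_cancel₀ _ (norm_pos_iff.1 hevpos), ← hbn, sub_self]
  refine ⟨c, fun n => ?_⟩
  have hfin := H₂ L hcard (fun μ hμ => ⟨(hL μ hμ).1, (hL μ hμ).2.1⟩) e hee (D * B) (by positivity)
    (fun i hi => ?_) n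
  · rw [he, map_sub, PowerSeries.coeff_smul, PowerSeries.coeff_mk, smul_eq_mul] at hfin
    rwa [mul_assoc C₂ D B]
  · rw [he, map_sub, PowerSeries.coeff_smul, PowerSeries.coeff_mk, smul_eq_mul]
    have h1 : ‖rise (ν + t : ℂ) i‖ ≤ (K + t + r + 1) ^ r :=
      norm_rise_le ((norm_add_le _ _).trans (add_le_add hν (by simp))) (by omega)
    calc _ ≤ ‖PowerSeries.coeff i f‖ + ‖c‖ * ‖rise (ν + t : ℂ) i‖ := by
          rw [← norm_mul]; exact norm_sub_le _ _
      _ ≤ B + C₁ / gap ^ (r - 1) * B * (K + t + r + 1) ^ r := by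
          refine add_le_add (hfB i (by omega)) (mul_le_mul hcn h1 (norm_nonneg _) (by positivity))
      _ = D * B := by rw [hD]; ring

/-! ### Growth of rising factorials -/

theorem norm_rise (θ : ℂ) (n : ℕ) :
    ‖rise θ n‖ = ∏ k ∈ Finset.range n, ‖θ + k‖ / ((k : ℝ) + 1) := by
  rw [rise, norm_prod]
  refine Finset.prod_congr rfl fun k _ => ?_
  rw [norm_div]
  congr 1
  rw [← Nat.cast_one, ← Nat.cast_add, Complex.norm_natCast]
  push_cast
  ring

theorem rise_ofReal (a : ℝ) (n : ℕ) : rise (a : ℂ) n = ((rise a n : ℝ) : ℂ) := by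
  simp [rise]

theorem rise_mono_left {a b : ℝ} (ha : 0 ≤ a) (hab : a ≤ b) (n : ℕ) : rise a n ≤ rise b n := by
  refine Finset.prod_le_prod (fun k _ => by positivity) fun k _ => ?_
  gcongr

theorem monotone_rise {a : ℝ} (ha : 1 ≤ a) : Monotone (rise a) := by
  refine monotone_nat_of_le_succ fun n => ?_
  rw [rise_succ]
  refine le_mul_of_one_le_right (rise_pos (by linarith) n).le ?_
  rw [one_le_div (by positivity)]
  linarith

theorem rise_re_le_norm_rise {θ : ℂ} (hθ : 0 ≤ θ.re) (n : ℕ) : rise θ.re n ≤ ‖rise θ n‖ := by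
  rw [norm_rise]
  refine Finset.prod_le_prod (fun k _ => by positivity) fun k _ => ?_
  gcongr
  have := Complex.re_le_norm (θ + k)
  simpa using this

theorem rise_ne_zero {θ : ℂ} (hθ : 0 < θ.re) (n : ℕ) : rise θ n ≠ 0 :=
  norm_pos_iff.1 ((rise_pos hθ n).trans_le (rise_re_le_norm_rise hθ.le n))

theorem exists_prod_one_add_le {c : ℝ} (hc : 0 ≤ c) :
    ∃ C, 1 ≤ C ∧ ∀ n : ℕ, ∏ k ∈ Finset.range n, (1 + c / ((k : ℝ) + 1) ^ 2) ≤ C := by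
  have hs : Summable fun k : ℕ => c / ((k : ℝ) + 1) ^ 2 := by
    have h := (summable_nat_add_iff 1).2 (Real.summable_one_div_nat_pow.2 (le_refl 2))
    refine (h.mul_left c).congr fun k => ?_
    push_cast
    ring
  refine ⟨Real.exp (∑' k : ℕ, c / ((k : ℝ) + 1) ^ 2),
    Real.one_le_exp (tsum_nonneg fun k => by positivity), fun n => ?_⟩
  calc _ ≤ ∏ k ∈ Finset.range n, Real.exp (c / ((k : ℝ) + 1) ^ 2) :=
        Finset.prod_le_prod (fun k _ => by positivity) fun k _ => by
          rw [add_comm]; exact Real.add_one_le_exp _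
    _ = Real.exp (∑ k ∈ Finset.range n, c / ((k : ℝ) + 1) ^ 2) := (Real.exp_sum _ _).symm
    _ ≤ _ := Real.exp_le_exp.2 (hs.sum_le_tsum _ fun k _ => by positivity)

/-- The imaginary part changes the factor `‖θ + k‖` by a relative error `O(1/k²)`, and the product
of these corrections is bounded. -/
theorem exists_norm_rise_le (K : ℝ) : ∃ C, 1 ≤ C ∧ ∀ θ : ℂ, 1 ≤ θ.re → |θ.im| ≤ K →
    ∀ n, ‖rise θ n‖ ≤ C * rise θ.re n := by
  obtain ⟨C, hC, H⟩ := exists_prod_one_add_le (sq_nonneg K)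
  refine ⟨C, hC, fun θ hθ hK n => ?_⟩
  rw [norm_rise]
  calc _ ≤ ∏ k ∈ Finset.range n, ((1 + K ^ 2 / ((k : ℝ) + 1) ^ 2) * ((θ.re + k) / (k + 1))) := by
        refine Finset.prod_le_prod (fun k _ => by positivity) fun k _ => ?_
        rw [← mul_div_assoc]
        gcongr
        have h0 : (0 : ℝ) ≤ k := k.cast_nonneg
        have h1 : 0 < θ.re + k := by linarith
        have h2 : θ.im ^ 2 ≤ K ^ 2 := by rw [← sq_abs]; gcongr
        have h3 : K ^ 2 / (θ.re + k) ^ 2 ≤ K ^ 2 / ((k : ℝ) + 1) ^ 2 := by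
          gcongr K ^ 2 / ?_ ^ 2
          linarith
        refine le_trans ?_ (mul_le_mul_of_nonneg_right (by linarith : 1 + K ^ 2 / (θ.re + k) ^ 2 ≤ _)
          h1.le)
        refine abs_le_of_sq_le_sq' ?_ (by positivity) |>.2
        rw [Complex.sq_norm, Complex.normSq_apply]
        simp only [Complex.add_re, Complex.natCast_re, Complex.add_im, Complex.natCast_im, add_zero]
        have h4 : ((1 + K ^ 2 / (θ.re + k) ^ 2) * (θ.re + k)) ^ 2 =
          (θ.re + k) ^ 2 + 2 * K ^ 2 + K ^ 4 / (θ.re + k) ^ 2 := by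
            field_simp
            ring
        rw [h4]
        have : 0 ≤ K ^ 4 / (θ.re + k) ^ 2 := by positivity
        nlinarith
    _ = (∏ k ∈ Finset.range n, (1 + K ^ 2 / ((k : ℝ) + 1) ^ 2)) * rise θ.re n := by
        rw [Finset.prod_mul_distrib, rise]
    _ ≤ C * rise θ.re n := by
        gcongr
        · exact (rise_pos (by linarith) n).le
        · exact H n

theorem one_add_rpow_le {x s : ℝ} (hx : 0 ≤ x) (hs : 1 ≤ s) (hs' : s ≤ 2) :
    (1 + x) ^ s ≤ (1 + s * x) * (1 + x ^ 2) := by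
  have h1 : (1 + x) ^ s = (1 + x) * (1 + x) ^ (s - 1) := by
    rw [← Real.rpow_one_add' (by linarith) (by linarith)]
    congr 1
    ring
  have h2 := rpow_one_add_le_one_add_mul_self (s := x) (by linarith) (p := s - 1)
    (by linarith) (by linarith)
  rw [h1]
  calc _ ≤ (1 + x) * (1 + (s - 1) * x) := by gcongr
    _ ≤ _ := by
      nlinarith [mul_nonneg (mul_nonneg hx hx) hx,
        mul_nonneg (by linarith : 0 ≤ 2 - s) (mul_nonneg hx hx),
        mul_nonneg (by linarith : (0:ℝ) ≤ s) (mul_nonneg (mul_nonneg hx hx) hx)]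

/-- Bernoulli's inequality in each factor. Together with `exists_rise_rpow_le` it shows that both
sides have the same order of growth. -/
theorem rise_le_rise_rpow {a s : ℝ} (ha : 1 ≤ a) (hs : 1 ≤ s) (n : ℕ) :
    rise (s * (a - 1) + 1) n ≤ rise a n ^ s := by
  rw [rise, rise, ← Real.finsetProd_rpow _ _ fun k _ => by positivity]
  refine Finset.prod_le_prod (fun k _ => ?_) fun k _ => ?_
  · have : 0 ≤ s * (a - 1) := mul_nonneg (by linarith) (by linarith)
    positivity
  · have h1 : (a + k) / ((k : ℝ) + 1) = 1 + (a - 1) / (k + 1) := by field_simp; ring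
    have h2 : (s * (a - 1) + 1 + k) / ((k : ℝ) + 1) = 1 + s * ((a - 1) / (k + 1)) := by
      field_simp; ring
    rw [h1, h2]
    have h3 : 0 ≤ (a - 1) / ((k : ℝ) + 1) := div_nonneg (by linarith) (by positivity)
    exact one_add_mul_self_le_rpow_one_add (by linarith) hs

/-- With `x = (a-1)/(k+1)`, the factors `(1+x)^s` and `1 + s x` differ by at most a relative error
`x²`, which is summable over `k`. -/
theorem exists_rise_rpow_le (U : ℝ) : ∃ C, 1 ≤ C ∧ ∀ a s : ℝ, 1 ≤ a → a - 1 ≤ U → 1 ≤ s → s ≤ 2 →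
    ∀ n, rise a n ^ s ≤ C * rise (s * (a - 1) + 1) n := by
  obtain ⟨C, hC, H⟩ := exists_prod_one_add_le (sq_nonneg U)
  refine ⟨C, hC, fun a s ha haU hs hs' n => ?_⟩
  have hpos : 0 ≤ s * (a - 1) := mul_nonneg (by linarith) (by linarith)
  rw [rise, ← Real.finsetProd_rpow _ _ fun k _ => by positivity]
  calc _ ≤ ∏ k ∈ Finset.range n,
        ((1 + U ^ 2 / ((k : ℝ) + 1) ^ 2) * ((s * (a - 1) + 1 + k) / (k + 1))) := by
        refine Finset.prod_le_prod (fun k _ => by positivity) fun k _ => ?_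
        have h1 : (a + k) / ((k : ℝ) + 1) = 1 + (a - 1) / (k + 1) := by field_simp; ring
        have h2 : (s * (a - 1) + 1 + k) / ((k : ℝ) + 1) = 1 + s * ((a - 1) / (k + 1)) := by
          field_simp; ring
        have h3 : 0 ≤ (a - 1) / ((k : ℝ) + 1) := div_nonneg (by linarith) (by positivity)
        rw [h1, h2, mul_comm]
        refine (one_add_rpow_le h3 hs hs').trans ?_
        gcongr
        rw [div_pow]
        have : (a - 1) ^ 2 ≤ U ^ 2 := pow_le_pow_left₀ (by linarith) haU 2
        gcongr
    _ = (∏ k ∈ Finset.range n, (1 + U ^ 2 / ((k : ℝ) + 1) ^ 2)) * rise (s * (a - 1) + 1) n := by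
        rw [Finset.prod_mul_distrib, rise]
    _ ≤ C * rise (s * (a - 1) + 1) n := by
        gcongr
        · exact (rise_pos (by linarith) n).le
        · exact H n

/-- Through Euler's limit for the Gamma function this gives the growth of `rise θ n` as `n^(θ-1) /
Γ(θ)`. -/
theorem rise_eq_div_GammaSeq {θ : ℂ} (hθ : 0 < θ.re) {n : ℕ} (hn : n ≠ 0) :
    rise θ n = (n : ℂ) ^ θ / ((θ + n) * Complex.GammaSeq θ n) := by
  have h0 : ∀ k : ℕ, θ + k ≠ 0 := fun k h => by
    have := congrArg Complex.re h
    simp only [Complex.add_re, Complex.natCast_re, Complex.zero_re] at this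
    have h1 : (0 : ℝ) ≤ k := k.cast_nonneg
    linarith
  have hn' : (n : ℂ) ≠ 0 := by exact_mod_cast hn
  have hp : ∏ k ∈ Finset.range n, (θ + k) ≠ 0 := Finset.prod_ne_zero_iff.2 fun k _ => h0 k
  have hf : ∏ k ∈ Finset.range n, ((k : ℂ) + 1) = n ! := by
    rw [← Finset.prod_range_add_one_eq_factorial]; push_cast; rfl
  have hf0 : (n ! : ℂ) ≠ 0 := by exact_mod_cast n.factorial_ne_zero
  have hc : (n : ℂ) ^ θ ≠ 0 := by simp [Complex.cpow_eq_zero_iff, hn]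
  rw [Complex.GammaSeq, rise, Finset.prod_div_distrib, hf, Finset.prod_range_succ]
  have := h0 n
  field_simp

theorem tendsto_atTop_of_tendsto_div {X : Type*} {l : Filter X} {i n : X → ℕ} {s : ℝ} (hs : 0 < s)
    (hn : Tendsto n l atTop) (h : Tendsto (fun k => (i k : ℝ) / n k) l (𝓝 s)) :
    Tendsto i l atTop := by
  have h1 : Tendsto (fun k => (i k : ℝ) / n k * n k) l atTop :=
    h.pos_mul_atTop hs (tendsto_natCast_atTop_atTop.comp hn)
  rw [← tendsto_natCast_atTop_iff (R := ℝ)]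
  refine h1.congr' ?_
  filter_upwards [hn.eventually_ne_atTop 0] with k hk
  have hk' : (n k : ℝ) ≠ 0 := by exact_mod_cast hk
  field_simp

theorem tendsto_add_div_add (a b : ℂ) {X : Type*} {l : Filter X} {i n : X → ℕ} {s : ℝ} (hs : 0 < s)
    (hn : Tendsto n l atTop) (h : Tendsto (fun k => (i k : ℝ) / n k) l (𝓝 s)) :
    Tendsto (fun k => (a + n k) / (b + i k)) l (𝓝 (1 / (s : ℂ))) := by
  have h1 : Tendsto (fun k => ((n k : ℂ))⁻¹) l (𝓝 0) :=
    (tendsto_inv_atTop_nhds_zero_nat (𝕜 := ℂ)).comp hn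
  have h2 : Tendsto (fun k => (i k : ℂ) / n k) l (𝓝 s) := by
    have := (Complex.continuous_ofReal.tendsto s).comp h
    refine this.congr fun k => ?_
    simp
  have h3 : Tendsto (fun k => (a * ((n k : ℂ))⁻¹ + 1) / (b * ((n k : ℂ))⁻¹ + (i k : ℂ) / n k)) l
      (𝓝 ((a * 0 + 1) / (b * 0 + s))) :=
    ((h1.const_mul a).add_const 1).div ((h1.const_mul b).add h2) (by
      simpa using hs.ne')
  simp only [mul_zero, zero_add] at h3
  refine h3.congr' ?_
  filter_upwards [hn.eventually_ne_atTop 0] with k hk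
  have hk' : (n k : ℂ) ≠ 0 := by exact_mod_cast hk
  rw [← mul_div_mul_right (a + n k) _ (inv_ne_zero hk')]
  congr 1
  · field_simp
  · field_simp

theorem tendsto_rise_div_rise {θ : ℂ} (hθ : 0 < θ.re) {X : Type*} {l : Filter X} {i n : X → ℕ} {s : ℝ} (hs : 0 < s)
    (hn : Tendsto n l atTop) (h : Tendsto (fun k => (i k : ℝ) / n k) l (𝓝 s)) :
    Tendsto (fun k => rise θ (i k) / rise θ (n k)) l (𝓝 ((s : ℂ) ^ (θ - 1))) := by
  have hi := tendsto_atTop_of_tendsto_div hs hn h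
  have hΓ : Complex.Gamma θ ≠ 0 := Complex.Gamma_ne_zero_of_re_pos hθ
  have hG : Tendsto (fun k => Complex.GammaSeq θ (n k) / Complex.GammaSeq θ (i k)) l (𝓝 1) := by
    have := ((Complex.GammaSeq_tendsto_Gamma θ).comp hn).div
      ((Complex.GammaSeq_tendsto_Gamma θ).comp hi) hΓ
    rwa [div_self hΓ] at this
  have hpow : Tendsto (fun k => (((i k : ℝ) / n k : ℝ) : ℂ) ^ θ) l (𝓝 ((s : ℂ) ^ θ)) := by
    have := (Complex.continuous_ofReal.tendsto s).comp h
    exact (continuousAt_cpow_const (Or.inl (by simpa using hs))).tendsto.comp this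
  have hlim := (hpow.mul (tendsto_add_div_add θ θ hs hn h)).mul hG
  have hs' : (s : ℂ) ≠ 0 := by exact_mod_cast hs.ne'
  have e : (s : ℂ) ^ θ * (1 / s) * 1 = (s : ℂ) ^ (θ - 1) := by
    rw [Complex.cpow_sub _ _ hs', Complex.cpow_one]; ring
  rw [e] at hlim
  refine hlim.congr' ?_
  filter_upwards [hn.eventually_ne_atTop 0, hi.eventually_ne_atTop 0] with k hk hik
  rw [rise_eq_div_GammaSeq hθ hk, rise_eq_div_GammaSeq hθ hik]
  have e2 : (((i k : ℝ) / n k : ℝ) : ℂ) ^ θ = (i k : ℂ) ^ θ / (n k : ℂ) ^ θ := by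
    have := Complex.div_cpow_ofReal_nonneg (a := i k) (b := n k) (by positivity)
      (by positivity) θ
    push_cast at this ⊢
    exact this
  have hc : (n k : ℂ) ^ θ ≠ 0 := by simp [Complex.cpow_eq_zero_iff, hk]
  rw [e2]
  simp only [div_eq_mul_inv, mul_inv, inv_inv]
  ring

theorem tendsto_rise_div_rise_zero {a b : ℝ} (ha : 0 < a) (hab : a < b) :
    Tendsto (fun n => rise a n / rise b n) atTop (𝓝 0) := by
  have hb := ha.trans hab
  have h1 : Tendsto (fun n : ℕ => ‖Complex.GammaSeq b n / Complex.GammaSeq a n‖) atTop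
      (𝓝 ‖Complex.Gamma b / Complex.Gamma a‖) :=
    ((Complex.GammaSeq_tendsto_Gamma b).div (Complex.GammaSeq_tendsto_Gamma a)
      (Complex.Gamma_ne_zero_of_re_pos (by simpa using ha))).norm
  have h2 : Tendsto (fun n : ℕ => ‖((b : ℂ) + n) / (a + n)‖) atTop (𝓝 ‖(1 / ((1 : ℝ) : ℂ) : ℂ)‖) := by
    refine (tendsto_add_div_add (b : ℂ) a one_pos tendsto_id ?_).norm
    refine tendsto_const_nhds.congr' ?_
    filter_upwards [eventually_ne_atTop 0] with n hn
    have : (n : ℝ) ≠ 0 := by exact_mod_cast hn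
    simp [div_self this]
  have h3 : Tendsto (fun n : ℕ => (n : ℝ) ^ (-(b - a))) atTop (𝓝 0) :=
    (tendsto_rpow_neg_atTop (sub_pos.2 hab)).comp tendsto_natCast_atTop_atTop
  have h4 := (h3.mul h2).mul h1
  rw [zero_mul, zero_mul] at h4
  refine h4.congr' ?_
  filter_upwards [eventually_ne_atTop 0] with n hn
  have e1 : ((rise a n / rise b n : ℝ)) = ‖rise (a : ℂ) n / rise (b : ℂ) n‖ := by
    rw [rise_ofReal, rise_ofReal, ← Complex.ofReal_div, Complex.norm_real, Real.norm_of_nonneg]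
    exact (div_pos (rise_pos ha n) (rise_pos hb n)).le
  have hn' : (0 : ℝ) < n := by positivity
  rw [e1, rise_eq_div_GammaSeq (by simpa using ha) hn, rise_eq_div_GammaSeq (by simpa using hb) hn]
  have e2 : ∀ c : ℝ, ‖(n : ℂ) ^ (c : ℂ)‖ = (n : ℝ) ^ c := fun c => by
    rw [Complex.norm_natCast_cpow_of_pos (Nat.pos_of_ne_zero hn)]; simp
  simp only [norm_div, norm_mul, e2]
  rw [neg_sub, Real.rpow_sub hn']
  simp only [div_eq_mul_inv, mul_inv, inv_inv]
  ring

/-! ### The asymptotics of the expected profile polynomial -/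

theorem exists_norm_root_le (hm : 2 ≤ m) (R : ℝ) :
    ∃ K, 0 ≤ K ∧ ∀ z : ℂ, ‖z‖ ≤ R → ∀ θ ∈ rootsF m t z, ‖θ‖ ≤ K := by
  have hdeg : 0 < (polyF m t).degree := by
    rw [← Polynomial.natDegree_pos_iff_degree_pos, natDegree_polyF hm]
    exact Nat.mul_pos (by omega) (by omega)
  have h := Polynomial.tendsto_norm_atTop (polyF m t) hdeg (l := Filter.cocompact ℂ)
    (z := fun x => x) tendsto_norm_cocompact_atTop
  have h2 := h.eventually_gt_atTop R
  rw [Filter.Eventually, Filter.mem_cocompact] at h2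
  obtain ⟨S, hS, hSR⟩ := h2
  obtain ⟨K, hK⟩ := hS.isBounded.exists_norm_le
  refine ⟨max K 0, le_max_right _ _, fun z hz θ hθ => le_max_of_le_left (hK θ ?_)⟩
  by_contra hc
  have h3 : R < ‖(polyF m t).eval θ‖ := hSR hc
  rw [(mem_rootsF hm).1 hθ] at h3
  linarith

/-- The centred mean `𝔼 Wₙ(z) - (m-1)/(1-mz)`, a solution of the homogeneous recursion. -/
noncomputable def centredMean (σ : SupplementaryRule m t) (z : ℂ) (n : ℕ) : ℂ :=
  (meanPoly σ n).eval z - ((m - 1 : ℕ) : ℂ) / (1 - m * z)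

theorem re_meanPoly_nonneg (hm : 2 ≤ m) (σ : SupplementaryRule m t) {x : ℝ} (hx : 0 ≤ x) (n : ℕ) :
    0 ≤ ((meanPoly σ n).eval (x : ℂ)).re ∧ (1 ≤ n → 1 ≤ ((meanPoly σ n).eval (x : ℂ)).re) := by
  induction n using Nat.strong_induction_on with
  | _ n ih =>
    by_cases hn : n < m
    · rw [meanPoly_of_lt σ hn]
      simp
    · rw [eval_meanPoly_eq hm σ (not_lt.1 hn)]
      have h1 : 0 ≤ (ev (splitLaw σ n) fun I => ∑ j, (meanPoly σ (I j)).eval (x : ℂ)).re := by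
        have hfin := finite_support_splitLaw (σ := σ) hm (not_lt.1 hn)
        have := ev_linear hfin Complex.reLm fun I => ∑ j, (meanPoly σ (I j)).eval (x : ℂ)
        rw [Complex.reLm_coe] at this
        rw [← this]
        refine ev_nonneg hfin fun I hI => ?_
        rw [Complex.re_sum]
        exact Finset.sum_nonneg fun j _ =>
          (ih _ (lt_of_mem_support_splitLaw hm (not_lt.1 hn) hI j)).1
      have h2 : (1 : ℝ) ≤ ((m - 1 : ℕ) : ℝ) := by exact_mod_cast (by omega : 1 ≤ m - 1)
      have h3 := mul_nonneg hx h1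
      rw [Complex.add_re, Complex.re_ofReal_mul, Complex.natCast_re]
      exact ⟨by linarith, fun _ => by linarith⟩

/-- For real `x = F(θ₀) > 1/m` the subtracted constant is `-d < 0`, so the centred mean is at least
`d` for small `n`. It solves the same recursion with nonnegative coefficients as `rise θ₀`, so the
comparison propagates to all `n`. This prevents the leading coefficient from vanishing. -/
theorem exists_le_re_centredMean (hm : 2 ≤ m) (σ : SupplementaryRule m t) {θ₀ : ℝ} (hθ : 1 < θ₀) :
    ∃ c, 0 < c ∧ ∀ n, c * rise θ₀ n ≤ (centredMean σ (realF m t θ₀ : ℂ) n).re := by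
  set x := realF m t θ₀ with hx
  have ht : -(t : ℝ) < 1 := by have : (0 : ℝ) ≤ t := t.cast_nonneg; linarith
  have hm0 : (0 : ℝ) < m := by exact_mod_cast (by omega : 0 < m)
  have hx1 : 1 / (m : ℝ) < x := by
    rw [← realF_one (t := t) hm, hx]
    exact realF_lt hm ht hθ
  have hx0 : 0 < x := lt_trans (by positivity) hx1
  have hmx : 1 < m * x := by rwa [div_lt_iff₀ hm0, mul_comm] at hx1
  have hm1 : (1 : ℝ) ≤ ((m - 1 : ℕ) : ℝ) := by exact_mod_cast (by omega : 1 ≤ m - 1)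
  set d : ℝ := ((m - 1 : ℕ) : ℝ) / (m * x - 1) with hd
  have hdpos : 0 < d := div_pos (by linarith) (by linarith)
  have hcm : ∀ n, centredMean σ (x : ℂ) n = (meanPoly σ n).eval (x : ℂ) + (d : ℂ) := by
    intro n
    have : ((m - 1 : ℕ) : ℂ) / (1 - m * x) = -(d : ℂ) := by
      rw [hd]; push_cast
      rw [← neg_sub, div_neg]
    rw [centredMean, this, sub_neg_eq_add]
  set M := m * t + m - 1 with hM
  have hMpos : 1 ≤ M := by
    have : 0 ≤ m * t := Nat.zero_le _
    omega
  refine ⟨d / rise θ₀ M, div_pos hdpos (rise_pos (by linarith) _), fun n => ?_⟩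
  induction n using Nat.strong_induction_on with
  | _ n ih =>
    by_cases hn : M ≤ n
    · have h1 : centredMean σ (x : ℂ) n = x * splitMean m t (centredMean σ (x : ℂ)) n :=
        meanPoly_recursion hm σ (by
          intro h
          have := congrArg Complex.re h
          simp at this
          linarith) hn
      have h2 := splitMean_rise (t := t) hm (θ := (θ₀ : ℂ)) hn
      rw [polyF_eval_ofReal, ← hx] at h2
      have h3 : rise θ₀ n = x * (splitMean m t (rise (θ₀ : ℂ)) n).re := by
        have := congrArg Complex.re h2
        rw [rise_ofReal, Complex.re_ofReal_mul, Complex.ofReal_re] at this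
        exact this.symm
      rw [h1, h3, Complex.re_ofReal_mul, mul_left_comm]
      refine mul_le_mul_of_nonneg_left ?_ hx0.le
      have hre : ∀ A : ℕ → ℂ, (splitMean m t A n).re =
          (∑ i ∈ Finset.piAntidiag (Finset.univ : Finset (Fin m)) (n - (m - 1)),
            ((∏ j, (i j).choose t : ℕ) : ℝ) * ∑ j, (A (i j)).re) /
              (n.choose (m * t + m - 1) : ℕ) := by
        intro A
        rw [splitMean, Complex.div_natCast_re, Complex.re_sum]
        congr 1
        refine Finset.sum_congr rfl fun i _ => ?_
        rw [← Complex.ofReal_natCast, Complex.re_ofReal_mul, Complex.re_sum]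
      rw [hre, hre, mul_div_assoc', Finset.mul_sum]
      refine div_le_div_of_nonneg_right (Finset.sum_le_sum fun i hi => ?_) (Nat.cast_nonneg _)
      rw [mul_left_comm, Finset.mul_sum]
      refine mul_le_mul_of_nonneg_left (Finset.sum_le_sum fun j hj => ?_) (Nat.cast_nonneg _)
      rw [rise_ofReal, Complex.ofReal_re]
      refine ih _ ?_
      have := (Finset.mem_piAntidiag.1 hi).1
      have h4 : i j ≤ Finset.univ.sum i :=
        Finset.single_le_sum (f := i) (fun _ _ => Nat.zero_le _) (Finset.mem_univ j)
      rw [this] at h4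
      omega
    · rw [hcm, Complex.add_re, Complex.ofReal_re]
      have h1 := (re_meanPoly_nonneg hm σ hx0.le n).1
      have h2 : d / rise θ₀ M * rise θ₀ n ≤ d := by
        rw [div_mul_eq_mul_div, div_le_iff₀ (rise_pos (by linarith) _)]
        exact mul_le_mul_of_nonneg_left (monotone_rise hθ.le (not_le.1 hn).le) hdpos.le
      linarith

theorem exists_tendstoUniformlyOn_mean (hm : 2 ≤ m) (σ : SupplementaryRule m t) {θ₀ : ℝ}
    (hθ : 1 < θ₀) : ∃ r > 0, ∃ E : ℂ → ℂ, E (realF m t θ₀ : ℂ) ≠ 0 ∧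
      TendstoUniformlyOn (fun n z => (meanPoly σ n).eval z / rise (dominantRoot m t z) n) E atTop
        (Metric.ball (realF m t θ₀ : ℂ) r) := by
  have ht0 : (0 : ℝ) ≤ t := t.cast_nonneg
  obtain ⟨δ, hδ, H⟩ := dominantRoot_local (t := t) hm (θ₀ := θ₀) (by linarith)
  -- The constants separate the orders of growth: after the shift by `t`, all nondominant roots have
  -- real part below `τ`, whereas `τ < b + t < re λ₁(z) + t`.
  set ε := min (δ / 4) ((θ₀ - 1) / 4) with hε
  have hε0 : 0 < ε := lt_min (by linarith) (by linarith)
  have hε1 : ε ≤ δ / 4 := min_le_left _ _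
  have hε2 : ε ≤ (θ₀ - 1) / 4 := min_le_right _ _
  obtain ⟨r₁, hr₁, H⟩ := H ε hε0 (by linarith)
  set x := realF m t θ₀ with hx
  have hm0 : (0 : ℝ) < m := by exact_mod_cast (by omega : 0 < m)
  have hx1 : 1 / (m : ℝ) < x := by
    rw [← realF_one (t := t) hm, hx]
    exact realF_lt hm (by linarith) hθ
  have hmx : 1 < m * x := by rwa [div_lt_iff₀ hm0, mul_comm] at hx1
  set d := (m * x - 1) / 2 with hd
  have hd0 : 0 < d := by linarith
  set r := min r₁ (d / m) with hr
  have hr0 : 0 < r := lt_min hr₁ (by positivity)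
  have hden : ∀ z ∈ Metric.closedBall (x : ℂ) r, d ≤ ‖1 - m * z‖ := by
    intro z hz
    have h1 : ‖z - x‖ ≤ d / m := (mem_closedBall_iff_norm.1 hz).trans (min_le_right _ _)
    have h2 : ‖(m : ℂ) * (x - z)‖ ≤ d := by
      rw [norm_mul, Complex.norm_natCast, norm_sub_rev]
      calc (m : ℝ) * ‖z - x‖ ≤ m * (d / m) := by gcongr
        _ = d := by field_simp
    have h3 : (1 : ℂ) - m * z = (m : ℂ) * (x - z) - ((2 * d : ℝ) : ℂ) := by
      rw [hd]; push_cast; ring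
    have h4 := norm_sub_norm_le (((2 * d : ℝ) : ℂ)) ((m : ℂ) * (x - z))
    rw [Complex.norm_real, Real.norm_of_nonneg (by linarith), norm_sub_rev, ← h3] at h4
    linarith
  have hden' : ∀ z ∈ Metric.closedBall (x : ℂ) r, 1 - (m : ℂ) * z ≠ 0 := fun z hz =>
    norm_pos_iff.1 (hd0.trans_le (hden z hz))
  set b := θ₀ - ε with hb
  have hb1 : 1 < b := by linarith
  set τ := max 1 (t + θ₀ - δ / 2) with hτ
  have hτb : τ < b + t := max_lt (by linarith) (by linarith)
  obtain ⟨K, hK, hroots⟩ := exists_norm_root_le (t := t) hm (‖(x : ℂ)‖ + r)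
  obtain ⟨C, hC, HC⟩ := exists_expansion_const hm t (σ := θ₀ - δ) (τ := τ) (gap := δ / 2) hK
    (le_max_left _ _) (lt_of_lt_of_le (by linarith) (le_max_right _ _)) (by linarith)
  obtain ⟨B, hB⟩ : ∃ B, ∀ z ∈ Metric.closedBall (x : ℂ) r,
      ‖∑ i ∈ Finset.range ((m - 1) * (t + 1)),
        ‖((i + t).choose t : ℂ) * centredMean σ z (i + t)‖‖ ≤ B := by
    refine (isCompact_closedBall _ _).exists_bound_of_continuousOn ?_
    refine continuousOn_finsetSum _ fun i _ => ContinuousOn.norm (continuousOn_const.mul ?_)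
    refine ((meanPoly σ (i + t)).continuous.continuousOn).sub ?_
    exact continuousOn_const.div (by fun_prop) hden'
  have hB0 : 0 ≤ B := (norm_nonneg _).trans (hB x (Metric.mem_closedBall_self hr0.le))
  have key : ∀ z ∈ Metric.ball (x : ℂ) r, ∃ e : ℂ, ∀ n,
      ‖centredMean σ z (n + t) / rise (dominantRoot m t z) (n + t) - e‖ ≤
        C * B * (rise τ n / rise (b + t) n) := by
    intro z hz
    have hzc := Metric.ball_subset_closedBall hz
    obtain ⟨-, h2, h3, -, h5⟩ := H z (Metric.ball_subset_ball (min_le_left _ _) hz)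
    set lam := dominantRoot m t z with hlam
    have hre : b < lam.re := by
      have := (Complex.abs_re_le_norm _).trans_lt h2
      rw [Complex.sub_re, Complex.ofReal_re, abs_lt] at this
      linarith
    have hzn : ‖z‖ ≤ ‖(x : ℂ)‖ + r := by
      have := norm_le_norm_add_norm_sub (x : ℂ) z
      rw [norm_sub_rev] at this
      exact this.trans (add_le_add_right (mem_closedBall_iff_norm.1 hzc) _)
    obtain ⟨c, hc⟩ := HC z lam _ (Multiset.cons_erase h3).symm (hroots z hzn _ h3)
      (fun μ hμ => ⟨hroots z hzn _ (Multiset.mem_of_mem_erase hμ), (h5 μ hμ).le, by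
        have := h5 μ hμ
        linarith⟩) (baseSeries t (centredMean σ z)) B hB0
      (aeval_shiftOp_baseSeries hm fun n hn => meanPoly_recursion hm σ (hden' z hzc) hn)
      (fun i hi => by
        rw [baseSeries, PowerSeries.coeff_mk]
        have h6 := hB z hzc
        rw [Real.norm_of_nonneg (Finset.sum_nonneg fun _ _ => norm_nonneg _)] at h6
        exact (Finset.single_le_sum (f := fun i => ‖((i + t).choose t : ℂ) *
          centredMean σ z (i + t)‖) (fun _ _ => norm_nonneg _) (Finset.mem_range.2 hi)).trans h6)
    have hlt : rise lam t ≠ 0 := rise_ne_zero (by linarith) t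
    refine ⟨c / rise lam t, fun n => ?_⟩
    have h7 := hc n
    rw [baseSeries, PowerSeries.coeff_mk] at h7
    have h8 := choose_mul_rise_add lam n t
    have hl1 : rise lam (n + t) ≠ 0 := rise_ne_zero (by linarith) _
    have hl2 : rise (lam + t) n ≠ 0 := rise_ne_zero (by
      rw [Complex.add_re, Complex.natCast_re]; linarith) _
    have h9 : centredMean σ z (n + t) / rise lam (n + t) - c / rise lam t =
        (((n + t).choose t : ℂ) * centredMean σ z (n + t) - c * rise (lam + t) n) /
          (rise lam t * rise (lam + t) n) := by
      rw [← h8]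
      have hch : ((n + t).choose t : ℂ) ≠ 0 := by
        exact_mod_cast (Nat.choose_pos (Nat.le_add_left t n)).ne'
      have h10 : rise (lam + t) n = ((n + t).choose t : ℂ) * rise lam (n + t) / rise lam t := by
        rw [h8]; field_simp
      rw [h10]
      field_simp
    have h11 : rise (b + t) n ≤ ‖rise lam t * rise (lam + t) n‖ := by
      rw [norm_mul]
      have e1 : 1 ≤ ‖rise lam t‖ := (one_le_rise (by linarith) t).trans
        (rise_re_le_norm_rise (by linarith) t)
      have e2 : rise (b + t) n ≤ ‖rise (lam + t) n‖ := by
        refine le_trans ?_ (rise_re_le_norm_rise (by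
          rw [Complex.add_re, Complex.natCast_re]; linarith) n)
        rw [Complex.add_re, Complex.natCast_re]
        exact rise_mono_left (by linarith) (by linarith) n
      have e3 := rise_pos (a := b + t) (by linarith) n
      nlinarith
    rw [h9, norm_div, mul_div_assoc']
    exact div_le_div₀ (mul_nonneg (mul_nonneg hC hB0) (rise_pos (lt_of_lt_of_le one_pos
      (le_max_left _ _)) n).le) h7 (rise_pos (by linarith) n) h11
  choose! E hE using key
  have hlim0 : Tendsto (fun n => C * B * (rise τ n / rise (b + t) n)) atTop (𝓝 0) := by
    have := (tendsto_rise_div_rise_zero (lt_of_lt_of_le one_pos (le_max_left _ _) : 0 < τ)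
      hτb).const_mul (C * B)
    rwa [mul_zero] at this
  refine ⟨r, hr0, E, ?_, ?_⟩
  · obtain ⟨c, hc, hcA⟩ := exists_le_re_centredMean hm σ hθ
    have hxb : (x : ℂ) ∈ Metric.ball (x : ℂ) r := Metric.mem_ball_self hr0
    have hlim : Tendsto (fun n => centredMean σ (x : ℂ) (n + t) /
        rise (dominantRoot m t (x : ℂ)) (n + t)) atTop (𝓝 (E x)) :=
      tendsto_iff_norm_sub_tendsto_zero.2
        (squeeze_zero (fun _ => norm_nonneg _) (hE x hxb) hlim0)
    rw [hx, dominantRoot_realF hm (by linarith)] at hlim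
    have h1 : c ≤ (E x).re := by
      refine ge_of_tendsto ((Complex.continuous_re.tendsto _).comp hlim)
        (Eventually.of_forall fun n => ?_)
      rw [Function.comp_apply, rise_ofReal, Complex.div_ofReal_re,
        le_div_iff₀ (rise_pos (by linarith) _)]
      exact hcA (n + t)
    intro h
    rw [h, Complex.zero_re] at h1
    linarith
  -- The constant subtracted in `centredMean` is negligible after division, because `‖rise (λ₁(z))
  -- n‖ ≥ rise b n` and `b > 1`.
  · have hlim1 : Tendsto (fun n => m / d * (rise 1 (n + t) / rise b (n + t))) atTop (𝓝 0) := by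
      have := ((tendsto_rise_div_rise_zero one_pos hb1).comp
        (tendsto_add_atTop_nat t)).const_mul (m / d)
      rwa [mul_zero] at this
    have hlim2 := hlim0.add hlim1
    rw [add_zero] at hlim2
    rw [Metric.tendstoUniformlyOn_iff]
    intro η hη
    have hev := (hlim2.eventually_lt_const hη)
    obtain ⟨N, hN⟩ := eventually_atTop.1 hev
    refine eventually_atTop.2 ⟨N + t, fun n' hn' z hz => ?_⟩
    obtain ⟨n, rfl⟩ : ∃ n, n' = n + t := ⟨n' - t, by omega⟩
    have hn := hN n (by omega)
    refine lt_of_le_of_lt ?_ hn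
    have hzc := Metric.ball_subset_closedBall hz
    obtain ⟨-, h2, -, -, -⟩ := H z (Metric.ball_subset_ball (min_le_left _ _) hz)
    have hre : b < (dominantRoot m t z).re := by
      have := (Complex.abs_re_le_norm _).trans_lt h2
      rw [Complex.sub_re, Complex.ofReal_re, abs_lt] at this
      linarith
    rw [dist_comm, dist_eq_norm]
    have e : (meanPoly σ (n + t)).eval z / rise (dominantRoot m t z) (n + t) - E z =
        (centredMean σ z (n + t) / rise (dominantRoot m t z) (n + t) - E z) +
          ((m - 1 : ℕ) : ℂ) / (1 - m * z) / rise (dominantRoot m t z) (n + t) := by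
      rw [centredMean]; ring
    rw [e]
    refine (norm_add_le _ _).trans (add_le_add (hE z hz n) ?_)
    rw [norm_div, norm_div, Complex.norm_natCast, rise_one, mul_one_div]
    have hm' : ((m - 1 : ℕ) : ℝ) ≤ m := by exact_mod_cast Nat.sub_le m 1
    refine div_le_div₀ (by positivity) (div_le_div₀ (by positivity) hm' hd0 (hden z hzc))
      (rise_pos (by linarith) _) ?_
    exact (rise_mono_left (by linarith) hre.le _).trans (rise_re_le_norm_rise (by linarith) _)

/-- Uniform convergence to a function that is continuous and nonzero at `x` settles all large `n`;
continuity of `g n` at `x` settles the finitely many others. -/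
theorem exists_two_sided_bound {g : ℕ → ℂ → ℂ} {E : ℂ → ℂ} {x : ℂ} {r : ℝ} (hr : 0 < r)
    (hg : ∀ n, ContinuousOn (g n) (Metric.ball x r))
    (hE : TendstoUniformlyOn g E atTop (Metric.ball x r)) (hE0 : E x ≠ 0)
    (hg0 : ∀ n, 1 ≤ n → g n x ≠ 0) :
    ∃ r' > 0, r' ≤ r ∧ ∃ c > 0, ∃ A, 0 ≤ A ∧ ∀ z ∈ Metric.ball x r',
      (∀ n, 1 ≤ n → c ≤ ‖g n z‖) ∧ (∀ n, ‖g n z‖ ≤ A) ∧ E z ≠ 0 := by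
  have hEc : ContinuousAt E x := (hE.continuousOn
    (Eventually.of_forall hg).frequently).continuousAt (Metric.ball_mem_nhds _ hr)
  have hρ0 : 0 < ‖E x‖ := norm_pos_iff.2 hE0
  obtain ⟨N, hN⟩ := eventually_atTop.1
    ((Metric.tendstoUniformlyOn_iff.1 hE) (‖E x‖ / 4) (by linarith))
  have hev : ∀ᶠ z in 𝓝 x, ‖E z‖ < 2 * ‖E x‖ ∧ ‖E x‖ / 2 < ‖E z‖ :=
    (hEc.norm.eventually_lt_const (by linarith)).and (hEc.norm.eventually_const_lt (by linarith))
  have hsmall : ∀ᶠ z in 𝓝 x, ∀ n ∈ Finset.range N,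
      ‖g n z‖ < ‖g n x‖ + 1 ∧ (1 ≤ n → ‖g n x‖ / 2 < ‖g n z‖) := by
    rw [Filter.eventually_all_finset]
    intro n _
    have hc := ((hg n).continuousAt (Metric.ball_mem_nhds _ hr)).norm
    refine (hc.eventually_lt_const (by linarith)).and ?_
    by_cases hn : 1 ≤ n
    · have := norm_pos_iff.2 (hg0 n hn)
      filter_upwards [hc.eventually_const_lt (by linarith : ‖g n x‖ / 2 < ‖g n x‖)] with z hz _
      exact hz
    · exact Eventually.of_forall fun z h => (hn h).elim
  obtain ⟨r₄, hr₄, h₄⟩ := Metric.eventually_nhds_iff_ball.1 (hev.and hsmall)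
  obtain ⟨c₁, hc₁, hc₁a⟩ : ∃ c₁ > 0, ∀ n, 1 ≤ n → n < N → c₁ ≤ ‖g n x‖ / 2 := by
    by_cases hne : ((Finset.range N).filter fun n => 1 ≤ n).Nonempty
    · obtain ⟨n₀, hn₀, hmin⟩ := Finset.exists_min_image _ (fun n => ‖g n x‖ / 2) hne
      exact ⟨‖g n₀ x‖ / 2, half_pos (norm_pos_iff.2 (hg0 _ (Finset.mem_filter.1 hn₀).2)),
        fun n h1 h2 => hmin n (Finset.mem_filter.2 ⟨Finset.mem_range.2 h2, h1⟩)⟩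
    · exact ⟨1, one_pos, fun n h1 h2 =>
        (hne ⟨n, Finset.mem_filter.2 ⟨Finset.mem_range.2 h2, h1⟩⟩).elim⟩
  have hsum : 0 ≤ ∑ n ∈ Finset.range N, (‖g n x‖ + 1) := Finset.sum_nonneg fun _ _ => by positivity
  refine ⟨min r r₄, lt_min hr hr₄, min_le_left _ _, min (‖E x‖ / 4) c₁,
    lt_min (by linarith) hc₁, 3 * ‖E x‖ + ∑ n ∈ Finset.range N, (‖g n x‖ + 1), by positivity,
    fun z hz => ?_⟩
  have hz3 := Metric.ball_subset_ball (min_le_left r r₄) hz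
  obtain ⟨⟨hEu, hEl⟩, hs4⟩ := h₄ z (Metric.ball_subset_ball (min_le_right r r₄) hz)
  have hbig : ∀ n, N ≤ n → |‖E z‖ - ‖g n z‖| ≤ ‖E x‖ / 4 := by
    intro n hn
    have h1 := hN n hn z hz3
    rw [dist_eq_norm] at h1
    exact (abs_norm_sub_norm_le _ _).trans h1.le
  refine ⟨fun n hn => ?_, fun n => ?_, norm_pos_iff.1 (by linarith)⟩
  · by_cases hnN : N ≤ n
    · have h2 := abs_le.1 (hbig n hnN)
      exact (min_le_left _ _).trans (by linarith)
    · have h1 := (hs4 n (Finset.mem_range.2 (not_le.1 hnN))).2 hn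
      exact (min_le_right _ _).trans ((hc₁a n hn (not_le.1 hnN)).trans h1.le)
  · by_cases hnN : N ≤ n
    · have h2 := abs_le.1 (hbig n hnN)
      linarith
    · have h1 := (hs4 n (Finset.mem_range.2 (not_le.1 hnN))).1
      have h2 := Finset.single_le_sum (f := fun n => ‖g n x‖ + 1) (fun n _ => by positivity)
        (Finset.mem_range.2 (not_le.1 hnN))
      linarith

/-- Two-sided bounds and the asymptotics of the mean, uniformly near a point `F(θ₀)`, `θ₀ > 1`. -/
theorem exists_mean_bounds (hm : 2 ≤ m) (σ : SupplementaryRule m t) {θ₀ : ℝ} (hθ : 1 < θ₀) :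
    ∃ r > 0, ∃ c > 0, ∃ C, 0 ≤ C ∧ ∀ z ∈ Metric.ball (realF m t θ₀ : ℂ) r,
      (∀ n, 1 ≤ n → c * rise (dominantRoot m t z).re n ≤ ‖(meanPoly σ n).eval z‖) ∧
      (∀ n, ‖(meanPoly σ n).eval z‖ ≤ C * rise (dominantRoot m t z).re n) ∧
      ∃ e : ℂ, e ≠ 0 ∧ Tendsto (fun n => (meanPoly σ n).eval z / rise (dominantRoot m t z) n)
        atTop (𝓝 e) := by
  have ht0 : (0 : ℝ) ≤ t := t.cast_nonneg
  obtain ⟨r₁, hr₁, E, hE0, hE⟩ := exists_tendstoUniformlyOn_mean hm σ hθ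
  obtain ⟨δ, hδ, H⟩ := dominantRoot_local (t := t) hm (θ₀ := θ₀) (by linarith)
  set ε := min δ ((θ₀ - 1) / 2) with hε
  have hε0 : 0 < ε := lt_min hδ (by linarith)
  have hε2 : ε ≤ (θ₀ - 1) / 2 := min_le_right _ _
  obtain ⟨r₂, hr₂, H⟩ := H ε hε0 (min_le_left _ _)
  set x := realF m t θ₀ with hx
  have hx0 : 0 < x := realF_pos hm (by linarith)
  have hre : ∀ z ∈ Metric.ball (x : ℂ) r₂, 1 < (dominantRoot m t z).re ∧
      |(dominantRoot m t z).im| ≤ ε := by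
    intro z hz
    obtain ⟨-, h2, -⟩ := H z hz
    have h3 := (Complex.abs_re_le_norm _).trans_lt h2
    have h4 := (Complex.abs_im_le_norm _).trans_lt h2
    rw [Complex.sub_re, Complex.ofReal_re, abs_lt] at h3
    rw [Complex.sub_im, Complex.ofReal_im, sub_zero] at h4
    exact ⟨by linarith, h4.le⟩
  have hlamc : ContinuousOn (dominantRoot m t) (Metric.ball (x : ℂ) r₂) := fun z hz =>
    (H z hz).2.2.2.1.continuousAt.continuousWithinAt
  have hfc : ∀ n, ContinuousOn (fun z => (meanPoly σ n).eval z / rise (dominantRoot m t z) n)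
      (Metric.ball (x : ℂ) r₂) := fun n => by
    refine (meanPoly σ n).continuous.continuousOn.div ?_ fun z hz =>
      rise_ne_zero (by linarith [(hre z hz).1]) n
    simp only [rise]
    exact continuousOn_finsetProd _ fun k _ => (hlamc.add continuousOn_const).div_const _
  have hxb : (x : ℂ) ∈ Metric.ball (x : ℂ) r₂ := Metric.mem_ball_self hr₂
  obtain ⟨r, hr, hrr, c, hc, A, hA, key⟩ := exists_two_sided_bound (lt_min hr₁ hr₂)
    (fun n => (hfc n).mono (Metric.ball_subset_ball (min_le_right r₁ r₂)))
    (hE.mono (Metric.ball_subset_ball (min_le_left r₁ r₂))) hE0 (fun n hn => by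
      refine div_ne_zero ?_ (rise_ne_zero (by linarith [(hre x hxb).1]) n)
      intro h
      have := (re_meanPoly_nonneg hm σ hx0.le n).2 hn
      rw [h, Complex.zero_re] at this
      linarith)
  obtain ⟨K, hK1, hK⟩ := exists_norm_rise_le ε
  refine ⟨r, hr, c, hc, A * K, by positivity, fun z hz => ?_⟩
  obtain ⟨hlow, hupp, hEz⟩ := key z hz
  have hz1 := Metric.ball_subset_ball (hrr.trans (min_le_left r₁ r₂)) hz
  obtain ⟨hre1, him⟩ := hre z (Metric.ball_subset_ball (hrr.trans (min_le_right r₁ r₂)) hz)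
  have hrn : ∀ n, rise (dominantRoot m t z) n ≠ 0 := fun n => rise_ne_zero (by linarith) n
  refine ⟨fun n hn => ?_, fun n => ?_, E z, hEz, hE.tendsto_at hz1⟩
  · have h1 := hlow n hn
    rw [norm_div, le_div_iff₀ (norm_pos_iff.2 (hrn n))] at h1
    exact (mul_le_mul_of_nonneg_left (rise_re_le_norm_rise (by linarith) n) hc.le).trans h1
  · have h1 := hupp n
    rw [norm_div, div_le_iff₀ (norm_pos_iff.2 (hrn n))] at h1
    refine h1.trans ?_
    rw [mul_assoc]
    exact mul_le_mul_of_nonneg_left (hK _ hre1.le him n) hA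

/-! ### Moments of sums of independent centred variables -/

section Cost
variable {α β : Type}

/-- A first-order expansion of `‖·‖^s` at `a` whose remainder is uniform in `a`; the linear term
disappears for centred variables. If `‖b‖ ≤ ‖a‖`, apply Bernoulli's inequality with exponent `s/2 ≤
1` to `‖a+b‖²`; otherwise every term is at most a constant times `‖b‖^s`. -/
theorem exists_norm_add_rpow_le {s : ℝ} (hs : 1 < s) (hs' : s ≤ 2) (a : ℂ) :
    ∃ L : ℂ →ₗ[ℝ] ℝ, ∀ b, ‖a + b‖ ^ s ≤ ‖a‖ ^ s + L b + 6 * ‖b‖ ^ s := by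
  by_cases ha : a = 0
  · refine ⟨0, fun b => ?_⟩
    have h1 : (0 : ℝ) ≤ ‖b‖ ^ s := by positivity
    subst ha
    rw [zero_add, norm_zero, Real.zero_rpow (by linarith), LinearMap.zero_apply]
    linarith
  · have hA : 0 < ‖a‖ := norm_pos_iff.2 ha
    set A := ‖a‖ with hAdef
    refine ⟨(s * A ^ (s - 2)) • (Complex.reLm ∘ₗ LinearMap.mulLeft ℝ ((starRingEnd ℂ) a)),
      fun b => ?_⟩
    simp only [LinearMap.smul_apply, LinearMap.comp_apply, LinearMap.mulLeft_apply,
      Complex.reLm_coe, smul_eq_mul]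
    set ρ := ((starRingEnd ℂ) a * b).re with hρ
    have hρle : |ρ| ≤ A * ‖b‖ := by
      refine (Complex.abs_re_le_norm _).trans ?_
      rw [norm_mul, RCLike.norm_conj]
    have hsq : ‖a + b‖ ^ 2 = A ^ 2 + 2 * ρ + ‖b‖ ^ 2 := by
      rw [Complex.sq_norm, Complex.normSq_add, ← Complex.sq_norm, ← Complex.sq_norm, hρ]
      have : (a * (starRingEnd ℂ) b).re = ((starRingEnd ℂ) a * b).re := by
        simp
      rw [this]
      ring
    have hAs : A ^ s = A ^ (s - 2) * A ^ 2 := by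
      rw [← Real.rpow_natCast A 2, ← Real.rpow_add hA]
      congr 1
      push_cast
      ring
    have hA2 : 0 < A ^ (s - 2) := Real.rpow_pos_of_pos hA _
    by_cases hB : ‖b‖ ≤ A
    · set y := (2 * ρ + ‖b‖ ^ 2) / A ^ 2 with hy
      have hy1 : A ^ 2 * (1 + y) = ‖a + b‖ ^ 2 := by
        rw [hsq, hy]; field_simp; ring
      have hy0 : 0 ≤ 1 + y := by
        have : 0 ≤ A ^ 2 * (1 + y) := hy1 ▸ sq_nonneg _
        exact nonneg_of_mul_nonneg_right this (by positivity)
      have h1 : ‖a + b‖ ^ s = A ^ s * (1 + y) ^ (s / 2) := by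
        have e1 : ‖a + b‖ ^ s = (‖a + b‖ ^ 2) ^ (s / 2) := by
          rw [← Real.rpow_natCast, ← Real.rpow_mul (norm_nonneg _)]
          congr 1
          push_cast
          ring
        have e2 : A ^ s = (A ^ 2) ^ (s / 2) := by
          rw [← Real.rpow_natCast, ← Real.rpow_mul hA.le]
          congr 1
          push_cast
          ring
        rw [e1, e2, ← hy1, Real.mul_rpow (by positivity) hy0]
      have h2 := rpow_one_add_le_one_add_mul_self (s := y) (by linarith) (p := s / 2)
        (by linarith) (by linarith)
      have h3 : ‖a + b‖ ^ s ≤ A ^ s * (1 + s / 2 * y) := by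
        rw [h1]
        exact mul_le_mul_of_nonneg_left h2 (by positivity)
      have h4 : A ^ s * (1 + s / 2 * y) = A ^ s + s * A ^ (s - 2) * ρ +
          s / 2 * (A ^ (s - 2) * ‖b‖ ^ 2) := by
        rw [hAs, hy]; field_simp; ring
      have h5 : A ^ (s - 2) * ‖b‖ ^ 2 ≤ ‖b‖ ^ s := by
        by_cases hb0 : ‖b‖ = 0
        · rw [hb0, Real.zero_rpow (by linarith)]; simp
        · have hb : 0 < ‖b‖ := lt_of_le_of_ne (norm_nonneg _) (Ne.symm hb0)
          have e1 : ‖b‖ ^ s = ‖b‖ ^ (s - 2) * ‖b‖ ^ 2 := by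
            rw [← Real.rpow_natCast ‖b‖ 2, ← Real.rpow_add hb]
            congr 1
            push_cast
            ring
          rw [e1]
          gcongr ?_ * _
          exact Real.rpow_le_rpow_of_nonpos hb hB (by linarith)
      have h6 : 0 ≤ ‖b‖ ^ s := by positivity
      have h7 : 0 ≤ A ^ (s - 2) * ‖b‖ ^ 2 := by positivity
      nlinarith
    · rw [not_le] at hB
      have hb := hA.trans hB
      have h1 : ‖a + b‖ ^ s ≤ 4 * ‖b‖ ^ s := by
        calc ‖a + b‖ ^ s ≤ (2 * ‖b‖) ^ s := by
              gcongr
              refine (norm_add_le _ _).trans ?_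
              linarith
          _ = 2 ^ s * ‖b‖ ^ s := Real.mul_rpow (by norm_num) hb.le
          _ ≤ 2 ^ (2 : ℝ) * ‖b‖ ^ s := by
              gcongr
              norm_num
          _ = 4 * ‖b‖ ^ s := by norm_num
      have h2 : A ^ (s - 1) ≤ ‖b‖ ^ (s - 1) := Real.rpow_le_rpow hA.le hB.le (by linarith)
      have h3 : ‖b‖ ^ s = ‖b‖ ^ (s - 1) * ‖b‖ := by
        rw [← Real.rpow_add_one hb.ne']; congr 1; ring
      have h4 : A ^ (s - 1) = A ^ (s - 2) * A := by
        rw [← Real.rpow_add_one hA.ne']; congr 1; ring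
      have h5 : -(A ^ (s - 1) * ‖b‖) ≤ A ^ (s - 2) * ρ := by
        rw [h4]
        have := (abs_le.1 hρle).1
        nlinarith
      have h6 : 0 ≤ A ^ s := by positivity
      have h7 : A ^ (s - 1) * ‖b‖ ≤ ‖b‖ ^ s := by rw [h3]; gcongr
      have h8 : 0 ≤ ‖b‖ ^ s := by positivity
      nlinarith

/-- Adding the random variable `D` raises `s`-th absolute moments by at most `κ`. -/
def HasCost (s : ℝ) (p : PMF α) (D : α → ℂ) (κ : ℝ) : Prop :=
  ∀ a : ℂ, (ev p fun x => ‖a + D x‖ ^ s) ≤ ‖a‖ ^ s + κ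

theorem hasCost_of_ev_eq_zero {s : ℝ} (hs : 1 < s) (hs' : s ≤ 2) {p : PMF α}
    (hp : p.support.Finite) {D : α → ℂ} (hD : ev p D = 0) :
    HasCost s p D (6 * ev p fun x => ‖D x‖ ^ s) := by
  intro a
  obtain ⟨L, hL⟩ := exists_norm_add_rpow_le hs hs' a
  calc (ev p fun x => ‖a + D x‖ ^ s) ≤ ev p fun x => (‖a‖ ^ s + L (D x)) + 6 * ‖D x‖ ^ s :=
        ev_mono hp fun x _ => hL _
    _ = _ := by
        rw [ev_add hp, ev_add hp, ev_const hp, ev_linear hp L, hD, map_zero,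
          ev_mul_left hp (6 : ℝ) fun x => ‖D x‖ ^ s, add_zero]

theorem HasCost.mono {s : ℝ} {p : PMF α} {D : α → ℂ} {κ κ' : ℝ} (h : HasCost s p D κ)
    (hκ : κ ≤ κ') : HasCost s p D κ' := fun a => (h a).trans (by linarith)

theorem HasCost.ev_norm_rpow_le {s : ℝ} (hs : 0 < s) {p : PMF α} {D : α → ℂ} {κ : ℝ}
    (h : HasCost s p D κ) : (ev p fun x => ‖D x‖ ^ s) ≤ κ := by
  have := h 0
  simp only [zero_add, norm_zero, Real.zero_rpow hs.ne'] at this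
  exact this

theorem HasCost.const_mul {s : ℝ} {p : PMF α} (hp : p.support.Finite) {D : α → ℂ} {κ : ℝ}
    (h : HasCost s p D κ) {c : ℂ} (hc : c ≠ 0) : HasCost s p (fun x => c * D x) (‖c‖ ^ s * κ) := by
  intro a
  have e : ∀ x, ‖a + c * D x‖ ^ s = ‖c‖ ^ s * ‖a / c + D x‖ ^ s := fun x => by
    rw [← Real.mul_rpow (norm_nonneg _) (norm_nonneg _), ← norm_mul]
    congr 2
    field_simp
  simp only [e]
  rw [ev_mul_left hp (‖c‖ ^ s) fun x => ‖a / c + D x‖ ^ s]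
  refine (mul_le_mul_of_nonneg_left (h (a / c)) (by positivity)).trans_eq ?_
  rw [mul_add, ← Real.mul_rpow (norm_nonneg _) (norm_nonneg _), ← norm_mul, mul_div_cancel₀ _ hc]

/-- The bound in `HasCost` is uniform in the shift `a`, so coordinates can be integrated out one at
a time with the earlier summands included in the shift. No constant is lost, which matters because
this is iterated down the whole tree. -/
theorem hasCost_independentLaw {s : ℝ} {k : ℕ} {p : Fin k → PMF α}
    (hp : ∀ i, (p i).support.Finite) {D : Fin k → α → ℂ} {κ : Fin k → ℝ}
    (h : ∀ i, HasCost s (p i) (D i) (κ i)) :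
    HasCost s (independentLaw p) (fun f => ∑ i, D i (f i)) (∑ i, κ i) := by
  induction k with
  | zero =>
    intro a
    rw [independentLaw, ev_pure]
    simp
  | succ k ih =>
    intro a
    rw [ev_independentLaw_succ hp, Fin.sum_univ_succ]
    calc _ ≤ ev (p 0) fun x => ‖a + D 0 x‖ ^ s + ∑ i : Fin k, κ i.succ := by
          refine ev_mono (hp 0) fun x _ => ?_
          have := ih (fun i => hp i.succ) (fun i => h i.succ) (a + D 0 x)
          refine le_trans (le_of_eq ?_) this
          refine ev_congr fun g _ => ?_
          simp only [Fin.sum_univ_succ, Fin.cons_zero, Fin.cons_succ, add_assoc]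
      _ = (ev (p 0) fun x => ‖a + D 0 x‖ ^ s) + ∑ i : Fin k, κ i.succ := by
          rw [ev_add (hp 0), ev_const (hp 0)]
      _ ≤ _ := by
          have := h 0 a
          linarith

end Cost

theorem ev_polyLaw_sub (hm : 2 ≤ m) (σ : SupplementaryRule m t) (n : ℕ) (z : ℂ) :
    (ev (polyLaw σ n) fun p => p.eval z - (meanPoly σ n).eval z) = 0 := by
  rw [ev_sub (finite_support_polyLaw hm σ n), ev_const (finite_support_polyLaw hm σ n),
    ← eval_meanPoly hm, sub_self]

theorem ev_polyLaw_eq (hm : 2 ≤ m) (σ : SupplementaryRule m t) {n : ℕ} (hn : m ≤ n)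
    {E : Type*} [AddCommGroup E] [Module ℝ E] (f : ℂ[X] → E) :
    ev (polyLaw σ n) f = ev (splitLaw σ n) fun I =>
      ev (independentLaw fun j => polyLaw σ (I j)) fun g => f (joinPoly m g) := by
  have hp := finite_support_polyLaw hm σ
  rw [polyLaw_eq_bind hm σ hn, ev_bind (finite_support_splitLaw hm hn) fun I _ =>
    finite_support_map (finite_support_independentLaw fun j => hp (I j)) _]
  exact ev_congr fun I _ => ev_map (finite_support_independentLaw fun j => hp (I j)) _ _

/-- Write `Wₙ - 𝔼 Wₙ = b(I) + z ∑ⱼ (W_{Iⱼ} - 𝔼 W_{Iⱼ})`. The term `b` has mean zero under the split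
law and costs `C w n`. Given `I`, the independent subtrees cost `K ‖z‖^s ∑ w(Iⱼ)`, whose mean is at
most `K q w n`. So `C + K q ≤ K` closes the induction. -/
theorem hasCost_polyLaw (hm : 2 ≤ m) (σ : SupplementaryRule m t) {z : ℂ} (hz : z ≠ 0) {s q : ℝ}
    (hs : 1 < s) (hs' : s ≤ 2) {w : ℕ → ℝ} (hw : ∀ n, 0 ≤ w n) {N : ℕ} (hN : m ≤ N)
    (hq : ∀ n, N ≤ n → ‖z‖ ^ s * (ev (splitLaw σ n) fun I => ∑ j, w (I j)) ≤ q * w n)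
    {C K : ℝ} (hK : 0 ≤ K) (hCK : C + K * q ≤ K)
    (hbase : ∀ n, n < N → 6 * (ev (polyLaw σ n) fun p =>
      ‖p.eval z - (meanPoly σ n).eval z‖ ^ s) ≤ K * w n)
    (hb : ∀ n, N ≤ n → 6 * (ev (splitLaw σ n) fun I => ‖((m - 1 : ℕ) : ℂ) +
      z * ∑ j, (meanPoly σ (I j)).eval z - (meanPoly σ n).eval z‖ ^ s) ≤ C * w n) (n : ℕ) :
    HasCost s (polyLaw σ n) (fun p => p.eval z - (meanPoly σ n).eval z) (K * w n) := by
  have hp := finite_support_polyLaw hm σ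
  induction n using Nat.strong_induction_on with
  | _ n ih =>
    by_cases hn : n < N
    · exact (hasCost_of_ev_eq_zero hs hs' (hp n) (ev_polyLaw_sub hm σ n z)).mono (hbase n hn)
    · have hnN := not_lt.1 hn
      have hnm := hN.trans hnN
      have hfin := finite_support_splitLaw (σ := σ) hm hnm
      set b : (Fin m → ℕ) → ℂ := fun I => ((m - 1 : ℕ) : ℂ) +
        z * ∑ j, (meanPoly σ (I j)).eval z - (meanPoly σ n).eval z with hbdef
      have hb0 : ev (splitLaw σ n) b = 0 := by
        rw [hbdef, ev_sub hfin, ev_add hfin, ev_const hfin, ev_const hfin, ev_mul_left hfin,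
          ← eval_meanPoly_eq hm σ hnm, sub_self]
      intro a
      rw [ev_polyLaw_eq hm σ hnm]
      calc _ ≤ ev (splitLaw σ n) fun I => ‖a + b I‖ ^ s + ‖z‖ ^ s * ∑ j, K * w (I j) := by
            refine ev_mono hfin fun I hI => ?_
            have h1 := (hasCost_independentLaw (fun j => hp (I j)) fun j =>
              ih (I j) (lt_of_mem_support_splitLaw hm hnm hI j)).const_mul
                (finite_support_independentLaw fun j => hp (I j)) hz (a + b I)
            refine le_trans (le_of_eq (ev_congr fun g _ => ?_)) h1
            congr 2
            simp only [eval_joinPoly, Finset.sum_sub_distrib, hbdef]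
            ring
        _ = (ev (splitLaw σ n) fun I => ‖a + b I‖ ^ s) +
              K * (‖z‖ ^ s * ev (splitLaw σ n) fun I => ∑ j, w (I j)) := by
            rw [ev_add hfin]
            congr 1
            rw [← mul_assoc, ← ev_mul_left hfin (K * ‖z‖ ^ s) fun I => ∑ j, w (I j)]
            refine ev_congr fun I _ => ?_
            rw [← Finset.mul_sum]
            ring
        _ ≤ ‖a‖ ^ s + C * w n + K * (q * w n) :=
            add_le_add ((hasCost_of_ev_eq_zero hs hs' hfin hb0 a).trans
              (add_le_add_right (hb n hnN) _)) (mul_le_mul_of_nonneg_left (hq n hnN) hK)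
        _ ≤ ‖a‖ ^ s + K * w n := by
            have := mul_le_mul_of_nonneg_right hCK (hw n)
            linarith

/-! ### Points where the normalized profile polynomials are bounded in some `Lˢ`, `s > 1` -/

theorem realF_mul_ev_rise (hm : 2 ≤ m) (σ : SupplementaryRule m t) {n : ℕ}
    (hn : m * t + m - 1 ≤ n) (hn' : m ≤ n) (ρ : ℝ) :
    realF m t ρ * (ev (splitLaw σ n) fun I => ∑ j, rise ρ (I j)) = rise ρ n := by
  have h := splitMean_rise (t := t) hm (θ := (ρ : ℂ)) hn
  rw [polyF_eval_ofReal, splitMean_eq_ev hm σ hn hn', rise_ofReal] at h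
  have h2 := congrArg Complex.re h
  rw [Complex.re_ofReal_mul, Complex.ofReal_re] at h2
  have h3 := ev_linear (finite_support_splitLaw (σ := σ) hm hn') Complex.reLm
    fun I => ∑ j, rise (ρ : ℂ) (I j)
  rw [Complex.reLm_coe] at h3
  rw [← h2, ← h3]
  congr 1
  refine ev_congr fun I _ => ?_
  rw [Complex.re_sum]
  exact Finset.sum_congr rfl fun j _ => by rw [rise_ofReal, Complex.ofReal_re]

/-- The exponent `s (Re λ₁(z) - 1) + 1`. -/
noncomputable def momentExp (m t : ℕ) (s : ℝ) (z : ℂ) : ℝ := s * ((dominantRoot m t z).re - 1) + 1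

/-- The point `z` satisfies all the bounds needed for the limit theorem, with the given
constants. -/
structure IsGood (σ : SupplementaryRule m t) (s q c K : ℝ) (z : ℂ) : Prop where
  one_lt_re : 1 < (dominantRoot m t z).re
  dominant : ∀ θ ∈ (rootsF m t z).erase (dominantRoot m t z), θ.re < (dominantRoot m t z).re
  differentiableAt : DifferentiableAt ℂ (dominantRoot m t) z
  lower : ∀ n, 1 ≤ n → c * rise (dominantRoot m t z).re n ≤ ‖(meanPoly σ n).eval z‖
  limit : ∃ e : ℂ, e ≠ 0 ∧
    Tendsto (fun n => (meanPoly σ n).eval z / rise (dominantRoot m t z) n) atTop (𝓝 e)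
  weight : ‖z‖ ^ s ≤ q * realF m t (momentExp m t s z)
  moment : ∀ n, (ev (polyLaw σ n) fun p => ‖p.eval z - (meanPoly σ n).eval z‖ ^ s) ≤
    K * rise (momentExp m t s z) n

theorem continuous_ev {α X : Type} [TopologicalSpace X] {E : Type*} [NormedAddCommGroup E]
    [NormedSpace ℝ E] {p : PMF α} (hp : p.support.Finite) {f : α → X → E}
    (hf : ∀ a, Continuous (f a)) : Continuous fun x => ev p fun a => f a x := by
  simp only [ev_eq_sum (s := hp.toFinset) (by simp : p.support ⊆ _)]
  exact continuous_finsetSum _ fun a _ => (hf a).const_smul _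

/-- Splitting acts on `rise ρ` as multiplication by `1 / F(ρ)`, so the contraction factor is `‖z‖^s
/ F(ρ)`. -/
theorem weight_ev_le (hm : 2 ≤ m) (σ : SupplementaryRule m t) {n : ℕ}
    (hn : m * t + m - 1 ≤ n) (hn' : m ≤ n) {s q ρ : ℝ} (hρ : 0 < ρ) {z : ℂ}
    (h : ‖z‖ ^ s ≤ q * realF m t ρ) :
    ‖z‖ ^ s * (ev (splitLaw σ n) fun I => ∑ j, rise ρ (I j)) ≤ q * rise ρ n := by
  rw [← realF_mul_ev_rise hm σ hn hn' ρ, ← mul_assoc]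
  refine mul_le_mul_of_nonneg_right h ?_
  exact ev_nonneg (finite_support_splitLaw hm hn') fun I _ =>
    Finset.sum_nonneg fun j _ => (rise_pos hρ _).le

theorem norm_split_bias_le (hm : 2 ≤ m) (σ : SupplementaryRule m t) {z : ℂ} {a R C : ℝ}
    (ha : 1 ≤ a) (hC : 0 ≤ C) (hz : ‖z‖ ≤ R)
    (hG : ∀ n, ‖(meanPoly σ n).eval z‖ ≤ C * rise a n) {n : ℕ} (hn : m ≤ n) {I : Fin m → ℕ}
    (hI : I ∈ (splitLaw σ n).support) :
    ‖((m - 1 : ℕ) : ℂ) + z * ∑ j, (meanPoly σ (I j)).eval z - (meanPoly σ n).eval z‖ ≤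
      (m + R * (m * C) + C) * rise a n := by
  have h1 := one_le_rise ha n
  have hR : 0 ≤ R := (norm_nonneg z).trans hz
  have h2 : ‖∑ j, (meanPoly σ (I j)).eval z‖ ≤ m * C * rise a n := by
    refine (norm_sum_le _ _).trans ?_
    calc _ ≤ ∑ _j : Fin m, C * rise a n := Finset.sum_le_sum fun j _ => (hG _).trans
          (mul_le_mul_of_nonneg_left
            (monotone_rise ha (lt_of_mem_support_splitLaw hm hn hI j).le) hC)
      _ = _ := by simp [mul_assoc]
  calc _ ≤ ‖((m - 1 : ℕ) : ℂ)‖ + ‖z‖ * ‖∑ j, (meanPoly σ (I j)).eval z‖ +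
        ‖(meanPoly σ n).eval z‖ := by
        refine (norm_sub_le _ _).trans (add_le_add_left ((norm_add_le _ _).trans ?_) _)
        rw [norm_mul]
    _ ≤ m * rise a n + R * (m * C * rise a n) + C * rise a n := by
        refine add_le_add (add_le_add ?_ ?_) (hG n)
        · rw [Complex.norm_natCast]
          have h3 : ((m - 1 : ℕ) : ℝ) ≤ m := by exact_mod_cast Nat.sub_le m 1
          have h4 : (0 : ℝ) ≤ m := m.cast_nonneg
          nlinarith
        · exact mul_le_mul hz h2 (norm_nonneg _) hR
    _ = _ := by ring

theorem exists_isGood_ball (hm : 2 ≤ m) (σ : SupplementaryRule m t) {θ₀ s : ℝ} (hθ : 1 < θ₀)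
    (hs : 1 < s) (hs' : s ≤ 2) (hlt : realF m t θ₀ ^ s < realF m t (s * (θ₀ - 1) + 1)) :
    ∃ r > 0, ∃ q c K : ℝ, 0 ≤ q ∧ q < 1 ∧ 0 < c ∧ 0 ≤ K ∧
      ∀ z ∈ Metric.ball (realF m t θ₀ : ℂ) r, IsGood σ s q c K z := by
  have ht0 : (0 : ℝ) ≤ t := t.cast_nonneg
  obtain ⟨r₁, hr₁, c, hc, C, hC, hmean⟩ := exists_mean_bounds hm σ hθ
  obtain ⟨δ, hδ, H⟩ := dominantRoot_local (t := t) hm (θ₀ := θ₀) (by linarith)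
  set ε := min δ ((θ₀ - 1) / 2) with hε
  have hε0 : 0 < ε := lt_min hδ (by linarith)
  have hε1 : ε ≤ δ := min_le_left _ _
  have hε2 : ε ≤ (θ₀ - 1) / 2 := min_le_right _ _
  obtain ⟨r₂, hr₂, H⟩ := H ε hε0 hε1
  have hrealroot := dominantRoot_realF (t := t) hm (θ := θ₀) (by linarith)
  set x := realF m t θ₀ with hx
  have hx0 : 0 < x := realF_pos hm (by linarith)
  have hre : ∀ z ∈ Metric.ball (x : ℂ) r₂, θ₀ - ε < (dominantRoot m t z).re ∧
      (dominantRoot m t z).re < θ₀ + ε := by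
    intro z hz
    have h3 := (Complex.abs_re_le_norm _).trans_lt (H z hz).2.1
    rw [Complex.sub_re, Complex.ofReal_re, abs_lt] at h3
    exact ⟨by linarith, by linarith⟩
  have hcont : ContinuousAt (dominantRoot m t) (x : ℂ) :=
    (H x (Metric.mem_ball_self hr₂)).2.2.2.1.continuousAt
  set ρ := momentExp m t s with hρ
  have hρx : ρ (x : ℂ) = s * (θ₀ - 1) + 1 := by
    rw [hρ, momentExp, hrealroot, Complex.ofReal_re]
  have hFx : 0 < realF m t (ρ (x : ℂ)) := by
    rw [hρx]
    have : 0 ≤ s * (θ₀ - 1) := mul_nonneg (by linarith) (by linarith)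
    exact realF_pos hm (by linarith)
  have hFc : ContinuousAt (fun z => realF m t (ρ z)) (x : ℂ) := by
    refine continuous_realF.continuousAt.comp ?_
    simp only [hρ]
    unfold momentExp
    exact ((continuousAt_const.mul ((Complex.continuous_re.continuousAt.comp hcont).sub
      continuousAt_const)).add continuousAt_const)
  have hratio : ContinuousAt (fun z : ℂ => ‖z‖ ^ s / realF m t (ρ z)) (x : ℂ) :=
    ((continuous_norm.continuousAt).rpow_const (Or.inr (by linarith))).div hFc hFx.ne'
  -- By `hlt` the contraction factor is below 1 at the real point. By continuity it stays below the
  -- midpoint `q` of `q₀` and 1 nearby.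
  set q₀ := ‖(x : ℂ)‖ ^ s / realF m t (ρ (x : ℂ)) with hq₀
  have hq₀0 : 0 ≤ q₀ := by positivity
  have hq₀1 : q₀ < 1 := by
    rw [hq₀, div_lt_one hFx, hρx, Complex.norm_real, Real.norm_of_nonneg hx0.le]
    exact hlt
  set q := (q₀ + 1) / 2 with hq
  have hq1 : q < 1 := by linarith
  have hev : ∀ᶠ z in 𝓝 (x : ℂ), ‖z‖ ^ s / realF m t (ρ z) < q ∧ 0 < realF m t (ρ z) ∧ z ≠ 0 :=
    (hratio.eventually_lt_const (by linarith)).and ((hFc.eventually_const_lt hFx).and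
      (isOpen_ne.mem_nhds (by simpa using hx0.ne')))
  obtain ⟨r₃, hr₃, h₃⟩ := Metric.eventually_nhds_iff_ball.1 hev
  set r := min r₁ (min r₂ r₃) with hr
  have hr0 : 0 < r := lt_min hr₁ (lt_min hr₂ hr₃)
  obtain ⟨Cp, hCp1, hCp⟩ := exists_rise_rpow_le (θ₀ + ε)
  set R := ‖(x : ℂ)‖ + r with hR
  have hR0 : 0 ≤ R := by positivity
  set C₁ := 6 * ((m + R * (m * C) + C) ^ s * Cp) with hC₁
  have hC₁0 : 0 ≤ C₁ := by positivity
  have hpol := finite_support_polyLaw hm σ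
  set N := max (m * t + m - 1) m with hN
  obtain ⟨K₀, hK₀⟩ := (isCompact_closedBall (x : ℂ) r).exists_bound_of_continuousOn
    (f := fun z => ∑ n ∈ Finset.range N, 6 * (ev (polyLaw σ n) fun p =>
      ‖p.eval z - (meanPoly σ n).eval z‖ ^ s)) (by
        refine (continuous_finsetSum _ fun n _ => ?_).continuousOn
        refine continuous_const.mul (continuous_ev (hpol n) fun p => ?_)
        refine Continuous.rpow_const ?_ fun _ => Or.inr (by linarith)
        exact (p.continuous.sub (meanPoly σ n).continuous).norm)
  have hK₀0 : 0 ≤ K₀ := (norm_nonneg _).trans (hK₀ x (Metric.mem_closedBall_self hr0.le))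
  -- `K₀` covers the finitely many `n < N`, by compactness of the closed ball, and `C₁ / (1 - q)` is
  -- the fixed point of `K ↦ C₁ + K q`.
  set K := K₀ + C₁ / (1 - q) with hK
  have hdiv : 0 ≤ C₁ / (1 - q) := div_nonneg hC₁0 (by linarith)
  have hK0 : 0 ≤ K := by positivity
  have hCK : C₁ + K * q ≤ K := by
    have h1 : C₁ / (1 - q) * (1 - q) = C₁ := div_mul_cancel₀ _ (by linarith)
    have h2 : 0 ≤ K₀ * (1 - q) := mul_nonneg hK₀0 (by linarith)
    nlinarith
  refine ⟨r, hr0, q, c, K, by linarith, hq1, hc, hK0, fun z hz => ?_⟩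
  have hz1 := Metric.ball_subset_ball (min_le_left r₁ _) hz
  have hz2 := Metric.ball_subset_ball ((min_le_right r₁ _).trans (min_le_left r₂ r₃)) hz
  have hz3 := Metric.ball_subset_ball ((min_le_right r₁ _).trans (min_le_right r₂ r₃)) hz
  have hzR : ‖z‖ ≤ R := by
    have h1 := norm_le_norm_add_norm_sub (x : ℂ) z
    rw [norm_sub_rev] at h1
    exact h1.trans (add_le_add_right (mem_ball_iff_norm.1 hz).le _)
  obtain ⟨hlow, hupp, hlim⟩ := hmean z hz1
  obtain ⟨hre1, hre2⟩ := hre z hz2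
  obtain ⟨-, -, -, hder, hdom⟩ := H z hz2
  obtain ⟨hqz, hFz, hz0⟩ := h₃ z hz3
  have hweight : ‖z‖ ^ s ≤ q * realF m t (ρ z) := ((div_lt_iff₀ hFz).1 hqz).le
  have hρ1 : 1 ≤ ρ z := by
    have : 0 ≤ s * ((dominantRoot m t z).re - 1) := mul_nonneg (by linarith) (by linarith)
    rw [hρ, momentExp]
    linarith
  refine ⟨by linarith, fun θ hθ => (hdom θ hθ).trans (by linarith), hder.differentiableAt,
    hlow, hlim, hweight, fun n => ?_⟩
  refine (hasCost_polyLaw hm σ hz0 hs hs' (w := fun n => rise (ρ z) n)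
    (fun n => (rise_pos (by linarith) n).le) (N := N) (le_max_right _ _)
    (fun n hn => weight_ev_le hm σ ((le_max_left _ _).trans hn) ((le_max_right _ _).trans hn)
      (by linarith) hweight) hK0 hCK (fun n hn => ?_) (fun n hn => ?_) n).ev_norm_rpow_le
    (by linarith)
  · have h1 := hK₀ z (Metric.ball_subset_closedBall hz)
    have h0 : ∀ n, 0 ≤ 6 * (ev (polyLaw σ n) fun p =>
        ‖p.eval z - (meanPoly σ n).eval z‖ ^ s) := fun n =>
      mul_nonneg (by norm_num) (ev_nonneg (hpol n) fun p _ => by positivity)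
    rw [Real.norm_of_nonneg (Finset.sum_nonneg fun n _ => h0 n)] at h1
    refine (Finset.single_le_sum (f := fun n => 6 * (ev (polyLaw σ n) fun p =>
      ‖p.eval z - (meanPoly σ n).eval z‖ ^ s)) (fun n _ => h0 n) (Finset.mem_range.2 hn)).trans ?_
    refine h1.trans ?_
    have h2 := one_le_rise hρ1 n
    nlinarith
  · have hnm : m ≤ n := (le_max_right _ _).trans hn
    have hfin := finite_support_splitLaw (σ := σ) hm hnm
    rw [hC₁, mul_assoc]
    refine mul_le_mul_of_nonneg_left ?_ (by norm_num)
    calc _ ≤ ev (splitLaw σ n) fun _ => (m + R * (m * C) + C) ^ s * Cp * rise (ρ z) n := by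
          refine ev_mono hfin fun I hI => ?_
          have h1 := norm_split_bias_le hm σ (a := (dominantRoot m t z).re) (by linarith) hC hzR
            hupp hnm hI
          refine (Real.rpow_le_rpow (norm_nonneg _) h1 (by linarith)).trans ?_
          rw [Real.mul_rpow (by positivity) (rise_pos (by linarith) _).le, mul_assoc]
          refine mul_le_mul_of_nonneg_left ?_ (by positivity)
          exact hCp _ s (by linarith) (by linarith) hs.le hs' n
      _ = _ := ev_const hfin _

/-- The points with a neighbourhood of good points, with uniform constants. -/
def goodSet (σ : SupplementaryRule m t) : Set ℂ :=
  {x | ∃ r > 0, ∃ s q c K : ℝ, 1 < s ∧ s ≤ 2 ∧ 0 ≤ q ∧ q < 1 ∧ 0 < c ∧ 0 ≤ K ∧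
    ∀ z ∈ Metric.ball x r, IsGood σ s q c K z}

theorem isOpen_goodSet (σ : SupplementaryRule m t) : IsOpen (goodSet σ) := by
  rw [Metric.isOpen_iff]
  rintro x ⟨r, hr, s, q, c, K, h1, h2, h3, h4, h5, h7, h⟩
  refine ⟨r / 2, by linarith, fun y hy => ⟨r / 2, by linarith, s, q, c, K, h1, h2, h3, h4, h5,
    h7, fun z hz => h z ?_⟩⟩
  rw [Metric.mem_ball] at hy hz ⊢
  linarith [dist_triangle z y x]

theorem mem_goodSet (hm : 2 ≤ m) (σ : SupplementaryRule m t) {x : ℝ} (h1 : 1 / (m : ℝ) < x)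
    (h2 : x < beta m t (alphaPlus m t)) : (x : ℂ) ∈ goodSet σ := by
  obtain ⟨θ, s, hθ, rfl, hs, hs', hlt⟩ := exists_theta_of_mem_interval hm h1 h2
  obtain ⟨r, hr, q, c, K, h3, h4, h5, h7, h8⟩ := exists_isGood_ball hm σ hθ hs hs'.le hlt
  exact ⟨r, hr, s, q, c, K, hs, hs'.le, h3, h4, h5, h7, h8⟩

/-! ### The local limit theorem for the block sizes -/

theorem sum_fin_pred {M : Type*} [AddCommMonoid M] (hm : 1 ≤ m) (f : Fin m → M) :
    ∑ j, f j = ∑ i : Fin (m - 1), f ⟨i, by omega⟩ + f ⟨m - 1, by omega⟩ := by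
  obtain ⟨d, rfl⟩ : ∃ d, m = d + 1 := ⟨m - 1, by omega⟩
  exact Fin.sum_univ_castSucc f

/-- The point of the simplex with given first `m - 1` coordinates. -/
noncomputable def simplexExt (m : ℕ) (s : Fin (m - 1) → ℝ) : Fin m → ℝ := fun j =>
  if h : (j : ℕ) < m - 1 then s ⟨j, h⟩ else 1 - ∑ i, s i

/-- The tuple with sum `N` and given first `m - 1` entries. -/
def natExt (m N : ℕ) (k : Fin (m - 1) → ℕ) : Fin m → ℕ := fun j =>
  if h : (j : ℕ) < m - 1 then k ⟨j, h⟩ else N - ∑ i, k i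

theorem sum_simplexExt (hm : 1 ≤ m) (s : Fin (m - 1) → ℝ) : ∑ j, simplexExt m s j = 1 := by
  rw [sum_fin_pred hm]
  simp [simplexExt]

theorem sum_natExt (hm : 1 ≤ m) {N : ℕ} {k : Fin (m - 1) → ℕ} (hk : ∑ i, k i ≤ N) :
    ∑ j, natExt m N k j = N := by
  rw [sum_fin_pred hm]
  simp [natExt, hk]

theorem natExt_le {N : ℕ} {k : Fin (m - 1) → ℕ} (hk : ∑ i, k i ≤ N) (j : Fin m) :
    natExt m N k j ≤ N := by
  unfold natExt
  split_ifs with h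
  · exact (Finset.single_le_sum (f := k) (fun _ _ => Nat.zero_le _) (Finset.mem_univ _)).trans hk
  · exact Nat.sub_le _ _

/-- The tuples of `m - 1` numbers with sum at most `N`. -/
def subTuples (m N : ℕ) : Finset (Fin (m - 1) → ℕ) :=
  (Fintype.piFinset fun _ => Finset.range (N + 1)).filter fun k => ∑ i, k i ≤ N

theorem mem_subTuples {N : ℕ} {k : Fin (m - 1) → ℕ} : k ∈ subTuples m N ↔ ∑ i, k i ≤ N := by
  rw [subTuples, Finset.mem_filter, and_iff_right_iff_imp]
  intro h
  rw [Fintype.mem_piFinset]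
  intro i
  rw [Finset.mem_range]
  have := Finset.single_le_sum (f := k) (fun _ _ => Nat.zero_le _) (Finset.mem_univ i)
  omega

theorem sum_piAntidiag_eq {E : Type*} [AddCommMonoid E] (hm : 1 ≤ m) (N : ℕ)
    (g : (Fin m → ℕ) → E) :
    ∑ i ∈ Finset.piAntidiag (Finset.univ : Finset (Fin m)) N, g i =
      ∑ k ∈ subTuples m N, g (natExt m N k) := by
  refine Finset.sum_nbij' (fun i (j : Fin (m - 1)) => i ⟨j, by omega⟩) (natExt m N)
    (fun i hi => ?_) (fun k hk => ?_) (fun i hi => ?_) (fun k hk => ?_) (fun i hi => ?_)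
  · have h := (Finset.mem_piAntidiag.1 hi).1
    rw [sum_fin_pred hm] at h
    exact mem_subTuples.2 (by omega)
  · rw [Finset.mem_piAntidiag]
    exact ⟨sum_natExt hm (mem_subTuples.1 hk), fun _ _ => Finset.mem_univ _⟩
  · have h := (Finset.mem_piAntidiag.1 hi).1
    rw [sum_fin_pred hm] at h
    funext j
    unfold natExt
    split_ifs with hj
    · rfl
    · have : j = ⟨m - 1, by omega⟩ := Fin.ext (by have := j.2; simp only; omega)
      rw [this]
      dsimp only
      omega
  · funext j
    simp [natExt]
  · congr 1
    have h := (Finset.mem_piAntidiag.1 hi).1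
    rw [sum_fin_pred hm] at h
    funext j
    unfold natExt
    split_ifs with hj
    · rfl
    · have : j = ⟨m - 1, by omega⟩ := Fin.ext (by have := j.2; simp only; omega)
      rw [this]
      dsimp only
      omega

theorem tendsto_pow_div_choose (M : ℕ) :
    Tendsto (fun n : ℕ => (n : ℝ) ^ M / n.choose M) atTop (𝓝 (M ! : ℝ)) := by
  have h := (isEquivalent_choose M).symm
  have h1 := (Asymptotics.isEquivalent_iff_tendsto_one (by
    filter_upwards [eventually_ge_atTop M] with n hn
    exact_mod_cast (Nat.choose_pos hn).ne')).1 h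
  have h2 := h1.mul_const (M ! : ℝ)
  rw [one_mul] at h2
  refine h2.congr fun n => ?_
  have : (M ! : ℝ) ≠ 0 := by exact_mod_cast M.factorial_ne_zero
  simp only [Pi.div_apply]
  field_simp

theorem tendsto_choose_div_pow (t : ℕ) {X : Type*} {l : Filter X} {i n : X → ℕ} {v : ℝ} (hv : 0 < v)
    (hn : Tendsto n l atTop) (h : Tendsto (fun x => (i x : ℝ) / n x) l (𝓝 v)) :
    Tendsto (fun x => ((i x).choose t : ℝ) / (n x : ℝ) ^ t) l (𝓝 (v ^ t / t !)) := by
  have hi := tendsto_atTop_of_tendsto_div hv hn h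
  have h1 := ((tendsto_pow_div_choose t).comp hi).inv₀ (by exact_mod_cast t.factorial_ne_zero)
  have h2 := h1.mul (h.pow t)
  rw [inv_mul_eq_div] at h2
  refine h2.congr' ?_
  filter_upwards [hi.eventually_ne_atTop 0] with n hn
  have : (i n : ℝ) ≠ 0 := by exact_mod_cast hn
  simp only [Function.comp_apply, inv_div]
  rw [div_pow]
  field_simp

/-- Since `C(i,t)` behaves like `i^t / t!`, the probability of one vector of block sizes, multiplied
by `N^(m-1)` (the inverse volume of a grid box), tends to the Dirichlet density. -/
theorem tendsto_split_density (hm : 1 ≤ m) {X : Type*} {l : Filter X} {N : X → ℕ}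
    (hN : Tendsto N l atTop) {I : X → Fin m → ℕ} {v : Fin m → ℝ}
    (hv : ∀ j, 0 < v j) (h : ∀ j, Tendsto (fun x => (I x j : ℝ) / N x) l (𝓝 (v j))) :
    Tendsto (fun x => (N x : ℝ) ^ (m - 1) * (((∏ j, (I x j).choose t : ℕ) : ℝ) /
      ((N x).choose (m * t + m - 1) : ℕ))) l
      (𝓝 (((m * t + m - 1)! : ℝ) / (t ! : ℝ) ^ m * (∏ j, v j) ^ t)) := by
  have h1 := (tendsto_finsetProd Finset.univ fun j _ =>
    tendsto_choose_div_pow t (hv j) hN (h j)).mul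
      ((tendsto_pow_div_choose (m * t + m - 1)).comp hN)
  have e : (∏ j, v j ^ t / (t ! : ℝ)) * ((m * t + m - 1)! : ℝ) =
      ((m * t + m - 1)! : ℝ) / (t ! : ℝ) ^ m * (∏ j, v j) ^ t := by
    rw [Finset.prod_div_distrib, Finset.prod_pow, Finset.prod_const, Finset.card_univ,
      Fintype.card_fin]
    ring
  rw [e] at h1
  refine h1.congr' ?_
  filter_upwards [hN.eventually_ne_atTop 0] with x hx
  have hn' : (N x : ℝ) ≠ 0 := by exact_mod_cast hx
  rw [Function.comp_apply, Finset.prod_div_distrib, Finset.prod_const, Finset.card_univ,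
    Fintype.card_fin, ← pow_mul,
    show m * t + m - 1 = t * m + (m - 1) by rw [mul_comm t m]; omega, pow_add]
  push_cast
  field_simp

theorem measurableEmbedding_simplexExt (hm : 1 ≤ m) : MeasurableEmbedding (simplexExt m) := by
  refine Continuous.measurableEmbedding ?_ fun s s' h => ?_
  · refine continuous_pi fun j => ?_
    unfold simplexExt
    split_ifs with hj <;> fun_prop
  · funext i
    have := congrFun h ⟨i, by omega⟩
    simpa [simplexExt] using this

theorem integral_dirichlet (hm : 1 ≤ m) (Φ : (Fin m → ℝ) → ℂ) :
    ∫ v, Φ v ∂(dirichlet m t) = ∫ s in {s | ∀ j, 0 ≤ simplexExt m s j},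
      (((m * t + m - 1)! : ℝ) / (t ! : ℝ) ^ m * (∏ j, simplexExt m s j) ^ t) •
        Φ (simplexExt m s) := by
  have hmeas : Measurable (simplexExt m) := (measurableEmbedding_simplexExt hm).measurable
  have hset : MeasurableSet {s | ∀ j, 0 ≤ simplexExt m s j} := by
    simp only [Set.ofPred_forall]
    exact MeasurableSet.iInter fun j =>
      measurableSet_le measurable_const ((measurable_pi_apply j).comp hmeas)
  -- The local `extend` in `dirichlet` unfolds to `simplexExt`, and `ENNReal.ofReal` to the coercion
  -- of `Real.toNNReal`.
  have hd : dirichlet m t = (((volume : Measure (Fin (m - 1) → ℝ)).restrict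
      {s | ∀ j, 0 ≤ simplexExt m s j}).withDensity fun s => ((Real.toNNReal
        ((((t + 1) * m - 1)! : ℝ) / (t ! : ℝ) ^ m * (∏ j, simplexExt m s j) ^ t) : ℝ≥0) :
          ℝ≥0∞)).map (simplexExt m) := rfl
  rw [hd, (measurableEmbedding_simplexExt hm).integral_map, integral_withDensity_eq_integral_smul]
  · refine setIntegral_congr_fun hset fun s hs => ?_
    have hM : (t + 1) * m - 1 = m * t + m - 1 := by congr 1; ring
    rw [hM, NNReal.smul_def, Real.coe_toNNReal]
    have := Finset.prod_nonneg fun j (_ : j ∈ Finset.univ) => hs j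
    positivity
  · refine Measurable.real_toNNReal ?_
    refine Measurable.const_mul (Measurable.pow_const ?_ _) _
    exact Finset.measurable_prod _ fun j _ => (measurable_pi_apply j).comp hmeas

/-- The box of side `1/n` with lower corner `k/n`. -/
def gridBox (m n : ℕ) (k : Fin (m - 1) → ℕ) : Set (Fin (m - 1) → ℝ) :=
  Set.pi Set.univ fun i => Set.Ico ((k i : ℝ) / n) ((k i + 1 : ℝ) / n)

theorem mem_gridBox {n : ℕ} (hn : 0 < n) {k : Fin (m - 1) → ℕ} {s : Fin (m - 1) → ℝ} :
    s ∈ gridBox m n k ↔ (∀ i, 0 ≤ s i) ∧ ∀ i, ⌊s i * n⌋₊ = k i := by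
  have hn' : (0 : ℝ) < n := by exact_mod_cast hn
  rw [← forall_and]
  simp only [gridBox, Set.mem_pi, Set.mem_univ, forall_const, Set.mem_Ico, div_le_iff₀ hn',
    lt_div_iff₀ hn']
  refine forall_congr' fun i => ⟨fun h => ?_, fun h => ?_⟩
  · have h0 : 0 ≤ s i := nonneg_of_mul_nonneg_left ((Nat.cast_nonneg _).trans h.1) hn'
    exact ⟨h0, (Nat.floor_eq_iff (by positivity)).2 h⟩
  · exact (Nat.floor_eq_iff (mul_nonneg h.1 hn'.le)).1 h.2

theorem volume_gridBox {n : ℕ} (hn : 0 < n) (k : Fin (m - 1) → ℕ) :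
    (volume : Measure (Fin (m - 1) → ℝ)).real (gridBox m n k) = ((n : ℝ) ^ (m - 1))⁻¹ := by
  have hn' : (0 : ℝ) < n := by exact_mod_cast hn
  rw [Measure.real, gridBox, Real.volume_pi_Ico_toReal]
  · have : ∀ i, ((k i + 1 : ℝ) / n) - (k i : ℝ) / n = (n : ℝ)⁻¹ := fun i => by
      field_simp; ring
    simp [this]
  · intro i
    dsimp only
    gcongr
    linarith

theorem measurableSet_gridBox (n : ℕ) (k : Fin (m - 1) → ℕ) : MeasurableSet (gridBox m n k) :=
  MeasurableSet.univ_pi fun _ => measurableSet_Ico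

/-- Coordinate hyperplanes and the hyperplane `∑ s = 1` are null sets. Off them a point of the
simplex has only positive coordinates, where the asymptotics of the binomial coefficients apply. -/
theorem ae_simplex_boundary :
    ∀ᵐ s : Fin (m - 1) → ℝ, (∀ i, s i ≠ 0) ∧ ∑ i, s i ≠ 1 := by
  have h1 : ∀ᵐ s : Fin (m - 1) → ℝ, ∀ i, s i ≠ 0 := by
    rw [ae_all_iff]
    exact fun i => Measure.ae_eval_ne (μ := fun _ => volume) i 0
  have h2 : ∀ᵐ s : Fin (m - 1) → ℝ, ∑ i, s i ≠ 1 := by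
    let A : AffineSubspace ℝ (Fin (m - 1) → ℝ) :=
      { carrier := {s | ∑ i, s i = 1}
        smul_vsub_vadd_mem' := by
          intro c p₁ p₂ p₃ h₁ h₂ h₃
          simp only [Set.mem_ofPred_eq] at h₁ h₂ h₃ ⊢
          simp [Finset.sum_add_distrib, ← Finset.mul_sum, h₁, h₂, h₃] }
    have hA : A ≠ ⊤ := by
      intro h
      have h3 : (0 : Fin (m - 1) → ℝ) ∈ A := h ▸ AffineSubspace.mem_top _ _ _
      have h4 : ∑ i, (0 : Fin (m - 1) → ℝ) i = 1 := h3
      simp at h4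
    have := Measure.addHaar_affineSubspace (volume : Measure (Fin (m - 1) → ℝ)) A hA
    rw [ae_iff]
    simp only [ne_eq, not_not]
    exact this
  filter_upwards [h1, h2] with s hs1 hs2 using ⟨hs1, hs2⟩

/-- The probability that the block sizes are given by `k`, for `n` keys. -/
noncomputable def splitProb (m t n : ℕ) (k : Fin (m - 1) → ℕ) : ℝ :=
  ((∏ j, (natExt m (n - (m - 1)) k j).choose t : ℕ) : ℝ) / (n.choose (m * t + m - 1) : ℕ)

theorem ev_splitLaw_eq_sum (hm : 2 ≤ m) (σ : SupplementaryRule m t) {n : ℕ}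
    (hn : m * t + m - 1 ≤ n) (hn' : m ≤ n) (g : (Fin m → ℕ) → ℂ) :
    ev (splitLaw σ n) g = ∑ k ∈ subTuples m (n - (m - 1)),
      splitProb m t n k • g (natExt m (n - (m - 1)) k) := by
  rw [ev_eq_sum (s := Finset.piAntidiag Finset.univ (n - (m - 1)))]
  · refine Eq.trans ?_ (sum_piAntidiag_eq (by omega) (n - (m - 1)) fun i =>
      (((∏ j, (i j).choose t : ℕ) : ℝ) / (n.choose (m * t + m - 1) : ℕ)) • g i)
    refine Finset.sum_congr rfl fun i hi => ?_
    rw [splitLaw_apply hm σ hn hn', if_pos (Finset.mem_piAntidiag.1 hi).1, ENNReal.toReal_div,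
      ENNReal.toReal_natCast, ENNReal.toReal_natCast]
  · intro i hi
    simpa using sum_of_mem_support_splitLaw hm hn' hi

/-- The step function on `ℝ^(m-1)` whose integral is the expectation of `g`. -/
noncomputable def splitStep (m t n : ℕ) (g : (Fin m → ℕ) → ℂ) (s : Fin (m - 1) → ℝ) : ℂ :=
  ∑ k ∈ subTuples m (n - (m - 1)), (gridBox m n k).indicator (fun _ =>
    ((n : ℝ) ^ (m - 1) * splitProb m t n k) • g (natExt m (n - (m - 1)) k)) s

theorem integral_splitStep (n : ℕ) (hn : 0 < n) (g : (Fin m → ℕ) → ℂ) :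
    ∫ s, splitStep m t n g s = ∑ k ∈ subTuples m (n - (m - 1)),
      splitProb m t n k • g (natExt m (n - (m - 1)) k) := by
  have hn' : (n : ℝ) ≠ 0 := by exact_mod_cast hn.ne'
  have hvol : ∀ k, volume (gridBox m n k) ≠ ⊤ := fun k h => by
    have := volume_gridBox (m := m) hn k
    rw [Measure.real, h, ENNReal.toReal_top] at this
    exact (inv_ne_zero (pow_ne_zero (m - 1) hn')) this.symm
  simp only [splitStep]
  rw [integral_finsetSum]
  · refine Finset.sum_congr rfl fun k _ => ?_
    rw [integral_indicator_const _ (measurableSet_gridBox n k), volume_gridBox hn, smul_smul,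
      ← mul_assoc, inv_mul_cancel₀ (pow_ne_zero _ hn'), one_mul]
  · exact fun k _ => (integrable_indicator_iff (measurableSet_gridBox n k)).2
      (integrableOn_const (hvol k))

theorem splitStep_eq {n : ℕ} (hn : 0 < n) (g : (Fin m → ℕ) → ℂ) (s : Fin (m - 1) → ℝ) :
    splitStep m t n g s =
      if (∀ i, 0 ≤ s i) ∧ ∑ i, ⌊s i * n⌋₊ ≤ n - (m - 1) then
        ((n : ℝ) ^ (m - 1) * splitProb m t n fun i => ⌊s i * n⌋₊) •
          g (natExt m (n - (m - 1)) fun i => ⌊s i * n⌋₊)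
      else 0 := by
  rw [splitStep]
  split_ifs with h
  · rw [Finset.sum_eq_single_of_mem (fun i => ⌊s i * n⌋₊) (mem_subTuples.2 h.2)]
    · rw [Set.indicator_of_mem ((mem_gridBox hn).2 ⟨h.1, fun _ => rfl⟩)]
    · intro k _ hk
      refine Set.indicator_of_notMem (fun hs => hk ?_) _
      exact funext fun i => (((mem_gridBox hn).1 hs).2 i).symm
  · refine Finset.sum_eq_zero fun k hk => Set.indicator_of_notMem (fun hs => h ?_) _
    obtain ⟨h1, h2⟩ := (mem_gridBox hn).1 hs
    refine ⟨h1, ?_⟩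
    simp only [h2]
    exact mem_subTuples.1 hk

theorem measurable_splitStep (n : ℕ) (g : (Fin m → ℕ) → ℂ) : Measurable (splitStep m t n g) :=
  Finset.measurable_sum _ fun k _ => measurable_const.indicator (measurableSet_gridBox n k)

/-- Supplies the dominating function: `C(i,t) ≤ n^t` bounds the step function on the unit cube by a
quotient that stays bounded as `n` grows. -/
theorem norm_splitStep_le (hm : 2 ≤ m) {n : ℕ} (hn : m * t + m - 1 ≤ n) {g : (Fin m → ℕ) → ℂ}
    (hg : ∀ I, ‖g I‖ ≤ 1) (s : Fin (m - 1) → ℝ) :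
    ‖splitStep m t n g s‖ ≤ (Set.Icc (0 : Fin (m - 1) → ℝ) 1).indicator
      (fun _ => (n : ℝ) ^ (m * t + m - 1) / n.choose (m * t + m - 1)) s := by
  have hn0 : 0 < n := by
    have : 0 ≤ m * t := Nat.zero_le _
    omega
  have hn' : (0 : ℝ) < n := by exact_mod_cast hn0
  rw [splitStep_eq hn0]
  split_ifs with h
  · rw [Set.indicator_of_mem, norm_smul]
    · have hp : splitProb m t n (fun i => ⌊s i * n⌋₊) ≤
          (n : ℝ) ^ (m * t) / n.choose (m * t + m - 1) := by
        rw [splitProb]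
        gcongr
        rw [← Nat.cast_pow]
        gcongr
        calc _ ≤ ∏ _j : Fin m, n ^ t := Finset.prod_le_prod' fun j _ =>
              (Nat.choose_le_choose t ((natExt_le h.2 j).trans (Nat.sub_le _ _))).trans
                (Nat.choose_le_pow n t)
          _ = n ^ (m * t) := by simp [← pow_mul, mul_comm]
      have hp0 : 0 ≤ splitProb m t n (fun i => ⌊s i * n⌋₊) := by rw [splitProb]; positivity
      rw [Real.norm_of_nonneg (by positivity)]
      calc _ ≤ (n : ℝ) ^ (m - 1) * ((n : ℝ) ^ (m * t) / n.choose (m * t + m - 1)) * 1 := by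
            gcongr
            exact hg _
        _ = _ := by
            rw [mul_one, mul_div_assoc', ← pow_add]
            congr 2
            omega
    · refine ⟨fun i => h.1 i, fun i => ?_⟩
      have h1 : ⌊s i * n⌋₊ ≤ n - (m - 1) :=
        (Finset.single_le_sum (f := fun i => ⌊s i * n⌋₊) (fun _ _ => Nat.zero_le _)
          (Finset.mem_univ i)).trans h.2
      have h2 : ⌊s i * n⌋₊ + 1 ≤ n := by omega
      have h3 := Nat.lt_floor_add_one (s i * n)
      have h4 : ((⌊s i * n⌋₊ : ℝ) + 1) ≤ n := by exact_mod_cast h2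
      have h5 : s i * n < 1 * n := by linarith
      exact (lt_of_mul_lt_mul_right h5 hn'.le).le
  · rw [norm_zero]
    exact Set.indicator_nonneg (fun _ _ => by positivity) _

/-- The hypothesis `h` is continuous convergence of `g x` to `Φ`; it is applied to the rounded
points `⌊s i * N x⌋₊`. An arbitrary filter `l` is allowed so that other arguments of `g` may vary
together with the number of keys. -/
theorem tendsto_splitStep (hm : 2 ≤ m) {X : Type*} {l : Filter X} {N : X → ℕ}
    (hN : Tendsto N l atTop) {g : X → (Fin m → ℕ) → ℂ} {Φ : (Fin m → ℝ) → ℂ}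
    (h : ∀ v : Fin m → ℝ, (∀ j, 0 < v j) → ∑ j, v j = 1 → ∀ I : X → Fin m → ℕ,
      (∀ j, Tendsto (fun x => (I x j : ℝ) / N x) l (𝓝 (v j))) →
      Tendsto (fun x => g x (I x)) l (𝓝 (Φ v))) {s : Fin (m - 1) → ℝ}
    (hs0 : ∀ i, s i ≠ 0) (hs1 : ∑ i, s i ≠ 1) :
    Tendsto (fun x => splitStep m t (N x) (g x) s) l
      (𝓝 ({s | ∀ j, 0 ≤ simplexExt m s j}.indicator (fun s =>
        (((m * t + m - 1)! : ℝ) / (t ! : ℝ) ^ m * (∏ j, simplexExt m s j) ^ t) •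
          Φ (simplexExt m s)) s)) := by
  have hlast : simplexExt m s ⟨m - 1, by omega⟩ = 1 - ∑ i, s i := by simp [simplexExt]
  have hfirst : ∀ i : Fin (m - 1), simplexExt m s ⟨i, by omega⟩ = s i := by simp [simplexExt]
  by_cases hs : ∀ j, 0 ≤ simplexExt m s j
  · rw [Set.indicator_of_mem (by exact hs)]
    have hspos : ∀ i, 0 < s i := fun i => lt_of_le_of_ne (hfirst i ▸ hs ⟨i, by omega⟩) (hs0 i).symm
    have hsum : ∑ i, s i < 1 := lt_of_le_of_ne (by
      have := hs ⟨m - 1, by omega⟩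
      rw [hlast] at this
      linarith) hs1
    have hv : ∀ j, 0 < simplexExt m s j := fun j => by
      unfold simplexExt
      split_ifs
      · exact hspos _
      · linarith
    set I : X → Fin m → ℕ := fun x => natExt m (N x - (m - 1)) fun i => ⌊s i * N x⌋₊ with hI
    have hsumle : ∀ᶠ n : ℕ in atTop, ∑ i, ⌊s i * n⌋₊ ≤ n - (m - 1) := by
      have h1 : Tendsto (fun n : ℕ => (1 - ∑ i, s i) * (n : ℝ)) atTop atTop :=
        tendsto_natCast_atTop_atTop.const_mul_atTop (by linarith)
      filter_upwards [h1.eventually_ge_atTop (m : ℝ), eventually_ge_atTop m] with n hn hnm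
      have h2 : (∑ i, (⌊s i * n⌋₊ : ℝ)) ≤ (∑ i, s i) * n := by
        rw [Finset.sum_mul]
        exact Finset.sum_le_sum fun i _ => Nat.floor_le (mul_nonneg (hspos i).le n.cast_nonneg)
      have h3 : (∑ i, (⌊s i * n⌋₊ : ℝ)) + m ≤ n := by linarith
      have h4 : (∑ i, ⌊s i * n⌋₊) + m ≤ n := by exact_mod_cast h3
      omega
    have hfl : ∀ i, Tendsto (fun x => (⌊s i * N x⌋₊ : ℝ) / N x) l (𝓝 (s i)) := fun i =>
      (tendsto_nat_floor_mul_div_atTop (hspos i).le).comp (tendsto_natCast_atTop_atTop.comp hN)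
    have hIlim : ∀ j, Tendsto (fun x => (I x j : ℝ) / N x) l (𝓝 (simplexExt m s j)) := by
      intro j
      simp only [hI, natExt, simplexExt]
      split_ifs with hj
      · exact hfl _
      · have h1 : Tendsto (fun x => 1 - ((m - 1 : ℕ) : ℝ) / N x - ∑ i, (⌊s i * N x⌋₊ : ℝ) / N x)
            l (𝓝 (1 - 0 - ∑ i, s i)) :=
          (tendsto_const_nhds.sub ((tendsto_const_div_atTop_nhds_zero_nat _).comp hN)).sub
            (tendsto_finsetSum _ fun i _ => hfl i)
        rw [sub_zero] at h1
        refine h1.congr' ?_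
        filter_upwards [hN.eventually hsumle, hN.eventually_ge_atTop m] with x hn hnm
        have hn' : (N x : ℝ) ≠ 0 := by exact_mod_cast (by omega : N x ≠ 0)
        rw [Nat.cast_sub hn, Nat.cast_sub (show m - 1 ≤ N x by omega), ← Finset.sum_div,
          Nat.cast_sum]
        field_simp
    have h1 := (tendsto_split_density (t := t) (by omega : 1 ≤ m) hN hv hIlim).smul
      (h _ hv (sum_simplexExt (by omega) s) I hIlim)
    refine h1.congr' ?_
    filter_upwards [hN.eventually hsumle, hN.eventually_gt_atTop 0] with x hn hn0
    rw [splitStep_eq hn0, if_pos ⟨fun i => (hspos i).le, hn⟩, splitProb]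
  · rw [Set.indicator_of_notMem (by exact hs)]
    refine tendsto_const_nhds.congr' ?_
    filter_upwards [hN.eventually_gt_atTop m] with x hn
    generalize N x = n at hn ⊢
    rw [splitStep_eq (by omega), if_neg]
    rintro ⟨h1, h2⟩
    refine hs fun j => ?_
    unfold simplexExt
    split_ifs
    · exact h1 _
    · have hn' : (0 : ℝ) < n := by exact_mod_cast (by omega : 0 < n)
      -- Rounding down loses at most 1 in each of the `m - 1` coordinates, which is exactly the
      -- slack in `n - (m - 1)`. So outside the simplex the step function vanishes.
      have h3 : (∑ i, s i) * n ≤ n := by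
        calc (∑ i, s i) * n ≤ ∑ i : Fin (m - 1), ((⌊s i * n⌋₊ : ℝ) + 1) := by
              rw [Finset.sum_mul]
              exact Finset.sum_le_sum fun i _ => (Nat.lt_floor_add_one _).le
          _ = ((∑ i, ⌊s i * n⌋₊ + (m - 1) : ℕ) : ℝ) := by
              rw [Finset.sum_add_distrib]
              simp
          _ ≤ n := by
              exact_mod_cast (by omega : ∑ i, ⌊s i * n⌋₊ + (m - 1) ≤ n)
      have h4 : ∑ i, s i ≤ 1 := le_of_mul_le_mul_right (by linarith) hn'
      linarith

/-- The block sizes, divided by `n`, converge in law to the Dirichlet distribution, in the strong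
form of a local limit theorem. -/
theorem tendsto_ev_splitLaw (hm : 2 ≤ m) (σ : SupplementaryRule m t)
    {X : Type*} {l : Filter X} [l.IsCountablyGenerated] {N : X → ℕ}
    (hN : Tendsto N l atTop) {g : X → (Fin m → ℕ) → ℂ} {Φ : (Fin m → ℝ) → ℂ} (hg : ∀ x I, ‖g x I‖ ≤ 1)
    (h : ∀ v : Fin m → ℝ, (∀ j, 0 < v j) → ∑ j, v j = 1 → ∀ I : X → Fin m → ℕ,
      (∀ j, Tendsto (fun x => (I x j : ℝ) / N x) l (𝓝 (v j))) →
      Tendsto (fun x => g x (I x)) l (𝓝 (Φ v))) :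
    Tendsto (fun x => ev (splitLaw σ (N x)) (g x)) l (𝓝 (∫ v, Φ v ∂(dirichlet m t))) := by
  set M := m * t + m - 1
  have hset : MeasurableSet {s | ∀ j, 0 ≤ simplexExt m s j} := by
    simp only [Set.ofPred_forall]
    exact MeasurableSet.iInter fun j => measurableSet_le measurable_const
      ((measurable_pi_apply j).comp (measurableEmbedding_simplexExt (by omega)).measurable)
  rw [integral_dirichlet (by omega), ← integral_indicator hset]
  have key : Tendsto (fun x => ∫ s, splitStep m t (N x) (g x) s) l
      (𝓝 (∫ s, {s | ∀ j, 0 ≤ simplexExt m s j}.indicator (fun s =>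
        (((m * t + m - 1)! : ℝ) / (t ! : ℝ) ^ m * (∏ j, simplexExt m s j) ^ t) •
          Φ (simplexExt m s)) s)) := by
    refine tendsto_integral_filter_of_dominated_convergence
      ((Set.Icc (0 : Fin (m - 1) → ℝ) 1).indicator fun _ => (M ! : ℝ) + 1)
      (Eventually.of_forall fun x => (measurable_splitStep (N x) (g x)).aestronglyMeasurable) ?_ ?_ ?_
    · filter_upwards [hN.eventually ((tendsto_pow_div_choose M).eventually_le_const (lt_add_one _)),
        hN.eventually_ge_atTop M] with x hn hnM
      refine Eventually.of_forall fun s => (norm_splitStep_le hm hnM (hg x) s).trans ?_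
      exact Set.indicator_le_indicator hn
    · exact (integrable_indicator_iff measurableSet_Icc).2
        (integrableOn_const (isCompact_Icc.measure_lt_top).ne)
    · filter_upwards [ae_simplex_boundary (m := m)] with s hs
      exact tendsto_splitStep hm hN h hs.1 hs.2
  refine key.congr' ?_
  filter_upwards [hN.eventually_ge_atTop M, hN.eventually_ge_atTop m] with x hn hnm
  rw [integral_splitStep (N x) (by omega), ev_splitLaw_eq_sum hm σ hn hnm]

/-- The local limit theorem for the constant 1 yields the total mass, so no Dirichlet integral has
to be evaluated. -/
theorem isProbabilityMeasure_dirichlet (hm : 2 ≤ m) (σ : SupplementaryRule m t) :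
    IsProbabilityMeasure (dirichlet m t) := by
  have h := tendsto_ev_splitLaw hm σ tendsto_id (g := fun _ _ => 1) (Φ := fun _ => 1) (by simp)
    (fun _ _ _ _ _ => tendsto_const_nhds)
  have h2 : Tendsto (fun n => ev (splitLaw σ n) fun _ => (1 : ℂ)) atTop (𝓝 1) := by
    refine tendsto_const_nhds.congr' ?_
    filter_upwards [eventually_ge_atTop m] with n hn
    rw [ev_const (finite_support_splitLaw hm hn)]
  have h3 := tendsto_nhds_unique h h2
  rw [integral_const, Complex.real_smul, mul_one] at h3
  have h4 : (dirichlet m t).real Set.univ = 1 := by exact_mod_cast h3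
  exact isProbabilityMeasure_iff_real.2 h4

/-! ### Characteristic functions of the profile polynomials at finitely many points -/

theorem norm_prod_sub_prod_le {ι : Type*} (s : Finset ι) {a b : ι → ℂ} (ha : ∀ i, ‖a i‖ ≤ 1)
    (hb : ∀ i, ‖b i‖ ≤ 1) : ‖∏ i ∈ s, a i - ∏ i ∈ s, b i‖ ≤ ∑ i ∈ s, ‖a i - b i‖ := by
  classical
  induction s using Finset.induction_on with
  | empty => simp
  | insert j s hj ih =>
    rw [Finset.prod_insert hj, Finset.prod_insert hj, Finset.sum_insert hj]
    have hbs : ‖∏ i ∈ s, b i‖ ≤ 1 := by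
      rw [norm_prod]
      exact Finset.prod_le_one (fun _ _ => norm_nonneg _) fun i _ => hb i
    calc _ = ‖a j * (∏ i ∈ s, a i - ∏ i ∈ s, b i) + (a j - b j) * ∏ i ∈ s, b i‖ := by
          congr 1; ring
      _ ≤ ‖a j‖ * ‖∏ i ∈ s, a i - ∏ i ∈ s, b i‖ + ‖a j - b j‖ * ‖∏ i ∈ s, b i‖ := by
          refine (norm_add_le _ _).trans ?_
          rw [norm_mul, norm_mul]
      _ ≤ 1 * (∑ i ∈ s, ‖a i - b i‖) + ‖a j - b j‖ * 1 := by
          gcongr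
          exact ha j
      _ = _ := by ring

/-- Interpolation between the bound of order `y²`, used for `|y| ≤ 1`, and the bound `2|y|`, used
for `|y| > 1`. -/
theorem norm_exp_mul_I_sub_le {s : ℝ} (hs : 1 ≤ s) (hs' : s ≤ 2) (y : ℝ) :
    ‖Complex.exp (y * Complex.I) - 1 - y * Complex.I‖ ≤ 2 * |y| ^ s := by
  have hn : ‖(y : ℂ) * Complex.I‖ = |y| := by simp
  by_cases hy : |y| ≤ 1
  · by_cases hy0 : |y| = 0
    · rw [abs_eq_zero.1 hy0]
      simp [Real.zero_rpow (by linarith : s ≠ 0)]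
    · have h1 : |y| ^ (2 : ℝ) ≤ |y| ^ s :=
        Real.rpow_le_rpow_of_exponent_ge (lt_of_le_of_ne (abs_nonneg _) (Ne.symm hy0)) hy hs'
      have h2 := Complex.norm_exp_sub_one_sub_id_le (x := (y : ℂ) * Complex.I) (by rwa [hn])
      rw [hn] at h2
      rw [Real.rpow_two] at h1
      have h3 : 0 ≤ |y| ^ s := by positivity
      linarith
  · have h1 : |y| ≤ |y| ^ s := by
      have := Real.rpow_le_rpow_of_exponent_le (not_le.1 hy).le hs
      rwa [Real.rpow_one] at this
    have h2 : ‖Complex.exp (y * Complex.I) - 1‖ ≤ |y| := by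
      have := Real.norm_exp_I_mul_ofReal_sub_one_le (x := y)
      rwa [mul_comm, Real.norm_eq_abs] at this
    have h3 := norm_sub_le (Complex.exp (y * Complex.I) - 1) (y * Complex.I)
    rw [hn] at h3
    linarith

/-- The moment exponent may differ from point to point. Bounding the sum by the number of terms
times the largest one allows that term to be raised to its own exponent. -/
theorem norm_exp_mul_I_sub_le_sum {ι : Type*} [Fintype ι] {s : ι → ℝ} (hs : ∀ i, 1 ≤ s i)
    (hs' : ∀ i, s i ≤ 2) {u : ι → ℝ} (hu : ∀ i, 0 ≤ u i) {y : ℝ} (hy : |y| ≤ ∑ i, u i) :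
    ‖Complex.exp (y * Complex.I) - 1 - y * Complex.I‖ ≤
      2 * (Fintype.card ι : ℝ) ^ 2 * ∑ i, u i ^ s i := by
  rcases isEmpty_or_nonempty ι with hι | hι
  · have : y = 0 := by simpa using hy
    subst this
    simp
  · obtain ⟨j, -, hj⟩ := Finset.exists_max_image (Finset.univ : Finset ι) u Finset.univ_nonempty
    set p : ℝ := (Fintype.card ι : ℝ) with hp
    have hp1 : 1 ≤ p := by
      rw [hp]
      exact_mod_cast Fintype.card_pos
    have h1 : |y| ≤ p * u j := by
      refine hy.trans ?_
      calc ∑ i, u i ≤ ∑ _i : ι, u j := Finset.sum_le_sum fun i hi => hj i hi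
        _ = p * u j := by simp [hp]
    calc _ ≤ 2 * |y| ^ s j := norm_exp_mul_I_sub_le (hs j) (hs' j) y
      _ ≤ 2 * (p * u j) ^ s j := by
          gcongr
          linarith [hs j]
      _ = 2 * (p ^ s j * u j ^ s j) := by rw [Real.mul_rpow (by positivity) (hu j)]
      _ ≤ 2 * (p ^ 2 * ∑ i, u i ^ s i) := by
          have e1 : p ^ s j ≤ p ^ 2 := by
            have := Real.rpow_le_rpow_of_exponent_le hp1 (hs' j)
            rwa [Real.rpow_two] at this
          have e2 : u j ^ s j ≤ ∑ i, u i ^ s i :=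
            Finset.single_le_sum (f := fun i => u i ^ s i)
              (fun i _ => Real.rpow_nonneg (hu i) _) (Finset.mem_univ j)
          have e3 := Real.rpow_nonneg (hu j) (s j)
          gcongr
      _ = _ := by ring

theorem ev_independentLaw_prod {α : Type} {k : ℕ} {p : Fin k → PMF α}
    (hp : ∀ i, (p i).support.Finite) (f : Fin k → α → ℂ) :
    (ev (independentLaw p) fun g => ∏ i, f i (g i)) = ∏ i, ev (p i) (f i) := by
  induction k with
  | zero => rw [independentLaw, ev_pure]; simp
  | succ k ih =>
    rw [ev_independentLaw_succ hp, Fin.prod_univ_succ, mul_comm, ← ev_mul_left (hp 0)]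
    refine ev_congr fun a _ => ?_
    simp only [Fin.prod_univ_succ, Fin.cons_zero, Fin.cons_succ]
    rw [ev_mul_left (finite_support_independentLaw fun i => hp i.succ),
      ih (fun i => hp i.succ), mul_comm]

section Phase
variable {ι : Type*} [Fintype ι]

/-- The character `exp(i Re ∑ ξᵢ xᵢ)` of `ℂ^ι`. -/
noncomputable def phase (ξ x : ι → ℂ) : ℂ := Complex.exp (((∑ i, ξ i * x i).re : ℝ) * Complex.I)

theorem norm_phase (ξ x : ι → ℂ) : ‖phase ξ x‖ = 1 := Complex.norm_exp_ofReal_mul_I _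

theorem phase_add (ξ x y : ι → ℂ) : phase ξ (x + y) = phase ξ x * phase ξ y := by
  rw [phase, phase, phase, ← Complex.exp_add, ← add_mul, ← Complex.ofReal_add, ← Complex.add_re,
    ← Finset.sum_add_distrib]
  simp [mul_add]

theorem phase_zero (ξ : ι → ℂ) : phase ξ 0 = 1 := by simp [phase]

theorem phase_sum {κ : Type*} (s : Finset κ) (ξ : ι → ℂ) (x : κ → ι → ℂ) :
    phase ξ (∑ j ∈ s, x j) = ∏ j ∈ s, phase ξ (x j) := by
  classical
  induction s using Finset.induction_on with
  | empty => simp [phase_zero]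
  | insert j s hj ih => rw [Finset.sum_insert hj, Finset.prod_insert hj, phase_add, ih]

theorem phase_mul (ξ z x : ι → ℂ) : phase ξ (z * x) = phase (ξ * z) x := by
  simp [phase, mul_assoc]

theorem continuous_phase : Continuous fun p : (ι → ℂ) × (ι → ℂ) => phase p.1 p.2 := by
  unfold phase
  fun_prop

end Phase

section ApproxChar

variable {ι : Type*} [Fintype ι]

/-- The characteristic function of `(Wₙ(zᵢ))ᵢ`. -/
noncomputable def profileChar (σ : SupplementaryRule m t) (z : ι → ℂ) (n : ℕ) (ξ : ι → ℂ) : ℂ :=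
  ev (polyLaw σ n) fun p => phase ξ fun i => p.eval (z i)

/-- The operator on characteristic functions given by the splitting of the root. -/
noncomputable def splitChar (σ : SupplementaryRule m t) (z : ι → ℂ) (g : ℕ → (ι → ℂ) → ℂ) (n : ℕ)
    (ξ : ι → ℂ) : ℂ :=
  ev (splitLaw σ n) fun I => phase ξ (fun _ => ((m - 1 : ℕ) : ℂ)) * ∏ j, g (I j) (ξ * z)

theorem norm_ev_le_of_norm_le {α : Type} {p : PMF α} (hp : p.support.Finite) {f : α → ℂ} {c : ℝ}
    (h : ∀ a ∈ p.support, ‖f a‖ ≤ c) : ‖ev p f‖ ≤ c :=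
  (norm_ev_le hp f).trans ((ev_mono hp h).trans_eq (ev_const hp c))

theorem norm_profileChar_le (hm : 2 ≤ m) (σ : SupplementaryRule m t) (z : ι → ℂ) (n : ℕ)
    (ξ : ι → ℂ) : ‖profileChar σ z n ξ‖ ≤ 1 :=
  norm_ev_le_of_norm_le (finite_support_polyLaw hm σ n) fun _ _ => (norm_phase _ _).le

theorem norm_splitTerm_le {g : ℕ → (ι → ℂ) → ℂ} (hg : ∀ n ξ, ‖g n ξ‖ ≤ 1) (z ξ : ι → ℂ)
    (I : Fin m → ℕ) :
    ‖phase ξ (fun _ => ((m - 1 : ℕ) : ℂ)) * ∏ j, g (I j) (ξ * z)‖ ≤ 1 := by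
  rw [norm_mul, norm_phase, one_mul, norm_prod]
  exact Finset.prod_le_one (fun _ _ => norm_nonneg _) fun j _ => hg _ _

theorem profileChar_eq (hm : 2 ≤ m) (σ : SupplementaryRule m t) (z : ι → ℂ) {n : ℕ} (hn : m ≤ n)
    (ξ : ι → ℂ) : profileChar σ z n ξ = splitChar σ z (profileChar σ z) n ξ := by
  have hp := finite_support_polyLaw hm σ
  rw [profileChar, ev_polyLaw_eq hm σ hn, splitChar]
  refine ev_congr fun I _ => ?_
  simp only [profileChar]
  rw [← ev_independentLaw_prod fun j => hp (I j),
    ← ev_mul_left (finite_support_independentLaw fun j => hp (I j))]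
  refine ev_congr fun g _ => ?_
  have : (fun i => (joinPoly m g).eval (z i)) =
      (fun _ => ((m - 1 : ℕ) : ℂ)) + z * ∑ j, fun i => (g j).eval (z i) := by
    funext i
    simp [eval_joinPoly, Finset.sum_apply]
  rw [this, phase_add, phase_mul, phase_sum]

/-- The number of keys from which on the pivots follow the regular rule. -/
def regularSize (m t : ℕ) : ℕ := max (m * t + m - 1) m

/-- The iterative approximations of `profileChar`. -/
noncomputable def approxChar (σ : SupplementaryRule m t) (z : ι → ℂ) : ℕ → ℕ → (ι → ℂ) → ℂ
  -- Level 0 replaces the random polynomial by its mean. Each further level performs one true split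
  -- of the root, and below `regularSize` the exact function is kept, so no error arises there.
  | 0, n, ξ => phase ξ fun i => (meanPoly σ n).eval (z i)
  | k + 1, n, ξ =>
    if n < regularSize m t then profileChar σ z n ξ else splitChar σ z (approxChar σ z k) n ξ

theorem le_of_regularSize_le {n : ℕ} (hn : regularSize m t ≤ n) : m * t + m - 1 ≤ n ∧ m ≤ n :=
  ⟨(le_max_left _ _).trans hn, (le_max_right _ _).trans hn⟩

theorem norm_approxChar_le (hm : 2 ≤ m) (σ : SupplementaryRule m t) (z : ι → ℂ) (k n : ℕ)
    (ξ : ι → ℂ) : ‖approxChar σ z k n ξ‖ ≤ 1 := by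
  induction k generalizing n ξ with
  | zero => exact (norm_phase _ _).le
  | succ k ih =>
    rw [approxChar]
    split_ifs with h
    · exact norm_profileChar_le hm σ z n ξ
    · exact norm_ev_le_of_norm_le
        (finite_support_splitLaw hm (le_of_regularSize_le (not_lt.1 h)).2)
        fun I _ => norm_splitTerm_le ih z ξ I

/-- After the phase of the mean is factored out, the linear term of the exponential has expectation
zero, and the remainder is controlled by the `s i`-th moments. -/
theorem norm_profileChar_sub_approxChar_zero_le (hm : 2 ≤ m) (σ : SupplementaryRule m t)
    {z : ι → ℂ} {s K : ι → ℝ} (hs : ∀ i, 1 < s i) (hs' : ∀ i, s i ≤ 2) {w : ι → ℕ → ℝ} {n : ℕ}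
    (hK : ∀ i, (ev (polyLaw σ n) fun p => ‖p.eval (z i) - (meanPoly σ n).eval (z i)‖ ^ s i) ≤
      K i * w i n) (ξ : ι → ℂ) :
    ‖profileChar σ z n ξ - approxChar σ z 0 n ξ‖ ≤
      ∑ i, 2 * (Fintype.card ι : ℝ) ^ 2 * K i * w i n * ‖ξ i‖ ^ s i := by
  have hp := finite_support_polyLaw hm σ n
  set G : ι → ℂ := fun i => (meanPoly σ n).eval (z i) with hG
  set D : ℂ[X] → ℝ := fun p => (∑ i, ξ i * (p.eval (z i) - G i)).re with hD
  have hD0 : ev (polyLaw σ n) D = 0 := by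
    have h1 : (ev (polyLaw σ n) fun p => ∑ i, ξ i * (p.eval (z i) - G i)) = 0 := by
      rw [ev_sum hp]
      refine Finset.sum_eq_zero fun i _ => ?_
      rw [ev_mul_left hp, ev_polyLaw_sub hm, mul_zero]
    have h2 := ev_linear hp Complex.reLm fun p : ℂ[X] => ∑ i, ξ i * (p.eval (z i) - G i)
    rw [h1, map_zero] at h2
    exact h2
  have e1 : ∀ p : ℂ[X], (phase ξ fun i => p.eval (z i)) =
      phase ξ G * Complex.exp (D p * Complex.I) := by
    intro p
    have : (fun i => p.eval (z i)) = G + fun i => p.eval (z i) - G i := by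
      funext i
      simp
    rw [this, phase_add]
    rfl
  have e2 : profileChar σ z n ξ - approxChar σ z 0 n ξ = phase ξ G *
      ev (polyLaw σ n) fun p => Complex.exp (D p * Complex.I) - 1 - D p * Complex.I := by
    have e0 : approxChar σ z 0 n ξ = phase ξ G := rfl
    rw [profileChar, e0]
    simp only [e1]
    rw [ev_mul_left hp, ev_sub hp, ev_sub hp, ev_const hp]
    have h3 : (ev (polyLaw σ n) fun p => (D p : ℂ) * Complex.I) = 0 := by
      simp only [mul_comm _ Complex.I]
      rw [ev_mul_left hp]
      have h4 := ev_linear hp Complex.ofRealAm.toLinearMap D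
      rw [hD0, map_zero] at h4
      have h5 : (ev (polyLaw σ n) fun p => (D p : ℂ)) = 0 := h4
      rw [h5, mul_zero]
    rw [h3]
    ring
  rw [e2, norm_mul, norm_phase, one_mul]
  refine (norm_ev_le hp _).trans ?_
  calc _ ≤ ev (polyLaw σ n) fun p => 2 * (Fintype.card ι : ℝ) ^ 2 *
        ∑ i, ‖ξ i‖ ^ s i * ‖p.eval (z i) - G i‖ ^ s i := by
        refine ev_mono hp fun p _ => ?_
        refine (norm_exp_mul_I_sub_le_sum (s := s) (fun i => (hs i).le) hs'
          (u := fun i => ‖ξ i‖ * ‖p.eval (z i) - G i‖) (fun i => by positivity) ?_).trans_eq ?_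
        · refine (Complex.abs_re_le_norm _).trans ((norm_sum_le _ _).trans_eq ?_)
          simp
        · congr 1
          refine Finset.sum_congr rfl fun i _ => ?_
          rw [Real.mul_rpow (norm_nonneg _) (norm_nonneg _)]
    _ = 2 * (Fintype.card ι : ℝ) ^ 2 * ∑ i, ‖ξ i‖ ^ s i *
        ev (polyLaw σ n) fun p => ‖p.eval (z i) - G i‖ ^ s i := by
        rw [ev_mul_left hp (2 * (Fintype.card ι : ℝ) ^ 2)
          fun p : ℂ[X] => ∑ i, ‖ξ i‖ ^ s i * ‖p.eval (z i) - G i‖ ^ s i, ev_sum hp]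
        congr 1
        exact Finset.sum_congr rfl fun i _ => ev_mul_left hp _ _
    _ ≤ 2 * (Fintype.card ι : ℝ) ^ 2 * ∑ i, ‖ξ i‖ ^ s i * (K i * w i n) := by
        gcongr with i
        exact hK i
    _ = _ := by
        rw [Finset.mul_sum]
        exact Finset.sum_congr rfl fun i _ => by ring

/-- A product of numbers of norm at most 1 changes by at most the sum of the changes of its factors.
One split therefore turns the error weight `w i n` into `‖z i‖^(s i) 𝔼 ∑ w i (Iⱼ) ≤ q i * w i n`,
which gives geometric decay in `k`. -/
theorem norm_profileChar_sub_approxChar_le (hm : 2 ≤ m) (σ : SupplementaryRule m t) {z : ι → ℂ}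
    {s K q : ι → ℝ} (hs : ∀ i, 1 < s i) (hs' : ∀ i, s i ≤ 2) (hq0 : ∀ i, 0 ≤ q i)
    (hK0 : ∀ i, 0 ≤ K i) {w : ι → ℕ → ℝ} (hw : ∀ i n, 0 ≤ w i n)
    (hK : ∀ n i, (ev (polyLaw σ n) fun p => ‖p.eval (z i) - (meanPoly σ n).eval (z i)‖ ^ s i) ≤
      K i * w i n)
    (hq : ∀ i n, regularSize m t ≤ n →
      ‖z i‖ ^ s i * (ev (splitLaw σ n) fun I => ∑ j, w i (I j)) ≤ q i * w i n) (k n : ℕ)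
    (ξ : ι → ℂ) :
    ‖profileChar σ z n ξ - approxChar σ z k n ξ‖ ≤
      ∑ i, 2 * (Fintype.card ι : ℝ) ^ 2 * K i * q i ^ k * w i n * ‖ξ i‖ ^ s i := by
  induction k generalizing n ξ with
  | zero => simpa using norm_profileChar_sub_approxChar_zero_le hm σ hs hs' (hK n) ξ
  | succ k ih =>
    set A := 2 * (Fintype.card ι : ℝ) ^ 2 with hA
    have hA0 : 0 ≤ A := by positivity
    rw [approxChar]
    split_ifs with h
    · rw [sub_self, norm_zero]
      refine Finset.sum_nonneg fun i _ => ?_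
      have := hK0 i
      have := hq0 i
      have := hw i n
      positivity
    · have hnN := not_lt.1 h
      have hnm := (le_of_regularSize_le hnN).2
      have hfin := finite_support_splitLaw (σ := σ) hm hnm
      rw [profileChar_eq hm σ z hnm, splitChar, splitChar, ← ev_sub hfin]
      refine (norm_ev_le hfin _).trans ?_
      calc _ ≤ ev (splitLaw σ n) fun I =>
            ∑ i, A * K i * q i ^ k * ‖ξ i‖ ^ s i * (‖z i‖ ^ s i * ∑ j, w i (I j)) := by
            refine ev_mono hfin fun I _ => ?_
            rw [← mul_sub, norm_mul, norm_phase, one_mul]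
            refine (norm_prod_sub_prod_le _ (fun j => norm_profileChar_le hm σ z _ _)
              fun j => norm_approxChar_le hm σ z _ _ _).trans ?_
            refine (Finset.sum_le_sum fun j _ => ih (I j) (ξ * z)).trans_eq ?_
            rw [Finset.sum_comm]
            refine Finset.sum_congr rfl fun i _ => ?_
            rw [Finset.mul_sum, Finset.mul_sum]
            refine Finset.sum_congr rfl fun j _ => ?_
            rw [Pi.mul_apply, norm_mul, Real.mul_rpow (norm_nonneg _) (norm_nonneg _)]
            ring
        _ = ∑ i, A * K i * q i ^ k * ‖ξ i‖ ^ s i *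
              (‖z i‖ ^ s i * ev (splitLaw σ n) fun I => ∑ j, w i (I j)) := by
            rw [ev_sum hfin]
            refine Finset.sum_congr rfl fun i _ => ?_
            rw [ev_mul_left hfin (A * K i * q i ^ k * ‖ξ i‖ ^ s i)
              fun I => ‖z i‖ ^ s i * ∑ j, w i (I j),
              ev_mul_left hfin (‖z i‖ ^ s i) fun I => ∑ j, w i (I j)]
        _ ≤ ∑ i, A * K i * q i ^ k * ‖ξ i‖ ^ s i * (q i * w i n) := by
            refine Finset.sum_le_sum fun i _ => mul_le_mul_of_nonneg_left (hq i n hnN) ?_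
            have := hK0 i
            have := hq0 i
            positivity
        _ = _ := Finset.sum_congr rfl fun i _ => by ring

end ApproxChar

/-! ### Limits of the normalized characteristic functions. -/

section CharLimit

variable {ι : Type*}

/-- The point `z` satisfies `IsGood` for some constants. -/
def IsGoodAt (σ : SupplementaryRule m t) (z : ℂ) : Prop :=
  ∃ s q c K : ℝ, 1 < s ∧ s ≤ 2 ∧ 0 ≤ q ∧ q < 1 ∧ 0 < c ∧ 0 ≤ K ∧ IsGood σ s q c K z

theorem isGoodAt_of_mem_goodSet {σ : SupplementaryRule m t} {z : ℂ} (hz : z ∈ goodSet σ) :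
    IsGoodAt σ z := by
  obtain ⟨r, hr, s, q, c, K, h1, h2, h3, h4, h5, h7, h⟩ := hz
  exact ⟨s, q, c, K, h1, h2, h3, h4, h5, h7, h z (Metric.mem_ball_self hr)⟩

theorem IsGood.momentExp_pos {σ : SupplementaryRule m t} {s q c K : ℝ} {z : ℂ} (hs : 0 ≤ s)
    (h : IsGood σ s q c K z) : 0 < momentExp m t s z := by
  have := mul_nonneg hs (sub_nonneg.2 h.one_lt_re.le)
  rw [momentExp]
  linarith

theorem IsGood.mean_ne_zero {σ : SupplementaryRule m t} {s q c K : ℝ} {z : ℂ} (hc : 0 < c)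
    (h : IsGood σ s q c K z) {n : ℕ} (hn : 1 ≤ n) : (meanPoly σ n).eval z ≠ 0 := by
  rw [← norm_pos_iff]
  refine lt_of_lt_of_le (mul_pos hc (rise_pos ?_ n)) (h.lower n hn)
  linarith [h.one_lt_re]

theorem IsGoodAt.mean_ne_zero {σ : SupplementaryRule m t} {z : ℂ} (h : IsGoodAt σ z) {n : ℕ}
    (hn : 1 ≤ n) : (meanPoly σ n).eval z ≠ 0 := by
  obtain ⟨s, q, c, K, h1, h2, h3, h4, h5, h7, h⟩ := h
  exact h.mean_ne_zero h5 hn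

/-- The moment weight grows no faster than the `s`-th power of the mean: use `rise_le_rise_rpow` and
the lower bound for the mean. Hence normalized moments stay bounded in `n`. -/
theorem IsGood.weight_mul_inv_mean_le {σ : SupplementaryRule m t} {s q c K : ℝ} {z : ℂ}
    (hs : 1 ≤ s) (hc : 0 < c) (h : IsGood σ s q c K z) {n : ℕ} (hn : 1 ≤ n) :
    rise (momentExp m t s z) n * ‖((meanPoly σ n).eval z)⁻¹‖ ^ s ≤ c⁻¹ ^ s := by
  have h1 := h.one_lt_re
  have hr := rise_pos (by linarith : 0 < (dominantRoot m t z).re) n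
  have h0 : 0 < ‖(meanPoly σ n).eval z‖ := norm_pos_iff.2 (h.mean_ne_zero hc hn)
  calc _ ≤ rise (dominantRoot m t z).re n ^ s * ‖((meanPoly σ n).eval z)⁻¹‖ ^ s := by
        gcongr
        exact rise_le_rise_rpow h1.le hs n
    _ = (rise (dominantRoot m t z).re n * ‖((meanPoly σ n).eval z)⁻¹‖) ^ s :=
        (Real.mul_rpow hr.le (norm_nonneg _)).symm
    _ ≤ c⁻¹ ^ s := by
        gcongr
        rw [norm_inv, ← div_eq_mul_inv, div_le_iff₀ h0, ← div_eq_inv_mul, le_div_iff₀ hc, mul_comm]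
        exact h.lower n hn

theorem IsGoodAt.tendsto_inv_mean {σ : SupplementaryRule m t} {z : ℂ} (h : IsGoodAt σ z) :
    Tendsto (fun n => ((meanPoly σ n).eval z)⁻¹) atTop (𝓝 0) := by
  obtain ⟨s, q, c, K, h1, h2, h3, h4, h5, h7, h⟩ := h
  have hlim := (tendsto_rise_div_rise_zero one_pos h.one_lt_re).const_mul c⁻¹
  rw [mul_zero] at hlim
  refine squeeze_zero_norm' ?_ hlim
  filter_upwards [eventually_ge_atTop 1] with n hn
  have h6 := h.lower n hn
  have hr := rise_pos (by linarith [h.one_lt_re] : 0 < (dominantRoot m t z).re) n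
  rw [norm_inv, rise_one, one_div, ← mul_inv]
  gcongr

/-- The leading constant `e` cancels, which leaves a ratio of rising factorials; this is where the
exponent `λ₁(z) - 1` in the fixed-point equation comes from. -/
theorem IsGoodAt.tendsto_mean_ratio {σ : SupplementaryRule m t} {z : ℂ} (h : IsGoodAt σ z)
    {X : Type*} {l : Filter X} {i n : X → ℕ} {v : ℝ} (hv : 0 < v) (hn : Tendsto n l atTop)
    (hi : Tendsto (fun x => (i x : ℝ) / n x) l (𝓝 v)) :
    Tendsto (fun x => (meanPoly σ (i x)).eval z * ((meanPoly σ (n x)).eval z)⁻¹) l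
      (𝓝 ((v : ℂ) ^ (dominantRoot m t z - 1))) := by
  obtain ⟨s, q, c, K, h1, h2, h3, h4, h5, h7, h⟩ := h
  obtain ⟨e, he, hlim⟩ := h.limit
  have hre : 0 < (dominantRoot m t z).re := by linarith [h.one_lt_re]
  have h6 := ((hlim.comp (tendsto_atTop_of_tendsto_div hv hn hi)).mul
    (tendsto_rise_div_rise hre hv hn hi)).mul ((hlim.comp hn).inv₀ he)
  have e1 : e * (v : ℂ) ^ (dominantRoot m t z - 1) * e⁻¹ = (v : ℂ) ^ (dominantRoot m t z - 1) := by
    field_simp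
  rw [e1] at h6
  refine h6.congr fun x => ?_
  have hr1 := rise_ne_zero hre (i x)
  have hr2 := rise_ne_zero hre (n x)
  simp only [Function.comp_apply, inv_div]
  field_simp

/-- The vector of the normalizing constants `1 / 𝔼 Wₙ(zᵢ)`. -/
noncomputable def invMean (σ : SupplementaryRule m t) (z : ι → ℂ) (n : ℕ) : ι → ℂ :=
  fun i => ((meanPoly σ n).eval (z i))⁻¹

/-- The coefficients `zᵢ v^(λ₁(zᵢ) - 1)` of the limiting equation. -/
noncomputable def limitCoef (m t : ℕ) (z : ι → ℂ) (v : ℝ) : ι → ℂ :=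
  fun i => z i * (v : ℂ) ^ (dominantRoot m t (z i) - 1)

/-- The normalized functions `g n` converge to `ψ`, locally uniformly. -/
def HasCharLimit (σ : SupplementaryRule m t) (z : ι → ℂ) (g : ℕ → (ι → ℂ) → ℂ)
    (ψ : (ι → ℂ) → ℂ) : Prop :=
  ∀ η, Tendsto (fun p : ℕ × (ι → ℂ) => g p.1 (p.2 * invMean σ z p.1)) (atTop ×ˢ 𝓝 η) (𝓝 (ψ η))

theorem HasCharLimit.congr {σ : SupplementaryRule m t} {z : ι → ℂ} {g g' : ℕ → (ι → ℂ) → ℂ}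
    {ψ : (ι → ℂ) → ℂ} (h : HasCharLimit σ z g ψ) {N : ℕ} (hg : ∀ n, N ≤ n → g n = g' n) :
    HasCharLimit σ z g' ψ := by
  intro η
  refine (h η).congr' ?_
  filter_upwards [(tendsto_fst : Tendsto Prod.fst (atTop ×ˢ 𝓝 η : Filter (ℕ × (ι → ℂ)))
    atTop).eventually_ge_atTop N] with x hx
  rw [hg _ hx]

theorem HasCharLimit.tendsto {σ : SupplementaryRule m t} {z : ι → ℂ} {g : ℕ → (ι → ℂ) → ℂ}
    {ψ : (ι → ℂ) → ℂ} (h : HasCharLimit σ z g ψ) (η : ι → ℂ) :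
    Tendsto (fun n => g n (η * invMean σ z n)) atTop (𝓝 (ψ η)) :=
  (h η).comp (tendsto_id.prodMk tendsto_const_nhds)

variable [Fintype ι]

/-- In block `j` the argument is `η z (𝔼 W_{Iⱼ} / 𝔼 Wₙ)` times the normalization for `Iⱼ`, and the
first factor tends to `η * limitCoef`. Since it moves with `n`, convergence jointly in `n` and `η`
is needed, as the product filter in `HasCharLimit` provides. The contribution of the `m - 1` root
keys disappears because the mean tends to infinity. -/
theorem HasCharLimit.splitChar (hm : 2 ≤ m) {σ : SupplementaryRule m t} {z : ι → ℂ}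
    (hz : ∀ i, IsGoodAt σ (z i)) {g : ℕ → (ι → ℂ) → ℂ} (hg : ∀ n ξ, ‖g n ξ‖ ≤ 1)
    {ψ : (ι → ℂ) → ℂ} (h : HasCharLimit σ z g ψ) :
    HasCharLimit σ z (splitChar σ z g)
      fun η => ∫ v, ∏ j, ψ (η * limitCoef m t z (v j)) ∂(dirichlet m t) := by
  intro η
  have hN : Tendsto Prod.fst (atTop ×ˢ 𝓝 η : Filter (ℕ × (ι → ℂ))) atTop := tendsto_fst
  have hη : Tendsto Prod.snd (atTop ×ˢ 𝓝 η : Filter (ℕ × (ι → ℂ))) (𝓝 η) := tendsto_snd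
  refine tendsto_ev_splitLaw hm σ hN (fun x I => norm_splitTerm_le hg z _ I)
    fun v hv _ I hI => ?_
  have hinv : Tendsto (fun x : ℕ × (ι → ℂ) => x.2 * invMean σ z x.1) (atTop ×ˢ 𝓝 η) (𝓝 0) := by
    have h1 : Tendsto (fun x : ℕ × (ι → ℂ) => invMean σ z x.1) (atTop ×ˢ 𝓝 η) (𝓝 0) :=
      tendsto_pi_nhds.2 fun i => (hz i).tendsto_inv_mean.comp hN
    simpa using hη.mul h1
  have hphase : Tendsto (fun x : ℕ × (ι → ℂ) => phase (x.2 * invMean σ z x.1)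
      fun _ => ((m - 1 : ℕ) : ℂ)) (atTop ×ˢ 𝓝 η) (𝓝 1) := by
    have h1 := (continuous_phase.tendsto ((0 : ι → ℂ), fun _ => ((m - 1 : ℕ) : ℂ))).comp
      (hinv.prodMk_nhds tendsto_const_nhds)
    have h2 : phase (0 : ι → ℂ) (fun _ => ((m - 1 : ℕ) : ℂ)) = 1 := by simp [phase]
    rwa [h2] at h1
  rw [← one_mul (∏ j, ψ (η * limitCoef m t z (v j)))]
  refine hphase.mul (tendsto_finsetProd _ fun j _ => ?_)
  have hIj := tendsto_atTop_of_tendsto_div (hv j) hN (hI j)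
  have hcoef : Tendsto (fun x : ℕ × (ι → ℂ) => x.2 *
      fun i => z i * ((meanPoly σ (I x j)).eval (z i) * ((meanPoly σ x.1).eval (z i))⁻¹))
      (atTop ×ˢ 𝓝 η) (𝓝 (η * limitCoef m t z (v j))) :=
    hη.mul (tendsto_pi_nhds.2 fun i =>
      ((hz i).tendsto_mean_ratio (hv j) hN (hI j)).const_mul (z i))
  refine ((h (η * limitCoef m t z (v j))).comp (hIj.prodMk hcoef)).congr' ?_
  filter_upwards [hIj.eventually_ge_atTop 1] with x hx
  simp only [Function.comp_apply]
  congr 1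
  funext i
  have := (hz i).mean_ne_zero hx
  simp only [Pi.mul_apply, invMean]
  field_simp

theorem exists_hasCharLimit_approxChar (hm : 2 ≤ m) {σ : SupplementaryRule m t} {z : ι → ℂ}
    (hz : ∀ i, IsGoodAt σ (z i)) (k : ℕ) : ∃ ψ, HasCharLimit σ z (approxChar σ z k) ψ := by
  induction k with
  | zero =>
    refine ⟨fun η => phase η fun _ => (1 : ℂ), fun η => ?_⟩
    have hc : Continuous fun η : ι → ℂ => phase η fun _ => (1 : ℂ) :=
      continuous_phase.comp (continuous_id.prodMk continuous_const)
    have h1 : Tendsto (fun x : ℕ × (ι → ℂ) => phase x.2 fun _ => (1 : ℂ)) (atTop ×ˢ 𝓝 η)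
        (𝓝 (phase η fun _ => (1 : ℂ))) := (hc.tendsto η).comp tendsto_snd
    refine h1.congr' ?_
    filter_upwards [(tendsto_fst : Tendsto Prod.fst (atTop ×ˢ 𝓝 η : Filter (ℕ × (ι → ℂ)))
      atTop).eventually_ge_atTop 1] with x hx
    have e : ∑ i, x.2 i * 1 = ∑ i, (x.2 * invMean σ z x.1) i * (meanPoly σ x.1).eval (z i) := by
      refine Finset.sum_congr rfl fun i _ => ?_
      have := (hz i).mean_ne_zero hx
      simp only [Pi.mul_apply, invMean]
      field_simp
    simp only [approxChar, phase]
    rw [e]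
  | succ k ih =>
    obtain ⟨ψ, hψ⟩ := ih
    refine ⟨_, (hψ.splitChar hm hz (norm_approxChar_le hm σ z k)).congr (N := regularSize m t)
      fun n hn => ?_⟩
    funext ξ
    rw [approxChar, if_neg (not_lt.2 hn)]

theorem exists_tendsto_of_approx {X : Type*} {l : Filter X} [l.NeBot] {f : X → ℂ}
    (h : ∀ ε > 0, ∃ (g : X → ℂ) (a : ℂ), Tendsto g l (𝓝 a) ∧ ∀ᶠ x in l, ‖f x - g x‖ ≤ ε) :
    ∃ a, Tendsto f l (𝓝 a) := by
  refine CompleteSpace.complete (f := Filter.map f l) (Metric.cauchy_iff.2 ⟨inferInstance, ?_⟩)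
  intro ε hε
  obtain ⟨g, a, hg, hfg⟩ := h (ε / 8) (by linarith)
  refine ⟨f '' {x | ‖f x - g x‖ ≤ ε / 8 ∧ dist (g x) a < ε / 8},
    Filter.image_mem_map (hfg.and (hg.eventually (Metric.ball_mem_nhds a (by linarith)))), ?_⟩
  rintro _ ⟨x, ⟨hx1, hx2⟩, rfl⟩ _ ⟨y, ⟨hy1, hy2⟩, rfl⟩
  have hx : dist (f x) a < ε / 4 := by
    have := dist_triangle (f x) (g x) a
    rw [dist_eq_norm (f x) (g x)] at this
    linarith
  have hy : dist (f y) a < ε / 4 := by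
    have := dist_triangle (f y) (g y) a
    rw [dist_eq_norm (f y) (g y)] at this
    linarith
  have := dist_triangle_right (f x) (f y) a
  linarith

/-- The characteristic functions of `(Wₙ(zᵢ) / 𝔼 Wₙ(zᵢ))ᵢ` converge. -/
theorem exists_hasCharLimit (hm : 2 ≤ m) {σ : SupplementaryRule m t} {z : ι → ℂ}
    (hz : ∀ i, IsGoodAt σ (z i)) : ∃ ψ, HasCharLimit σ z (profileChar σ z) ψ := by
  have hz' := hz
  unfold IsGoodAt at hz'
  choose s q c K hs hs' hq0 hq1 hc hK h using hz'
  suffices H : ∀ η, ∃ a, Tendsto (fun p : ℕ × (ι → ℂ) =>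
      profileChar σ z p.1 (p.2 * invMean σ z p.1)) (atTop ×ˢ 𝓝 η) (𝓝 a) by
    choose ψ hψ using H
    exact ⟨ψ, hψ⟩
  intro η
  refine exists_tendsto_of_approx fun ε hε => ?_
  set A := 2 * (Fintype.card ι : ℝ) ^ 2 with hA
  -- This bounds the error at level `k` for arguments near `η`. It is free of `n`, because
  -- `weight_mul_inv_mean_le` absorbs the normalization.
  have hlim : Tendsto (fun k => ∑ i, A * K i * q i ^ k * ((‖η i‖ + 1) ^ s i * (c i)⁻¹ ^ s i))
      atTop (𝓝 0) := by
    rw [← Finset.sum_const_zero (s := (Finset.univ : Finset ι))]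
    refine tendsto_finsetSum _ fun i _ => ?_
    have := ((tendsto_pow_atTop_nhds_zero_of_lt_one (hq0 i) (hq1 i)).const_mul (A * K i)).mul_const
      ((‖η i‖ + 1) ^ s i * (c i)⁻¹ ^ s i)
    simpa using this
  obtain ⟨k, hk⟩ := (hlim.eventually_le_const hε).exists
  obtain ⟨ψ, hψ⟩ := exists_hasCharLimit_approxChar hm hz k
  refine ⟨_, _, hψ η, ?_⟩
  have hη : ∀ᶠ x : ℕ × (ι → ℂ) in atTop ×ˢ 𝓝 η, ∀ i, ‖x.2 i‖ ≤ ‖η i‖ + 1 := by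
    rw [eventually_all]
    intro i
    have h1 : Tendsto (fun x : ℕ × (ι → ℂ) => ‖x.2 i‖) (atTop ×ˢ 𝓝 η) (𝓝 ‖η i‖) :=
      (((continuous_apply i).tendsto η).comp tendsto_snd).norm
    exact h1.eventually_le_const (by linarith)
  filter_upwards [hη, (tendsto_fst : Tendsto Prod.fst (atTop ×ˢ 𝓝 η : Filter (ℕ × (ι → ℂ)))
    atTop).eventually_ge_atTop 1] with x hx hx1
  refine (norm_profileChar_sub_approxChar_le hm σ hs hs' hq0 hK
    (w := fun i n => rise (momentExp m t (s i) (z i)) n)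
    (fun i n => (rise_pos ((h i).momentExp_pos (by linarith [hs i])) n).le)
    (fun n i => (h i).moment n) (fun i n hn => weight_ev_le hm σ (le_of_regularSize_le hn).1
      (le_of_regularSize_le hn).2 ((h i).momentExp_pos (by linarith [hs i])) (h i).weight)
    k _ _).trans (le_trans (Finset.sum_le_sum fun i _ => ?_) hk)
  have h1 := (h i).weight_mul_inv_mean_le (hs i).le (hc i) hx1
  have h2 : ‖x.2 i‖ ^ s i ≤ (‖η i‖ + 1) ^ s i := by
    have := hs i
    gcongr
    exact hx i
  have h3 := rise_pos ((h i).momentExp_pos (by linarith [hs i])) x.1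
  have h4 : 0 ≤ A * K i * q i ^ k := by
    have := hK i
    have := hq0 i
    positivity
  rw [mul_assoc]
  refine mul_le_mul_of_nonneg_left ?_ h4
  rw [Pi.mul_apply, norm_mul, Real.mul_rpow (norm_nonneg _) (norm_nonneg _), mul_left_comm]
  exact mul_le_mul h2 h1 (by positivity) (by positivity)

/-- The limit solves the equation for characteristic functions. -/
theorem HasCharLimit.eq_integral (hm : 2 ≤ m) {σ : SupplementaryRule m t} {z : ι → ℂ}
    (hz : ∀ i, IsGoodAt σ (z i)) {ψ : (ι → ℂ) → ℂ} (h : HasCharLimit σ z (profileChar σ z) ψ)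
    (η : ι → ℂ) : ψ η = ∫ v, ∏ j, ψ (η * limitCoef m t z (v j)) ∂(dirichlet m t) := by
  refine tendsto_nhds_unique (h η) (((h.splitChar hm hz (norm_profileChar_le hm σ z)).congr
    (N := m) fun n hn => ?_) η)
  funext ξ
  exact (profileChar_eq hm σ z hn ξ).symm

end CharLimit

/-! ### The space of analytic functions on an open set -/

section Hol

variable {B : Set ℂ}

/-- The extension by zero of an analytic function on `B`. -/
noncomputable def Hol.ext (f : Hol B) : ℂ → ℂ := Function.extend Subtype.val f.1 0

theorem Hol.ext_apply (f : Hol B) (z : B) : f.ext z = f z :=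
  Subtype.val_injective.extend_apply _ _ _

theorem Hol.differentiableOn_ext (f : Hol B) : DifferentiableOn ℂ f.ext B := by
  obtain ⟨g, hg, hfg⟩ := f.2
  exact hg.differentiableOn.congr fun z hz => (f.ext_apply ⟨z, hz⟩).trans (hfg ⟨z, hz⟩)

/-- The element of `H(B)` given by a function that is differentiable on the open set `B`. -/
def Hol.mk (hB : IsOpen B) (g : ℂ → ℂ) (hg : DifferentiableOn ℂ g B) : Hol B :=
  ⟨⟨fun z : B => g z, hg.continuousOn.domRestrict⟩, g, hg.analyticOnNhd hB, fun _ => rfl⟩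

theorem Hol.continuous_val : Continuous (fun f : Hol B => f.1) := continuous_subtype_val

theorem Hol.continuous_eval (z : B) : Continuous fun f : Hol B => f z :=
  (ContinuousEvalConst.continuous_eval_const (F := C(B, ℂ)) z).comp Hol.continuous_val

/-- Weierstrass: locally uniform limits of holomorphic functions are holomorphic. So `H(B)` is
closed in the Polish space `C(B, ℂ)` and is itself Polish. -/
theorem Hol.isClosedEmbedding_val (hB : IsOpen B) :
    IsClosedEmbedding (fun f : Hol B => f.1) := by
  refine ⟨IsEmbedding.subtypeVal, ?_⟩
  have hr : Set.range (fun f : Hol B => f.1) =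
      {f : C(B, ℂ) | ∃ g : ℂ → ℂ, AnalyticOnNhd ℂ g B ∧ ∀ z : B, f z = g z} :=
    Subtype.range_coe_subtype
  have := hB.locallyCompactSpace
  refine isClosed_of_closure_subset fun f hf => ?_
  have hl := mem_closure_iff_nhdsWithin_neBot.1 hf
  set l := 𝓝[Set.range fun f : Hol B => f.1] f
  have h1 : Tendsto (fun g : C(B, ℂ) => g) l (𝓝 f) := tendsto_id.mono_left nhdsWithin_le_nhds
  rw [ContinuousMap.tendsto_iff_tendstoLocallyUniformly] at h1
  have h2 : TendstoLocallyUniformlyOn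
      (fun (g : C(B, ℂ)) => Function.extend Subtype.val g (0 : ℂ → ℂ))
      (Function.extend Subtype.val f (0 : ℂ → ℂ)) l B := by
    rw [tendstoLocallyUniformlyOn_iff_tendstoLocallyUniformly_comp_coe]
    have e : ∀ g : C(B, ℂ), Function.extend Subtype.val g (0 : ℂ → ℂ) ∘ Subtype.val = g :=
      fun g => funext fun z => Subtype.val_injective.extend_apply _ _ _
    convert h1 using 2
    all_goals exact e _
  have h3 := h2.differentiableOn (by
    filter_upwards [self_mem_nhdsWithin] with g hg
    obtain ⟨g, rfl⟩ := hg
    exact g.differentiableOn_ext) hB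
  exact ⟨⟨f, _, h3.analyticOnNhd hB, fun z => (Subtype.val_injective.extend_apply _ _ _).symm⟩, rfl⟩

theorem Hol.polishSpace (hB : IsOpen B) : PolishSpace (Hol B) := by
  have := hB.locallyCompactSpace
  exact (Hol.isClosedEmbedding_val hB).polishSpace

theorem Hol.eq_of_eqOn_dense {s : Set B} (hs : Dense s) {f g : Hol B} (h : ∀ z ∈ s, f z = g z) :
    f = g :=
  Subtype.ext (DFunLike.coe_injective (f.1.continuous.ext_on hs g.1.continuous h))

/-- A continuous injection from a Polish space is a measurable embedding. Hence evaluations at a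
countable dense set already generate the Borel σ-algebra. -/
theorem Hol.measurableEmbedding_restrict (hB : IsOpen B) {s : Set B} (hs : Dense s)
    (hc : s.Countable) : MeasurableEmbedding fun (f : Hol B) (z : s) => f z := by
  have := Hol.polishSpace hB
  have := hc.to_subtype
  refine Continuous.measurableEmbedding (continuous_pi fun z => Hol.continuous_eval _) ?_
  intro f g h
  exact Hol.eq_of_eqOn_dense hs fun z hz => congrFun h ⟨z, hz⟩

theorem Hol.measurable_of_eval (hB : IsOpen B) {α : Type*} [MeasurableSpace α] {g : α → Hol B}
    (h : ∀ z : B, Measurable fun a => g a z) : Measurable g := by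
  obtain ⟨s, hc, hs⟩ := TopologicalSpace.exists_countable_dense B
  exact (Hol.measurableEmbedding_restrict hB hs hc).measurable_comp_iff.1
    (measurable_pi_lambda _ fun z => h z)

theorem Hol.continuous_eval_uncurry (hB : IsOpen B) :
    Continuous fun p : Hol B × B => p.1 p.2 := by
  have := hB.locallyCompactSpace
  exact (ContinuousEval.continuous_eval (F := C(B, ℂ))).comp (Hol.continuous_val.prodMap continuous_id)

/-- The bilinear pairing `Re ∑ xᵢ ξᵢ`. -/
noncomputable def rePairing (ι : Type*) [Fintype ι] : (ι → ℂ) →ₗ[ℝ] (ι → ℂ) →ₗ[ℝ] ℝ :=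
  LinearMap.mk₂ ℝ (fun x ξ => (∑ i, ξ i * x i).re)
    (fun x y ξ => by simp only [Pi.add_apply, mul_add, Finset.sum_add_distrib, Complex.add_re])
    (fun c x ξ => by
      simp only [Pi.smul_apply, mul_smul_comm, ← Finset.smul_sum, Complex.smul_re])
    (fun x ξ η => by simp only [Pi.add_apply, add_mul, Finset.sum_add_distrib, Complex.add_re])
    (fun c x ξ => by
      simp only [Pi.smul_apply, smul_mul_assoc, ← Finset.smul_sum, Complex.smul_re])

theorem ext_of_integral_phase {ι : Type*} [Fintype ι] {μ ν : Measure (ι → ℂ)} [IsFiniteMeasure μ]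
    [IsFiniteMeasure ν] (h : ∀ ξ, ∫ x, phase ξ x ∂μ = ∫ x, phase ξ x ∂ν) : μ = ν := by
  have hL : Continuous fun p : (ι → ℂ) × (ι → ℂ) => rePairing ι p.1 p.2 := by
    simp only [rePairing, LinearMap.mk₂_apply]
    fun_prop
  refine ext_of_integral_char_eq (L := rePairing ι) Real.continuous_probChar
    Real.probChar_ne_one ?_ hL ?_
  · intro v hv h0
    refine hv ?_
    have h1 := LinearMap.congr_fun h0 (fun i => (starRingEnd ℂ) (v i))
    simp only [rePairing, LinearMap.mk₂_apply, LinearMap.zero_apply, Complex.re_sum,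
      ← Complex.normSq_eq_conj_mul_self, Complex.ofReal_re] at h1
    rw [Finset.sum_eq_zero_iff_of_nonneg fun i _ => Complex.normSq_nonneg _] at h1
    funext i
    simpa using h1 i (Finset.mem_univ i)
  · intro ξ
    exact h ξ

/-- The values on a countable dense set determine the law; their joint law is determined by its
finite-dimensional marginals, and these by their characteristic functions. -/
theorem Hol.measure_ext (hB : IsOpen B) {μ ν : Measure (Hol B)} [IsFiniteMeasure μ]
    [IsFiniteMeasure ν]
    (h : ∀ (s : Finset B) (ξ : s → ℂ), ∫ f, phase ξ (fun i => f.1 i) ∂μ =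
      ∫ f, phase ξ (fun i => f.1 i) ∂ν) : μ = ν := by
  obtain ⟨s, hc, hs⟩ := TopologicalSpace.exists_countable_dense B
  have he := Hol.measurableEmbedding_restrict hB hs hc
  have hm : Measurable fun (f : Hol B) (z : s) => f z := he.measurable
  suffices H : μ.map (fun (f : Hol B) (z : s) => f z) = ν.map fun (f : Hol B) (z : s) => f z by
    rw [← he.comap_map μ, H, he.comap_map]
  have hproj : ∀ κ : Measure (Hol B), IsProjectiveLimit
      (κ.map fun (f : Hol B) (z : s) => f z) fun I : Finset s =>
        (κ.map fun (f : Hol B) (z : s) => f z).map I.restrict := fun κ I => rfl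
  refine IsProjectiveLimit.unique (hproj μ) (P := fun I : Finset s =>
    (μ.map fun (f : Hol B) (z : s) => f z).map I.restrict) fun I => ?_
  refine ext_of_integral_phase fun ξ => ?_
  have hI : Measurable (I.restrict : (s → ℂ) → I → ℂ) := by fun_prop
  have hph : Continuous fun x : I → ℂ => phase ξ x :=
    continuous_phase.comp (continuous_const.prodMk continuous_id)
  have key : ∀ κ : Measure (Hol B), ∫ x, phase ξ x ∂((κ.map fun (f : Hol B) (z : s) => f z).map
      I.restrict) = ∫ f, phase ξ (fun i => f.1 i) ∂κ := by
    intro κ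
    rw [Measure.map_map hI hm, integral_map (hI.comp hm).aemeasurable
      hph.aestronglyMeasurable]
    rfl
  rw [key, key]
  -- Reindexes a finite set of points of the dense subset as a finite set of points of `B`.
  let e : I ≃ (I.map (Function.Embedding.subtype _) : Finset B) :=
    { toFun := fun i => ⟨i.1.1, Finset.mem_map_of_mem _ i.2⟩
      invFun := fun b => ⟨⟨b.1, by
          obtain ⟨a, _, h⟩ := Finset.mem_map.1 b.2
          rw [← h]
          exact a.2⟩, by
          obtain ⟨a, ha, h⟩ := Finset.mem_map.1 b.2
          convert ha using 1
          exact Subtype.ext h.symm⟩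
      left_inv := fun i => rfl
      right_inv := fun b => rfl }
  have key2 : ∀ f : Hol B, phase ξ (fun i : I => f.1 i) =
      phase (fun b => ξ (e.symm b)) (fun b => f.1 b.1) := by
    intro f
    unfold phase
    congr 4
    exact Fintype.sum_equiv e _ _ fun i => rfl
  simp only [key2]
  exact (h _ _).symm

end Hol

/-! ### Tightness and convergence in law in `H(B)`. -/

section Tight

variable {B : Set ℂ}

/-- Montel's theorem: the Schwarz lemma turns local bounds into equicontinuity, and Arzelà–Ascoli
applies. -/
theorem Hol.isCompact_of_locally_bounded (hB : IsOpen B) {K : Set (Hol B)} (hK : IsClosed K)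
    (h : ∀ x ∈ B, ∃ ρ > 0, Metric.ball x ρ ⊆ B ∧ ∃ R : ℝ, ∀ f ∈ K, ∀ w : B,
      (w : ℂ) ∈ Metric.ball x ρ → ‖f w‖ ≤ R) : IsCompact K := by
  have := hB.locallyCompactSpace
  have : T2Space (UniformOnFun B ℂ {K : Set B | IsCompact K}) :=
    UniformOnFun.t2Space_of_covering (Set.eq_univ_of_forall fun x =>
      Set.mem_sUnion_of_mem (Set.mem_singleton x) isCompact_singleton)
  have hc : IsCompact (closure ((fun f : Hol B => f.1) '' K)) := by
    refine ArzelaAscoli.isCompact_closure_of_isClosedEmbedding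
      (𝔖 := {K : Set B | IsCompact K}) (F := fun f : C(B, ℂ) => (f : B → ℂ)) (fun K hK => hK)
      (ContinuousMap.isUniformEmbedding_toUniformOnFunIsCompact (α := B)
        (β := ℂ)).isClosedEmbedding ?_ ?_
    · intro L _
      refine Equicontinuous.equicontinuousOn (fun x => ?_) L
      obtain ⟨ρ, hρ, hsub, R, hR⟩ := h x x.2
      rw [Metric.equicontinuousAt_iff]
      intro ε hε
      have hR0 : 0 < 2 * |R| + 1 := by positivity
      refine ⟨min ρ (ε / ((2 * |R| + 1) / ρ)), by positivity, ?_⟩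
      rintro w hw ⟨_, f, hf, rfl⟩
      have hw1 : (w : ℂ) ∈ Metric.ball (x : ℂ) ρ := lt_of_lt_of_le hw (min_le_left _ _)
      have hw2 : dist (w : ℂ) x < ε / ((2 * |R| + 1) / ρ) := lt_of_lt_of_le hw (min_le_right _ _)
      have hmaps : Set.MapsTo f.ext (Metric.ball (x : ℂ) ρ)
          (Metric.ball (f.ext x) (2 * |R| + 1)) := by
        intro y hy
        have e1 := hR f hf ⟨y, hsub hy⟩ hy
        have e2 := hR f hf x (Metric.mem_ball_self hρ)
        rw [← f.ext_apply] at e1 e2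
        rw [Metric.mem_ball, dist_eq_norm]
        have := norm_sub_le (f.ext y) (f.ext x)
        have := le_abs_self R
        dsimp only at e1
        linarith
      have h1 := Complex.dist_le_div_mul_dist_of_mapsTo_ball
        (f.differentiableOn_ext.mono hsub) (hmaps.mono_right Metric.ball_subset_closedBall) hw1
      rw [f.ext_apply, f.ext_apply] at h1
      rw [dist_comm]
      refine lt_of_le_of_lt h1 ?_
      rwa [lt_div_iff₀' (by positivity)] at hw2
    · intro L _ x _
      obtain ⟨ρ, hρ, hsub, R, hR⟩ := h x x.2
      refine ⟨Metric.closedBall 0 R, isCompact_closedBall _ _, ?_⟩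
      rintro _ ⟨f, hf, rfl⟩
      simpa using hR f hf x (Metric.mem_ball_self hρ)
  refine ((Hol.isClosedEmbedding_val hB).isCompact_preimage hc).of_isClosed_subset hK ?_
  intro f hf
  exact subset_closure ⟨f, hf, rfl⟩

/-- Cauchy's formula on the circle of radius `2r`, whose points have distance at least `r` from `w`.
The resulting constant `2 / (2π)` is below 1. -/
theorem norm_le_integral_circle {f : ℂ → ℂ} {c w : ℂ} {r : ℝ} (hr : 0 < r)
    (hf : DifferentiableOn ℂ f (Metric.closedBall c (2 * r))) (hw : w ∈ Metric.ball c r) :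
    ‖f w‖ ≤ ∫ θ in (0 : ℝ)..2 * Real.pi, ‖f (circleMap c (2 * r) θ)‖ := by
  have hd : DiffContOnCl ℂ f (Metric.ball c (2 * r)) :=
    (DifferentiableOn.diffContOnCl (by rwa [closure_ball _ (by positivity)]))
  have hw2 : w ∈ Metric.ball c (2 * r) := Metric.ball_subset_ball (by linarith) hw
  have h1 := hd.two_pi_i_inv_smul_circleIntegral_sub_inv_smul hw2
  have hcont : Continuous fun θ : ℝ => f (circleMap c (2 * r) θ) :=
    hf.continuousOn.comp_continuous (continuous_circleMap _ _)
      fun θ => Metric.sphere_subset_closedBall (circleMap_mem_sphere _ (by positivity) θ)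
  have h2 : ‖∮ z in C(c, 2 * r), (z - w)⁻¹ • f z‖ ≤
      ∫ θ in (0 : ℝ)..2 * Real.pi, 2 * ‖f (circleMap c (2 * r) θ)‖ := by
    rw [circleIntegral]
    refine intervalIntegral.norm_integral_le_of_norm_le Real.two_pi_pos.le ?_
      ((continuous_const.mul hcont.norm).intervalIntegrable _ _)
    refine ae_of_all _ fun θ _ => ?_
    rw [smul_eq_mul, smul_eq_mul, norm_mul, norm_mul, norm_inv, deriv_circleMap, norm_mul,
      Complex.norm_I, mul_one, norm_circleMap_zero, abs_of_pos (by positivity), ← mul_assoc]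
    refine mul_le_mul_of_nonneg_right ?_ (norm_nonneg _)
    have e1 : r ≤ ‖circleMap c (2 * r) θ - w‖ := by
      have e2 := circleMap_mem_sphere c (by positivity : 0 ≤ 2 * r) θ
      rw [mem_sphere_iff_norm] at e2
      rw [mem_ball_iff_norm] at hw
      have := norm_sub_norm_le (circleMap c (2 * r) θ - c) (w - c)
      rw [sub_sub_sub_cancel_right] at this
      linarith
    rw [← div_eq_mul_inv, div_le_iff₀ (by linarith)]
    linarith
  rw [← h1, norm_smul, norm_inv]
  have e3 : ‖(2 * Real.pi * Complex.I : ℂ)‖ = 2 * Real.pi := by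
    simp [Real.pi_pos.le]
  rw [e3]
  rw [intervalIntegral.integral_const_mul] at h2
  have h0 : 0 ≤ ∫ θ in (0 : ℝ)..2 * Real.pi, ‖f (circleMap c (2 * r) θ)‖ :=
    intervalIntegral.integral_nonneg Real.two_pi_pos.le fun _ _ => norm_nonneg _
  rw [inv_mul_le_iff₀ (by positivity)]
  nlinarith [Real.pi_gt_three]

/-- Cauchy's formula replaces the supremum over a disc by an integral over a circle; Fubini and
Markov's inequality then need only first moments at single points. -/
theorem Hol.measure_exists_norm_gt_le (hB : IsOpen B) (κ : Measure (Hol B)) [SFinite κ] {c : ℂ}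
    {r : ℝ} (hr : 0 < r) (hsub : Metric.closedBall c (2 * r) ⊆ B) {C : ℝ≥0∞}
    (hC : ∀ z : B, (z : ℂ) ∈ Metric.closedBall c (2 * r) → ∫⁻ f, ‖f z‖ₑ ∂κ ≤ C) {R : ℝ≥0}
    (hR : R ≠ 0) :
    κ {f | ∃ w : B, (w : ℂ) ∈ Metric.ball c r ∧ (R : ℝ) < ‖f w‖} ≤
      C * ENNReal.ofReal (2 * Real.pi) / R := by
  have := Hol.polishSpace hB
  have hmem : ∀ θ : ℝ, circleMap c (2 * r) θ ∈ B := fun θ =>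
    hsub (Metric.sphere_subset_closedBall (circleMap_mem_sphere _ (by positivity) θ))
  let γ : ℝ → B := fun θ => ⟨circleMap c (2 * r) θ, hmem θ⟩
  have hγ : Continuous γ := (continuous_circleMap c (2 * r)).subtype_mk _
  let vol : Measure ℝ := volume.restrict (Set.Ioc 0 (2 * Real.pi))
  let G : Hol B → ℝ≥0∞ := fun f => ∫⁻ θ, ‖f (γ θ)‖ₑ ∂vol
  have hjoint : Measurable fun p : Hol B × ℝ => ‖p.1 (γ p.2)‖ₑ :=
    ((Hol.continuous_eval_uncurry hB).comp (continuous_id.prodMap hγ)).measurable.enorm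
  have hGm : Measurable G := hjoint.lintegral_prod_right'
  have hG : ∫⁻ f, G f ∂κ ≤ C * ENNReal.ofReal (2 * Real.pi) := by
    calc ∫⁻ f, G f ∂κ = ∫⁻ θ, ∫⁻ f, ‖f (γ θ)‖ₑ ∂κ ∂vol :=
          lintegral_lintegral_swap hjoint.aemeasurable
      _ ≤ ∫⁻ _, C ∂vol := lintegral_mono fun θ =>
          hC (γ θ) (Metric.sphere_subset_closedBall (circleMap_mem_sphere _ (by positivity) θ))
      _ = _ := by simp [vol]
  have hle : {f : Hol B | ∃ w : B, (w : ℂ) ∈ Metric.ball c r ∧ (R : ℝ) < ‖f w‖} ⊆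
      {f | (R : ℝ≥0∞) ≤ G f} := by
    rintro f ⟨w, hw, hlt⟩
    have h1 := norm_le_integral_circle hr (f.differentiableOn_ext.mono hsub) hw
    have hcont : Continuous fun θ : ℝ => f.ext (circleMap c (2 * r) θ) :=
      f.differentiableOn_ext.continuousOn.comp_continuous (continuous_circleMap _ _) hmem
    rw [intervalIntegral.integral_of_le Real.two_pi_pos.le, f.ext_apply,
      integral_norm_eq_lintegral_enorm hcont.aestronglyMeasurable] at h1
    have e : ∫⁻ θ in Set.Ioc 0 (2 * Real.pi), ‖f.ext (circleMap c (2 * r) θ)‖ₑ = G f :=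
      lintegral_congr fun θ => by rw [show f.ext (circleMap c (2 * r) θ) = f (γ θ) from
        f.ext_apply (γ θ)]
    rw [e] at h1
    have hne : G f ≠ ∞ := by
      intro h
      rw [h] at h1
      simp only [ENNReal.toReal_top] at h1
      have := R.2
      have : (0 : ℝ) ≤ R := R.2
      linarith
    rw [Set.mem_ofPred_eq, ← ENNReal.ofReal_coe_nnreal, ← ENNReal.ofReal_toReal hne]
    exact ENNReal.ofReal_le_ofReal (by linarith)
  calc _ ≤ κ {f | (R : ℝ≥0∞) ≤ G f} := measure_mono hle
    _ ≤ (∫⁻ f, G f ∂κ) / R := meas_ge_le_lintegral_div hGm.aemeasurable (by simpa using hR) (by simp)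
    _ ≤ _ := by gcongr

/-- Countably many small discs cover `B`. Allow an exceptional probability `δ x` for disc `x`, with
total below `ε`; the functions obeying all the resulting bounds form a compact set by Montel's
theorem. -/
theorem Hol.isTightMeasureSet (hB : IsOpen B) {S : Set (Measure (Hol B))}
    (hS : ∀ κ ∈ S, IsProbabilityMeasure κ)
    (hC : ∀ x ∈ B, ∃ r > 0, ∃ C : ℝ≥0, ∀ κ ∈ S, ∀ z : B, (z : ℂ) ∈ Metric.ball x r →
      ∫⁻ f, ‖f z‖ₑ ∂κ ≤ C) : IsTightMeasureSet S := by
  rw [isTightMeasureSet_iff_exists_isCompact_measure_compl_le]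
  intro ε hε
  have H : ∀ x : B, ∃ r > 0, Metric.closedBall (x : ℂ) (2 * r) ⊆ B ∧ ∃ C : ℝ≥0, ∀ κ ∈ S, ∀ z : B,
      (z : ℂ) ∈ Metric.closedBall (x : ℂ) (2 * r) → ∫⁻ f, ‖f z‖ₑ ∂κ ≤ C := by
    intro x
    obtain ⟨r, hr, C, h⟩ := hC x x.2
    obtain ⟨r', hr', h'⟩ := Metric.isOpen_iff.1 hB x x.2
    have hsub : Metric.closedBall (x : ℂ) (2 * (min r r' / 4)) ⊆ Metric.ball x (min r r') :=
      Metric.closedBall_subset_ball (by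
        have : 0 < min r r' := lt_min hr hr'
        linarith)
    exact ⟨min r r' / 4, by positivity,
      hsub.trans ((Metric.ball_subset_ball (min_le_right _ _)).trans h'), C, fun κ hκ z hz =>
      h κ hκ z (Metric.ball_subset_ball (min_le_left _ _) (hsub hz))⟩
  choose r hr hsub C hC using H
  obtain ⟨T, hTc, hT⟩ := TopologicalSpace.isOpen_iUnion_countable
    (fun x : B => Metric.ball (x : ℂ) (r x)) fun x => Metric.isOpen_ball
  have := hTc.to_subtype
  obtain ⟨δ, hδ, hδs⟩ := ENNReal.exists_pos_sum_of_countable hε.ne' T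
  have HR : ∀ x : T, ∃ R : ℝ≥0, R ≠ 0 ∧ (C x : ℝ≥0∞) * ENNReal.ofReal (2 * Real.pi) / R ≤ δ x := by
    intro x
    set a : ℝ≥0 := C x * Real.toNNReal (2 * Real.pi) with ha
    refine ⟨(a + 1) / δ x, by have := hδ x; positivity, ?_⟩
    have e : (C x : ℝ≥0∞) * ENNReal.ofReal (2 * Real.pi) = (a : ℝ≥0∞) := by
      rw [ha, ENNReal.coe_mul]; rfl
    have hd := (hδ x).ne'
    rw [e, ← ENNReal.coe_div (by have := hδ x; positivity), ENNReal.coe_le_coe,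
      div_div_eq_mul_div, div_le_iff₀ (by positivity), mul_comm]
    gcongr
    exact le_self_add
  choose R hR0 hR using HR
  let K : Set (Hol B) := {f | ∀ x : T, ∀ w : B, (w : ℂ) ∈ Metric.ball (x.1 : ℂ) (r x) → ‖f w‖ ≤ R x}
  have hcl : IsClosed K := by
    simp only [K, Set.ofPred_forall]
    exact isClosed_iInter fun x => isClosed_iInter fun w => isClosed_iInter fun _ =>
      isClosed_le (Hol.continuous_eval w).norm continuous_const
  refine ⟨K, Hol.isCompact_of_locally_bounded hB hcl fun x hx => ?_, fun κ hκ => ?_⟩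
  · have hxT : x ∈ ⋃ i ∈ T, Metric.ball (i : ℂ) (r i) := by
      rw [hT]
      exact Set.mem_iUnion.2 ⟨⟨x, hx⟩, Metric.mem_ball_self (hr _)⟩
    simp only [Set.mem_iUnion, exists_prop] at hxT
    obtain ⟨i, hi, hxi⟩ := hxT
    obtain ⟨ρ, hρ, hρs⟩ := Metric.isOpen_iff.1 Metric.isOpen_ball x hxi
    refine ⟨ρ, hρ, hρs.trans ((Metric.ball_subset_closedBall.trans
      (Metric.closedBall_subset_closedBall (by linarith [hr i]))).trans (hsub i)), R ⟨i, hi⟩,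
      fun f hf w hw => hf ⟨i, hi⟩ w (hρs hw)⟩
  · have := hS κ hκ
    have hcompl : Kᶜ ⊆ ⋃ x : T, {f : Hol B | ∃ w : B, (w : ℂ) ∈ Metric.ball (x.1 : ℂ) (r x) ∧
        (R x : ℝ) < ‖f w‖} := by
      intro f hf
      simp only [K, Set.mem_compl_iff, Set.mem_ofPred_eq, not_forall, not_le] at hf
      obtain ⟨x, w, hw, hlt⟩ := hf
      exact Set.mem_iUnion.2 ⟨x, w, hw, hlt⟩
    calc κ Kᶜ ≤ ∑' x : T, κ {f : Hol B | ∃ w : B, (w : ℂ) ∈ Metric.ball (x.1 : ℂ) (r x) ∧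
          (R x : ℝ) < ‖f w‖} := (measure_mono hcompl).trans (measure_iUnion_le _)
      _ ≤ ∑' x : T, (δ x : ℝ≥0∞) := ENNReal.tsum_le_tsum fun x =>
          (Hol.measure_exists_norm_gt_le hB κ (hr x) (hsub x) (hC x κ hκ) (hR0 x)).trans (hR x)
      _ ≤ ε := hδs.le

theorem Hol.continuous_integral {g : Hol B → ℂ} (hg : Continuous g) {c : ℝ}
    (hc : ∀ f, ‖g f‖ ≤ c) :
    Continuous fun μ : ProbabilityMeasure (Hol B) => ∫ f, g f ∂(μ : Measure (Hol B)) := by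
  let h : BoundedContinuousFunction (Hol B) ℂ :=
    BoundedContinuousFunction.ofNormedAddCommGroup g hg c hc
  rw [continuous_iff_continuousAt]
  intro μ
  exact (ProbabilityMeasure.tendsto_iff_forall_integral_rclike_tendsto ℂ).1
    (tendsto_id : Tendsto id (𝓝 μ) (𝓝 μ)) h

theorem Hol.continuous_phase_eval (s : Finset B) (ξ : s → ℂ) :
    Continuous fun f : Hol B => phase ξ (fun i => f.1 i) :=
  continuous_phase.comp (continuous_const.prodMk
    (continuous_pi fun i : s => Hol.continuous_eval i.1))

theorem Hol.continuous_integral_phase (s : Finset B) (ξ : s → ℂ) :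
    Continuous fun μ : ProbabilityMeasure (Hol B) =>
      ∫ f, phase ξ (fun i => f.1 i) ∂(μ : Measure (Hol B)) :=
  Hol.continuous_integral (Hol.continuous_phase_eval s ξ) fun _ => (norm_phase _ _).le

/-- Convergence in distribution of random analytic functions from convergence of the
finite-dimensional characteristic functions. -/
theorem Hol.exists_tendsto (hB : IsOpen B) {P : ℕ → ProbabilityMeasure (Hol B)}
    (hC : ∀ x ∈ B, ∃ r > 0, ∃ C : ℝ≥0, ∀ n, ∀ z : B, (z : ℂ) ∈ Metric.ball x r →
      ∫⁻ f, ‖f z‖ₑ ∂(P n : Measure (Hol B)) ≤ C)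
    (hψ : ∀ (s : Finset B) (ξ : s → ℂ), ∃ a, Tendsto
      (fun n => ∫ f, phase ξ (fun i => f.1 i) ∂(P n : Measure (Hol B))) atTop (𝓝 a)) :
    ∃ Q : ProbabilityMeasure (Hol B), Tendsto P atTop (𝓝 Q) := by
  have := Hol.polishSpace hB
  have ht : IsTightMeasureSet {((μ : ProbabilityMeasure (Hol B)) : Measure (Hol B)) |
      μ ∈ Set.range P} := by
    refine Hol.isTightMeasureSet hB ?_ ?_
    · rintro _ ⟨μ, -, rfl⟩
      infer_instance
    · intro x hx
      obtain ⟨r, hr, C, h⟩ := hC x hx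
      refine ⟨r, hr, C, ?_⟩
      rintro _ ⟨_, ⟨n, rfl⟩, rfl⟩
      exact h n
  -- Prokhorov's theorem. It remains to see that there is only one cluster point: all of them have
  -- the limiting characteristic functions, so `Hol.measure_ext` identifies them.
  have hcomp := isCompact_closure_of_isTightMeasureSet ht
  have hmem : ∀ᶠ n in atTop, P n ∈ closure (Set.range P) :=
    Eventually.of_forall fun n => subset_closure ⟨n, rfl⟩
  obtain ⟨Q, -, hQ⟩ := hcomp.exists_clusterPt (f := map P atTop) (by
    rw [le_principal_iff]
    exact hmem)
  refine ⟨Q, ?_⟩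
  refine hcomp.tendsto_nhds_of_unique_mapClusterPt hmem fun Q' _ hQ' => ?_
  have key : ∀ (s : Finset B) (ξ : s → ℂ) (a : ℂ), Tendsto
      (fun n => ∫ f, phase ξ (fun i => f.1 i) ∂(P n : Measure (Hol B))) atTop (𝓝 a) →
      ∀ Q : ProbabilityMeasure (Hol B), MapClusterPt Q atTop P →
        ∫ f, phase ξ (fun i => f.1 i) ∂(Q : Measure (Hol B)) = a := by
    intro s ξ a ha Q hQ
    have h2 := hQ.continuousAt_comp (Hol.continuous_integral_phase s ξ).continuousAt
    exact eq_of_nhds_neBot (ClusterPt.mono h2 ha)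
  refine Subtype.ext ?_
  refine Hol.measure_ext hB (μ := (Q' : Measure (Hol B))) (ν := (Q : Measure (Hol B)))
    fun s ξ => ?_
  obtain ⟨a, ha⟩ := hψ s ξ
  rw [key s ξ a ha Q hQ, key s ξ a ha Q' hQ']

end Tight

/-! ### Moments under convergence in distribution -/

section Moments

variable {S : Type*} [MeasurableSpace S] [TopologicalSpace S] [OpensMeasurableSpace S]
  {P : ℕ → ProbabilityMeasure S} {Q : ProbabilityMeasure S}

/-- Fatou's lemma for weak convergence: integrals of nonnegative continuous functions are lower
semicontinuous in the law. -/
theorem lintegral_rpow_le_of_tendsto [HasOuterApproxClosed S] (hP : Tendsto P atTop (𝓝 Q)) {g : S → ℂ} (hg : Continuous g)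
    {s : ℝ} (hs : 0 ≤ s) {D : ℝ≥0∞} (hD : ∀ n, ∫⁻ x, ‖g x‖ₑ ^ s ∂(P n : Measure S) ≤ D) :
    ∫⁻ x, ‖g x‖ₑ ^ s ∂(Q : Measure S) ≤ D := by
  have e : ∀ x, ENNReal.ofReal (‖g x‖ ^ s) = ‖g x‖ₑ ^ s := fun x => by
    rw [← ENNReal.ofReal_rpow_of_nonneg (norm_nonneg _) hs, ofReal_norm]
  have h := lintegral_le_liminf_lintegral_of_forall_isOpen_measure_le_liminf_measure
    (μ := (Q : Measure S)) (μs := fun n => (P n : Measure S)) (f := fun x => ‖g x‖ ^ s)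
    (hg.norm.rpow_const fun _ => Or.inr hs) (fun x => by positivity)
    fun G hG => ProbabilityMeasure.le_liminf_measure_open_of_tendsto hP hG
  simp only [e] at h
  refine h.trans ((liminf_le_liminf (v := fun _ => D) (Eventually.of_forall hD)).trans ?_)
  simp

theorem enorm_le_one_add_rpow {s : ℝ} (hs : 1 ≤ s) (x : ℝ≥0∞) : x ≤ 1 + x ^ s := by
  rcases le_total x 1 with h | h
  · exact h.trans le_self_add
  · calc x = x ^ (1 : ℝ) := (ENNReal.rpow_one x).symm
      _ ≤ x ^ s := ENNReal.rpow_le_rpow_of_exponent_le h hs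
      _ ≤ _ := le_add_self

theorem integrable_of_lintegral_rpow_le {μ : Measure S} [IsFiniteMeasure μ] {g : S → ℂ}
    (hg : Continuous g) {s : ℝ} (hs : 1 ≤ s) {D : ℝ≥0} (hD : ∫⁻ x, ‖g x‖ₑ ^ s ∂μ ≤ D) :
    Integrable g μ := by
  refine ⟨hg.aestronglyMeasurable, ?_⟩
  calc ∫⁻ x, ‖g x‖ₑ ∂μ ≤ ∫⁻ x, (1 + ‖g x‖ₑ ^ s) ∂μ :=
        lintegral_mono fun x => enorm_le_one_add_rpow hs _
    _ = ∫⁻ _, 1 ∂μ + ∫⁻ x, ‖g x‖ₑ ^ s ∂μ := lintegral_add_left measurable_const _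
    _ < ∞ := by
      rw [lintegral_one]
      exact ENNReal.add_lt_top.2 ⟨measure_lt_top _ _, lt_of_le_of_lt hD ENNReal.coe_lt_top⟩

/-- Radial truncation at radius `R`. -/
noncomputable def radialTruncation (R : ℝ) (w : ℂ) : ℂ := ((R / max R ‖w‖ : ℝ) : ℂ) * w

theorem continuous_radialTruncation {R : ℝ} (hR : 0 < R) : Continuous (radialTruncation R) := by
  unfold radialTruncation
  refine (Complex.continuous_ofReal.comp ?_).mul continuous_id
  exact continuous_const.div (by fun_prop) fun w => (lt_max_of_lt_left hR).ne'

theorem norm_radialTruncation_le {R : ℝ} (hR : 0 < R) (w : ℂ) : ‖radialTruncation R w‖ ≤ R := by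
  have h : 0 < max R ‖w‖ := lt_max_of_lt_left hR
  rw [radialTruncation, norm_mul, Complex.norm_real, Real.norm_eq_abs, abs_of_pos (by positivity),
    div_mul_eq_mul_div, div_le_iff₀ h]
  gcongr
  exact le_max_right _ _

theorem norm_sub_radialTruncation_le {R s : ℝ} (hR : 0 < R) (hs : 1 ≤ s) (w : ℂ) :
    ‖w - radialTruncation R w‖ ≤ R ^ (1 - s) * ‖w‖ ^ s := by
  have h : 0 < max R ‖w‖ := lt_max_of_lt_left hR
  have e : w - radialTruncation R w = ((1 - R / max R ‖w‖ : ℝ) : ℂ) * w := by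
    rw [radialTruncation]; push_cast; ring
  have h1 : R / max R ‖w‖ ≤ 1 := (div_le_one h).2 (le_max_left _ _)
  rw [e, norm_mul, Complex.norm_real, Real.norm_eq_abs, abs_of_nonneg (by linarith)]
  rcases le_or_gt ‖w‖ R with hw | hw
  · rw [max_eq_left hw, div_self hR.ne', sub_self, zero_mul]
    positivity
  · have hw0 : 0 < ‖w‖ := hR.trans hw
    calc _ ≤ 1 * ‖w‖ := by
          gcongr
          have : 0 ≤ R / max R ‖w‖ := by positivity
          linarith
      _ = ‖w‖ ^ (1 - s) * ‖w‖ ^ s := by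
          rw [← Real.rpow_add hw0]; simp
      _ ≤ _ := by
          refine mul_le_mul_of_nonneg_right ?_ (by positivity)
          exact Real.rpow_le_rpow_of_nonpos hR hw.le (by linarith)

theorem norm_integral_sub_truncation_le {μ : Measure S} [IsFiniteMeasure μ] {g : S → ℂ}
    (hg : Continuous g) {s : ℝ} (hs : 1 ≤ s) {D : ℝ≥0} (hD : ∫⁻ x, ‖g x‖ₑ ^ s ∂μ ≤ D) {R : ℝ}
    (hR : 0 < R) : ‖∫ x, g x ∂μ - ∫ x, radialTruncation R (g x) ∂μ‖ ≤ R ^ (1 - s) * D := by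
  have hi := integrable_of_lintegral_rpow_le hg hs hD
  have ht : Integrable (fun x => radialTruncation R (g x)) μ :=
    Integrable.of_bound ((continuous_radialTruncation hR).comp hg).aestronglyMeasurable R
      (ae_of_all _ fun x => norm_radialTruncation_le hR _)
  rw [← integral_sub hi ht]
  have h1 : ∫⁻ x, ‖g x - radialTruncation R (g x)‖ₑ ∂μ ≤ ENNReal.ofReal (R ^ (1 - s) * D) := by
    calc _ ≤ ∫⁻ x, ENNReal.ofReal (R ^ (1 - s)) * ‖g x‖ₑ ^ s ∂μ := by
          refine lintegral_mono fun x => ?_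
          rw [← ofReal_norm, ← ofReal_norm, ENNReal.ofReal_rpow_of_nonneg (norm_nonneg _)
            (by linarith), ← ENNReal.ofReal_mul (by positivity)]
          exact ENNReal.ofReal_le_ofReal (norm_sub_radialTruncation_le hR hs _)
      _ = ENNReal.ofReal (R ^ (1 - s)) * ∫⁻ x, ‖g x‖ₑ ^ s ∂μ :=
          lintegral_const_mul' _ _ ENNReal.ofReal_ne_top
      _ ≤ _ := by
          rw [ENNReal.ofReal_mul (by positivity), ENNReal.ofReal_coe_nnreal]
          gcongr
  have h2 := enorm_integral_le_lintegral_enorm (μ := μ) fun x => g x - radialTruncation R (g x)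
  have h3 := h2.trans h1
  rwa [← ofReal_norm, ENNReal.ofReal_le_ofReal_iff (by positivity)] at h3

/-- Uniform integrability. Truncation at radius `R` changes all the integrals by at most `R^(1-s)
D`, which tends to 0 as `s > 1`, and the truncated function is bounded and continuous. -/
theorem integral_eq_of_tendsto [HasOuterApproxClosed S] (hP : Tendsto P atTop (𝓝 Q)) {g : S → ℂ} (hg : Continuous g)
    {s : ℝ} (hs : 1 < s) {D : ℝ≥0} (hD : ∀ n, ∫⁻ x, ‖g x‖ₑ ^ s ∂(P n : Measure S) ≤ D) {a : ℂ}
    (ha : ∀ᶠ n in atTop, ∫ x, g x ∂(P n : Measure S) = a) : ∫ x, g x ∂(Q : Measure S) = a := by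
  have hQ := lintegral_rpow_le_of_tendsto hP hg (by linarith) hD
  have key : ∀ R > 0, ‖∫ x, g x ∂(Q : Measure S) - a‖ ≤ R ^ (1 - s) * D + R ^ (1 - s) * D := by
    intro R hR
    have hlim : Tendsto (fun n => ∫ x, radialTruncation R (g x) ∂(P n : Measure S)) atTop
        (𝓝 (∫ x, radialTruncation R (g x) ∂(Q : Measure S))) :=
      (ProbabilityMeasure.tendsto_iff_forall_integral_rclike_tendsto ℂ).1 hP
        (BoundedContinuousFunction.ofNormedAddCommGroup (fun x => radialTruncation R (g x))
          ((continuous_radialTruncation hR).comp hg) R fun x => norm_radialTruncation_le hR _)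
    have h1 : ‖a - ∫ x, radialTruncation R (g x) ∂(Q : Measure S)‖ ≤ R ^ (1 - s) * D := by
      refine le_of_tendsto (hlim.const_sub a).norm ?_
      filter_upwards [ha] with n hn
      rw [← hn]
      exact norm_integral_sub_truncation_le hg hs.le (hD n) hR
    have h2 := norm_integral_sub_truncation_le hg hs.le hQ hR
    calc _ = ‖(∫ x, g x ∂(Q : Measure S) - ∫ x, radialTruncation R (g x) ∂(Q : Measure S)) -
          (a - ∫ x, radialTruncation R (g x) ∂(Q : Measure S))‖ := by
          congr 1; ring
      _ ≤ _ := (norm_sub_le _ _).trans (add_le_add h2 h1)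
  have hz : Tendsto (fun R : ℝ => R ^ (1 - s) * D + R ^ (1 - s) * D) atTop (𝓝 0) := by
    have h := (tendsto_rpow_neg_atTop (by linarith : 0 < s - 1)).mul_const (D : ℝ)
    rw [neg_sub, zero_mul] at h
    simpa using h.add h
  have h0 : ‖∫ x, g x ∂(Q : Measure S) - a‖ ≤ 0 := by
    refine ge_of_tendsto hz ?_
    filter_upwards [eventually_gt_atTop 0] with R hR
    exact key R hR
  exact sub_eq_zero.1 (norm_le_zero_iff.1 h0)

end Moments

/-! ### Laws of the normalized profile polynomials -/

theorem integrable_toMeasure {α : Type} [MeasurableSpace α] [MeasurableSingletonClass α]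
    {p : PMF α} (hp : p.support.Finite) {E : Type*} [NormedAddCommGroup E] (f : α → E) :
    Integrable f p.toMeasure := by
  rw [← p.restrict_toMeasure_support]
  conv => rw [show p.support = (hp.toFinset : Set α) by simp]
  exact IntegrableOn.finset

section Profile

variable {B : Set ℂ}

theorem differentiableOn_normProfile (hm : 2 ≤ m) {σ : SupplementaryRule m t} (hBs : B ⊆ goodSet σ)
    (n : ℕ) (p : ℂ[X]) :
    DifferentiableOn ℂ (fun z => p.eval z * ((meanPoly σ n).eval z)⁻¹) B := by
  -- For `n = 0` the mean vanishes; with the convention `0⁻¹ = 0` the normalized function is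
  -- identically zero, hence still analytic.
  rcases Nat.eq_zero_or_pos n with rfl | hn
  · rw [meanPoly_of_lt σ (by omega)]
    simp only [Nat.cast_zero, map_zero, Polynomial.eval_zero, inv_zero, mul_zero]
    exact differentiableOn_const 0
  · exact p.differentiable.differentiableOn.mul
      ((meanPoly σ n).differentiable.differentiableOn.inv fun z hz =>
        (isGoodAt_of_mem_goodSet (hBs hz)).mean_ne_zero hn)

/-- The normalized profile polynomial `Wₙ / 𝔼 Wₙ` as an element of `H(B)`. -/
noncomputable def normProfile (hm : 2 ≤ m) {σ : SupplementaryRule m t} (hB : IsOpen B)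
    (hBs : B ⊆ goodSet σ) (n : ℕ) (T : SearchTree m) : Hol B :=
  Hol.mk hB _ (differentiableOn_normProfile hm hBs n (treePoly T))

theorem normProfile_apply (hm : 2 ≤ m) {σ : SupplementaryRule m t} (hB : IsOpen B)
    (hBs : B ⊆ goodSet σ) (n : ℕ) (T : SearchTree m) (z : B) :
    normProfile hm hB hBs n T z = T.profilePoly z / expectedPoly σ n z := by
  rw [profilePoly_eq_eval, expectedPoly_eq_eval hm, div_eq_mul_inv]
  rfl

/-- The law of `Wₙ / 𝔼 Wₙ` on `H(B)`. -/
noncomputable def profileMeasure (hm : 2 ≤ m) {σ : SupplementaryRule m t} (hB : IsOpen B)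
    (hBs : B ⊆ goodSet σ) (n : ℕ) : ProbabilityMeasure (Hol B) :=
  ⟨(treeMeasure σ n).map (normProfile hm hB hBs n),
    Measure.isProbabilityMeasure_map measurable_from_top.aemeasurable⟩

theorem integral_profileMeasure (hm : 2 ≤ m) {σ : SupplementaryRule m t} (hB : IsOpen B)
    (hBs : B ⊆ goodSet σ) (n : ℕ) {E : Type*} [NormedAddCommGroup E] [NormedSpace ℝ E]
    [CompleteSpace E] {F : Hol B → E} (hF : Continuous F) [SecondCountableTopology E] :
    ∫ f, F f ∂(profileMeasure hm hB hBs n : Measure (Hol B)) =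
      ev (polyLaw σ n) fun p => F (Hol.mk hB _ (differentiableOn_normProfile hm hBs n p)) := by
  have := Hol.polishSpace hB
  rw [profileMeasure, ProbabilityMeasure.coe_mk,
    integral_map measurable_from_top.aemeasurable hF.aestronglyMeasurable, treeMeasure,
    integral_toMeasure (finite_support_treeLaw hm σ _), polyLaw,
    ev_map (finite_support_treeLaw hm σ _)]
  rfl

theorem integral_phase_profileMeasure (hm : 2 ≤ m) {σ : SupplementaryRule m t} (hB : IsOpen B)
    (hBs : B ⊆ goodSet σ) (n : ℕ) (s : Finset B) (ξ : s → ℂ) :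
    ∫ f, phase ξ (fun i => f.1 i) ∂(profileMeasure hm hB hBs n : Measure (Hol B)) =
      profileChar σ (fun i : s => ((i : B) : ℂ)) n (ξ * invMean σ (fun i : s => ((i : B) : ℂ)) n) := by
  rw [integral_profileMeasure hm hB hBs n (Hol.continuous_phase_eval s ξ), profileChar]
  refine ev_congr fun p _ => ?_
  rw [← phase_mul]
  congr 1
  funext i
  exact mul_comm _ _

theorem integral_eval_profileMeasure (hm : 2 ≤ m) {σ : SupplementaryRule m t} (hB : IsOpen B)
    (hBs : B ⊆ goodSet σ) {n : ℕ} (hn : 1 ≤ n) (z : B) :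
    ∫ f, f.1 z ∂(profileMeasure hm hB hBs n : Measure (Hol B)) = 1 := by
  have h0 := (isGoodAt_of_mem_goodSet (hBs z.2)).mean_ne_zero hn
  rw [integral_profileMeasure hm hB hBs n (Hol.continuous_eval z)]
  calc _ = ev (polyLaw σ n) fun p => ((meanPoly σ n).eval (z : ℂ))⁻¹ * p.eval (z : ℂ) :=
        ev_congr fun p _ => mul_comm _ _
    _ = 1 := by
        rw [ev_mul_left (finite_support_polyLaw hm σ n), ← eval_meanPoly hm, inv_mul_cancel₀ h0]

theorem add_one_rpow_le {a s : ℝ} (ha : 0 ≤ a) (hs : 0 ≤ s) (hs' : s ≤ 2) :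
    (a + 1) ^ s ≤ 4 * (a ^ s + 1) := by
  have h2 : (2 : ℝ) ^ s ≤ 4 := by
    have := Real.rpow_le_rpow_of_exponent_le (by norm_num : (1 : ℝ) ≤ 2) hs'
    rw [Real.rpow_two] at this
    linarith
  have h0 : 0 ≤ a ^ s := by positivity
  have hmax : max a 1 ^ s ≤ a ^ s + 1 := by
    rcases le_total a 1 with h | h
    · rw [max_eq_right h, Real.one_rpow]
      linarith
    · rw [max_eq_left h]
      linarith
  calc (a + 1) ^ s ≤ (2 * max a 1) ^ s := by
        gcongr
        linarith [le_max_left a 1, le_max_right a 1]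
    _ = 2 ^ s * max a 1 ^ s := Real.mul_rpow (by norm_num) (by positivity)
    _ ≤ _ := mul_le_mul h2 hmax (by positivity) (by norm_num)

theorem IsGood.ev_norm_rpow_le (hm : 2 ≤ m) {σ : SupplementaryRule m t} {s q c K : ℝ} {z : ℂ}
    (hs : 1 < s) (hs' : s ≤ 2) (hc : 0 < c) (hK : 0 ≤ K) (h : IsGood σ s q c K z) (n : ℕ) :
    (ev (polyLaw σ n) fun p => ‖p.eval z * ((meanPoly σ n).eval z)⁻¹‖ ^ s) ≤
      4 * (K * c⁻¹ ^ s + 1) := by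
  have hf := finite_support_polyLaw hm σ n
  rcases Nat.eq_zero_or_pos n with rfl | hn
  · rw [meanPoly_of_lt σ (by omega)]
    simp only [Nat.cast_zero, map_zero, Polynomial.eval_zero, inv_zero, mul_zero, norm_zero]
    rw [Real.zero_rpow (by linarith), ev_const hf]
    positivity
  · have h0 := h.mean_ne_zero hc hn
    set G := (meanPoly σ n).eval z
    calc _ ≤ ev (polyLaw σ n) fun p => 4 * (‖G⁻¹‖ ^ s * ‖p.eval z - G‖ ^ s + 1) := by
          refine ev_mono hf fun p _ => ?_
          have e : p.eval z * G⁻¹ = (p.eval z - G) * G⁻¹ + 1 := by field_simp; ring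
          have h1 : ‖p.eval z * G⁻¹‖ ≤ ‖G⁻¹‖ * ‖p.eval z - G‖ + 1 := by
            rw [e]
            refine (norm_add_le _ _).trans ?_
            rw [norm_mul, norm_one, mul_comm]
          calc _ ≤ (‖G⁻¹‖ * ‖p.eval z - G‖ + 1) ^ s := by gcongr
            _ ≤ 4 * ((‖G⁻¹‖ * ‖p.eval z - G‖) ^ s + 1) :=
              add_one_rpow_le (by positivity) (by linarith) hs'
            _ = _ := by rw [Real.mul_rpow (by positivity) (by positivity)]
      _ = 4 * (‖G⁻¹‖ ^ s * (ev (polyLaw σ n) fun p => ‖p.eval z - G‖ ^ s) + 1) := by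
          rw [ev_mul_left hf, ev_add hf, ev_mul_left hf, ev_const hf]
      _ ≤ 4 * (‖G⁻¹‖ ^ s * (K * rise (momentExp m t s z) n) + 1) := by
          gcongr
          exact h.moment n
      _ = 4 * (K * (rise (momentExp m t s z) n * ‖G⁻¹‖ ^ s) + 1) := by ring
      _ ≤ _ := by
          gcongr
          exact h.weight_mul_inv_mean_le hs.le hc hn

theorem exists_lintegral_profileMeasure_le (hm : 2 ≤ m) {σ : SupplementaryRule m t} (hB : IsOpen B)
    (hBs : B ⊆ goodSet σ) {x : ℂ} (hx : x ∈ goodSet σ) :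
    ∃ r > 0, ∃ s : ℝ, 1 < s ∧ ∃ D : ℝ≥0, ∀ n, ∀ z : B, (z : ℂ) ∈ Metric.ball x r →
      ∫⁻ f, ‖f.1 z‖ₑ ^ s ∂(profileMeasure hm hB hBs n : Measure (Hol B)) ≤ D := by
  have := Hol.polishSpace hB
  obtain ⟨r, hr, s, q, c, K, h1, h2, h3, h4, h5, h7, h⟩ := hx
  refine ⟨r, hr, s, h1, Real.toNNReal (4 * (K * c⁻¹ ^ s + 1)), fun n z hz => ?_⟩
  have hcont : Continuous fun f : Hol B => ‖f.1 z‖ ^ s :=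
    (Hol.continuous_eval z).norm.rpow_const fun _ => Or.inr (by linarith)
  have e : ∀ f : Hol B, ‖f.1 z‖ₑ ^ s = ENNReal.ofReal (‖f.1 z‖ ^ s) := fun f => by
    rw [← ENNReal.ofReal_rpow_of_nonneg (norm_nonneg _) (by linarith), ofReal_norm]
  have hi : Integrable (fun f : Hol B => ‖f.1 z‖ ^ s)
      (profileMeasure hm hB hBs n : Measure (Hol B)) := by
    rw [profileMeasure, ProbabilityMeasure.coe_mk, integrable_map_measure
      hcont.aestronglyMeasurable measurable_from_top.aemeasurable]
    exact integrable_toMeasure (finite_support_treeLaw hm σ _) _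
  simp only [e]
  rw [← ofReal_integral_eq_lintegral_ofReal hi (ae_of_all _ fun f => by positivity),
    integral_profileMeasure hm hB hBs n hcont]
  exact ENNReal.ofReal_le_ofReal ((h z hz).ev_norm_rpow_le hm h1 h2 h5 h7 n)

theorem exists_tendsto_profileMeasure (hm : 2 ≤ m) {σ : SupplementaryRule m t} (hB : IsOpen B)
    (hBs : B ⊆ goodSet σ) :
    ∃ Q : ProbabilityMeasure (Hol B), Tendsto (profileMeasure hm hB hBs) atTop (𝓝 Q) := by
  refine Hol.exists_tendsto hB (fun x hx => ?_) fun s ξ => ?_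
  · obtain ⟨r, hr, s, hs, D, h⟩ := exists_lintegral_profileMeasure_le hm hB hBs (hBs hx)
    refine ⟨r, hr, 1 + D, fun n z hz => ?_⟩
    calc _ ≤ ∫⁻ f, (1 + ‖f.1 z‖ₑ ^ s) ∂(profileMeasure hm hB hBs n : Measure (Hol B)) :=
          lintegral_mono fun f => enorm_le_one_add_rpow hs.le _
      _ = 1 + ∫⁻ f, ‖f.1 z‖ₑ ^ s ∂(profileMeasure hm hB hBs n : Measure (Hol B)) := by
          rw [lintegral_add_left measurable_const, lintegral_one, measure_univ]
      _ ≤ _ := by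
          push_cast
          gcongr
          exact h n z hz
  · obtain ⟨ψ, hψ⟩ := exists_hasCharLimit hm (z := fun i : s => ((i : B) : ℂ))
      fun i => isGoodAt_of_mem_goodSet (hBs i.1.2)
    refine ⟨ψ ξ, ?_⟩
    simp only [integral_phase_profileMeasure]
    exact hψ.tendsto ξ

/-! ### The fixed-point equation for the limit. -/

/-- The right-hand side of the fixed-point equation, as a random element of `H(B)`. -/
noncomputable def fixedPointMap (hB : IsOpen B) {σ : SupplementaryRule m t} (hBs : B ⊆ goodSet σ)
    (p : (Fin m → ℝ) × (Fin m → Hol B)) : Hol B :=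
  Hol.mk hB (fun z => ∑ j, z * (p.1 j : ℂ) ^ (dominantRoot m t z - 1) * (p.2 j).ext z) (by
    refine DifferentiableOn.fun_sum fun j _ => ?_
    refine (differentiableOn_id.mul fun z hz => ?_).mul (p.2 j).differentiableOn_ext
    obtain ⟨r, hr, s, q, c, K, h1, h2, h3, h4, h5, h7, h⟩ := hBs hz
    have hz' := h z (Metric.mem_ball_self hr)
    -- The base `p.1 j` may be zero, so differentiability of the power rests on the exponent `λ₁(z)
    -- - 1` being nonzero, which follows from `Re λ₁(z) > 1`.
    refine ((hz'.differentiableAt.sub_const 1).const_cpow (Or.inr fun h0 => ?_)).differentiableWithinAt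
    have := hz'.one_lt_re
    rw [sub_eq_zero.1 h0, Complex.one_re] at this
    exact lt_irrefl _ this)

theorem fixedPointMap_apply (hB : IsOpen B) {σ : SupplementaryRule m t} (hBs : B ⊆ goodSet σ)
    (p : (Fin m → ℝ) × (Fin m → Hol B)) (z : B) : (fixedPointMap hB hBs p).1 z =
      ∑ j, (z : ℂ) * (p.1 j : ℂ) ^ (dominantRoot m t z - 1) * (p.2 j).1 z := by
  have e : (fixedPointMap hB hBs p).1 z =
      ∑ j, (z : ℂ) * (p.1 j : ℂ) ^ (dominantRoot m t z - 1) * (p.2 j).ext z := rfl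
  rw [e]
  exact Finset.sum_congr rfl fun j _ => by rw [Hol.ext_apply]

theorem measurable_fixedPointMap (hB : IsOpen B) {σ : SupplementaryRule m t}
    (hBs : B ⊆ goodSet σ) : Measurable (fixedPointMap hB hBs) := by
  refine Hol.measurable_of_eval hB fun z => ?_
  simp only [fixedPointMap_apply]
  refine Finset.measurable_sum _ fun j _ => ?_
  refine (measurable_const.mul ?_).mul ?_
  · exact (Complex.measurable_ofReal.comp
      ((measurable_pi_apply j).comp measurable_fst)).pow_const _
  · exact (Hol.continuous_eval z).measurable.comp ((measurable_pi_apply j).comp measurable_snd)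

theorem phase_fixedPointMap (hB : IsOpen B) {σ : SupplementaryRule m t} (hBs : B ⊆ goodSet σ)
    (s : Finset B) (ξ : s → ℂ) (p : (Fin m → ℝ) × (Fin m → Hol B)) :
    phase ξ (fun i => (fixedPointMap hB hBs p).1 i) =
      ∏ j, phase (ξ * limitCoef m t (fun i : s => ((i : B) : ℂ)) (p.1 j)) fun i => (p.2 j).1 i := by
  simp only [← phase_mul]
  rw [← phase_sum]
  congr 1
  funext i
  rw [fixedPointMap_apply, Finset.sum_apply]
  rfl

/-- By `Hol.measure_ext` only characteristic functions have to be compared. Fubini and independence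
turn that of the right-hand side into the Dirichlet integral of `HasCharLimit.eq_integral`. -/
theorem solvesFixedPoint_of_tendsto (hm : 2 ≤ m) {σ : SupplementaryRule m t} (hB : IsOpen B)
    (hBs : B ⊆ goodSet σ) {Q : ProbabilityMeasure (Hol B)}
    (hQ : Tendsto (profileMeasure hm hB hBs) atTop (𝓝 Q)) :
    SolvesFixedPoint m t B (Q : Measure (Hol B)) := by
  have := Hol.polishSpace hB
  have := isProbabilityMeasure_dirichlet hm σ
  have hΦ := measurable_fixedPointMap hB hBs
  refine ⟨fixedPointMap hB hBs, hΦ.aemeasurable, fun v y z => fixedPointMap_apply hB hBs (v, y) z, ?_⟩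
  have := Measure.isProbabilityMeasure_map (μ := (dirichlet m t).prod
    (Measure.pi fun _ : Fin m => (Q : Measure (Hol B)))) hΦ.aemeasurable
  refine Hol.measure_ext hB fun s ξ => ?_
  have hg : ∀ i : s, IsGoodAt σ ((i : B) : ℂ) := fun i => isGoodAt_of_mem_goodSet (hBs i.1.2)
  obtain ⟨ψ, hψ⟩ := exists_hasCharLimit hm hg
  have hint : ∀ η : s → ℂ, ∫ f, phase η (fun i => f.1 i) ∂(Q : Measure (Hol B)) = ψ η := by
    intro η
    refine tendsto_nhds_unique (((Hol.continuous_integral_phase s η).tendsto Q).comp hQ) ?_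
    refine (hψ.tendsto η).congr fun n => ?_
    exact (integral_phase_profileMeasure hm hB hBs n s η).symm
  have hph := Hol.continuous_phase_eval s ξ
  have hi : Integrable (fun p => phase ξ (fun i => (fixedPointMap hB hBs p).1 i))
      ((dirichlet m t).prod (Measure.pi fun _ : Fin m => (Q : Measure (Hol B)))) :=
    Integrable.of_bound (hph.measurable.comp hΦ).aestronglyMeasurable 1
      (ae_of_all _ fun _ => (norm_phase _ _).le)
  rw [integral_map hΦ.aemeasurable hph.aestronglyMeasurable, hint, hψ.eq_integral hm hg,
    integral_prod _ hi]
  refine integral_congr_ae (ae_of_all _ fun v => ?_)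
  simp only [phase_fixedPointMap]
  rw [integral_fintype_prod_eq_prod (fun (j : Fin m) (f : Hol B) =>
    phase (ξ * limitCoef m t (fun i : s => ((i : B) : ℂ)) (v j)) fun i => f.1 i)]
  exact Finset.prod_congr rfl fun j _ => hint _

end Profile

end SearchTreeProfile

open SearchTreeProfile

/-! ### Assembly of the theorem. -/

theorem theorem1p2 (m t : ℕ) (hm : 2 ≤ m) (σ : SupplementaryRule m t) :
    ∃ B : Set ℂ,
      -- `B` is a domain inside `D₁` that contains the real interval `(1/m, β(α₊))`
      IsOpen B ∧ IsConnected B ∧ B ⊆ regionD m t 1 ∧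
      (∀ x : ℝ, 1 / (m : ℝ) < x → x < beta m t (alphaPlus m t) → (x : ℂ) ∈ B) ∧
      -- the normalization does not vanish on `B`
      (∀ n : ℕ, 1 ≤ n → ∀ z ∈ B, expectedPoly σ n z ≠ 0) ∧
      -- the analytic random process `Y` on `B`
      ∃ (Ω : Type) (_ : MeasurableSpace Ω) (P : Measure Ω) (_ : IsProbabilityMeasure P)
        (Y : Ω → Hol B),
        Measurable Y ∧
        SolvesFixedPoint m t B (P.map Y) ∧
        (∀ z : B, Integrable (fun ω => Y ω z) P ∧ ∫ ω, Y ω z ∂P = 1) ∧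
        (∀ x : ℝ, 1 / (m : ℝ) < x → x < beta m t (alphaPlus m t) →
          ∃ s : ℝ, 1 < s ∧ ∃ U ∈ 𝓝 (x : ℂ), ∃ C : ℝ≥0,
            ∀ z : B, (z : ℂ) ∈ U → ∫⁻ ω, ‖Y ω z‖ₑ ^ s ∂P ≤ C) ∧
        -- the normalized profile polynomials `Wₙ / 𝔼 Wₙ` as random elements of `H(B)`
        ∃ M : ℕ → SearchTree m → Hol B,
          (∀ n : ℕ, ∀ T : SearchTree m, ∀ z : B, M n T z = T.profilePoly z / expectedPoly σ n z) ∧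
          TendstoInDistribution M atTop Y (treeMeasure σ) P := by
  obtain ⟨x₀, h₀, h₀'⟩ := exists_between (one_div_lt_beta_alphaPlus (t := t) hm)
  have hx₀ : (x₀ : ℂ) ∈ goodSet σ := mem_goodSet hm σ h₀ h₀'
  -- `goodSet σ` is open but not known to be connected. The component of one point of the real
  -- interval contains the whole interval, because the interval is connected and lies in `goodSet
  -- σ`.
  set B : Set ℂ := connectedComponentIn (goodSet σ) x₀
  have hB : IsOpen B := (isOpen_goodSet σ).connectedComponentIn
  have hBs : B ⊆ goodSet σ := connectedComponentIn_subset _ _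
  have hseg : ∀ x : ℝ, 1 / (m : ℝ) < x → x < beta m t (alphaPlus m t) → (x : ℂ) ∈ B := by
    intro x h1 h2
    have hp : IsPreconnected ((fun x : ℝ => (x : ℂ)) ''
        Set.Ioo (1 / (m : ℝ)) (beta m t (alphaPlus m t))) :=
      isPreconnected_Ioo.image _ Complex.continuous_ofReal.continuousOn
    refine hp.subset_connectedComponentIn ⟨x₀, ⟨h₀, h₀'⟩, rfl⟩ ?_ ⟨x, ⟨h1, h2⟩, rfl⟩
    rintro _ ⟨y, hy, rfl⟩
    exact mem_goodSet hm σ hy.1 hy.2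
  obtain ⟨Q, hQ⟩ := exists_tendsto_profileMeasure hm hB hBs
  have := Hol.polishSpace hB
  -- `Y` is the identity on the canonical probability space `(H(B), Q)`, where `Q` is the limit law.
  refine ⟨B, hB, isConnected_connectedComponentIn_iff.2 hx₀, fun z hz => ?_, hseg,
    fun n hn z hz => ?_, Hol B, inferInstance, Q, inferInstance, id, measurable_id, ?_,
    fun z => ?_, fun x h1 h2 => ?_, normProfile hm hB hBs, normProfile_apply hm hB hBs, ?_⟩
  · obtain ⟨s, q, c, K, -, -, -, -, -, -, h⟩ := isGoodAt_of_mem_goodSet (hBs hz)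
    exact ⟨h.one_lt_re, h.dominant⟩
  · rw [expectedPoly_eq_eval hm]
    exact (isGoodAt_of_mem_goodSet (hBs hz)).mean_ne_zero hn
  · rw [Measure.map_id]
    exact solvesFixedPoint_of_tendsto hm hB hBs hQ
  · obtain ⟨r, hr, s, hs, D, h⟩ := exists_lintegral_profileMeasure_le hm hB hBs (hBs z.2)
    have hD := fun n => h n z (Metric.mem_ball_self hr)
    have hc := Hol.continuous_eval z
    refine ⟨integrable_of_lintegral_rpow_le hc hs.le
      (lintegral_rpow_le_of_tendsto hQ hc (by linarith) hD), ?_⟩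
    refine integral_eq_of_tendsto hQ hc hs hD ?_
    filter_upwards [eventually_ge_atTop 1] with n hn
    exact integral_eval_profileMeasure hm hB hBs hn z
  · obtain ⟨r, hr, s, hs, D, h⟩ := exists_lintegral_profileMeasure_le hm hB hBs
      (mem_goodSet hm σ h1 h2)
    exact ⟨s, hs, Metric.ball x r, Metric.ball_mem_nhds _ hr, D, fun z hz =>
      lintegral_rpow_le_of_tendsto hQ (Hol.continuous_eval z) (by linarith) fun n => h n z hz⟩
  · refine ⟨fun n => measurable_from_top.aemeasurable, measurable_id.aemeasurable, ?_⟩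
    simp only [Measure.map_id]
    exact hQ
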